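/- **Setting.** Consider the Ising model on the faces of the square lattice $\mathbb Z^2$. To each edge $e$ is attached an angle $\theta_e\in(0,\frac{\pi}{2})$, and the Ising weight is $x_e=\tan(\theta_e/2)=e^{-2\beta J_e}$. The full-plane model is the limit of the models in the boxes $[-R,R]^2$ with wired boundary conditions (the spins of all faces outside the box being equal); $\mathbb E$ is its expectation, and $\varepsilon_e=\sigma_{v_-^\circ(e)}\sigma_{v_+^\circ(e)}$ is the product of the two spins separated by $e$. Corners are pairs $c=(v^\bullet(c)v^\circ(c))$ of a vertex and an incident face; two corners are neighbours (across the edge, or quad, $e$) if they are consecutive around $e$, i.e. both touch the quad formed by the endpoints of $e$ and the faces on both sides of $e$ and they share their vertex or their face. $\Upsilon^\times$ is the double cover of the corner graph that branches around every vertex, every face and every quad. A function $\mathcal X:\Upsilon^\times\to\mathbb C$ *satisfies the propagation equation for the angles $\theta$* if for all $\mathfrak p\in\Upsilon^\times$ and each quad $e$ containing $\mathfrak p$, $$\mathcal X(\mathfrak p)=\mathcal X(\mathfrak p_1)\cos\theta_e+\mathcal X(\mathfrak p_2)\sin\theta_e ,$$ where $\mathfrak p_1,\mathfrak p_2$ are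 the neighbours of $\mathfrak p$ in $\Upsilon^\times$ across $e$ that share with $\mathfrak p$ its vertex and its face, respectively. An *s-embedding* of the model with angles $\theta$ and propagator $\mathcal X$ is a map $\mathcal S$ from vertices and faces to $\mathbb C$ such that $\mathcal X$ satisfies the propagation equation for $\theta$ and $\mathcal S(v^\bullet(c))-\mathcal S(v^\circ(c))=\mathcal X(c)^2$ for all corners $c$. For every edge $e_k$, turned so that it points north (a vertical edge as it is, a horizontal edge oriented to the east and then turned), let $a_k^+,d_k^+,c_k^+\in\Upsilon^\times$ be lifts of the south-eastern, south-western and north-western corners of its quad, with $a_k^+$ adjacent to $d_k^+$ and $d_k^+$ adjacent to $c_k^+$. For $q\in\{a_k^+,c_k^+\}$, $\langle\chi_{\mathfrak p}\chi_q\rangle$ denotes the full-plane Kadanoff–Ceva fermion $\mathbb E[\mu_{v^\bullet(\mathfrak p)}\mu_{v^\bullet(q)}\sigma_{v^\circ(\mathfrak p)}\sigma_{v^\circ(q)}]$. It is a spinor on the double cover that branches everywhere except around $v^\bullet(q)$ and $v^\circ(q)$; this cover is identified with $\Upsilon^\times$ in such a way that the two agree around the quad of $q$ other than that of $e_k$,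 and the fermion is normalised by the value $1$ at $\mathfrak p=q$. **Random environment.** Let $\theta^{(0)}_e\in(0,\frac{\pi}{2})$ for all $e$, and let $\mathcal Y^{(0)}$ be the propagator of an s-embedding of the model with angles $\theta^{(0)}$. Let $\Lambda$ be a finite set of edges, $\sigma_e\in\mathbb R$ with $\sigma_e=0$ for $e\notin\Lambda$, let $(B^{(e)})_e$ be independent standard Brownian motions under $\mathbf P$, and put $\theta_e^{(s)}=\theta_e^{(0)}+\sigma_eB^{(e)}_s$. As long as all these angles are in $(0,\frac{\pi}{2})$, $S_\omega(s)$ denotes the Ising model with angles $\theta^{(s)}$. Consider the system, for all $\mathfrak p\in\Upsilon^\times$, $$\begin{aligned} d\mathcal Y^{(s)}(\mathfrak p)=&-\frac12\sum_{e_k\in\Lambda}\sigma_k\Big(\mathcal Y^{(s)}(c_k^+)\langle\chi_{\mathfrak p}\chi_{a_k^+}\rangle_{S_\omega(s)}-\mathcal Y^{(s)}(a_k^+)\langle\chi_{\mathfrak p}\chi_{c_k^+}\rangle_{S_\omega(s)}\Big)dB^{(e_k)}_s\\&+\frac14\sum_{e_k\in\Lambda}\sigma_k^2\Big(\frac{\cos\theta_k^{(s)}}{\sin\theta_k^{(s)}}-\frac{\mathbb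 E_{S_\omega(s)}[\varepsilon_{e_k}]}{\sin\theta_k^{(s)}}\Big)\Big(\mathcal Y^{(s)}(c_k^+)\langle\chi_{\mathfrak p}\chi_{a_k^+}\rangle_{S_\omega(s)}-\mathcal Y^{(s)}(a_k^+)\langle\chi_{\mathfrak p}\chi_{c_k^+}\rangle_{S_\omega(s)}\Big)ds\end{aligned}$$ in the sense of Itô, with initial value $\mathcal Y^{(0)}$. A *(strong) solution up to* $T$ consists of a stopping time $T\in[0,\infty)$ of the completed filtration of $(B^{(e)})_{e\in\Lambda}$ such that a.s. all angles $\theta^{(s)}_e$, $0\le s\le T$, are in $(0,\frac{\pi}{2})$, and of processes $(\mathcal Y^{(s)}(\mathfrak p))_{s\le T}$, a.s. continuous and adapted to this filtration, that satisfy the system on $[0,T]$. **Statement.** 1. There exist a stopping time $T_0$ with $T_0>0$ $\mathbf P$-almost surely and a strong solution of the system up to $T_0$. 2. For every strong solution $(\mathcal Y^{(s)})_{0\le s\le T}$ up to a stopping time $T$, $\mathbf P$-almost surely, for all $0\le s\le T$, $\mathcal Y^{(s)}$ is the propagator of an s-embedding of the Ising model $S_\omega(s)$. -/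

import Mathlib

open MeasureTheory ProbabilityTheory Filter Topology
open scoped NNReal

noncomputable section

namespace IsingEmb

/-! ## The square lattice, its corners and the double cover branching over every face -/

/-- Vertices of the square lattice. -/
abbrev Vertex := ℤ × ℤ

/-- Faces of the square lattice: `(m, n)` is the unit square with lower left vertex `(m, n)`. -/
abbrev Face := ℤ × ℤ

/-- Edges of the square lattice: `h m n` joins `(m, n)` to `(m + 1, n)` and
`v m n` joins `(m, n)` to `(m, n + 1)`. They are identified with the quads. -/
inductive Edge : Type
  | h (m n : ℤ)
  | v (m n : ℤ)
  deriving DecidableEq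

/-- The two faces separated by an edge. -/
def Edge.faces : Edge → Face × Face
  | .h m n => ((m, n), (m, n - 1))
  | .v m n => ((m, n), (m - 1, n))

/-- Points of the double cover `Υ^×` of the corner graph.

The corner with coordinates `(i, j)` sits at the point `((2 i + 1) / 4, (2 j + 1) / 4)` of the plane:
it is the midpoint between the vertex of the lattice closest to it and the centre of the face that
contains it. The corner graph is therefore a square grid, and its unit cells are exactly
the vertices, the faces and the quads. `sgn` tells which of the two lifts is meant. -/
@[ext]
structure LiftedCorner : Type where
  i : ℤ
  j : ℤ
  sgn : ℤˣ
  deriving DecidableEq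

namespace LiftedCorner

/-- The vertex of the lattice to which the corner belongs. -/
def vertex (p : LiftedCorner) : Vertex := ((p.i + 1) / 2, (p.j + 1) / 2)

/-- The face of the lattice to which the corner belongs. -/
def face (p : LiftedCorner) : Face := (p.i / 2, p.j / 2)

/-- The other lift of the same corner. -/
def flip (p : LiftedCorner) : LiftedCorner := ⟨p.i, p.j, -p.sgn⟩

/-- Two lifts of the same corner. -/
def SameCorner (p q : LiftedCorner) : Prop := p.i = q.i ∧ p.j = q.j

/-- Adjacency in the double cover. The sign rule changes the sheet along vertical steps in odd
columns, so that the sheet changes after one turn around any unit cell: the cover branches around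
every vertex, every face and every quad (the plane being simply connected, there is only one such
double cover up to isomorphism). -/
def Adj (p q : LiftedCorner) : Prop :=
  (q.j = p.j ∧ (q.i = p.i + 1 ∨ q.i = p.i - 1) ∧ q.sgn = p.sgn) ∨
  (q.i = p.i ∧ (q.j = p.j + 1 ∨ q.j = p.j - 1) ∧ q.sgn = (-1) ^ p.i * p.sgn)

/-- The corner is one of the four corners of the quad of the edge `e`. -/
def InQuad (e : Edge) (p : LiftedCorner) : Prop :=
  match e with
  | .h m n => (p.i = 2 * m ∨ p.i = 2 * m + 1) ∧ (p.j = 2 * n - 1 ∨ p.j = 2 * n)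
  | .v m n => (p.i = 2 * m - 1 ∨ p.i = 2 * m) ∧ (p.j = 2 * n ∨ p.j = 2 * n + 1)

/-- The corners `p`, `q` are neighbours in the double cover, across the quad of `e`. -/
def AdjIn (e : Edge) (p q : LiftedCorner) : Prop := InQuad e p ∧ InQuad e q ∧ Adj p q

end LiftedCorner

/-- The lift `a⁺` of the south-eastern corner of a quad, seen with its edge pointing north
(a horizontal edge is oriented to the east and then turned by a quarter turn, so that its
south-eastern corner is the one at its left end and below it). -/
def Edge.aPlus : Edge → LiftedCorner
  | .h m n => ⟨2 * m, 2 * n - 1, 1⟩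
  | .v m n => ⟨2 * m, 2 * n, 1⟩

/-- The lift `d⁺` of the south-western corner adjacent to `a⁺`. -/
def Edge.dPlus : Edge → LiftedCorner
  | .h m n => ⟨2 * m, 2 * n, 1⟩
  | .v m n => ⟨2 * m - 1, 2 * n, 1⟩

/-- The lift `c⁺` of the north-western corner adjacent to `d⁺`. -/
def Edge.cPlus : Edge → LiftedCorner
  | .h m n => ⟨2 * m + 1, 2 * n, 1⟩
  | .v m n => ⟨2 * m - 1, 2 * n + 1, -1⟩

theorem Edge.adjIn_aPlus_dPlus (e : Edge) : LiftedCorner.AdjIn e e.aPlus e.dPlus := by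
  cases e <;> simp [LiftedCorner.AdjIn, LiftedCorner.InQuad, LiftedCorner.Adj, aPlus, dPlus,
    zpow_mul]

theorem Edge.adjIn_dPlus_cPlus (e : Edge) : LiftedCorner.AdjIn e e.dPlus e.cPlus := by
  cases e <;> simp [LiftedCorner.AdjIn, LiftedCorner.InQuad, LiftedCorner.Adj, cPlus, dPlus,
    zpow_sub, zpow_mul]

/-! ## Propagators and s-embeddings -/

/-- The propagation equation around every quad, for the angles `θ`:
`X(p) = X(p₁) cos θ_e + X(p₂) sin θ_e` when `p₁` and `p₂` are the neighbours of `p` across the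
quad of `e` which share with `p` their vertex and their face respectively. -/
def Propagation (θ : Edge → ℝ) (X : LiftedCorner → ℂ) : Prop :=
  ∀ (e : Edge) (p p₁ p₂ : LiftedCorner),
    LiftedCorner.AdjIn e p p₁ → p₁.vertex = p.vertex →
    LiftedCorner.AdjIn e p p₂ → p₂.face = p.face →
    X p = X p₁ * (Real.cos (θ e) : ℂ) + X p₂ * (Real.sin (θ e) : ℂ)

/-- `S` is the s-embedding, with propagator `X`, of the square lattice with Ising angles `θ`. -/
structure IsSEmbedding (θ : Edge → ℝ) (X : LiftedCorner → ℂ) (S : Vertex ⊕ Face → ℂ) : Prop where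
  propagation : Propagation θ X
  increment : ∀ p : LiftedCorner, S (Sum.inl p.vertex) - S (Sum.inr p.face) = X p ^ 2

/-! ## The Ising model on the faces of the square lattice -/

/-- The Ising weight `x_e = tan (θ_e / 2)`. -/
def weight (θ : Edge → ℝ) (e : Edge) : ℝ := Real.tan (θ e / 2)

/-- The interaction constant `β J_e`, determined by `x_e = exp (-2 β J_e)`. -/
def coupling (θ : Edge → ℝ) (e : Edge) : ℝ := -(Real.log (weight θ e)) / 2

/-- Spin configurations. -/
abbrev Config := Face → ℤˣ

/-- The energy `ε_e`: product of the two spins separated by `e`. -/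
def energy (s : Config) (e : Edge) : ℤˣ := s e.faces.1 * s e.faces.2

/-- The edges of the box `[-R, R]²`. -/
def boxEdges (R : ℕ) : Finset Edge :=
  ((Finset.Ico (-(R : ℤ)) R ×ˢ Finset.Icc (-(R : ℤ)) R).image fun x => Edge.h x.1 x.2) ∪
  ((Finset.Icc (-(R : ℤ)) R ×ˢ Finset.Ico (-(R : ℤ)) R).image fun x => Edge.v x.1 x.2)

/-- The bounded faces of the box `[-R, R]²`. -/
def boxFaces (R : ℕ) : Finset Face := Finset.Ico (-(R : ℤ)) R ×ˢ Finset.Ico (-(R : ℤ)) R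

/-- A configuration in the box with wired boundary conditions: all the faces outside of the box
carry one and the same spin, fixed to be `+1`. -/
def wired (R : ℕ) (s : boxFaces R → ℤˣ) : Config :=
  fun f => if hf : f ∈ boxFaces R then s ⟨f, hf⟩ else 1

/-- The Boltzmann weight of a configuration in the box. -/
def boltzmann (θ : Edge → ℝ) (R : ℕ) (s : Config) : ℝ :=
  Real.exp (∑ e ∈ boxEdges R, coupling θ e * ((energy s e : ℤ) : ℝ))

/-- Expectation in the box `[-R, R]²` with wired boundary conditions. -/
def boxExpectation (θ : Edge → ℝ) (R : ℕ) (F : Config → ℝ) : ℝ :=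
  (∑ s : boxFaces R → ℤˣ, boltzmann θ R (wired R s) * F (wired R s)) /
    ∑ s : boxFaces R → ℤˣ, boltzmann θ R (wired R s)

/-- Expectation of a local observable in the full-plane Ising model: the limit of the expectations
in increasing boxes with wired boundary conditions. -/
def expectation (θ : Edge → ℝ) (F : Config → ℝ) : ℝ :=
  limUnder atTop fun R : ℕ => boxExpectation θ R F

/-- The energy density `𝔼[ε_e]`. -/
def energyDensity (θ : Edge → ℝ) (e : Edge) : ℝ :=
  expectation θ fun s => ((energy s e : ℤ) : ℝ)

/-! ## Kadanoff-Ceva fermions -/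

/-- State of a corner that moves away from a fixed corner: its present lift, the disorder line (edges
along which its vertex has moved, modulo two), and the sign collected so far. -/
structure KCState : Type where
  corner : LiftedCorner
  line : Finset Edge
  sgn : ℤˣ

/-- The initial state. -/
def KCState.init (q : LiftedCorner) : KCState := ⟨q, ∅, 1⟩

/-- One elementary move across the quad of `e`. Either the vertex is kept and the spin jumps across
`e`, which costs a sign when `e` belongs to the disorder line; or the face is kept and
the disorder moves along `e`. -/
def KCState.Move (e : Edge) (A A' : KCState) : Prop :=
  LiftedCorner.AdjIn e A.corner A'.corner ∧
  ((A'.corner.vertex = A.corner.vertex ∧ A'.line = A.line ∧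
      A'.sgn = if e ∈ A.line then -A.sgn else A.sgn) ∨
   (A'.corner.face = A.corner.face ∧ A'.line = symmDiff A.line {e} ∧ A'.sgn = A.sgn))

/-- The states reached from `q` by leaving `q` through the quad that is not the one of `z`, and by
never coming back to `q`. -/
inductive KCState.Reached (z : Edge) (q : LiftedCorner) : KCState → Prop
  | first {A : KCState} (e : Edge) (he : e ≠ z) (hA : KCState.Move e (KCState.init q) A) :
      KCState.Reached z q A
  | next {A A' : KCState} (e : Edge) (hA : KCState.Reached z q A) (hm : KCState.Move e A A')
      (hq : ¬ A'.corner.SameCorner q) : KCState.Reached z q A'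

/-- The correlation `𝔼[μ μ σ σ]` in a given state, the disorder being
`∏ x_e ^ ε_e` over the disorder line. -/
def KCState.value (θ : Edge → ℝ) (q : LiftedCorner) (A : KCState) : ℝ :=
  ((A.sgn : ℤ) : ℝ) * expectation θ fun s =>
    (∏ e ∈ A.line, weight θ e ^ ((energy s e : ℤˣ) : ℤ)) *
      ((s A.corner.face : ℤ) : ℝ) * ((s q.face : ℤ) : ℝ)

/-- The two-point Kadanoff-Ceva fermion `p ↦ ⟨χ_p χ_q⟩` of the full-plane Ising model, where `q` is
a corner of the quad `z`. It is a spinor on the double cover that branches everywhere except around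
the vertex and the face of `q`; that cover is identified with `Υ^×` away from `q`, in
such a way that the two agree around the quad of `q` other than `z`, and the fermion is normalised
by the value `1` at `q`. The correlation does not depend on the way in which `p` is
reached from `q`. -/
def fermion (θ : Edge → ℝ) (z : Edge) (q p : LiftedCorner) : ℝ :=
  if p = q then 1
  else if p = q.flip then -1
  else
    haveI : Nonempty KCState := ⟨KCState.init q⟩
    (Classical.epsilon fun A : KCState => A.Reached z q ∧ A.corner = p).value θ q

/-! ## Stochastic calculus -/

variable {Ω : Type*} [mΩ : MeasurableSpace Ω]

/-- The filtration generated by the processes `B e`, `e ∈ Λ`, completed by the null events. -/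
def completedFiltration (P : Measure Ω) (B : Edge → ℝ≥0 → Ω → ℝ)
    (hB : ∀ e t, Measurable (B e t)) (Λ : Finset Edge) : Filtration ℝ≥0 mΩ where
  seq t := (⨆ e ∈ Λ, ⨆ s ≤ t, MeasurableSpace.comap (B e s) inferInstance) ⊔
    MeasurableSpace.generateFrom {N | MeasurableSet N ∧ P N = 0}
  mono' t t' htt := by
    refine sup_le_sup_right ?_ _
    refine iSup₂_mono fun e _ => ?_
    exact iSup₂_le fun s hs => le_iSup₂_of_le s (hs.trans htt) le_rfl
  le' t := by
    refine sup_le ?_ (MeasurableSpace.generateFrom_le fun N hN => hN.1)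
    exact iSup₂_le fun e _ => iSup₂_le fun s _ => (hB e s).comap_le

/-- `I` is the Itô integral `I_t = ∑_{k ∈ K} ∫₀ᵗ H^k dW^k` of processes `H^k` with continuous paths:
for every `t` and all partitions of `[0, t]` whose mesh tends to zero, the sums of
left-point Riemann sums converge to `I_t` in probability. -/
def IsItoIntegral {ι : Type*} (P : Measure Ω) (K : Finset ι) (H : ι → ℝ≥0 → Ω → ℂ)
    (W : ι → ℝ≥0 → Ω → ℝ) (I : ℝ≥0 → Ω → ℂ) : Prop :=
  ∀ (t : ℝ≥0) (N : ℕ → ℕ) (τ : ℕ → ℕ → ℝ≥0),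
    (∀ n, Monotone (τ n)) → (∀ n, τ n 0 = 0) → (∀ n, τ n (N n) = t) →
    (∀ δ : ℝ≥0, 0 < δ → ∀ᶠ n in atTop, ∀ l < N n, τ n (l + 1) ≤ τ n l + δ) →
    TendstoInMeasure P
      (fun n ω => ∑ k ∈ K, ∑ l ∈ Finset.range (N n),
        H k (τ n l) ω * ((W k (τ n (l + 1)) ω - W k (τ n l) ω : ℝ) : ℂ))
      atTop (I t)

/-! ## The stochastic differential equation -/

/-- The random angles `θ_e^{(t)} = θ_e^{(0)} + σ_e B_t^{(e)}`. -/
def angle (θ₀ σ : Edge → ℝ) (B : Edge → ℝ≥0 → Ω → ℝ) (t : ℝ≥0) (ω : Ω) (e : Edge) : ℝ :=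
  θ₀ e + σ e * B e t ω

/-- `Y(c_k⁺) ⟨χ_p χ_{a_k⁺}⟩ - Y(a_k⁺) ⟨χ_p χ_{c_k⁺}⟩`, for the Ising model with angles `θ`. -/
def bracket (θ : Edge → ℝ) (Y : LiftedCorner → ℂ) (k : Edge) (p : LiftedCorner) : ℂ :=
  Y k.cPlus * (fermion θ k k.aPlus p : ℂ) - Y k.aPlus * (fermion θ k k.cPlus p : ℂ)

/-- Coefficient of `dB^{(k)}` in `dY(p)`. -/
def diffusion (σ θ : Edge → ℝ) (Y : LiftedCorner → ℂ) (k : Edge) (p : LiftedCorner) : ℂ :=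
  -(1 / 2 : ℂ) * (σ k : ℂ) * bracket θ Y k p

/-- Coefficient of `ds` in `dY(p)`. -/
def drift (Λ : Finset Edge) (σ θ : Edge → ℝ) (Y : LiftedCorner → ℂ) (p : LiftedCorner) : ℂ :=
  (1 / 4 : ℂ) * ∑ k ∈ Λ, (σ k : ℂ) ^ 2 *
    ((Real.cos (θ k) / Real.sin (θ k) - energyDensity θ k / Real.sin (θ k) : ℝ) : ℂ) *
      bracket θ Y k p

/-- `Y` solves, up to the stopping time `T` (included), the stochastic differential system
`dY(p) = ∑_{k ∈ Λ} diffusion_k(p) dB^{(k)} + drift(p) ds` with initial condition `Y₀`. On `[0, T]` the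
angles stay in `(0, π / 2)`, so that the Ising models in the coefficients make sense. -/
structure IsSDESolution (P : Measure Ω) (B : Edge → ℝ≥0 → Ω → ℝ)
    (hB : ∀ e t, Measurable (B e t)) (Λ : Finset Edge) (θ₀ σ : Edge → ℝ)
    (Y₀ : LiftedCorner → ℂ) (T : Ω → ℝ≥0) (Y : LiftedCorner → ℝ≥0 → Ω → ℂ) : Prop where
  stopping : IsStoppingTime (completedFiltration P B hB Λ) fun ω => (T ω : WithTop ℝ≥0)
  angle_mem : ∀ᵐ ω ∂P, ∀ s ≤ T ω, ∀ e, angle θ₀ σ B s ω e ∈ Set.Ioo 0 (Real.pi / 2)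
  adapted : ∀ p, StronglyAdapted (completedFiltration P B hB Λ) fun t ω => Y p (min t (T ω)) ω
  continuous : ∀ᵐ ω ∂P, ∀ p, ContinuousOn (fun s => Y p s ω) (Set.Iic (T ω))
  initial : ∀ᵐ ω ∂P, ∀ p, Y p 0 ω = Y₀ p
  equation : ∀ p, IsItoIntegral P Λ
    (fun k t ω => diffusion σ (angle θ₀ σ B (min t (T ω)) ω) (fun q => Y q (min t (T ω)) ω) k p)
    (fun k t ω => B k (min t (T ω)) ω)
    (fun t ω => Y p (min t (T ω)) ω - Y₀ p -
      ∫ s in (0 : ℝ)..((min t (T ω) : ℝ≥0) : ℝ),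
        drift Λ σ (angle θ₀ σ B s.toNNReal ω) (fun q => Y q s.toNNReal ω) p)

end IsingEmb

end

/-!
The deformation of a propagator under a random change of finitely many angles.

*Fermions as fundamental solutions.* Griffiths' inequalities give the existence of the full-plane
limits, and the correlations of local observables depend smoothly on finitely many angles
(`contDiffOn_fermion`, `contDiffOn_energyDensity`). A gauge argument shows that a Kadanoff-Ceva
correlation does not depend on the disorder line, so that the fermion is a well-defined spinor
satisfying the propagation equation at all quads except the one of its source (`bracket_quad`), with
an explicit defect there (`bracket_quad_self`). In a box, the circulation of the product of two
solutions vanishes, whence a spinor is determined by its defects; in the limit, a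
spinor which is a limit of spinors in boxes is the combination of fermions with the same defects
(`IsBoxLimit.eq_sum`). Finally, a solution of the propagation equation always defines an s-embedding,
since its square is a closed discrete one-form (`Propagation.exists_isSEmbedding`).

*Stochastic calculus.* An Itô integral is a limit in probability of Riemann sums along all
partitions. All limits are handled through almost sure convergence along subsequences (`SubAE`).
Orthogonality of martingale increments, also in blocks of a partition, gives the quadratic variation
of stopped Brownian motions (`RegularProcess.subAE_quad`), Itô differentials along uniform partitions
(`hasItoDifferential_of_isItoIntegral`) and the product rule (`HasItoDifferential.product_rule`).

*Solutions are propagators.* The defect at a quad of a solution is a sum of products of `cos` or `sin`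
of the random angle and values of the solution. By the product rule its differential is a combination
of the defects of the diffusion and drift coefficients and of second order terms. The diffusion
coefficients are brackets of fermions, whose only defects are at their own quads; these defects
cancel the first order variation of the angle, and those of the drift cancel the second order terms
(`sum_diffusion_quad`, `drift_quad`). Hence all defects stay zero
(`propagation_of_hasItoDifferential`), at the times of a countable dense set and then, by continuity,
at all times.

*Existence.* For angles `θ` that differ from `θ₀` on `Λ` only, subtracting from the initial propagator
the fermions that carry its defects gives a propagator for `θ` (`deformation`). Its increments are
combinations of the fermions before the change (`deformation_sub_deformation`). Expanded to second order
(`norm_increment_sub_le`) and summed along a partition, they yield the stochastic differential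
equation: the quadratic variation only leaves the diagonal second order terms, which add up to the
drift (`sum_hessian_self`). The solution lives until the angles come close to the boundary of
`(0, π / 2)`, which takes a positive time.
-/


noncomputable section

namespace IsingEmb

/-! ### Correlation inequalities and the infinite-volume limit -/

/-- Product of the spins of a multiset of faces. -/
def chi (A : Multiset Face) (s : Config) : ℝ := (A.map fun f => ((s f : ℤ) : ℝ)).prod

theorem unitsInt_cast_mul_self (u : ℤˣ) : ((u : ℤ) : ℝ) * ((u : ℤ) : ℝ) = 1 := by
  rcases Int.units_eq_one_or u with rfl | rfl <;> norm_num

theorem chi_zero (s : Config) : chi 0 s = 1 := by simp [chi]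

theorem chi_add (A A' : Multiset Face) (s : Config) : chi (A + A') s = chi A s * chi A' s := by
  simp [chi]

theorem chi_cons (f : Face) (A : Multiset Face) (s : Config) :
    chi (f ::ₘ A) s = ((s f : ℤ) : ℝ) * chi A s := by simp [chi]

theorem chi_mul (A : Multiset Face) (s t : Config) : chi A (s * t) = chi A s * chi A t := by
  simp [chi, Multiset.prod_map_mul]

theorem chi_eq_one_or (A : Multiset Face) (s : Config) : chi A s = 1 ∨ chi A s = -1 := by
  induction A using Multiset.induction_on with
  | empty => simp [chi_zero]
  | cons f A ih =>
    rw [chi_cons]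
    rcases Int.units_eq_one_or (s f) with h | h <;> rcases ih with ih | ih <;> simp [h, ih]

theorem chi_pair_faces (e : Edge) (s : Config) :
    chi {e.faces.1, e.faces.2} s = ((energy s e : ℤ) : ℝ) := by
  simp [chi, energy]

/-- The cone of non-negative combinations of products of spins. -/
inductive Ferro : (Config → ℝ) → Prop
  | monomial (c : ℝ) (hc : 0 ≤ c) (A : Multiset Face) : Ferro fun s => c * chi A s
  | add {F G : Config → ℝ} (hF : Ferro F) (hG : Ferro G) : Ferro fun s => F s + G s

theorem Ferro.mul {F G : Config → ℝ} (hF : Ferro F) (hG : Ferro G) :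
    Ferro fun s => F s * G s := by
  induction hF with
  | monomial c hc A =>
    induction hG with
    | monomial d hd A' =>
      convert Ferro.monomial (c * d) (mul_nonneg hc hd) (A + A') using 2 with s
      rw [chi_add]; ring
    | add h₁ h₂ ih₁ ih₂ => simpa only [mul_add] using ih₁.add ih₂
  | add h₁ h₂ ih₁ ih₂ => simpa only [add_mul] using ih₁.add ih₂

theorem Ferro.chi (A : Multiset Face) : Ferro (chi A) := by
  simpa using Ferro.monomial 1 zero_le_one A

theorem Ferro.const {c : ℝ} (hc : 0 ≤ c) : Ferro fun _ => c := by
  simpa [chi_zero] using Ferro.monomial c hc 0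

theorem Ferro.prod {ι : Type*} (T : Finset ι) {F : ι → Config → ℝ} (h : ∀ i ∈ T, Ferro (F i)) :
    Ferro fun s => ∏ i ∈ T, F i s := by
  classical
  induction T using Finset.induction_on with
  | empty => simpa using Ferro.const zero_le_one
  | insert i T hi ih =>
    simp only [Finset.prod_insert hi]
    exact (h i (by simp)).mul (ih fun j hj => h j (by simp [hj]))

theorem exp_mul_energy (c : ℝ) (s : Config) (e : Edge) :
    Real.exp (c * ((energy s e : ℤ) : ℝ)) =
      Real.cosh c + Real.sinh c * ((energy s e : ℤ) : ℝ) := by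
  rcases Int.units_eq_one_or (energy s e) with h | h
  · simp [h]
  · simp only [h, Units.val_neg, Units.val_one, Int.cast_neg, Int.cast_one, mul_neg, mul_one]
    rw [← sub_eq_add_neg, Real.cosh_sub_sinh]

theorem Ferro.exp_energy {c : ℝ} (hc : 0 ≤ c) (e : Edge) :
    Ferro fun s => Real.exp (c * ((energy s e : ℤ) : ℝ)) := by
  simp only [exp_mul_energy]
  convert (Ferro.const (Real.cosh_pos c).le).add
    (Ferro.monomial (Real.sinh c) (Real.sinh_nonneg_iff.2 hc) {e.faces.1, e.faces.2}) using 3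
  rw [chi_pair_faces]

theorem Ferro.exp_sum (T : Finset Edge) {c : Edge → ℝ} (hc : ∀ e ∈ T, 0 ≤ c e) :
    Ferro fun s => Real.exp (∑ e ∈ T, c e * ((energy s e : ℤ) : ℝ)) := by
  simp only [Real.exp_sum]
  exact Ferro.prod T fun e he => Ferro.exp_energy (hc e he) e

theorem wired_mul (R : ℕ) (s t : boxFaces R → ℤˣ) :
    wired R (s * t) = wired R s * wired R t := by
  ext f; by_cases hf : f ∈ boxFaces R <;> simp [wired, hf]

theorem sum_chi_nonneg (R : ℕ) (A : Multiset Face) :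
    0 ≤ ∑ s : boxFaces R → ℤˣ, chi A (wired R s) := by
  by_cases h : ∃ u : boxFaces R → ℤˣ, chi A (wired R u) = -1
  · obtain ⟨u, hu⟩ := h
    have := Equiv.sum_comp (Equiv.mulLeft u) fun s : boxFaces R → ℤˣ => chi A (wired R s)
    simp only [Equiv.coe_mulLeft, wired_mul, chi_mul, hu, neg_mul, one_mul,
      Finset.sum_neg_distrib] at this
    linarith
  · push Not at h
    exact Finset.sum_nonneg fun s _ => by
      rcases chi_eq_one_or A (wired R s) with h' | h'
      · simp [h']
      · exact absurd h' (h s)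

/-- First Griffiths inequality. -/
theorem Ferro.sum_nonneg (R : ℕ) {F : Config → ℝ} (hF : Ferro F) :
    0 ≤ ∑ s : boxFaces R → ℤˣ, F (wired R s) := by
  induction hF with
  | monomial c hc A => rw [← Finset.mul_sum]; exact mul_nonneg hc (sum_chi_nonneg R A)
  | add h₁ h₂ ih₁ ih₂ => rw [Finset.sum_add_distrib]; exact add_nonneg ih₁ ih₂

theorem energy_mul (s t : Config) (e : Edge) : energy (s * t) e = energy s e * energy t e := by
  simp only [energy, Pi.mul_apply, mul_mul_mul_comm]

section Box

variable {θ : Edge → ℝ}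

theorem weight_pos {θ : Edge → ℝ} {e : Edge} (h : θ e ∈ Set.Ioo 0 (Real.pi / 2)) :
    0 < weight θ e :=
  Real.tan_pos_of_pos_of_lt_pi_div_two (by linarith [h.1]) (by linarith [h.2, Real.pi_pos])

theorem weight_lt_one {θ : Edge → ℝ} {e : Edge} (h : θ e ∈ Set.Ioo 0 (Real.pi / 2)) :
    weight θ e < 1 := by
  rw [weight, ← Real.tan_pi_div_four]
  exact Real.tan_lt_tan_of_lt_of_lt_pi_div_two (by linarith [h.1, Real.pi_pos])
    (by linarith [Real.pi_pos]) (by linarith [h.2])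

theorem coupling_nonneg {θ : Edge → ℝ} {e : Edge} (h : θ e ∈ Set.Ioo 0 (Real.pi / 2)) :
    0 ≤ coupling θ e := by
  have := Real.log_nonpos (weight_pos h).le (weight_lt_one h).le
  unfold coupling; linarith

theorem boltzmann_pos (θ : Edge → ℝ) (R : ℕ) (s : Config) : 0 < boltzmann θ R s := Real.exp_pos _

theorem partition_pos (θ : Edge → ℝ) (R : ℕ) :
    0 < ∑ s : boxFaces R → ℤˣ, boltzmann θ R (wired R s) :=
  Finset.sum_pos (fun _ _ => boltzmann_pos _ _ _) Finset.univ_nonempty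

theorem boxExpectation_add (θ : Edge → ℝ) (R : ℕ) (F G : Config → ℝ) :
    boxExpectation θ R (fun s => F s + G s) = boxExpectation θ R F + boxExpectation θ R G := by
  simp only [boxExpectation, mul_add, Finset.sum_add_distrib, add_div]

theorem boxExpectation_const_mul (θ : Edge → ℝ) (R : ℕ) (c : ℝ) (F : Config → ℝ) :
    boxExpectation θ R (fun s => c * F s) = c * boxExpectation θ R F := by
  simp only [boxExpectation, mul_left_comm _ c, ← Finset.mul_sum, mul_div_assoc]

theorem boxExpectation_const (θ : Edge → ℝ) (R : ℕ) (c : ℝ) :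
    boxExpectation θ R (fun _ => c) = c := by
  simp only [boxExpectation, ← Finset.sum_mul]
  field_simp [(partition_pos θ R).ne']

theorem boxExpectation_mono (θ : Edge → ℝ) (R : ℕ) {F G : Config → ℝ} (h : ∀ s, F s ≤ G s) :
    boxExpectation θ R F ≤ boxExpectation θ R G := by
  refine div_le_div_of_nonneg_right (Finset.sum_le_sum fun s _ => ?_) (partition_pos θ R).le
  exact mul_le_mul_of_nonneg_left (h _) (boltzmann_pos _ _ _).le

/-- Second Griffiths inequality, by duplication of the spins. -/
theorem boxExpectation_chi_mul_chi (hθ : ∀ e, θ e ∈ Set.Ioo 0 (Real.pi / 2)) (R : ℕ)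
    (A A' : Multiset Face) :
    boxExpectation θ R (chi A) * boxExpectation θ R (chi A') ≤
      boxExpectation θ R (fun s => chi A s * chi A' s) := by
  have key : 0 ≤ ∑ u : boxFaces R → ℤˣ, ∑ s : boxFaces R → ℤˣ,
      boltzmann θ R (wired R s) * boltzmann θ R (wired R (s * u)) *
        (chi A (wired R s) * (chi A' (wired R s) - chi A' (wired R (s * u)))) := by
    refine Finset.sum_nonneg fun u _ => ?_
    have hF : Ferro fun s => (1 - chi A' (wired R u)) * (Real.exp (∑ e ∈ boxEdges R,
        (coupling θ e * (1 + ((energy (wired R u) e : ℤ) : ℝ))) * ((energy s e : ℤ) : ℝ)) *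
        (chi A s * chi A' s)) := by
      refine Ferro.mul (Ferro.const ?_) (Ferro.mul (Ferro.exp_sum _ fun e _ => ?_)
        ((Ferro.chi A).mul (Ferro.chi A')))
      · rcases chi_eq_one_or A' (wired R u) with h | h <;> simp [h]
      · refine mul_nonneg (coupling_nonneg (hθ e)) ?_
        rcases Int.units_eq_one_or (energy (wired R u) e) with h | h <;> simp [h]
    refine (hF.sum_nonneg R).trans_eq (Finset.sum_congr rfl fun s _ => ?_)
    rw [boltzmann, boltzmann, ← Real.exp_add, ← Finset.sum_add_distrib, wired_mul, chi_mul]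
    have : ∀ e ∈ boxEdges R, coupling θ e * (1 + ((energy (wired R u) e : ℤ) : ℝ)) *
        ((energy (wired R s) e : ℤ) : ℝ) = coupling θ e * ((energy (wired R s) e : ℤ) : ℝ) +
        coupling θ e * ((energy (wired R s * wired R u) e : ℤ) : ℝ) := fun e _ => by
      rw [energy_mul]; push_cast; ring
    rw [Finset.sum_congr rfl this]; ring
  rw [Finset.sum_comm] at key
  have h2 : ∀ s : boxFaces R → ℤˣ, ∑ u : boxFaces R → ℤˣ,
      boltzmann θ R (wired R s) * boltzmann θ R (wired R (s * u)) *
        (chi A (wired R s) * (chi A' (wired R s) - chi A' (wired R (s * u)))) =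
      ∑ t : boxFaces R → ℤˣ, boltzmann θ R (wired R s) * boltzmann θ R (wired R t) *
        (chi A (wired R s) * (chi A' (wired R s) - chi A' (wired R t))) := fun s =>
    Equiv.sum_comp (Equiv.mulLeft s) fun t : boxFaces R → ℤˣ =>
      boltzmann θ R (wired R s) * boltzmann θ R (wired R t) *
        (chi A (wired R s) * (chi A' (wired R s) - chi A' (wired R t)))
  simp only [h2] at key
  have h3 : ∑ s : boxFaces R → ℤˣ, ∑ t : boxFaces R → ℤˣ,
      boltzmann θ R (wired R s) * boltzmann θ R (wired R t) *
        (chi A (wired R s) * (chi A' (wired R s) - chi A' (wired R t))) =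
      (∑ s : boxFaces R → ℤˣ, boltzmann θ R (wired R s) *
          (chi A (wired R s) * chi A' (wired R s))) *
        (∑ t : boxFaces R → ℤˣ, boltzmann θ R (wired R t)) -
      (∑ s : boxFaces R → ℤˣ, boltzmann θ R (wired R s) * chi A (wired R s)) *
        ∑ t : boxFaces R → ℤˣ, boltzmann θ R (wired R t) * chi A' (wired R t) := by
    rw [Finset.sum_mul_sum, Finset.sum_mul_sum, ← Finset.sum_sub_distrib]
    refine Finset.sum_congr rfl fun s _ => ?_
    rw [← Finset.sum_sub_distrib]
    exact Finset.sum_congr rfl fun t _ => by ring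
  rw [h3] at key
  have hZ := partition_pos θ R
  simp only [boxExpectation]
  rw [div_mul_div_comm, div_le_div_iff₀ (mul_pos hZ hZ) hZ]
  nlinarith

theorem boxExpectation_chi_mul_ferro (hθ : ∀ e, θ e ∈ Set.Ioo 0 (Real.pi / 2)) (R : ℕ)
    (A : Multiset Face) {G : Config → ℝ} (hG : Ferro G) :
    boxExpectation θ R (chi A) * boxExpectation θ R G ≤
      boxExpectation θ R (fun s => chi A s * G s) := by
  induction hG with
  | monomial c hc A' =>
    simp only [mul_left_comm _ c, boxExpectation_const_mul]
    exact mul_le_mul_of_nonneg_left (boxExpectation_chi_mul_chi hθ R A A') hc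
  | add h₁ h₂ ih₁ ih₂ =>
    simp only [mul_add, boxExpectation_add]
    exact add_le_add ih₁ ih₂

theorem boxFaces_subset_succ (R : ℕ) : boxFaces R ⊆ boxFaces (R + 1) := by
  intro f hf
  simp only [boxFaces, Finset.mem_product, Finset.mem_Ico] at hf ⊢
  push_cast; omega

theorem mem_boxEdges_h {R : ℕ} {m n : ℤ} :
    Edge.h m n ∈ boxEdges R ↔ -(R : ℤ) ≤ m ∧ m < R ∧ -(R : ℤ) ≤ n ∧ n ≤ R := by
  simp only [boxEdges, Finset.mem_union, Finset.mem_image, Finset.mem_product, Finset.mem_Ico,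
    Finset.mem_Icc, Prod.exists, Edge.h.injEq, reduceCtorEq, and_false, exists_false, or_false]
  constructor
  · rintro ⟨a, b, h, rfl, rfl⟩; omega
  · intro h; exact ⟨m, n, by omega, rfl, rfl⟩

theorem mem_boxEdges_v {R : ℕ} {m n : ℤ} :
    Edge.v m n ∈ boxEdges R ↔ -(R : ℤ) ≤ m ∧ m ≤ R ∧ -(R : ℤ) ≤ n ∧ n < R := by
  simp only [boxEdges, Finset.mem_union, Finset.mem_image, Finset.mem_product, Finset.mem_Ico,
    Finset.mem_Icc, Prod.exists, Edge.v.injEq, reduceCtorEq, and_false, exists_false, false_or]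
  constructor
  · rintro ⟨a, b, h, rfl, rfl⟩; omega
  · intro h; exact ⟨m, n, by omega, rfl, rfl⟩

theorem mem_boxFaces {R : ℕ} {f : Face} :
    f ∈ boxFaces R ↔ -(R : ℤ) ≤ f.1 ∧ f.1 < R ∧ -(R : ℤ) ≤ f.2 ∧ f.2 < R := by
  simp only [boxFaces, Finset.mem_product, Finset.mem_Ico]; tauto

theorem boxEdges_mono {R R' : ℕ} (h : R ≤ R') : boxEdges R ⊆ boxEdges R' := by
  intro e he
  cases e with
  | h m n => rw [mem_boxEdges_h] at he ⊢; omega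
  | v m n => rw [mem_boxEdges_v] at he ⊢; omega

theorem eventually_mem_boxEdges (e : Edge) : ∀ᶠ R in atTop, e ∈ boxEdges R := by
  cases e with
  | h m n =>
    filter_upwards [eventually_ge_atTop (m.natAbs + n.natAbs + 1)] with R hR
    rw [mem_boxEdges_h]; omega
  | v m n =>
    filter_upwards [eventually_ge_atTop (m.natAbs + n.natAbs + 1)] with R hR
    rw [mem_boxEdges_v]; omega

theorem eventually_subset_boxEdges (T : Finset Edge) : ∀ᶠ R in atTop, T ⊆ boxEdges R := by
  have : ∀ᶠ R in atTop, ∀ e ∈ T, e ∈ boxEdges R :=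
    (Finset.eventually_all T).2 fun e _ => eventually_mem_boxEdges e
  exact this

theorem energy_wired_of_notMem {R : ℕ} {e : Edge} (he : e ∉ boxEdges R) (s : boxFaces R → ℤˣ) :
    energy (wired R s) e = 1 := by
  have h : e.faces.1 ∉ boxFaces R ∧ e.faces.2 ∉ boxFaces R := by
    cases e with
    | h m n => simp only [Edge.faces, mem_boxFaces]; rw [mem_boxEdges_h] at he; omega
    | v m n => simp only [Edge.faces, mem_boxFaces]; rw [mem_boxEdges_v] at he; omega
  simp [energy, wired, h.1, h.2]

/-- The indicator of the event that the spins of the outermost faces of the box of size `R + 1`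
are all `+1`, as a polynomial in the spins. -/
def frameIndicator (R : ℕ) (s : Config) : ℝ :=
  ∏ f ∈ boxFaces (R + 1) \ boxFaces R, ((1 / 2 : ℝ) + (1 / 2) * chi {f} s)

theorem ferro_frameIndicator (R : ℕ) : Ferro (frameIndicator R) :=
  Ferro.prod _ fun f _ => (Ferro.const (by norm_num)).add (Ferro.monomial _ (by norm_num) _)

/-- Conditioning on the outermost spins of the larger box gives the model in the smaller box. -/
theorem sum_frameIndicator (θ : Edge → ℝ) (R : ℕ) (F : Config → ℝ) :
    ∑ s : boxFaces (R + 1) → ℤˣ, boltzmann θ (R + 1) (wired (R + 1) s) *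
        (frameIndicator R (wired (R + 1) s) * F (wired (R + 1) s)) =
      Real.exp (∑ e ∈ boxEdges (R + 1) \ boxEdges R, coupling θ e) *
        ∑ s : boxFaces R → ℤˣ, boltzmann θ R (wired R s) * F (wired R s) := by
  have hw : ∀ s : boxFaces R → ℤˣ,
      wired (R + 1) (fun f : boxFaces (R + 1) => wired R s f) = wired R s := fun s => by
    ext f
    by_cases hf : f ∈ boxFaces (R + 1)
    · simp [wired, hf]
    · have : f ∉ boxFaces R := fun h => hf (boxFaces_subset_succ R h)
      simp [wired, hf, this]
  rw [Finset.mul_sum]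
  symm
  refine Finset.sum_of_injOn (fun s f => wired R s f) ?_ (fun _ _ => by simp) ?_ ?_
  · intro s _ t _ hst
    funext f
    have := congrFun hst ⟨f, boxFaces_subset_succ R f.2⟩
    simpa [wired] using this
  · intro s _ hs
    have : frameIndicator R (wired (R + 1) s) = 0 := by
      by_contra h0
      refine hs ⟨fun f => s ⟨f, boxFaces_subset_succ R f.2⟩, by simp, ?_⟩
      ext ⟨f, hf⟩
      by_cases hfR : f ∈ boxFaces R
      · simp [wired, hfR]
      · have h1 := Finset.prod_ne_zero_iff.1 h0 f (by simp [hf, hfR])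
        simp only [chi, Multiset.map_singleton, Multiset.prod_singleton, wired, hf, dif_pos] at h1
        rcases Int.units_eq_one_or (s ⟨f, hf⟩) with h | h
        · simp [wired, hfR, h]
        · simp [h] at h1
    simp [this]
  · intro s _
    simp only [hw]
    have h1 : frameIndicator R (wired R s) = 1 := Finset.prod_eq_one fun f hf => by
      have : f ∉ boxFaces R := (Finset.mem_sdiff.1 hf).2
      norm_num [chi, wired, this]
    rw [h1, one_mul, ← mul_assoc, boltzmann, boltzmann, ← Real.exp_add]
    congr 2
    rw [← Finset.sum_sdiff (boxEdges_mono (Nat.le_succ R))]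
    congr 1
    refine Finset.sum_congr rfl fun e he => ?_
    simp [energy_wired_of_notMem (Finset.mem_sdiff.1 he).2 s]

theorem boxExpectation_frameIndicator_mul (θ : Edge → ℝ) (R : ℕ) (F : Config → ℝ) :
    boxExpectation θ (R + 1) (fun s => frameIndicator R s * F s) =
      boxExpectation θ (R + 1) (frameIndicator R) * boxExpectation θ R F ∧
      0 < boxExpectation θ (R + 1) (frameIndicator R) := by
  have h1 := sum_frameIndicator θ R F
  have h2 := sum_frameIndicator θ R fun _ => 1
  simp only [mul_one] at h2
  have hZ := partition_pos θ R
  have hZ' := partition_pos θ (R + 1)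
  simp only [boxExpectation]
  rw [h1, h2]
  generalize ∑ s : boxFaces R → ℤˣ, boltzmann θ R (wired R s) * F (wired R s) = x
  generalize ∑ s : boxFaces R → ℤˣ, boltzmann θ R (wired R s) = y at hZ ⊢
  generalize ∑ s : boxFaces (R + 1) → ℤˣ, boltzmann θ (R + 1) (wired (R + 1) s) = z at hZ' ⊢
  have := Real.exp_pos (∑ e ∈ boxEdges (R + 1) \ boxEdges R, coupling θ e)
  exact ⟨by field_simp, by positivity⟩

theorem boxExpectation_chi_antitone (hθ : ∀ e, θ e ∈ Set.Ioo 0 (Real.pi / 2))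
    (A : Multiset Face) : Antitone fun R => boxExpectation θ R (chi A) := by
  refine antitone_nat_of_succ_le fun R => ?_
  have h1 := boxExpectation_chi_mul_ferro hθ (R + 1) A (ferro_frameIndicator R)
  obtain ⟨h2, h3⟩ := boxExpectation_frameIndicator_mul θ R (chi A)
  simp only [mul_comm (frameIndicator R _)] at h2
  rw [h2, mul_comm] at h1
  exact le_of_mul_le_mul_left h1 h3

theorem exists_tendsto_boxExpectation_chi_mul (hθ : ∀ e, θ e ∈ Set.Ioo 0 (Real.pi / 2))
    (V : Finset Face) : ∀ (F : Config → ℝ), DependsOn F (V : Set Face) → ∀ A : Multiset Face,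
      ∃ L, Tendsto (fun R => boxExpectation θ R fun s => chi A s * F s) atTop (𝓝 L) := by
  classical
  induction V using Finset.induction_on with
  | empty =>
    intro F hF A
    have hc : ∀ s, F s = F 1 := fun s => hF (by simp)
    simp only [hc]
    simp only [mul_comm _ (F 1), boxExpectation_const_mul]
    refine ⟨_, (tendsto_atTop_ciInf (boxExpectation_chi_antitone hθ A) ⟨-1, ?_⟩).const_mul _⟩
    rintro _ ⟨R, rfl⟩
    refine (boxExpectation_const θ R (-1)).symm.le.trans (boxExpectation_mono θ R fun s => ?_)
    rcases chi_eq_one_or A s with h | h <;> simp [h]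
  | insert f V hf ih =>
    intro F hF A
    have hup : ∀ u : ℤˣ, DependsOn (fun s : Config => F (Function.update s f u))
        (V : Set Face) := by
      intro u s t hst
      refine hF fun g hg => ?_
      by_cases hgf : g = f
      · subst hgf; simp
      · simp only [Function.update_of_ne hgf]
        exact hst g (by simpa [hgf] using hg)
    have h1 := ih (fun s => (F (Function.update s f 1) + F (Function.update s f (-1))) / 2)
      (fun s t hst => by simp only [hup 1 hst, hup (-1) hst]) A
    have h2 := ih (fun s => (F (Function.update s f 1) - F (Function.update s f (-1))) / 2)
      (fun s t hst => by simp only [hup 1 hst, hup (-1) hst]) (f ::ₘ A)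
    obtain ⟨L₁, hL₁⟩ := h1
    obtain ⟨L₂, hL₂⟩ := h2
    refine ⟨L₁ + L₂, (hL₁.add hL₂).congr fun R => ?_⟩
    rw [← boxExpectation_add]
    congr 1
    ext s
    have hs : F s = F (Function.update s f (s f)) := by rw [Function.update_eq_self]
    rw [hs, chi_cons]
    rcases Int.units_eq_one_or (s f) with h | h
    · simp only [h, Units.val_one, Int.cast_one]; ring
    · simp only [h, Units.val_neg, Units.val_one, Int.cast_neg, Int.cast_one]; ring

/-- The infinite-volume limit of the expectations of a local observable exists. -/
theorem tendsto_boxExpectation (hθ : ∀ e, θ e ∈ Set.Ioo 0 (Real.pi / 2)) {V : Finset Face}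
    {F : Config → ℝ} (hF : DependsOn F (V : Set Face)) :
    Tendsto (fun R => boxExpectation θ R F) atTop (𝓝 (expectation θ F)) := by
  obtain ⟨L, hL⟩ := exists_tendsto_boxExpectation_chi_mul hθ V F hF 0
  simp only [chi_zero, one_mul] at hL
  exact tendsto_nhds_limUnder ⟨L, hL⟩

end Box

/-! ### Local observables and their dependence on finitely many angles -/

/-- An observable that depends on finitely many spins. -/
def IsLocal (F : Config → ℝ) : Prop := ∃ V : Finset Face, DependsOn F (V : Set Face)

theorem IsLocal.const (c : ℝ) : IsLocal fun _ => c := ⟨∅, fun _ _ _ => rfl⟩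

theorem IsLocal.comp₂ {F G : Config → ℝ} (hF : IsLocal F) (hG : IsLocal G) (φ : ℝ → ℝ → ℝ) :
    IsLocal fun s => φ (F s) (G s) := by
  classical
  obtain ⟨V, hV⟩ := hF
  obtain ⟨W, hW⟩ := hG
  refine ⟨V ∪ W, fun s t h => ?_⟩
  have h1 := hV (x := s) (y := t) fun f hf => h f (by simp [Finset.mem_coe.1 hf])
  have h2 := hW (x := s) (y := t) fun f hf => h f (by simp [Finset.mem_coe.1 hf])
  simp only [h1, h2]

theorem IsLocal.comp {F : Config → ℝ} (hF : IsLocal F) (φ : ℝ → ℝ) : IsLocal fun s => φ (F s) :=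
  hF.comp₂ hF fun x _ => φ x

theorem IsLocal.add {F G : Config → ℝ} (hF : IsLocal F) (hG : IsLocal G) :
    IsLocal fun s => F s + G s := hF.comp₂ hG (· + ·)

theorem IsLocal.mul {F G : Config → ℝ} (hF : IsLocal F) (hG : IsLocal G) :
    IsLocal fun s => F s * G s := hF.comp₂ hG (· * ·)

theorem IsLocal.sum {ι : Type*} (T : Finset ι) {F : ι → Config → ℝ}
    (h : ∀ i ∈ T, IsLocal (F i)) : IsLocal fun s => ∑ i ∈ T, F i s := by
  classical
  induction T using Finset.induction_on with
  | empty => simpa using IsLocal.const 0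
  | insert i T hi ih =>
    simp only [Finset.sum_insert hi]
    exact (h i (by simp)).add (ih fun j hj => h j (by simp [hj]))

theorem IsLocal.prod {ι : Type*} (T : Finset ι) {F : ι → Config → ℝ}
    (h : ∀ i ∈ T, IsLocal (F i)) : IsLocal fun s => ∏ i ∈ T, F i s := by
  classical
  induction T using Finset.induction_on with
  | empty => simpa using IsLocal.const 1
  | insert i T hi ih =>
    simp only [Finset.prod_insert hi]
    exact (h i (by simp)).mul (ih fun j hj => h j (by simp [hj]))

theorem isLocal_spin (f : Face) : IsLocal fun s => ((s f : ℤ) : ℝ) :=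
  ⟨{f}, fun s t h => by simp only [h f (by simp)]⟩

theorem isLocal_energy (e : Edge) : IsLocal fun s => ((energy s e : ℤ) : ℝ) := by
  simpa [energy] using (isLocal_spin e.faces.1).mul (isLocal_spin e.faces.2)

theorem isLocal_disorder (θ : Edge → ℝ) (e : Edge) :
    IsLocal fun s => weight θ e ^ ((energy s e : ℤˣ) : ℤ) := by
  obtain ⟨V, hV⟩ := isLocal_energy e
  refine ⟨V, fun s t h => ?_⟩
  have := hV h
  simp only [Int.cast_inj] at this
  simp only [this]

section

variable {θ : Edge → ℝ} (hθ : ∀ e, θ e ∈ Set.Ioo 0 (Real.pi / 2))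
include hθ

theorem IsLocal.tendsto {F : Config → ℝ} (hF : IsLocal F) :
    Tendsto (fun R => boxExpectation θ R F) atTop (𝓝 (expectation θ F)) :=
  tendsto_boxExpectation hθ hF.choose_spec

theorem expectation_add {F G : Config → ℝ} (hF : IsLocal F) (hG : IsLocal G) :
    expectation θ (fun s => F s + G s) = expectation θ F + expectation θ G :=
  tendsto_nhds_unique (((hF.add hG).tendsto hθ).congr fun R => boxExpectation_add θ R F G)
    ((hF.tendsto hθ).add (hG.tendsto hθ))

theorem expectation_const_mul (c : ℝ) {F : Config → ℝ} (hF : IsLocal F) :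
    expectation θ (fun s => c * F s) = c * expectation θ F :=
  tendsto_nhds_unique ((((IsLocal.const c).mul hF).tendsto hθ).congr fun R =>
    boxExpectation_const_mul θ R c F) ((hF.tendsto hθ).const_mul c)

theorem expectation_const (c : ℝ) : expectation θ (fun _ => c) = c :=
  tendsto_nhds_unique (((IsLocal.const c).tendsto hθ).congr fun R =>
    boxExpectation_const θ R c) tendsto_const_nhds

theorem expectation_mono {F G : Config → ℝ} (hF : IsLocal F) (hG : IsLocal G)
    (h : ∀ s, F s ≤ G s) : expectation θ F ≤ expectation θ G :=
  le_of_tendsto_of_tendsto' (hF.tendsto hθ) (hG.tendsto hθ) fun R => boxExpectation_mono θ R h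

theorem expectation_sum {ι : Type*} (T : Finset ι) {F : ι → Config → ℝ}
    (h : ∀ i ∈ T, IsLocal (F i)) :
    expectation θ (fun s => ∑ i ∈ T, F i s) = ∑ i ∈ T, expectation θ (F i) := by
  classical
  induction T using Finset.induction_on with
  | empty => simpa using expectation_const hθ 0
  | insert i T hi ih =>
    simp only [Finset.sum_insert hi]
    rw [expectation_add hθ (h i (by simp)) (IsLocal.sum T fun j hj => h j (by simp [hj])),
      ih fun j hj => h j (by simp [hj])]

end

/-- The density of the model with angles `θ` relative to the model with angles `θ₀`, up to
normalisation, when the angles differ only on `Λ`. -/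
def relWeight (θ₀ θ : Edge → ℝ) (Λ : Finset Edge) (s : Config) : ℝ :=
  Real.exp (∑ e ∈ Λ, (coupling θ e - coupling θ₀ e) * ((energy s e : ℤ) : ℝ))

theorem isLocal_relWeight (θ₀ θ : Edge → ℝ) (Λ : Finset Edge) : IsLocal (relWeight θ₀ θ Λ) :=
  (IsLocal.sum Λ fun e _ => (IsLocal.const _).mul (isLocal_energy e)).comp Real.exp

theorem expectation_relWeight_pos {θ₀ : Edge → ℝ} (hθ₀ : ∀ e, θ₀ e ∈ Set.Ioo 0 (Real.pi / 2))
    (θ : Edge → ℝ) (Λ : Finset Edge) : 0 < expectation θ₀ (relWeight θ₀ θ Λ) := by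
  refine (Real.exp_pos (-∑ e ∈ Λ, |coupling θ e - coupling θ₀ e|)).trans_le ?_
  rw [← expectation_const hθ₀ (Real.exp (-∑ e ∈ Λ, |coupling θ e - coupling θ₀ e|))]
  refine expectation_mono hθ₀ (IsLocal.const _) (isLocal_relWeight _ _ _) fun s => ?_
  refine Real.exp_le_exp.2 ?_
  rw [← Finset.sum_neg_distrib]
  refine Finset.sum_le_sum fun e _ => ?_
  rcases Int.units_eq_one_or (energy s e) with h | h
  · simpa [h] using neg_abs_le (coupling θ e - coupling θ₀ e)
  · simpa [h] using neg_le_neg (le_abs_self (coupling θ e - coupling θ₀ e))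

theorem expectation_eq_div {θ₀ θ : Edge → ℝ} (hθ₀ : ∀ e, θ₀ e ∈ Set.Ioo 0 (Real.pi / 2))
    (hθ : ∀ e, θ e ∈ Set.Ioo 0 (Real.pi / 2)) {Λ : Finset Edge} (hΛ : ∀ e, e ∉ Λ → θ e = θ₀ e)
    {F : Config → ℝ} (hF : IsLocal F) :
    expectation θ F = expectation θ₀ (fun s => relWeight θ₀ θ Λ s * F s) /
      expectation θ₀ (relWeight θ₀ θ Λ) := by
  refine tendsto_nhds_unique (hF.tendsto hθ)
    (((((isLocal_relWeight θ₀ θ Λ).mul hF).tendsto hθ₀).div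
      ((isLocal_relWeight θ₀ θ Λ).tendsto hθ₀)
      (expectation_relWeight_pos hθ₀ θ Λ).ne').congr' ?_)
  filter_upwards [eventually_subset_boxEdges Λ] with R hR
  have hb : ∀ s, boltzmann θ R s = boltzmann θ₀ R s * relWeight θ₀ θ Λ s := fun s => by
    rw [boltzmann, boltzmann, relWeight, ← Real.exp_add]
    congr 1
    rw [Finset.sum_subset hR, ← Finset.sum_add_distrib]
    · exact Finset.sum_congr rfl fun e _ => by ring
    · intro e _ he
      simp [coupling, weight, hΛ e he]
  have hZ := partition_pos θ₀ R
  have hZ' := partition_pos θ R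
  simp only [Pi.div_apply, boxExpectation, hb, mul_assoc] at hZ' ⊢
  field_simp

/-- The angles which are `u` on `Λ` and `θ₀` elsewhere. -/
def extendAngles (θ₀ : Edge → ℝ) (Λ : Finset Edge) (u : Λ → ℝ) (e : Edge) : ℝ :=
  if h : e ∈ Λ then u ⟨e, h⟩ else θ₀ e

/-- The admissible values of the angles on `Λ`. -/
def angleBox (Λ : Finset Edge) : Set (Λ → ℝ) := {u | ∀ e, u e ∈ Set.Ioo 0 (Real.pi / 2)}

theorem extendAngles_mem {θ₀ : Edge → ℝ} (hθ₀ : ∀ e, θ₀ e ∈ Set.Ioo 0 (Real.pi / 2))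
    {Λ : Finset Edge} {u : Λ → ℝ} (hu : u ∈ angleBox Λ) (e : Edge) :
    extendAngles θ₀ Λ u e ∈ Set.Ioo 0 (Real.pi / 2) := by
  unfold extendAngles; split_ifs with h
  · exact hu _
  · exact hθ₀ e

theorem contDiffOn_extendAngles (θ₀ : Edge → ℝ) (Λ : Finset Edge) (e : Edge) :
    ContDiffOn ℝ 1 (fun u => extendAngles θ₀ Λ u e) (angleBox Λ) := by
  unfold extendAngles; split_ifs with h <;> fun_prop

section Smooth

variable {θ₀ : Edge → ℝ} (hθ₀ : ∀ e, θ₀ e ∈ Set.Ioo 0 (Real.pi / 2)) (Λ : Finset Edge)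
include hθ₀

theorem contDiffOn_weight (e : Edge) :
    ContDiffOn ℝ 1 (fun u => weight (extendAngles θ₀ Λ u) e) (angleBox Λ) := by
  intro u hu
  have h := extendAngles_mem hθ₀ hu e
  have hc : Real.cos (extendAngles θ₀ Λ u e / 2) ≠ 0 :=
    (Real.cos_pos_of_mem_Ioo ⟨by linarith [h.1, Real.pi_pos], by linarith [h.2, Real.pi_pos]⟩).ne'
  exact (Real.contDiffAt_tan.2 hc).comp_contDiffWithinAt (f := fun u => extendAngles θ₀ Λ u e / 2)
    u ((contDiffOn_extendAngles θ₀ Λ e u hu).div_const 2)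

theorem contDiffOn_weight_zpow (e : Edge) (k : ℤˣ) :
    ContDiffOn ℝ 1 (fun u => weight (extendAngles θ₀ Λ u) e ^ (k : ℤ)) (angleBox Λ) := by
  rcases Int.units_eq_one_or k with rfl | rfl
  · simpa using contDiffOn_weight hθ₀ Λ e
  · have h := (contDiffOn_weight hθ₀ Λ e).inv fun u hu =>
      (weight_pos (extendAngles_mem hθ₀ hu e)).ne'
    simp only [Units.val_neg, Units.val_one, zpow_neg, zpow_one]
    exact h

theorem contDiffOn_relWeight (s : Config) :
    ContDiffOn ℝ 1 (fun u => relWeight θ₀ (extendAngles θ₀ Λ u) Λ s) (angleBox Λ) := by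
  unfold relWeight coupling
  refine ContDiffOn.exp (ContDiffOn.sum fun e _ => ContDiffOn.mul (ContDiffOn.sub ?_
    contDiffOn_const) contDiffOn_const)
  exact (((contDiffOn_weight hθ₀ Λ e).log fun u hu =>
      (weight_pos (extendAngles_mem hθ₀ hu e)).ne').neg).div_const 2

theorem contDiffOn_expectation_base {F : (Λ → ℝ) → Config → ℝ} (V : Finset Face)
    (hV : ∀ u, DependsOn (F u) (V : Set Face))
    (hF : ∀ s, ContDiffOn ℝ 1 (fun u => F u s) (angleBox Λ)) :
    ContDiffOn ℝ 1 (fun u => expectation θ₀ (F u)) (angleBox Λ) := by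
  classical
  let ext : (V → ℤˣ) → Config := fun η f => if h : f ∈ V then η ⟨f, h⟩ else 1
  let ind : (V → ℤˣ) → Config → ℝ := fun η s => if (fun f : V => s f) = η then 1 else 0
  have hind : ∀ η, IsLocal (ind η) := fun η => ⟨V, fun s t h => by
    have : (fun f : V => s f) = fun f : V => t f := funext fun f => h f f.2
    simp only [ind, this]⟩
  have key : ∀ u, expectation θ₀ (F u) = ∑ η, F u (ext η) * expectation θ₀ (ind η) := by
    intro u
    have : F u = fun s => ∑ η, F u (ext η) * ind η s := by
      ext s
      rw [Finset.sum_eq_single (fun f : V => s f)]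
      · simp only [ind, if_true, mul_one]
        exact hV u fun f hf => by simp [ext, Finset.mem_coe.1 hf]
      · intro η _ h; simp [ind, h.symm]
      · simp
    conv_lhs => rw [this]
    rw [expectation_sum hθ₀ _ fun η _ => (IsLocal.const _).mul (hind η)]
    exact Finset.sum_congr rfl fun η _ => expectation_const_mul hθ₀ _ (hind η)
  simp only [key]
  exact ContDiffOn.sum fun η _ => (hF _).mul contDiffOn_const

theorem contDiffOn_expectation {F : (Λ → ℝ) → Config → ℝ} (V : Finset Face)
    (hV : ∀ u, DependsOn (F u) (V : Set Face))
    (hF : ∀ s, ContDiffOn ℝ 1 (fun u => F u s) (angleBox Λ)) :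
    ContDiffOn ℝ 1 (fun u => expectation (extendAngles θ₀ Λ u) (F u)) (angleBox Λ) := by
  classical
  -- a common finite set of faces for the densities
  let W : Finset Face := Λ.biUnion fun e => {e.faces.1, e.faces.2}
  have hW : ∀ u, DependsOn (relWeight θ₀ (extendAngles θ₀ Λ u) Λ) (W : Set Face) := by
    intro u s t h
    unfold relWeight
    congr 1
    refine Finset.sum_congr rfl fun e he => ?_
    have h1 : s e.faces.1 = t e.faces.1 := h _ (by
      simp only [W, Finset.coe_biUnion, Set.mem_iUnion]; exact ⟨e, he, by simp⟩)
    have h2 : s e.faces.2 = t e.faces.2 := h _ (by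
      simp only [W, Finset.coe_biUnion, Set.mem_iUnion]; exact ⟨e, he, by simp⟩)
    simp only [energy, h1, h2]
  have hnum := contDiffOn_expectation_base hθ₀ Λ (F := fun u s =>
    relWeight θ₀ (extendAngles θ₀ Λ u) Λ s * F u s) (W ∪ V) (fun u s t h => by
      have h1 := hW u (x := s) (y := t) fun f hf => h f (by simp [Finset.mem_coe.1 hf])
      have h2 := hV u (x := s) (y := t) fun f hf => h f (by simp [Finset.mem_coe.1 hf])
      simp only [h1, h2]) fun s => (contDiffOn_relWeight hθ₀ Λ s).mul (hF s)
  have hden := contDiffOn_expectation_base hθ₀ Λ (F := fun u s =>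
    relWeight θ₀ (extendAngles θ₀ Λ u) Λ s) W hW fun s => contDiffOn_relWeight hθ₀ Λ s
  refine (hnum.div hden fun u hu => (expectation_relWeight_pos hθ₀ _ Λ).ne').congr
    fun u hu => ?_
  exact expectation_eq_div hθ₀ (extendAngles_mem hθ₀ hu)
    (fun e he => by simp [extendAngles, he]) ⟨V, hV u⟩

theorem contDiffOn_energyDensity (e : Edge) :
    ContDiffOn ℝ 1 (fun u => energyDensity (extendAngles θ₀ Λ u) e) (angleBox Λ) := by
  obtain ⟨V, hV⟩ := isLocal_energy e
  exact contDiffOn_expectation hθ₀ Λ V (fun _ => hV) fun s => contDiffOn_const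

theorem contDiffOn_fermion (z : Edge) (q p : LiftedCorner) :
    ContDiffOn ℝ 1 (fun u => fermion (extendAngles θ₀ Λ u) z q p) (angleBox Λ) := by
  classical
  have : Nonempty KCState := ⟨KCState.init q⟩
  unfold fermion
  split_ifs
  · exact contDiffOn_const
  · exact contDiffOn_const
  generalize Classical.epsilon (fun A : KCState => A.Reached z q ∧ A.corner = p) = A
  unfold KCState.value
  refine contDiffOn_const.mul (contDiffOn_expectation hθ₀ Λ
    ((A.line.biUnion fun e => {e.faces.1, e.faces.2}) ∪ {A.corner.face, q.face}) ?_ ?_)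
  · intro u s t h
    have h1 : s A.corner.face = t A.corner.face := h _ (by simp)
    have h2 : s q.face = t q.face := h _ (by simp)
    have h3 : ∀ e ∈ A.line, energy s e = energy t e := fun e he => by
      have h1 : s e.faces.1 = t e.faces.1 := h _ (by
        simp only [Finset.coe_union, Finset.coe_biUnion]
        exact Or.inl (Set.mem_biUnion he (by simp)))
      have h2 : s e.faces.2 = t e.faces.2 := h _ (by
        simp only [Finset.coe_union, Finset.coe_biUnion]
        exact Or.inl (Set.mem_biUnion he (by simp)))
      simp only [energy, h1, h2]
    simp only [h1, h2]
    rw [Finset.prod_congr rfl fun e he => by rw [h3 e he]]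
  · intro s
    exact ((contDiffOn_prod fun e _ => contDiffOn_weight_zpow hθ₀ Λ e _).mul
      contDiffOn_const).mul contDiffOn_const

end Smooth

/-! ### Kadanoff-Ceva correlations do not depend on the disorder line -/

/-- The sign `-1` on the edges of a disorder line. -/
def lineSign (γ : Finset Edge) (e : Edge) : ℤˣ := if e ∈ γ then -1 else 1

/-- The sign `-1` on the edges of the horizontal ray that goes from the vertex `w` to the left. -/
def raySign (w : Vertex) : Edge → ℤˣ
  | .h m n => if n = w.2 ∧ m < w.1 then -1 else 1
  | .v _ _ => 1

/-- The sign `-1` on the faces of the half-row to the left of a vertical edge. -/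
def halfRowSign : Edge → Face → ℤˣ
  | .h _ _, _ => 1
  | .v m n, f => if f.1 < m ∧ f.2 = n then -1 else 1

/-- The sign `-1` on the faces with negative abscissa that lie below the vertex `w`. -/
def farSign (w : Vertex) (f : Face) : ℤˣ := if f.1 < 0 ∧ f.2 < w.2 then -1 else 1

/-- The two end points of an edge. -/
def Edge.ends : Edge → Vertex × Vertex
  | .h m n => ((m, n), (m + 1, n))
  | .v m n => ((m, n), (m, n + 1))

theorem raySign_h (w₁ w₂ m n : ℤ) :
    raySign (w₁, w₂) (.h m n) = if n = w₂ ∧ m < w₁ then -1 else 1 := rfl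

theorem halfRowSign_v (m n f₁ f₂ : ℤ) :
    halfRowSign (.v m n) (f₁, f₂) = if f₁ < m ∧ f₂ = n then -1 else 1 := rfl

theorem farSign_mk (w₁ w₂ f₁ f₂ : ℤ) :
    farSign (w₁, w₂) (f₁, f₂) = if f₁ < 0 ∧ f₂ < w₂ then -1 else 1 := rfl

theorem lineSign_singleton_v (m n m' n' : ℤ) :
    lineSign {.v m n} (.v m' n') = if m' = m ∧ n' = n then -1 else 1 := by
  simp [lineSign]

theorem lineSign_singleton_h (m n m' n' : ℤ) :
    lineSign {.h m n} (.h m' n') = if m' = m ∧ n' = n then -1 else 1 := by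
  simp [lineSign]

/-- The half-row to the left of a vertical edge is bounded by the edge and the rays
from its two end points; a horizontal edge and these two rays cancel. -/
theorem halfRowSign_faces (e e' : Edge) :
    halfRowSign e e'.faces.1 * halfRowSign e e'.faces.2 =
      lineSign {e} e' * raySign e.ends.1 e' * raySign e.ends.2 e' := by
  cases e <;> cases e' <;> simp only [Edge.faces, Edge.ends, raySign_h, halfRowSign_v,
    lineSign_singleton_h, lineSign_singleton_v] <;> simp only [raySign, halfRowSign, lineSign,
    Finset.mem_singleton, reduceCtorEq, if_false] <;> (repeat' split) <;> first | rfl | (exfalso; omega)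

theorem lineSign_symmDiff (γ γ' : Finset Edge) (e : Edge) :
    lineSign (symmDiff γ γ') e = lineSign γ e * lineSign γ' e := by
  by_cases h : e ∈ γ <;> by_cases h' : e ∈ γ' <;>
    simp [lineSign, Finset.mem_symmDiff, h, h']

/-- The gauge `c` of a state `A` reached from `q`: a sign on the faces that changes
exactly across the disorder line of `A` and the rays from the two disorders. The sign of the state
is compared, up to `η`, with its sheet in the double cover by means of the gauge. -/
def KCState.Gauged (q : LiftedCorner) (η : ℤˣ) (A : KCState) : Prop :=
  ∃ c : Face → ℤˣ,
    (∀ e, c e.faces.1 * c e.faces.2 =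
      lineSign A.line e * (raySign A.corner.vertex e * raySign q.vertex e)) ∧
    (∃ R : ℕ, ∀ f, f ∉ boxFaces R → c f = farSign A.corner.vertex f * farSign q.vertex f) ∧
    A.sgn * (c A.corner.face * c q.face) = η * (A.corner.sgn * q.sgn)

/-- The sign `-1` for steps of the corner graph that cross the horizontal ray to the left of the
vertex of `q` or the horizontal ray to the right of the centre of the face of `q`. -/
def cutSign (q p p' : LiftedCorner) : ℤˣ :=
  if p.j ≠ p'.j ∧ ((min p.j p'.j = 2 * q.vertex.2 - 1 ∧ p.i < 2 * q.vertex.1) ∨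
    (min p.j p'.j = 2 * q.face.2 ∧ 2 * q.face.1 + 1 ≤ p.i)) then -1 else 1

theorem neg_one_zpow_two_mul (m : ℤ) : (-1 : ℤˣ) ^ (2 * m) = 1 := by
  rw [zpow_mul]; simp

theorem neg_one_zpow_two_mul_add_one (m : ℤ) : (-1 : ℤˣ) ^ (2 * m + 1) = -1 := by
  rw [zpow_add, neg_one_zpow_two_mul]; simp

theorem neg_one_zpow_two_mul_sub_one (m : ℤ) : (-1 : ℤˣ) ^ (2 * m - 1) = -1 := by
  rw [zpow_sub, neg_one_zpow_two_mul]; simp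

theorem gauged_init (q : LiftedCorner) : (KCState.init q).Gauged q 1 := by
  refine ⟨1, fun e => ?_, ⟨0, fun f _ => ?_⟩, ?_⟩
  · simp [KCState.init, lineSign, ← pow_two]
  · simp [KCState.init, ← pow_two]
  · simp [KCState.init]

theorem gauged_flip (q : LiftedCorner) : (⟨q.flip, ∅, 1⟩ : KCState).Gauged q (-1) := by
  refine ⟨1, fun e => ?_, ⟨0, fun f _ => ?_⟩, ?_⟩
  · simp [LiftedCorner.flip, LiftedCorner.vertex, lineSign, ← pow_two]
  · simp [LiftedCorner.flip, LiftedCorner.vertex, ← pow_two]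
  · simp [LiftedCorner.flip]

/-- Two neighbours across `e` that share their vertex lie in the two faces separated by `e`, and the
sheet changes together with the sign of the ray from this vertex. -/
theorem adjIn_vertex {e : Edge} {p p' : LiftedCorner} (h : LiftedCorner.AdjIn e p p')
    (hv : p'.vertex = p.vertex) (q : LiftedCorner) :
    ((p.face = e.faces.1 ∧ p'.face = e.faces.2) ∨ (p.face = e.faces.2 ∧ p'.face = e.faces.1)) ∧
    raySign p.vertex e * raySign q.vertex e * p.sgn = cutSign q p p' * p'.sgn := by
  obtain ⟨i, j, s⟩ := p
  obtain ⟨i', j', s'⟩ := p'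
  generalize hw : q.vertex = w
  generalize hg : q.face = g
  obtain ⟨w₁, w₂⟩ := w
  obtain ⟨g₁, g₂⟩ := g
  obtain ⟨h1, h2, h3⟩ := h
  simp only [LiftedCorner.vertex, Prod.mk.injEq] at hv
  cases e with
  | h m n =>
    simp only [LiftedCorner.InQuad, LiftedCorner.Adj] at h1 h2 h3
    have hi : i' = i := by omega
    have hj : j' ≠ j := by omega
    obtain ⟨-, -, hs⟩ := h3.resolve_left (by omega)
    subst hi
    refine ⟨?_, ?_⟩
    · simp only [LiftedCorner.face, Edge.faces, Prod.mk.injEq]; omega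
    simp only [cutSign, hw, hg]
    simp only [LiftedCorner.vertex, raySign_h]
    rw [hs]
    rcases h1.1 with rfl | rfl
    · rw [neg_one_zpow_two_mul]
      (repeat' split) <;> first | (simp; done) | (exfalso; omega)
    · rw [neg_one_zpow_two_mul_add_one]
      (repeat' split) <;> first | (simp; done) | (exfalso; omega)
  | v m n =>
    simp only [LiftedCorner.InQuad, LiftedCorner.Adj] at h1 h2 h3
    have hj : j' = j := by omega
    obtain ⟨-, -, hs⟩ := h3.resolve_right (by omega)
    refine ⟨?_, ?_⟩
    · simp only [LiftedCorner.face, Edge.faces, Prod.mk.injEq]; omega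
    simp [raySign, cutSign, hj, hs]

/-- Two neighbours across `e` that share their face belong to the two end points of `e`. -/
theorem adjIn_face {e : Edge} {p p' : LiftedCorner} (h : LiftedCorner.AdjIn e p p')
    (hf : p'.face = p.face) (q : LiftedCorner) :
    ((p.vertex = e.ends.1 ∧ p'.vertex = e.ends.2) ∨
      (p.vertex = e.ends.2 ∧ p'.vertex = e.ends.1)) ∧
    halfRowSign e p.face * halfRowSign e q.face * p.sgn = cutSign q p p' * p'.sgn := by
  obtain ⟨i, j, s⟩ := p
  obtain ⟨i', j', s'⟩ := p'
  generalize hw : q.vertex = w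
  generalize hg : q.face = g
  obtain ⟨w₁, w₂⟩ := w
  obtain ⟨g₁, g₂⟩ := g
  obtain ⟨h1, h2, h3⟩ := h
  simp only [LiftedCorner.face, Prod.mk.injEq] at hf
  cases e with
  | h m n =>
    simp only [LiftedCorner.InQuad, LiftedCorner.Adj] at h1 h2 h3
    have hj : j' = j := by omega
    obtain ⟨-, -, hs⟩ := h3.resolve_right (by omega)
    refine ⟨?_, ?_⟩
    · simp only [LiftedCorner.vertex, Edge.ends, Prod.mk.injEq]; omega
    simp [halfRowSign, cutSign, hj, hs]
  | v m n =>
    simp only [LiftedCorner.InQuad, LiftedCorner.Adj] at h1 h2 h3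
    have hi : i' = i := by omega
    have hj : j' ≠ j := by omega
    obtain ⟨-, -, hs⟩ := h3.resolve_left (by omega)
    subst hi
    refine ⟨?_, ?_⟩
    · simp only [LiftedCorner.vertex, Edge.ends, Prod.mk.injEq]; omega
    simp only [cutSign, hw, hg]
    simp only [LiftedCorner.face, halfRowSign_v]
    rw [hs]
    rcases h1.1 with rfl | rfl
    · rw [neg_one_zpow_two_mul_sub_one]
      (repeat' split) <;> first | (simp; done) | (exfalso; omega)
    · rw [neg_one_zpow_two_mul]
      (repeat' split) <;> first | (simp; done) | (exfalso; omega)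

theorem units_mul_self_eq (u : ℤˣ) : u * u = 1 := by
  rcases Int.units_eq_one_or u with rfl | rfl <;> rfl

/-- Away from a large box the half-row to the left of an edge consists of the faces with negative
abscissa between the heights of the two end points. -/
theorem exists_halfRowSign_eq_farSign (e : Edge) : ∃ R : ℕ, ∀ f, f ∉ boxFaces R →
    halfRowSign e f = farSign e.ends.1 f * farSign e.ends.2 f := by
  cases e with
  | h m n => exact ⟨0, fun f _ => by
    rw [farSign, farSign, Edge.ends, units_mul_self_eq]; rfl⟩
  | v m n =>
    refine ⟨m.natAbs + n.natAbs + 1, fun ⟨f₁, f₂⟩ hf => ?_⟩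
    rw [mem_boxFaces] at hf
    simp only [Edge.ends, halfRowSign_v, farSign_mk]
    (repeat' split) <;> first | rfl | (exfalso; omega)

theorem KCState.Gauged.move {q : LiftedCorner} {η : ℤˣ} {A A' : KCState} {e : Edge}
    (hA : A.Gauged q η) (hm : KCState.Move e A A') :
    A'.Gauged q (η * cutSign q A.corner A'.corner) := by
  obtain ⟨c, hc, ⟨R, hR⟩, hs⟩ := hA
  obtain ⟨hadj, ⟨hv, hl, hs'⟩ | ⟨hf, hl, hs'⟩⟩ := hm
  · obtain ⟨hfaces, hsgn⟩ := adjIn_vertex hadj hv q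
    refine ⟨c, ?_, ⟨R, ?_⟩, ?_⟩
    · rw [hl, hv]; exact hc
    · rw [hv]; exact hR
    · have h1 : A'.sgn = lineSign A.line e * A.sgn := by
        rw [hs', lineSign]; split_ifs <;> simp
      have h2 : c A'.corner.face =
          lineSign A.line e * (raySign A.corner.vertex e * raySign q.vertex e) *
            c A.corner.face := by
        rw [← hc e]
        rcases hfaces with ⟨h, h'⟩ | ⟨h, h'⟩ <;> rw [h, h']
        · rw [mul_right_comm, units_mul_self_eq, one_mul]
        · rw [mul_assoc, units_mul_self_eq, mul_one]
      rw [h1, h2]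
      calc lineSign A.line e * A.sgn * (lineSign A.line e * (raySign A.corner.vertex e *
            raySign q.vertex e) * c A.corner.face * c q.face)
          = (lineSign A.line e * lineSign A.line e) * (raySign A.corner.vertex e *
            raySign q.vertex e) * (A.sgn * (c A.corner.face * c q.face)) := by ac_rfl
        _ = η * q.sgn * (raySign A.corner.vertex e * raySign q.vertex e * A.corner.sgn) := by
              rw [hs, units_mul_self_eq]; rw [one_mul]; ac_rfl
        _ = _ := by rw [hsgn]; ac_rfl
  · obtain ⟨hends, hsgn⟩ := adjIn_face hadj hf q
    obtain ⟨R', hR'⟩ := exists_halfRowSign_eq_farSign e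
    refine ⟨fun f => halfRowSign e f * c f, ?_, ⟨max R R', ?_⟩, ?_⟩
    · intro e'
      rw [mul_mul_mul_comm, halfRowSign_faces, hc, hl, lineSign_symmDiff]
      rcases hends with ⟨h, h'⟩ | ⟨h, h'⟩
      · rw [h, h']
        calc _ = raySign e.ends.1 e' * raySign e.ends.1 e' * (lineSign A.line e' *
              lineSign {e} e' * (raySign e.ends.2 e' * raySign q.vertex e')) := by ac_rfl
          _ = _ := by rw [units_mul_self_eq, one_mul]
      · rw [h, h']
        calc _ = raySign e.ends.2 e' * raySign e.ends.2 e' * (lineSign A.line e' *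
              lineSign {e} e' * (raySign e.ends.1 e' * raySign q.vertex e')) := by ac_rfl
          _ = _ := by rw [units_mul_self_eq, one_mul]
    · intro f hf'
      have h1 : f ∉ boxFaces R := fun h => hf' (by
        rw [mem_boxFaces] at h ⊢; push_cast; omega)
      have h2 : f ∉ boxFaces R' := fun h => hf' (by
        rw [mem_boxFaces] at h ⊢; push_cast; omega)
      simp only [hR f h1, hR' f h2]
      rcases hends with ⟨h, h'⟩ | ⟨h, h'⟩
      · rw [h, h']
        calc _ = farSign e.ends.1 f * farSign e.ends.1 f * (farSign e.ends.2 f *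
              farSign q.vertex f) := by ac_rfl
          _ = _ := by rw [units_mul_self_eq, one_mul]
      · rw [h, h']
        calc _ = farSign e.ends.2 f * farSign e.ends.2 f * (farSign e.ends.1 f *
              farSign q.vertex f) := by ac_rfl
          _ = _ := by rw [units_mul_self_eq, one_mul]
    · simp only [hs', hf]
      calc _ = halfRowSign e A.corner.face * halfRowSign e q.face *
            (A.sgn * (c A.corner.face * c q.face)) := by ac_rfl
        _ = η * q.sgn * (halfRowSign e A.corner.face * halfRowSign e q.face * A.corner.sgn) := by
              rw [hs]; ac_rfl
        _ = _ := by rw [hsgn]; ac_rfl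

/-- The observable whose expectation is the Kadanoff-Ceva correlation. -/
def kcObservable (θ : Edge → ℝ) (γ : Finset Edge) (f g : Face) (s : Config) : ℝ :=
  (∏ e ∈ γ, weight θ e ^ ((energy s e : ℤˣ) : ℤ)) * ((s f : ℤ) : ℝ) * ((s g : ℤ) : ℝ)

theorem isLocal_kcObservable (θ : Edge → ℝ) (γ : Finset Edge) (f g : Face) :
    IsLocal (kcObservable θ γ f g) :=
  ((IsLocal.prod γ fun e _ => isLocal_disorder θ e).mul (isLocal_spin f)).mul (isLocal_spin g)

theorem KCState.value_eq (θ : Edge → ℝ) (q : LiftedCorner) (A : KCState) :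
    A.value θ q = ((A.sgn : ℤ) : ℝ) *
      expectation θ (kcObservable θ A.line A.corner.face q.face) := rfl

section

variable {θ : Edge → ℝ} (hθ : ∀ e, θ e ∈ Set.Ioo 0 (Real.pi / 2))
include hθ

/-- A disorder line changes the sign of the interaction constants along it. -/
theorem boltzmann_mul_prod_weight {R : ℕ} {γ : Finset Edge} (hγ : γ ⊆ boxEdges R) (s : Config) :
    boltzmann θ R s * ∏ e ∈ γ, weight θ e ^ ((energy s e : ℤˣ) : ℤ) =
      Real.exp (∑ e ∈ boxEdges R, coupling θ e * ((lineSign γ e * energy s e : ℤˣ) : ℤ)) := by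
  have h1 : ∀ e, weight θ e ^ ((energy s e : ℤˣ) : ℤ) =
      Real.exp (-2 * coupling θ e * ((energy s e : ℤ) : ℝ)) := fun e => by
    have hw : weight θ e = Real.exp (-2 * coupling θ e) := by
      rw [coupling, show -2 * (-Real.log (weight θ e) / 2) = Real.log (weight θ e) by ring,
        Real.exp_log (weight_pos (hθ e))]
    rcases Int.units_eq_one_or (energy s e) with h | h
    · simp [hw, h]
    · simp only [hw, h, Units.val_neg, Units.val_one, zpow_neg, zpow_one, Int.cast_neg,
        Int.cast_one, mul_neg, mul_one, ← Real.exp_neg]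
  simp only [h1]
  rw [← Real.exp_sum, boltzmann, ← Real.exp_add, ← Finset.sum_sdiff hγ,
    ← Finset.sum_sdiff (s₁ := γ) (s₂ := boxEdges R) hγ, add_assoc, ← Finset.sum_add_distrib]
  congr 2
  · exact Finset.sum_congr rfl fun e he => by simp [lineSign, (Finset.mem_sdiff.1 he).2]
  · refine Finset.sum_congr rfl fun e he => ?_
    simp only [lineSign, he, if_true, Units.val_mul, Units.val_neg, Units.val_one]
    push_cast; ring

/-- Flipping the spins of a region replaces a disorder line by another one. -/
theorem boxExpectation_kcObservable {R : ℕ} {γ γ' : Finset Edge} (hγ : γ ⊆ boxEdges R)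
    (hγ' : γ' ⊆ boxEdges R) {c : Face → ℤˣ} (hc : ∀ f, f ∉ boxFaces R → c f = 1)
    (hcc : ∀ e, c e.faces.1 * c e.faces.2 = lineSign γ e * lineSign γ' e) (f g : Face) :
    boxExpectation θ R (kcObservable θ γ f g) =
      (((c f * c g : ℤˣ) : ℤ) : ℝ) * boxExpectation θ R (kcObservable θ γ' f g) := by
  rw [← boxExpectation_const_mul]
  unfold boxExpectation
  congr 1
  have hw : ∀ s : boxFaces R → ℤˣ, wired R ((fun f : boxFaces R => c f) * s) = c * wired R s := fun s => by
    funext f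
    by_cases hf : f ∈ boxFaces R <;> simp [wired, hf]
    exact (hc f hf).symm
  rw [← Equiv.sum_comp (Equiv.mulLeft fun f : boxFaces R => c f)]
  refine Finset.sum_congr rfl fun s _ => ?_
  have h1 := boltzmann_mul_prod_weight hθ hγ (c * wired R s)
  have h2 := boltzmann_mul_prod_weight hθ hγ' (wired R s)
  have h3 : ∀ e, lineSign γ e * energy (c * wired R s) e =
      lineSign γ' e * energy (wired R s) e := fun e => by
    rw [energy_mul, energy, hcc, ← mul_assoc, ← mul_assoc, units_mul_self_eq, one_mul]
  simp only [h3] at h1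
  rw [← h2] at h1
  simp only [Equiv.coe_mulLeft, hw, kcObservable, ← mul_assoc]
  rw [h1]
  simp only [Pi.mul_apply, Units.val_mul]
  push_cast; ring

omit hθ in
theorem units_gauge (a b x y x' y' t : ℤˣ) :
    a * (x * y) * t * a * (x * x' * (y * y')) = b * (x' * y') * t * b := by
  calc _ = a * a * (x * x) * (y * y) * (x' * y' * t) := by ac_rfl
    _ = b * b * (x' * y' * t) := by simp only [units_mul_self_eq, one_mul]
    _ = _ := by ac_rfl

omit hθ in
/-- The outside of a box is connected. -/
theorem eq_one_of_notMem_boxFaces {R R' : ℕ} {g : Face → ℤˣ}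
    (hg : ∀ e, e ∉ boxEdges R → g e.faces.1 = g e.faces.2) (hR' : ∀ f, f ∉ boxFaces R' → g f = 1)
    {f : Face} (hf : f ∉ boxFaces R) : g f = 1 := by
  obtain ⟨m, n⟩ := f
  have hf' : (m < -(R : ℤ) ∨ R ≤ m) ∨ (n < -(R : ℤ) ∨ R ≤ n) := by
    rw [mem_boxFaces] at hf; omega
  have hv : ∀ m n, Edge.v m n ∉ boxEdges R → g (m, n) = g (m - 1, n) := fun m n h => hg _ h
  have hh : ∀ m n, Edge.h m n ∉ boxEdges R → g (m, n) = g (m, n - 1) := fun m n h => hg _ h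
  simp only [mem_boxEdges_v, mem_boxEdges_h] at hv hh
  rcases hf' with (h | h) | (h | h)
  · have key : ∀ k : ℕ, g (m - k, n) = g (m, n) := fun k => by
      induction k with
      | zero => simp
      | succ k ih =>
        rw [← ih, hv (m - k) n (by omega)]; congr 2; push_cast; ring
    rw [← key R', hR' _ (by rw [mem_boxFaces]; simp only; omega)]
  · have key : ∀ k : ℕ, g (m + k, n) = g (m, n) := fun k => by
      induction k with
      | zero => simp
      | succ k ih =>
        rw [← ih, hv (m + (k + 1 : ℕ)) n (by omega)]; congr 2; push_cast; ring
    rw [← key R', hR' _ (by rw [mem_boxFaces]; simp only; omega)]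
  · have key : ∀ k : ℕ, g (m, n - k) = g (m, n) := fun k => by
      induction k with
      | zero => simp
      | succ k ih =>
        rw [← ih, hh m (n - k) (by omega)]; congr 2; push_cast; ring
    rw [← key R', hR' _ (by rw [mem_boxFaces]; simp only; omega)]
  · have key : ∀ k : ℕ, g (m, n + k) = g (m, n) := fun k => by
      induction k with
      | zero => simp
      | succ k ih =>
        rw [← ih, hh m (n + (k + 1 : ℕ)) (by omega)]; congr 2; push_cast; ring
    rw [← key R', hR' _ (by rw [mem_boxFaces]; simp only; omega)]

omit hθ in
/-- The correlation in a given state, in a box. -/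
def KCState.boxValue (θ : Edge → ℝ) (R : ℕ) (q : LiftedCorner) (A : KCState) : ℝ :=
  ((A.sgn : ℤ) : ℝ) * boxExpectation θ R (kcObservable θ A.line A.corner.face q.face)

theorem KCState.tendsto_boxValue (q : LiftedCorner) (A : KCState) :
    Tendsto (fun R => A.boxValue θ R q) atTop (𝓝 (A.value θ q)) :=
  ((isLocal_kcObservable θ A.line _ _).tendsto hθ).const_mul _

/-- The value of a gauged state depends only on its corner and on `η`, as long as the disorder line
stays in the box. -/
theorem KCState.Gauged.boxValue_eq_boxValue {q : LiftedCorner} {η η' : ℤˣ} {A A' : KCState}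
    (hA : A.Gauged q η) (hA' : A'.Gauged q η') (hp : A.corner.SameCorner A'.corner) {N : ℕ}
    (h1 : A.line ⊆ boxEdges N) (h2 : A'.line ⊆ boxEdges N) :
    (((η * A.corner.sgn : ℤˣ) : ℤ) : ℝ) * A.boxValue θ N q =
      (((η' * A'.corner.sgn : ℤˣ) : ℤ) : ℝ) * A'.boxValue θ N q := by
  obtain ⟨c, hc, ⟨R, hR⟩, hs⟩ := hA
  obtain ⟨c', hc', ⟨R', hR'⟩, hs'⟩ := hA'
  have hv : A'.corner.vertex = A.corner.vertex := by
    simp only [LiftedCorner.vertex, hp.1, hp.2]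
  have hf : A'.corner.face = A.corner.face := by
    simp only [LiftedCorner.face, hp.1, hp.2]
  rw [hv] at hc' hR'
  rw [hf] at hs'
  have hcc : ∀ e, (c * c') e.faces.1 * (c * c') e.faces.2 =
      lineSign A.line e * lineSign A'.line e := fun e => by
    rw [Pi.mul_apply, Pi.mul_apply, mul_mul_mul_comm, hc, hc', mul_mul_mul_comm,
      units_mul_self_eq, mul_one]
  have key : boxExpectation θ N (kcObservable θ A.line A.corner.face q.face) =
      (((c A.corner.face * c' A.corner.face * (c q.face * c' q.face) : ℤˣ) : ℤ) : ℝ) *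
        boxExpectation θ N (kcObservable θ A'.line A.corner.face q.face) := by
    refine boxExpectation_kcObservable hθ h1 h2 (c := c * c') (fun f hf =>
      eq_one_of_notMem_boxFaces (R := N) (R' := max R R') (fun e he => ?_) (fun f hf => ?_) hf)
      hcc _ _
    · have h3 := hcc e
      rw [lineSign, lineSign, if_neg fun h => he (h1 h), if_neg fun h => he (h2 h), mul_one] at h3
      rw [← mul_one ((c * c') e.faces.1), ← units_mul_self_eq ((c * c') e.faces.2), ← mul_assoc, h3,
        one_mul]
    · rw [Pi.mul_apply, hR f, hR' f, units_mul_self_eq]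
      · rw [mem_boxFaces] at hf ⊢; push_cast at hf; omega
      · rw [mem_boxFaces] at hf ⊢; push_cast at hf; omega
  have e1 : η * A.corner.sgn = A.sgn * (c A.corner.face * c q.face) * q.sgn := by
    rw [hs, mul_assoc, mul_assoc, units_mul_self_eq, mul_one]
  have e2 : η' * A'.corner.sgn = A'.sgn * (c' A.corner.face * c' q.face) * q.sgn := by
    rw [hs', mul_assoc, mul_assoc, units_mul_self_eq, mul_one]
  have e3 := units_gauge A.sgn A'.sgn (c A.corner.face) (c q.face) (c' A.corner.face)
    (c' q.face) q.sgn
  rw [← e1, ← e2] at e3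
  have e4 : (((η * A.corner.sgn * A.sgn * (c A.corner.face * c' A.corner.face *
      (c q.face * c' q.face)) : ℤˣ) : ℤ) : ℝ) = (((η' * A'.corner.sgn * A'.sgn : ℤˣ) : ℤ) : ℝ) := by
    rw [e3]
  rw [KCState.boxValue, KCState.boxValue, key, hf]
  generalize boxExpectation θ N (kcObservable θ A'.line A.corner.face q.face) = X
  simp only [Units.val_mul, Int.cast_mul] at e4 ⊢
  linear_combination X * e4

/-- The value of a gauged state depends only on its corner and on `η`. -/
theorem KCState.Gauged.value_eq_value {q : LiftedCorner} {η η' : ℤˣ} {A A' : KCState}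
    (hA : A.Gauged q η) (hA' : A'.Gauged q η') (hp : A.corner.SameCorner A'.corner) :
    (((η * A.corner.sgn : ℤˣ) : ℤ) : ℝ) * A.value θ q =
      (((η' * A'.corner.sgn : ℤˣ) : ℤ) : ℝ) * A'.value θ q := by
  refine tendsto_nhds_unique ((A.tendsto_boxValue hθ q).const_mul _)
    (((A'.tendsto_boxValue hθ q).const_mul _).congr' ?_)
  filter_upwards [eventually_subset_boxEdges A.line, eventually_subset_boxEdges A'.line] with N h1 h2
  exact (hA.boxValue_eq_boxValue hθ hA' hp h1 h2).symm

end

/-! ### The corner graph without one corner is connected -/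

theorem int_forall_of_step {Q : ℤ → Prop} (i : ℤ) (hi : Q i) (h₁ : ∀ k, Q k → Q (k + 1))
    (h₂ : ∀ k, Q k → Q (k - 1)) (k : ℤ) : Q k :=
  Int.inductionOn' k i hi (fun k _ h => h₁ k h) fun k _ h => h₂ k h

/-- The double cover of the corner graph stays connected when the two lifts of one corner
are removed. -/
theorem forall_of_lifted_steps {Q : ℤ → ℤ → ℤˣ → Prop} {i₀ j₀ : ℤ}
    (hr : ∀ i j s, Q i j s → ¬(i + 1 = i₀ ∧ j = j₀) → Q (i + 1) j s)
    (hl : ∀ i j s, Q i j s → ¬(i - 1 = i₀ ∧ j = j₀) → Q (i - 1) j s)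
    (hu : ∀ i j s, Q i j s → ¬(i = i₀ ∧ j + 1 = j₀) → Q i (j + 1) ((-1) ^ i * s))
    (hd : ∀ i j s, Q i j s → ¬(i = i₀ ∧ j - 1 = j₀) → Q i (j - 1) ((-1) ^ i * s))
    {i₁ : ℤ} {s₀ : ℤˣ} (h₀ : Q i₁ j₀ s₀) (i j : ℤ) (s : ℤˣ) (hij : ¬(i = i₀ ∧ j = j₀)) :
    Q i j s := by
  have row : ∀ j s i, j ≠ j₀ → Q i j s → ∀ i', Q i' j s := fun j s i hj h =>
    int_forall_of_step i h (fun k hk => hr k j s hk (by tauto)) fun k hk => hl k j s hk (by tauto)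
  -- an even column to the right of the removed corner, and the odd column next to it
  have hE : ((2 * (|i₀| + 1) : ℤ) ≠ i₀) ∧ (2 * (|i₀| + 1) + 1 : ℤ) ≠ i₀ := by
    have := le_abs_self i₀; have := abs_nonneg i₀
    constructor <;> omega
  generalize |i₀| + 1 = m at hE
  have rows : ∀ s j, j ≠ j₀ → Q (2 * m) j s → ∀ i j, j ≠ j₀ → Q i j s := by
    intro s j _ h i' j' hj'
    refine row j' s (2 * m) hj' ?_ i'
    refine int_forall_of_step (Q := fun j => Q (2 * m) j s) j h (fun k hk => ?_)
      (fun k hk => ?_) j'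
    · have := hu _ _ _ hk (by tauto)
      rwa [neg_one_zpow_two_mul, one_mul] at this
    · have := hd _ _ _ hk (by tauto)
      rwa [neg_one_zpow_two_mul, one_mul] at this
  have hs1 : ∃ s, ∀ i j, j ≠ j₀ → Q i j s :=
    ⟨_, rows _ (j₀ + 1) (by omega) (row _ _ _ (by omega) (hu _ _ _ h₀ (by omega)) _)⟩
  obtain ⟨s₁, hs₁⟩ := hs1
  have hneg : ∀ i j, j ≠ j₀ → Q i j (-s₁) := by
    have h := hu (2 * m + 1) (j₀ + 1) s₁ (hs₁ _ _ (by omega)) (by tauto)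
    rw [neg_one_zpow_two_mul_add_one, neg_one_mul] at h
    exact rows _ (j₀ + 1 + 1) (by omega) (row _ _ _ (by omega) h _)
  have hall : ∀ s i j, j ≠ j₀ → Q i j s := fun s i j hj => by
    have : s = s₁ ∨ s = -s₁ := by
      rcases Int.units_eq_one_or s with rfl | rfl <;>
        rcases Int.units_eq_one_or s₁ with rfl | rfl <;> simp
    rcases this with rfl | rfl
    · exact hs₁ i j hj
    · exact hneg i j hj
  by_cases hj : j = j₀
  · subst hj
    have := hd i (j + 1) ((-1) ^ i * s) (hall _ _ _ (by omega)) (by omega)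
    rwa [← mul_assoc, units_mul_self_eq, one_mul, add_sub_cancel_right] at this
  · exact hall s i j hj

/-! ### The fermion and its propagation equation -/

/-- The sign that relates the double cover on which the fermion from `q` lives to `Υ^×`: the
removed corner `q` and the two rays of `cutSign` separate the corners into a lower part, with
sign `1`, and an upper part, with sign `-1`. -/
def sheetSign (q p : LiftedCorner) : ℤˣ :=
  if q.j < p.j ∨ (p.j = q.j ∧ ((q.j % 2 = 0 ∧ p.i < q.i) ∨ (q.j % 2 = 1 ∧ q.i < p.i)))
  then -1 else 1

theorem sheetSign_mk (i₀ j₀ i j : ℤ) (s₀ s : ℤˣ) : sheetSign ⟨i₀, j₀, s₀⟩ ⟨i, j, s⟩ =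
    if j₀ < j ∨ (j = j₀ ∧ ((j₀ % 2 = 0 ∧ i < i₀) ∨ (j₀ % 2 = 1 ∧ i₀ < i))) then -1 else 1 := rfl

theorem cutSign_mk (i₀ j₀ i j i' j' : ℤ) (s₀ s s' : ℤˣ) :
    cutSign ⟨i₀, j₀, s₀⟩ ⟨i, j, s⟩ ⟨i', j', s'⟩ =
    if j ≠ j' ∧ ((min j j' = 2 * ((j₀ + 1) / 2) - 1 ∧ i < 2 * ((i₀ + 1) / 2)) ∨
      (min j j' = 2 * (j₀ / 2) ∧ 2 * (i₀ / 2) + 1 ≤ i)) then -1 else 1 := rfl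

theorem sheetSign_self (q : LiftedCorner) : sheetSign q q = 1 := by
  simp [sheetSign]

theorem sheetSign_flip (q p : LiftedCorner) : sheetSign q p.flip = sheetSign q p := rfl

/-- The sign `-1` for the steps across `z` to or from the corner `q`. -/
def starSign (z : Edge) (q : LiftedCorner) (e : Edge) (p p' : LiftedCorner) : ℤˣ :=
  haveI := Classical.propDecidable (e = z ∧ (p.SameCorner q ∨ p'.SameCorner q))
  if e = z ∧ (p.SameCorner q ∨ p'.SameCorner q) then -1 else 1

/-- `q` is one of the two corners `a⁺`, `c⁺` of the quad of `z`. -/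
def IsSource (z : Edge) (q : LiftedCorner) : Prop := q = z.aPlus ∨ q = z.cPlus

theorem sheetSign_aux (i₀ j₀ i j i' j' : ℤ)
    (h4 : (j' = j ∧ (i' = i + 1 ∨ i' = i - 1)) ∨ (i' = i ∧ (j' = j + 1 ∨ j' = j - 1)))
    (hp : ¬ (i = i₀ ∧ j = j₀)) (hp' : ¬ (i' = i₀ ∧ j' = j₀)) :
    (if j₀ < j ∨ (j = j₀ ∧ ((j₀ % 2 = 0 ∧ i < i₀) ∨ (j₀ % 2 = 1 ∧ i₀ < i))) then (-1 : ℤˣ) else 1) *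
    (if j₀ < j' ∨ (j' = j₀ ∧ ((j₀ % 2 = 0 ∧ i' < i₀) ∨ (j₀ % 2 = 1 ∧ i₀ < i'))) then (-1 : ℤˣ) else 1) =
    if j ≠ j' ∧ ((min j j' = 2 * ((j₀ + 1) / 2) - 1 ∧ i < 2 * ((i₀ + 1) / 2)) ∨
      (min j j' = 2 * (j₀ / 2) ∧ 2 * (i₀ / 2) + 1 ≤ i)) then -1 else 1 := by
  rcases h4 with ⟨rfl, h⟩ | ⟨rfl, rfl | rfl⟩
  · have : (j₀ < j' ∨ (j' = j₀ ∧ ((j₀ % 2 = 0 ∧ i < i₀) ∨ (j₀ % 2 = 1 ∧ i₀ < i)))) ↔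
      (j₀ < j' ∨ (j' = j₀ ∧ ((j₀ % 2 = 0 ∧ i' < i₀) ∨ (j₀ % 2 = 1 ∧ i₀ < i')))) := by omega
    simp only [this, ne_eq, not_true_eq_false, false_and, if_false]
    split <;> rfl
  · rw [min_eq_left (by omega)]
    (repeat' split) <;> first | rfl | (exfalso; omega)
  · rw [min_eq_right (by omega)]
    (repeat' split) <;> first | rfl | (exfalso; omega)
theorem LiftedCorner.Adj.coords {p p' : LiftedCorner} (h : Adj p p') :
    (p'.j = p.j ∧ (p'.i = p.i + 1 ∨ p'.i = p.i - 1)) ∨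
      (p'.i = p.i ∧ (p'.j = p.j + 1 ∨ p'.j = p.j - 1)) := by
  rcases h with ⟨h, h', -⟩ | ⟨h, h', -⟩
  · exact Or.inl ⟨h, h'⟩
  · exact Or.inr ⟨h, h'⟩

theorem sheetSign_source {z : Edge} {q : LiftedCorner} (hq : IsSource z q) {e : Edge}
    {p : LiftedCorner} (h : LiftedCorner.InQuad e p) (hqe : LiftedCorner.InQuad e q)
    (h4 : (p.j = q.j ∧ (p.i = q.i + 1 ∨ p.i = q.i - 1)) ∨
      (p.i = q.i ∧ (p.j = q.j + 1 ∨ p.j = q.j - 1))) :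
    sheetSign q p = cutSign q q p * if e = z then -1 else 1 := by
  obtain ⟨i, j, s⟩ := p
  cases z <;> rcases hq with rfl | rfl <;>
    simp only [Edge.aPlus, Edge.cPlus] at h4 hqe ⊢ <;>
    rcases h4 with ⟨rfl, rfl | rfl⟩ | ⟨rfl, rfl | rfl⟩ <;> cases e <;>
    simp only [LiftedCorner.InQuad] at h hqe <;>
    simp only [sheetSign_mk, cutSign_mk, Edge.h.injEq, Edge.v.injEq, reduceCtorEq] <;>
    (repeat' split) <;> first | rfl | (exfalso; omega) |
      (simp only [true_and] at *; exfalso; omega)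

theorem cutSign_comm {q p p' : LiftedCorner} (h : LiftedCorner.Adj p p') :
    cutSign q p p' = cutSign q p' p := by
  have h := h.coords
  by_cases hj : p'.j = p.j
  · simp [cutSign, hj]
  · have hi : p'.i = p.i := by omega
    have hj' : ¬ p.j = p'.j := fun h => hj h.symm
    simp only [cutSign, ne_eq, hj, hj', not_false_eq_true, true_and, hi, min_comm p.j p'.j]

/-- Across the quad of `z`, and there only, the double cover of the fermion starting at `q` and
`Υ^×` disagree around `q`. -/
theorem sheetSign_mul_sheetSign {z : Edge} {q : LiftedCorner} (hq : IsSource z q) {e : Edge}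
    {p p' : LiftedCorner} (h : LiftedCorner.AdjIn e p p') :
    sheetSign q p * sheetSign q p' = cutSign q p p' * starSign z q e p p' := by
  have h4 := h.2.2.coords
  have hself : ∀ r : LiftedCorner, r.SameCorner q → ∀ r', sheetSign q r = 1 ∧
      cutSign q r r' = cutSign q q r' ∧
      (∀ e, LiftedCorner.InQuad e r → LiftedCorner.InQuad e q) := by
    rintro ⟨i, j, s⟩ ⟨rfl, rfl⟩ r'
    exact ⟨by simp [sheetSign], rfl, fun e he => by cases e <;> exact he⟩
  by_cases hp : p.SameCorner q
  · obtain ⟨h1, h2, h3⟩ := hself p hp p'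
    rw [h1, h2, one_mul, sheetSign_source hq h.2.1 (h3 e h.1) (by
      have := hp.1; have := hp.2; omega)]
    congr 1
    unfold starSign
    simp only [hp, true_or, and_true]
  by_cases hp' : p'.SameCorner q
  · obtain ⟨h1, h2, h3⟩ := hself p' hp' p
    rw [cutSign_comm h.2.2, h1, h2, mul_one, sheetSign_source hq h.1 (h3 e h.2.1) (by
      have := hp'.1; have := hp'.2; omega)]
    congr 1
    unfold starSign
    simp only [hp', or_true, and_true]
  · rw [starSign, if_neg (by tauto), mul_one]
    exact sheetSign_aux q.i q.j p.i p.j p'.i p'.j h4 hp hp'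

theorem LiftedCorner.exists_adjIn {p p' : LiftedCorner} (h : Adj p p') :
    ∃ e, AdjIn e p p' ∧ (p'.vertex = p.vertex ∨ p'.face = p.face) := by
  obtain ⟨i, j, s⟩ := p
  obtain ⟨i', j', s'⟩ := p'
  have h4 := h.coords
  simp only at h4
  have key : ∀ e, InQuad e ⟨i, j, s⟩ → InQuad e ⟨i', j', s'⟩ →
      ((⟨i', j', s'⟩ : LiftedCorner).vertex = (⟨i, j, s⟩ : LiftedCorner).vertex ∨
        (⟨i', j', s'⟩ : LiftedCorner).face = (⟨i, j, s⟩ : LiftedCorner).face) →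
      ∃ e, AdjIn e ⟨i, j, s⟩ ⟨i', j', s'⟩ ∧ ((⟨i', j', s'⟩ : LiftedCorner).vertex =
        (⟨i, j, s⟩ : LiftedCorner).vertex ∨ (⟨i', j', s'⟩ : LiftedCorner).face =
          (⟨i, j, s⟩ : LiftedCorner).face) := fun e h1 h2 h3 => ⟨e, ⟨h1, h2, h⟩, h3⟩
  clear h
  simp only [InQuad, vertex, face, Prod.mk.injEq] at key ⊢
  by_cases hh : (j' = j ∧ min i i' % 2 = 0) ∨ (i' = i ∧ j' ≠ j ∧ min j j' % 2 = 1)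
  · exact key (.h (min i i' / 2) ((max j j' + 1) / 2)) (by simp only; omega)
      (by simp only; omega) (by omega)
  · exact key (.v ((max i i' + 1) / 2) (min j j' / 2)) (by simp only; omega)
      (by simp only; omega) (by omega)

theorem KCState.exists_move {e : Edge} (A : KCState) {p : LiftedCorner}
    (h : LiftedCorner.AdjIn e A.corner p)
    (h' : p.vertex = A.corner.vertex ∨ p.face = A.corner.face) :
    ∃ A', KCState.Move e A A' ∧ A'.corner = p := by
  rcases h' with h' | h'
  · exact ⟨⟨p, A.line, if e ∈ A.line then -A.sgn else A.sgn⟩, ⟨h, Or.inl ⟨h', rfl, rfl⟩⟩, rfl⟩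
  · exact ⟨⟨p, symmDiff A.line {e}, A.sgn⟩, ⟨h, Or.inr ⟨h', rfl, rfl⟩⟩, rfl⟩

theorem exists_reached {z : Edge} {q : LiftedCorner} (hq : IsSource z q) (p : LiftedCorner)
    (hp : ¬ p.SameCorner q) : ∃ A : KCState, A.Reached z q ∧ A.corner = p := by
  have step : ∀ p p' : LiftedCorner, (∃ A : KCState, A.Reached z q ∧ A.corner = p) →
      LiftedCorner.Adj p p' → ¬ p'.SameCorner q →
      ∃ A : KCState, A.Reached z q ∧ A.corner = p' := by
    rintro p p' ⟨A, hA, rfl⟩ hadj hne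
    obtain ⟨e, he, h⟩ := LiftedCorner.exists_adjIn hadj
    obtain ⟨A', hm, hA'⟩ := A.exists_move he h
    exact ⟨A', KCState.Reached.next e hA hm (by rwa [hA']), hA'⟩
  -- a horizontal neighbour of `q` outside of the quad of `z`
  have first : ∃ (e : Edge) (i : ℤ), e ≠ z ∧ LiftedCorner.AdjIn e q ⟨i, q.j, q.sgn⟩ := by
    cases z with
    | h m n =>
      rcases hq with rfl | rfl
      · exact ⟨.v m (n - 1), 2 * m - 1, by simp, by
          refine ⟨?_, ?_, Or.inl ⟨rfl, ?_, rfl⟩⟩ <;>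
            simp [LiftedCorner.InQuad, Edge.aPlus] <;> omega⟩
      · exact ⟨.v (m + 1) n, 2 * m + 2, by simp, by
          refine ⟨?_, ?_, Or.inl ⟨rfl, ?_, rfl⟩⟩ <;>
            simp [LiftedCorner.InQuad, Edge.cPlus] <;> omega⟩
    | v m n =>
      rcases hq with rfl | rfl
      · exact ⟨.h m n, 2 * m + 1, by simp, by
          refine ⟨?_, ?_, Or.inl ⟨rfl, ?_, rfl⟩⟩ <;>
            simp [LiftedCorner.InQuad, Edge.aPlus]⟩
      · exact ⟨.h (m - 1) (n + 1), 2 * m - 2, by simp, by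
          refine ⟨?_, ?_, Or.inl ⟨rfl, ?_, rfl⟩⟩ <;>
            simp [LiftedCorner.InQuad, Edge.cPlus] <;> omega⟩
  obtain ⟨e, i₁, hez, he⟩ := first
  have hvf : (⟨i₁, q.j, q.sgn⟩ : LiftedCorner).vertex = q.vertex ∨
      (⟨i₁, q.j, q.sgn⟩ : LiftedCorner).face = q.face := by
    obtain ⟨-, -, h3⟩ := he
    change ((i₁ + 1) / 2, (q.j + 1) / 2) = ((q.i + 1) / 2, (q.j + 1) / 2) ∨
      (i₁ / 2, q.j / 2) = (q.i / 2, q.j / 2)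
    simp only [Prod.mk.injEq, and_true]
    rcases h3 with ⟨-, h, -⟩ | ⟨-, h, -⟩
    · have h : i₁ = q.i + 1 ∨ i₁ = q.i - 1 := h
      omega
    · have h : q.j = q.j + 1 ∨ q.j = q.j - 1 := h
      omega
  obtain ⟨A₁, hm, hA₁⟩ := (KCState.init q).exists_move he hvf
  obtain ⟨i, j, s⟩ := p
  refine forall_of_lifted_steps (i₀ := q.i) (j₀ := q.j) (s₀ := q.sgn) (i₁ := i₁)
    (Q := fun i j s => ∃ A : KCState, A.Reached z q ∧ A.corner = ⟨i, j, s⟩)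
    (fun i j s h h' => step _ _ h ?_ h') (fun i j s h h' => step _ _ h ?_ h')
    (fun i j s h h' => step _ _ h ?_ h') (fun i j s h h' => step _ _ h ?_ h')
    ⟨A₁, KCState.Reached.first e hez hm, hA₁⟩ i j s hp
  all_goals simp [LiftedCorner.Adj]

theorem LiftedCorner.AdjIn.not_sameCorner {e : Edge} {p p' : LiftedCorner}
    (h : AdjIn e p p') : ¬ p'.SameCorner p := by
  obtain ⟨-, -, h⟩ := h
  rintro ⟨h1, h2⟩
  rcases h with ⟨h3, h4, -⟩ | ⟨h3, h4, -⟩ <;> omega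

theorem starSign_eq_one {z : Edge} {q : LiftedCorner} {e : Edge} {p p' : LiftedCorner}
    (h : e ≠ z ∨ (¬ p.SameCorner q ∧ ¬ p'.SameCorner q)) : starSign z q e p p' = 1 := by
  unfold starSign; rw [if_neg]; tauto

theorem starSign_eq_neg_one {z : Edge} {q : LiftedCorner} {p p' : LiftedCorner}
    (h : p.SameCorner q ∨ p'.SameCorner q) : starSign z q z p p' = -1 := by
  unfold starSign; rw [if_pos ⟨rfl, h⟩]

theorem KCState.Reached.gauged {z : Edge} {q : LiftedCorner} (hq : IsSource z q) {A : KCState}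
    (hA : A.Reached z q) : A.Gauged q (sheetSign q A.corner) ∧ ¬ A.corner.SameCorner q := by
  induction hA with
  | first e he hm =>
    refine ⟨?_, hm.1.not_sameCorner⟩
    have h := (gauged_init q).move hm
    have h' := sheetSign_mul_sheetSign hq hm.1
    rw [starSign_eq_one (Or.inl he)] at h'
    rw [KCState.init, sheetSign_self, one_mul, mul_one] at h'
    rw [one_mul] at h
    rw [h']; exact h
  | next e hA hm hne ih =>
    refine ⟨?_, hne⟩
    have h := ih.1.move hm
    have h' := sheetSign_mul_sheetSign hq hm.1
    rw [starSign_eq_one (Or.inr ⟨ih.2, hne⟩), mul_one] at h'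
    rwa [← h', ← mul_assoc, units_mul_self_eq, one_mul] at h

theorem exists_gauged {z : Edge} {q : LiftedCorner} (hq : IsSource z q) (p : LiftedCorner) :
    ∃ (A : KCState) (η : ℤˣ), A.Gauged q η ∧ A.corner = p := by
  by_cases hp : p.SameCorner q
  · have : p = q ∨ p = q.flip := by
      obtain ⟨h1, h2⟩ := hp
      have : p.sgn = q.sgn ∨ p.sgn = -q.sgn := by
        rcases Int.units_eq_one_or p.sgn with h | h <;>
          rcases Int.units_eq_one_or q.sgn with h' | h' <;> simp [h, h']
      rcases this with h | h
      · exact Or.inl (LiftedCorner.ext h1 h2 h)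
      · exact Or.inr (LiftedCorner.ext h1 h2 h)
    rcases this with rfl | rfl
    · exact ⟨_, 1, gauged_init p, rfl⟩
    · exact ⟨_, -1, gauged_flip q, rfl⟩
  · obtain ⟨A, hA, rfl⟩ := exists_reached hq p hp
    exact ⟨A, _, (hA.gauged hq).1, rfl⟩

/-- The vertex `w` lies in the box of size `R`. -/
abbrev InBox (R : ℕ) (w : Vertex) : Prop :=
  -(R : ℤ) ≤ w.1 ∧ w.1 ≤ R ∧ -(R : ℤ) ≤ w.2 ∧ w.2 ≤ R

theorem eventually_inBox (w : Vertex) : ∀ᶠ R in atTop, InBox R w := by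
  filter_upwards [eventually_ge_atTop (w.1.natAbs + w.2.natAbs)] with R hR
  refine ⟨?_, ?_, ?_, ?_⟩ <;> omega

theorem ends_inBox {R : ℕ} {e : Edge} (he : e ∈ boxEdges R) :
    InBox R e.ends.1 ∧ InBox R e.ends.2 := by
  cases e
  · rw [mem_boxEdges_h] at he; simp only [Edge.ends, InBox]; omega
  · rw [mem_boxEdges_v] at he; simp only [Edge.ends, InBox]; omega

/-- Outside of the box, the two horizontal rays from two vertices of the box bound the region
between them. -/
theorem farSign_mul_farSign {R : ℕ} {w w' : Vertex} (hw : InBox R w) (hw' : InBox R w') {e : Edge}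
    (he : e ∉ boxEdges R) :
    farSign w e.faces.1 * farSign w' e.faces.1 * (farSign w e.faces.2 * farSign w' e.faces.2) =
      raySign w e * raySign w' e := by
  obtain ⟨w₁, w₂⟩ := w
  obtain ⟨w₁', w₂'⟩ := w'
  simp only [InBox] at hw hw'
  cases e with
  | h m n =>
    rw [mem_boxEdges_h] at he
    have key : ∀ w₁ w₂ : ℤ, -(R : ℤ) ≤ w₁ ∧ w₁ ≤ R ∧ -(R : ℤ) ≤ w₂ ∧ w₂ ≤ R →
        farSign (w₁, w₂) (m, n) * farSign (w₁, w₂) (m, n - 1) = raySign (w₁, w₂) (.h m n) := by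
      intro w₁ w₂ h
      rw [farSign_mk, farSign_mk, raySign_h]
      (repeat' split) <;> first | rfl | (exfalso; omega)
    rw [mul_mul_mul_comm]
    exact congrArg₂ _ (key _ _ hw) (key _ _ hw')
  | v m n =>
    rw [mem_boxEdges_v] at he
    simp only [Edge.faces, farSign_mk, raySign]
    (repeat' split) <;> first | rfl | (exfalso; omega)

theorem exists_gauged_of_inBox {R : ℕ} {q p : LiftedCorner} (hq : InBox R q.vertex)
    (hp : InBox R p.vertex) :
    ∃ (A : KCState) (η : ℤˣ), A.Gauged q η ∧ A.corner = p ∧ A.line ⊆ boxEdges R := by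
  let c : Face → ℤˣ := fun f => farSign p.vertex f * farSign q.vertex f
  let r : Edge → ℤˣ := fun e => raySign p.vertex e * raySign q.vertex e
  refine ⟨⟨p, (boxEdges R).filter fun e => c e.faces.1 * c e.faces.2 * r e = -1, 1⟩,
    c p.face * c q.face * (p.sgn * q.sgn), ⟨c, fun e => ?_, ⟨0, fun f _ => rfl⟩, ?_⟩, rfl,
    Finset.filter_subset _ _⟩
  · change c e.faces.1 * c e.faces.2 = lineSign _ e * r e
    by_cases he : e ∈ boxEdges R
    · simp only [lineSign, Finset.mem_filter, he, true_and]
      rcases Int.units_eq_one_or (c e.faces.1 * c e.faces.2) with h | h <;>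
        rcases Int.units_eq_one_or (r e) with h' | h' <;> rw [h, h'] <;> decide
    · rw [lineSign, if_neg fun h => he (Finset.mem_filter.1 h).1, one_mul]
      exact farSign_mul_farSign hp hq he
  · change 1 * (c p.face * c q.face) = c p.face * c q.face * (p.sgn * q.sgn) * (p.sgn * q.sgn)
    rw [mul_assoc (c p.face * c q.face), units_mul_self_eq, mul_one, one_mul]

/-- The fermion in a box with wired boundary conditions. It vanishes outside of the box. -/
def boxFermion (θ : Edge → ℝ) (R : ℕ) (q p : LiftedCorner) : ℝ :=
  if h : InBox R q.vertex ∧ InBox R p.vertex then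
    (((((exists_gauged_of_inBox h.1 h.2).choose_spec.choose * sheetSign q p : ℤˣ) : ℤ) : ℝ) *
      (exists_gauged_of_inBox h.1 h.2).choose.boxValue θ R q)
  else 0

/-- In a box, spins are not separated by the edges outside, which amounts to the angle zero. -/
def boxAngle (θ : Edge → ℝ) (R : ℕ) (e : Edge) : ℝ := if e ∈ boxEdges R then θ e else 0

section

variable {θ : Edge → ℝ} (hθ : ∀ e, θ e ∈ Set.Ioo 0 (Real.pi / 2))
include hθ

theorem value_init (q : LiftedCorner) : (KCState.init q).value θ q = 1 := by
  rw [KCState.value_eq]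
  have : kcObservable θ (KCState.init q).line (KCState.init q).corner.face q.face =
      fun _ => 1 := by
    funext s
    simp [kcObservable, KCState.init, unitsInt_cast_mul_self]
  rw [this, expectation_const hθ]
  simp [KCState.init]

/-- The fermion can be computed along any disorder line, once the sheets are compared. -/
theorem fermion_eq {z : Edge} {q : LiftedCorner} (hq : IsSource z q) {A : KCState} {η : ℤˣ}
    (hA : A.Gauged q η) :
    fermion θ z q A.corner = (((η * sheetSign q A.corner : ℤˣ) : ℤ) : ℝ) * A.value θ q := by
  have h0 := hA.value_eq_value hθ (gauged_init q)
  rw [value_init hθ, KCState.init] at h0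
  have hη := unitsInt_cast_mul_self η
  have hq2 := unitsInt_cast_mul_self q.sgn
  unfold fermion
  split_ifs with h1 h2
  · have := h0 ⟨by rw [h1], by rw [h1]⟩
    rw [h1] at this ⊢
    rw [sheetSign_self]
    simp only [Units.val_mul, Int.cast_mul, mul_one, one_mul] at this ⊢
    have h3 : (((q.sgn : ℤˣ) : ℤ) : ℝ) ≠ 0 := by intro h; simp [h] at hq2
    refine mul_left_cancel₀ h3 ?_
    linear_combination -this
  · have := h0 ⟨by rw [h2]; rfl, by rw [h2]; rfl⟩
    rw [h2] at this ⊢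
    rw [sheetSign_flip, sheetSign_self]
    simp only [LiftedCorner.flip, mul_neg, Units.val_neg, Units.val_mul, Int.cast_neg,
      Int.cast_mul, mul_one, one_mul] at this ⊢
    have h3 : (((q.sgn : ℤˣ) : ℤ) : ℝ) ≠ 0 := by intro h; simp [h] at hq2
    refine mul_left_cancel₀ h3 ?_
    linear_combination this
  · have hne : ¬ A.corner.SameCorner q := by
      rintro ⟨h3, h4⟩
      have : A.corner.sgn = q.sgn ∨ A.corner.sgn = -q.sgn := by
        rcases Int.units_eq_one_or A.corner.sgn with h | h <;>
          rcases Int.units_eq_one_or q.sgn with h' | h' <;> simp [h, h']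
      rcases this with h | h
      · exact h1 (LiftedCorner.ext h3 h4 h)
      · exact h2 (LiftedCorner.ext h3 h4 h)
    have : Nonempty KCState := ⟨KCState.init q⟩
    have hs := Classical.epsilon_spec (exists_reached hq A.corner hne)
    generalize Classical.epsilon (fun B : KCState => B.Reached z q ∧ B.corner = A.corner) = B at hs
    have h3 := (hs.1.gauged hq).1.value_eq_value hθ hA ⟨by rw [hs.2], by rw [hs.2]⟩
    rw [hs.2] at h3
    have h4 := unitsInt_cast_mul_self (sheetSign q A.corner)
    have h5 := unitsInt_cast_mul_self A.corner.sgn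
    simp only [Units.val_mul, Int.cast_mul] at h3 ⊢
    generalize (((sheetSign q A.corner : ℤˣ) : ℤ) : ℝ) = x at *
    generalize (((A.corner.sgn : ℤˣ) : ℤ) : ℝ) = y at *
    linear_combination x * y * h3 - y ^ 2 * B.value θ q * h4 + (x * ((η : ℤ) : ℝ) * A.value θ q
      - B.value θ q) * h5

theorem boxFermion_eq {R : ℕ} {q : LiftedCorner} {A : KCState} {η : ℤˣ} (hA : A.Gauged q η)
    (hq : InBox R q.vertex) (hp : InBox R A.corner.vertex) (hl : A.line ⊆ boxEdges R) :
    boxFermion θ R q A.corner =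
      (((η * sheetSign q A.corner : ℤˣ) : ℤ) : ℝ) * A.boxValue θ R q := by
  have hex := exists_gauged_of_inBox hq hp
  rw [boxFermion, dif_pos ⟨hq, hp⟩]
  have hspec := (exists_gauged_of_inBox hq hp).choose_spec.choose_spec
  generalize (exists_gauged_of_inBox hq hp).choose_spec.choose = η' at *
  generalize (exists_gauged_of_inBox hq hp).choose = A' at *
  obtain ⟨h1, h2, h3⟩ := hspec
  have h4 := hA.boxValue_eq_boxValue hθ h1 ⟨by rw [h2], by rw [h2]⟩ hl h3
  rw [h2] at h4
  have h5 := unitsInt_cast_mul_self A.corner.sgn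
  simp only [Units.val_mul, Int.cast_mul] at h4 ⊢
  generalize (((A.corner.sgn : ℤˣ) : ℤ) : ℝ) = y at *
  generalize (((sheetSign q A.corner : ℤˣ) : ℤ) : ℝ) = x at *
  generalize A'.boxValue θ R q = X at *
  generalize A.boxValue θ R q = X' at *
  linear_combination (-y * x) * h4 + (x * ((η : ℤ) : ℝ) * X' - x * ((η' : ℤ) : ℝ) * X) * h5

theorem tendsto_boxFermion {z : Edge} {q : LiftedCorner} (hq : IsSource z q) (p : LiftedCorner) :
    Tendsto (fun R => boxFermion θ R q p) atTop (𝓝 (fermion θ z q p)) := by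
  obtain ⟨A, η, hA, rfl⟩ := exists_gauged hq p
  rw [fermion_eq hθ hq hA]
  refine ((A.tendsto_boxValue hθ q).const_mul _).congr' ?_
  filter_upwards [eventually_inBox q.vertex, eventually_inBox A.corner.vertex,
    eventually_subset_boxEdges A.line] with R h1 h2 h3
  exact (boxFermion_eq hθ hA h1 h2 h3).symm

omit hθ in
theorem boxFermion_of_not_inBox {R : ℕ} {q p : LiftedCorner} (hp : ¬ InBox R p.vertex) :
    boxFermion θ R q p = 0 := dif_neg fun h => hp h.2

theorem boxFermion_flip {R : ℕ} {q : LiftedCorner} (hq : InBox R q.vertex) (p : LiftedCorner) :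
    boxFermion θ R q p.flip = -boxFermion θ R q p := by
  by_cases hp : InBox R p.vertex
  · obtain ⟨A, η, hA, rfl, hl⟩ := exists_gauged_of_inBox hq hp
    have hA' : (⟨A.corner.flip, A.line, A.sgn⟩ : KCState).Gauged q (-η) := by
      obtain ⟨c, h1, h2, h3⟩ := hA
      refine ⟨c, h1, h2, ?_⟩
      simp only [LiftedCorner.flip, neg_mul, mul_neg, neg_neg]
      exact h3
    have h := boxFermion_eq hθ hA' hq hp hl
    rw [boxFermion_eq hθ hA hq hp hl]
    refine h.trans ?_
    rw [sheetSign_flip]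
    simp only [neg_mul, Units.val_neg, Int.cast_neg]
    rfl
  · rw [boxFermion_of_not_inBox (θ := θ) (p := p) hp,
      boxFermion_of_not_inBox (θ := θ) (p := p.flip) hp, neg_zero]

theorem boxFermion_self {R : ℕ} {q : LiftedCorner} (hq : InBox R q.vertex) :
    boxFermion θ R q q = 1 := by
  have h := boxFermion_eq hθ (gauged_init q) hq hq (Finset.empty_subset _)
  have : kcObservable θ (KCState.init q).line (KCState.init q).corner.face q.face =
      fun _ => 1 := by
    funext s
    simp [kcObservable, KCState.init, unitsInt_cast_mul_self]
  rw [KCState.boxValue, this, boxExpectation_const] at h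
  refine h.trans ?_
  simp [KCState.init, sheetSign_self]

theorem fermion_flip {z : Edge} {q : LiftedCorner} (hq : IsSource z q) (p : LiftedCorner) :
    fermion θ z q p.flip = -fermion θ z q p := by
  refine tendsto_nhds_unique (tendsto_boxFermion hθ hq p.flip)
    ((tendsto_boxFermion hθ hq p).neg.congr' ?_)
  filter_upwards [eventually_inBox q.vertex] with R h1
  exact (boxFermion_flip hθ h1 p).symm

omit hθ in
theorem one_eq_cos_add_sin {e : Edge} (he : θ e ∈ Set.Ioo 0 (Real.pi / 2)) (u : ℤˣ) :
    (1 : ℝ) = Real.cos (θ e) * ((u : ℤ) : ℝ) + Real.sin (θ e) * weight θ e ^ (u : ℤ) := by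
  have hc : 0 < Real.cos (θ e / 2) :=
    Real.cos_pos_of_mem_Ioo ⟨by linarith [he.1, Real.pi_pos], by linarith [he.2, Real.pi_pos]⟩
  have hs : 0 < Real.sin (θ e / 2) :=
    Real.sin_pos_of_pos_of_lt_pi (by linarith [he.1]) (by linarith [he.2, Real.pi_pos])
  have h2 : θ e = 2 * (θ e / 2) := by ring
  have hw : weight θ e = Real.sin (θ e / 2) / Real.cos (θ e / 2) := Real.tan_eq_sin_div_cos _
  have hcs := Real.sin_sq_add_cos_sq (θ e / 2)
  rw [hw, h2, Real.cos_two_mul, Real.sin_two_mul, ← h2]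
  rcases Int.units_eq_one_or u with rfl | rfl
  · simp only [Units.val_one, Int.cast_one, zpow_one]
    field_simp; linear_combination -2 * hcs
  · simp only [Units.val_neg, Units.val_one, Int.cast_neg, Int.cast_one, zpow_neg, zpow_one]
    field_simp; ring

omit hθ in
theorem disorder_eq_cos_add_sin {e : Edge} (he : θ e ∈ Set.Ioo 0 (Real.pi / 2)) (u : ℤˣ) :
    weight θ e ^ (u : ℤ) = -Real.cos (θ e) * ((u : ℤ) : ℝ) * weight θ e ^ (u : ℤ) +
      Real.sin (θ e) := by
  have h := one_eq_cos_add_sin he (-u)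
  have hw := weight_pos he
  have h2 : weight θ e ^ ((-u : ℤˣ) : ℤ) * weight θ e ^ (u : ℤ) = 1 := by
    rw [Units.val_neg, zpow_neg, inv_mul_cancel₀ (zpow_pos hw _).ne']
  rw [Units.val_neg] at h h2
  push_cast at h
  linear_combination (weight θ e ^ (u : ℤ)) * h + Real.sin (θ e) * h2

/-- The pointwise identity behind the propagation equation. -/
theorem kcObservable_eq {e : Edge} {p p₁ : LiftedCorner} (h₁ : LiftedCorner.AdjIn e p p₁)
    (hv : p₁.vertex = p.vertex) (γ : Finset Edge) (g : Face) (s : Config) :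
    kcObservable θ γ p.face g s =
      Real.cos (θ e) * (((lineSign γ e : ℤ) : ℝ) * kcObservable θ γ p₁.face g s) +
        Real.sin (θ e) * kcObservable θ (symmDiff γ {e}) p.face g s := by
  have hspin : ((s p₁.face : ℤ) : ℝ) =
      ((energy s e : ℤ) : ℝ) * ((s p.face : ℤ) : ℝ) := by
    have h5 : s p₁.face = energy s e * s p.face := by
      rw [energy]
      rcases (adjIn_vertex h₁ hv p).1 with ⟨h, h'⟩ | ⟨h, h'⟩ <;> rw [h, h']
      · rw [mul_right_comm, units_mul_self_eq, one_mul]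
      · rw [mul_assoc, units_mul_self_eq, mul_one]
    rw [h5, Units.val_mul, Int.cast_mul]
  unfold kcObservable
  rw [hspin]
  by_cases he : e ∈ γ
  · have hsd : symmDiff γ {e} = γ.erase e := by
      ext x; simp only [Finset.mem_symmDiff, Finset.mem_singleton, Finset.mem_erase]
      constructor
      · rintro (h | h)
        · exact ⟨h.2, h.1⟩
        · exact absurd (h.1 ▸ he) h.2
      · exact fun h => Or.inl ⟨h.2, h.1⟩
    have := disorder_eq_cos_add_sin (hθ e) (energy s e)
    rw [hsd, ← Finset.mul_prod_erase _ _ he]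
    simp only [lineSign, he, if_true, Units.val_neg, Units.val_one, Int.cast_neg, Int.cast_one]
    linear_combination (∏ x ∈ γ.erase e, weight θ x ^ ((energy s x : ℤˣ) : ℤ)) *
      ((s p.face : ℤ) : ℝ) * ((s g : ℤ) : ℝ) * this
  · have hsd : symmDiff γ {e} = insert e γ := by
      ext x; simp only [Finset.mem_symmDiff, Finset.mem_singleton, Finset.mem_insert]
      constructor
      · rintro (h | h)
        · exact Or.inr h.1
        · exact Or.inl h.1
      · rintro (h | h)
        · exact Or.inr ⟨h, h ▸ he⟩
        · exact Or.inl ⟨h, fun h' => he (h' ▸ h)⟩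
    have := one_eq_cos_add_sin (hθ e) (energy s e)
    rw [hsd, Finset.prod_insert he]
    simp only [lineSign, he, if_false, Units.val_one, Int.cast_one]
    linear_combination (∏ x ∈ γ, weight θ x ^ ((energy s x : ℤˣ) : ℤ)) *
      ((s p.face : ℤ) : ℝ) * ((s g : ℤ) : ℝ) * this

omit hθ in
/-- The two faces on both sides of an edge outside of the box carry the same spin. -/
theorem boxExpectation_kcObservable_of_notMem {R : ℕ} {e : Edge} {p p₁ : LiftedCorner}
    (h₁ : LiftedCorner.AdjIn e p p₁) (hv : p₁.vertex = p.vertex) (he : e ∉ boxEdges R)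
    (γ : Finset Edge) (g : Face) :
    boxExpectation θ R (kcObservable θ γ p.face g) =
      boxExpectation θ R (kcObservable θ γ p₁.face g) := by
  unfold boxExpectation
  congr 1
  refine Finset.sum_congr rfl fun s _ => ?_
  have hs := energy_wired_of_notMem he s
  have : wired R s p.face = wired R s p₁.face := by
    rw [energy] at hs
    have hs' : wired R s e.faces.1 = wired R s e.faces.2 := by
      rw [← mul_one (wired R s e.faces.1), ← units_mul_self_eq (wired R s e.faces.2),
        ← mul_assoc, hs, one_mul]
    rcases (adjIn_vertex h₁ hv p).1 with ⟨h, h'⟩ | ⟨h, h'⟩ <;> rw [h, h']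
    · exact hs'
    · exact hs'.symm
  rw [kcObservable, kcObservable, this]

/-- The propagation equation for the fermion in a box. It is twisted at the quad of `z` next to `q`,
since there the double cover of the fermion differs from `Υ^×`. -/
theorem boxFermion_propagation {R : ℕ} {z : Edge} {q : LiftedCorner} (hq : IsSource z q)
    (hqR : InBox R q.vertex) {e : Edge}
    {p p₁ p₂ : LiftedCorner} (h₁ : LiftedCorner.AdjIn e p p₁) (hv : p₁.vertex = p.vertex)
    (h₂ : LiftedCorner.AdjIn e p p₂) (hf : p₂.face = p.face) :
    boxFermion θ R q p =
      (((starSign z q e p p₁ : ℤˣ) : ℤ) : ℝ) * Real.cos (boxAngle θ R e) * boxFermion θ R q p₁ +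
      (((starSign z q e p p₂ : ℤˣ) : ℤ) : ℝ) * Real.sin (boxAngle θ R e) * boxFermion θ R q p₂ := by
  have s3 : ∀ η u v c t : ℤˣ, u * v = c * t → t * (η * c * v) = η * u := by
    intro η u v c t h
    have : c = u * v * t := by rw [h, mul_assoc, units_mul_self_eq, mul_one]
    rw [this]
    calc _ = η * u * (t * t) * (v * v) := by ac_rfl
      _ = _ := by rw [units_mul_self_eq, units_mul_self_eq, mul_one, mul_one]
  have s1 := sheetSign_mul_sheetSign hq h₁
  have s2 := sheetSign_mul_sheetSign hq h₂
  by_cases he : e ∈ boxEdges R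
  · have hpR : InBox R p.vertex ∧ InBox R p₂.vertex := by
      rcases (adjIn_face h₂ hf q).1 with ⟨h, h'⟩ | ⟨h, h'⟩ <;> rw [h, h']
      · exact ends_inBox he
      · exact (ends_inBox he).symm
    obtain ⟨A, η, hA, rfl, hl⟩ := exists_gauged_of_inBox hqR hpR.1
    have hm₁ : KCState.Move e A ⟨p₁, A.line, if e ∈ A.line then -A.sgn else A.sgn⟩ :=
      ⟨h₁, Or.inl ⟨hv, rfl, rfl⟩⟩
    have hm₂ : KCState.Move e A ⟨p₂, symmDiff A.line {e}, A.sgn⟩ := ⟨h₂, Or.inr ⟨hf, rfl, rfl⟩⟩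
    have hl₂ : symmDiff A.line {e} ⊆ boxEdges R := fun x hx => by
      rcases Finset.mem_symmDiff.1 hx with h | h
      · exact hl h.1
      · rwa [Finset.mem_singleton.1 h.1]
    have e1 := boxFermion_eq hθ (hA.move hm₁) hqR (by rw [hv]; exact hpR.1) hl
    have e2 := boxFermion_eq hθ (hA.move hm₂) hqR hpR.2 hl₂
    simp only at e1 e2
    rw [boxFermion_eq hθ hA hqR hpR.1 hl, e1, e2, boxAngle, if_pos he]
    have key : A.boxValue θ R q = Real.cos (θ e) * KCState.boxValue θ R q
        ⟨p₁, A.line, if e ∈ A.line then -A.sgn else A.sgn⟩ +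
        Real.sin (θ e) * KCState.boxValue θ R q ⟨p₂, symmDiff A.line {e}, A.sgn⟩ := by
      have hsg : (((if e ∈ A.line then -A.sgn else A.sgn : ℤˣ) : ℤ) : ℝ) =
          ((A.sgn : ℤ) : ℝ) * ((lineSign A.line e : ℤ) : ℝ) := by
        unfold lineSign; split_ifs <;> simp
      simp only [KCState.boxValue, hf]
      rw [hsg, funext (kcObservable_eq hθ h₁ hv A.line q.face), boxExpectation_add,
        boxExpectation_const_mul, boxExpectation_const_mul, boxExpectation_const_mul]
      ring
    have t1 := congrArg (fun u : ℤˣ => ((u : ℤ) : ℝ)) (s3 η _ _ _ _ s1)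
    have t2 := congrArg (fun u : ℤˣ => ((u : ℤ) : ℝ)) (s3 η _ _ _ _ s2)
    simp only [Units.val_mul, Int.cast_mul] at t1 t2 ⊢
    rw [key]
    generalize KCState.boxValue θ R q ⟨p₁, A.line, if e ∈ A.line then -A.sgn else A.sgn⟩ = X₁
    generalize KCState.boxValue θ R q ⟨p₂, symmDiff A.line {e}, A.sgn⟩ = X₂
    linear_combination -(Real.cos (θ e) * X₁) * t1 - Real.sin (θ e) * X₂ * t2
  · rw [boxAngle, if_neg he, Real.cos_zero, Real.sin_zero, mul_zero, zero_mul, add_zero, mul_one]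
    by_cases hp : InBox R p.vertex
    · obtain ⟨A, η, hA, rfl, hl⟩ := exists_gauged_of_inBox hqR hp
      have hm₁ : KCState.Move e A ⟨p₁, A.line, A.sgn⟩ :=
        ⟨h₁, Or.inl ⟨hv, rfl, (if_neg fun h => he (hl h)).symm⟩⟩
      have e1 := boxFermion_eq hθ (hA.move hm₁) hqR (by rw [hv]; exact hp) hl
      have t1 := congrArg (fun u : ℤˣ => ((u : ℤ) : ℝ)) (s3 η _ _ _ _ s1)
      have key : A.boxValue θ R q = KCState.boxValue θ R q ⟨p₁, A.line, A.sgn⟩ := by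
        unfold KCState.boxValue
        rw [boxExpectation_kcObservable_of_notMem h₁ hv he]
      rw [boxFermion_eq hθ hA hqR hp hl, e1, key]
      simp only [Units.val_mul, Int.cast_mul] at t1 ⊢
      generalize KCState.boxValue θ R q ⟨p₁, A.line, A.sgn⟩ = X₁
      linear_combination -X₁ * t1
    · rw [boxFermion_of_not_inBox hp, boxFermion_of_not_inBox (by rwa [hv]), mul_zero]

/-- The propagation equation for the fermion. -/
theorem fermion_propagation {z : Edge} {q : LiftedCorner} (hq : IsSource z q) {e : Edge}
    {p p₁ p₂ : LiftedCorner} (h₁ : LiftedCorner.AdjIn e p p₁) (hv : p₁.vertex = p.vertex)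
    (h₂ : LiftedCorner.AdjIn e p p₂) (hf : p₂.face = p.face) :
    fermion θ z q p =
      (((starSign z q e p p₁ : ℤˣ) : ℤ) : ℝ) * Real.cos (θ e) * fermion θ z q p₁ +
      (((starSign z q e p p₂ : ℤˣ) : ℤ) : ℝ) * Real.sin (θ e) * fermion θ z q p₂ := by
  refine tendsto_nhds_unique (tendsto_boxFermion hθ hq p)
    ((((tendsto_boxFermion hθ hq p₁).const_mul _).add
      ((tendsto_boxFermion hθ hq p₂).const_mul _)).congr' ?_)
  filter_upwards [eventually_mem_boxEdges e, eventually_inBox q.vertex] with R h4 h5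
  rw [boxFermion_propagation hθ hq h5 h₁ hv h₂ hf, boxAngle, if_pos h4]

/-- The fermion next to its source, across the edge `z`. -/
theorem fermion_vertex_neighbour {z : Edge} {q : LiftedCorner} (hq : IsSource z q)
    {p : LiftedCorner} (h : LiftedCorner.AdjIn z q p) (hv : p.vertex = q.vertex) :
    fermion θ z q p = -energyDensity θ z := by
  have hm : KCState.Move z (KCState.init q) ⟨p, ∅, 1⟩ :=
    ⟨h, Or.inl ⟨hv, rfl, by simp [KCState.init]⟩⟩
  have e1 := fermion_eq hθ hq ((gauged_init q).move hm)
  have s1 := sheetSign_mul_sheetSign hq h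
  rw [starSign_eq_neg_one (Or.inl ⟨rfl, rfl⟩), sheetSign_self, one_mul] at s1
  simp only [KCState.init] at e1
  rw [e1, s1, one_mul, ← mul_assoc, units_mul_self_eq, KCState.value_eq]
  have hobs : kcObservable θ ∅ p.face q.face = fun s => ((energy s z : ℤ) : ℝ) := by
    funext s
    simp only [kcObservable, Finset.prod_empty, one_mul, energy]
    rcases (adjIn_vertex h hv q).1 with ⟨h, h'⟩ | ⟨h, h'⟩ <;> rw [h, h']
    · push_cast; ring
    · push_cast; ring
  simp only [hobs, energyDensity]
  simp

end

/-! ### Propagators and quads -/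

/-- The lift of the north-eastern corner of a quad that is adjacent to `c⁺`. -/
def Edge.bPlus : Edge → LiftedCorner
  | .h m n => ⟨2 * m + 1, 2 * n - 1, -1⟩
  | .v m n => ⟨2 * m, 2 * n + 1, -1⟩

theorem Edge.adjIn_cPlus_bPlus (e : Edge) : LiftedCorner.AdjIn e e.cPlus e.bPlus := by
  cases e <;> simp [LiftedCorner.AdjIn, LiftedCorner.InQuad, LiftedCorner.Adj, bPlus, cPlus,
    neg_one_zpow_two_mul_add_one]

theorem Edge.adjIn_bPlus_aPlus_flip (e : Edge) :
    LiftedCorner.AdjIn e e.bPlus e.aPlus.flip := by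
  cases e <;> simp [LiftedCorner.AdjIn, LiftedCorner.InQuad, LiftedCorner.Adj, aPlus, bPlus,
    LiftedCorner.flip, neg_one_zpow_two_mul]

theorem Edge.dPlus_vertex (e : Edge) : e.dPlus.vertex = e.aPlus.vertex := by
  cases e <;> simp only [dPlus, aPlus, LiftedCorner.vertex, Prod.mk.injEq, true_and, and_true] <;> omega

theorem Edge.cPlus_face (e : Edge) : e.cPlus.face = e.dPlus.face := by
  cases e <;> simp only [dPlus, cPlus, LiftedCorner.face, Prod.mk.injEq, true_and, and_true] <;> omega

theorem Edge.bPlus_vertex (e : Edge) : e.bPlus.vertex = e.cPlus.vertex := by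
  cases e <;> simp only [bPlus, cPlus, LiftedCorner.vertex, Prod.mk.injEq, true_and, and_true] <;> omega

theorem Edge.aPlus_face (e : Edge) : e.aPlus.face = e.bPlus.face := by
  cases e <;> simp only [bPlus, aPlus, LiftedCorner.face, Prod.mk.injEq, true_and, and_true] <;> omega

namespace LiftedCorner

theorem flip_flip (p : LiftedCorner) : p.flip.flip = p := by
  simp [flip]

theorem flip_face (p : LiftedCorner) : p.flip.face = p.face := rfl

theorem AdjIn.flip {e : Edge} {p p' : LiftedCorner} (h : AdjIn e p p') :
    AdjIn e p.flip p'.flip := by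
  obtain ⟨h1, h2, h3⟩ := h
  refine ⟨by cases e <;> exact h1, by cases e <;> exact h2, ?_⟩
  rcases h3 with ⟨h3, h4, h5⟩ | ⟨h3, h4, h5⟩
  · exact Or.inl ⟨h3, h4, by simp only [LiftedCorner.flip, h5]⟩
  · exact Or.inr ⟨h3, h4, by simp only [LiftedCorner.flip, h5, mul_neg]⟩

theorem AdjIn.symm {e : Edge} {p p' : LiftedCorner} (h : AdjIn e p p') : AdjIn e p' p := by
  obtain ⟨h1, h2, h3⟩ := h
  refine ⟨h2, h1, ?_⟩
  rcases h3 with ⟨h3, h4, h5⟩ | ⟨h3, h4, h5⟩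
  · exact Or.inl ⟨h3.symm, by omega, h5.symm⟩
  · refine Or.inr ⟨h3.symm, by omega, ?_⟩
    rw [h5, h3, ← mul_assoc, units_mul_self_eq, one_mul]

theorem AdjIn.unique_vertex {e : Edge} {p p' p'' : LiftedCorner} (h : AdjIn e p p')
    (hv : p'.vertex = p.vertex) (h' : AdjIn e p p'') (hv' : p''.vertex = p.vertex) :
    p' = p'' := by
  obtain ⟨h1, h2, h3⟩ := h
  obtain ⟨-, h2', h3'⟩ := h'
  have : p'.i = p''.i ∧ p'.j = p''.j := by
    have a1 := (⟨h1, h2, h3⟩ : AdjIn e p p').2.2.coords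
    have a2 := (⟨h1, h2', h3'⟩ : AdjIn e p p'').2.2.coords
    clear h3 h3'
    cases e <;> simp only [InQuad, vertex, Prod.mk.injEq] at * <;> omega
  refine LiftedCorner.ext this.1 this.2 ?_
  rcases h3 with ⟨h3, h4, h5⟩ | ⟨h3, h4, h5⟩ <;> rcases h3' with ⟨h3', h4', h5'⟩ | ⟨h3', h4', h5'⟩
  · rw [h5, h5']
  · omega
  · omega
  · rw [h5, h5']

theorem AdjIn.unique_face {e : Edge} {p p' p'' : LiftedCorner} (h : AdjIn e p p')
    (hv : p'.face = p.face) (h' : AdjIn e p p'') (hv' : p''.face = p.face) :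
    p' = p'' := by
  obtain ⟨h1, h2, h3⟩ := h
  obtain ⟨-, h2', h3'⟩ := h'
  have : p'.i = p''.i ∧ p'.j = p''.j := by
    have a1 := (⟨h1, h2, h3⟩ : AdjIn e p p').2.2.coords
    have a2 := (⟨h1, h2', h3'⟩ : AdjIn e p p'').2.2.coords
    clear h3 h3'
    cases e <;> simp only [InQuad, face, Prod.mk.injEq] at * <;> omega
  refine LiftedCorner.ext this.1 this.2 ?_
  rcases h3 with ⟨h3, h4, h5⟩ | ⟨h3, h4, h5⟩ <;> rcases h3' with ⟨h3', h4', h5'⟩ | ⟨h3', h4', h5'⟩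
  · rw [h5, h5']
  · omega
  · omega
  · rw [h5, h5']

theorem eq_or_eq_flip_of_sameCorner {p q : LiftedCorner} (h : p.SameCorner q) :
    p = q ∨ p = q.flip := by
  have : p.sgn = q.sgn ∨ p.sgn = -q.sgn := by
    rcases Int.units_eq_one_or p.sgn with h | h <;>
      rcases Int.units_eq_one_or q.sgn with h' | h' <;> simp [h, h']
  rcases this with h' | h'
  · exact Or.inl (LiftedCorner.ext h.1 h.2 h')
  · exact Or.inr (LiftedCorner.ext h.1 h.2 h')

theorem InQuad.sameCorner {e : Edge} {p : LiftedCorner} (h : InQuad e p) :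
    p.SameCorner e.aPlus ∨ p.SameCorner e.dPlus ∨ p.SameCorner e.cPlus ∨
      p.SameCorner e.bPlus := by
  cases e <;> simp only [InQuad, SameCorner, Edge.aPlus, Edge.dPlus, Edge.cPlus, Edge.bPlus] at *
    <;> omega

end LiftedCorner

/-- A function on the double cover is a propagator if and only if it is a spinor which satisfies
two equations at each quad. -/
theorem Propagation.iff_quads {θ : Edge → ℝ} (hθ : ∀ e, θ e ∈ Set.Ioo 0 (Real.pi / 2))
    {X : LiftedCorner → ℂ} : Propagation θ X ↔ (∀ p : LiftedCorner, X p.flip = -X p) ∧ ∀ e : Edge,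
      X e.dPlus = X e.aPlus * (Real.cos (θ e) : ℂ) + X e.cPlus * (Real.sin (θ e) : ℂ) ∧
      X e.bPlus = X e.cPlus * (Real.cos (θ e) : ℂ) - X e.aPlus * (Real.sin (θ e) : ℂ) := by
  have hcs : ∀ e, (Real.cos (θ e) : ℂ) ^ 2 + (Real.sin (θ e) : ℂ) ^ 2 = 1 := fun e => by
    exact_mod_cast Real.cos_sq_add_sin_sq (θ e)
  constructor
  · intro h
    have hd := fun e => h e _ _ _ e.adjIn_aPlus_dPlus.symm e.dPlus_vertex.symm
      e.adjIn_dPlus_cPlus e.cPlus_face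
    have hc := fun e => h e _ _ _ e.adjIn_cPlus_bPlus e.bPlus_vertex e.adjIn_dPlus_cPlus.symm
      e.cPlus_face.symm
    have hb := fun e => h e _ _ _ e.adjIn_cPlus_bPlus.symm e.bPlus_vertex.symm
      e.adjIn_bPlus_aPlus_flip (e.aPlus.flip_face.trans e.aPlus_face)
    have ha' := fun e => h e _ _ _ e.adjIn_aPlus_dPlus.flip e.dPlus_vertex
      e.adjIn_bPlus_aPlus_flip.symm e.aPlus_face.symm
    have ha := fun e : Edge => h e e.aPlus _ e.bPlus.flip e.adjIn_aPlus_dPlus e.dPlus_vertex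
      (by simpa only [LiftedCorner.flip_flip] using e.adjIn_bPlus_aPlus_flip.symm.flip)
      e.aPlus_face.symm
    have hb' := fun e : Edge => h e e.bPlus.flip _ _ e.adjIn_cPlus_bPlus.symm.flip
      e.bPlus_vertex.symm
      (by simpa only [LiftedCorner.flip_flip] using e.adjIn_bPlus_aPlus_flip.flip) e.aPlus_face
    have hCS : ∀ e, (Real.cos (θ e) : ℂ) * (Real.sin (θ e) : ℂ) ≠ 0 := fun e => by
      have h1 := Real.cos_pos_of_mem_Ioo
        ⟨by linarith [(hθ e).1, Real.pi_pos], (hθ e).2⟩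
      have h2 := Real.sin_pos_of_pos_of_lt_pi (hθ e).1 (by linarith [(hθ e).2, Real.pi_pos])
      exact_mod_cast (mul_pos h1 h2).ne'
    have fa : ∀ e : Edge, X e.aPlus.flip = -X e.aPlus := fun e => by
      refine mul_left_cancel₀ (hCS e) ?_
      linear_combination -X e.cPlus * hcs e - hc e - (Real.cos (θ e) : ℂ) * hb e -
        (Real.sin (θ e) : ℂ) * hd e
    have fd : ∀ e : Edge, X e.dPlus.flip = -X e.dPlus := fun e => by
      refine mul_left_cancel₀ (hCS e) ?_
      linear_combination -X e.bPlus * hcs e - hb e - (Real.cos (θ e) : ℂ) * hc e -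
        (Real.sin (θ e) : ℂ) * ha' e
    have fc : ∀ e : Edge, X e.cPlus.flip = -X e.cPlus := fun e => by
      refine mul_left_cancel₀ (hCS e) ?_
      linear_combination -X e.aPlus * hcs e - ha e - (Real.cos (θ e) : ℂ) * hd e -
        (Real.sin (θ e) : ℂ) * hb' e
    have fb : ∀ e : Edge, X e.bPlus.flip = -X e.bPlus := fun e => by
      refine mul_left_cancel₀ (hCS e) ?_
      linear_combination -X e.dPlus * hcs e - hd e - (Real.cos (θ e) : ℂ) * ha e -
        (Real.sin (θ e) : ℂ) * hc e
    have hflip : ∀ p : LiftedCorner, X p.flip = -X p := by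
      intro p
      -- every corner lies on the quad of a vertical edge
      have hp : LiftedCorner.InQuad (.v ((p.i + 1) / 2) (p.j / 2)) p := by
        simp only [LiftedCorner.InQuad]; omega
      have key : ∀ q : LiftedCorner, X q.flip = -X q → p.SameCorner q → X p.flip = -X p := by
        intro q hq hpq
        rcases LiftedCorner.eq_or_eq_flip_of_sameCorner hpq with rfl | rfl
        · exact hq
        · rw [LiftedCorner.flip_flip, hq, neg_neg]
      rcases hp.sameCorner with h | h | h | h
      · exact key _ (fa _) h
      · exact key _ (fd _) h
      · exact key _ (fc _) h
      · exact key _ (fb _) h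
    refine ⟨hflip, fun e => ⟨hd e, ?_⟩⟩
    have := hb e
    rw [hflip] at this
    linear_combination this
  · rintro ⟨hflip, hq⟩ e p p₁ p₂ h₁ hv h₂ hf
    have key : ∀ q q₁ q₂ : LiftedCorner, LiftedCorner.AdjIn e q q₁ → q₁.vertex = q.vertex →
        LiftedCorner.AdjIn e q q₂ → q₂.face = q.face →
        X q = X q₁ * (Real.cos (θ e) : ℂ) + X q₂ * (Real.sin (θ e) : ℂ) → p.SameCorner q →
        X p = X p₁ * (Real.cos (θ e) : ℂ) + X p₂ * (Real.sin (θ e) : ℂ) := by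
      intro q q₁ q₂ g₁ gv g₂ gf hX hpq
      rcases LiftedCorner.eq_or_eq_flip_of_sameCorner hpq with rfl | rfl
      · rw [h₁.unique_vertex hv g₁ gv, h₂.unique_face hf g₂ gf]
        exact hX
      · rw [h₁.unique_vertex hv g₁.flip gv, h₂.unique_face hf g₂.flip gf, hflip, hflip, hflip, hX]
        ring
    obtain ⟨hd, hb⟩ := hq e
    rcases h₁.1.sameCorner with h | h | h | h
    · refine key _ _ e.bPlus.flip e.adjIn_aPlus_dPlus e.dPlus_vertex
        (by simpa only [LiftedCorner.flip_flip] using e.adjIn_bPlus_aPlus_flip.symm.flip)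
        e.aPlus_face.symm ?_ h
      rw [hflip]
      linear_combination -(Real.cos (θ e) : ℂ) * hd + (Real.sin (θ e) : ℂ) * hb -
        X e.aPlus * hcs e
    · exact key _ _ _ e.adjIn_aPlus_dPlus.symm e.dPlus_vertex.symm
        e.adjIn_dPlus_cPlus e.cPlus_face hd h
    · refine key _ _ _ e.adjIn_cPlus_bPlus e.bPlus_vertex e.adjIn_dPlus_cPlus.symm
        e.cPlus_face.symm ?_ h
      linear_combination -(Real.sin (θ e) : ℂ) * hd - (Real.cos (θ e) : ℂ) * hb -
        X e.cPlus * hcs e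
    · refine key _ _ _ e.adjIn_cPlus_bPlus.symm e.bPlus_vertex.symm
        e.adjIn_bPlus_aPlus_flip (e.aPlus.flip_face.trans e.aPlus_face) ?_ h
      rw [hflip]
      linear_combination hb

/-! ### A propagator defines an s-embedding -/

theorem exists_antidifference (g : ℤ → ℂ) : ∃ f : ℤ → ℂ, f 0 = 0 ∧ ∀ m, f m - f (m - 1) = g m := by
  refine ⟨fun m => ∑ i ∈ Finset.Ioc 0 m, g i - ∑ i ∈ Finset.Ioc m 0, g i, by simp, fun m => ?_⟩
  rcases lt_or_ge 0 m with hm | hm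
  · have h1 : Finset.Ioc 0 m = insert m (Finset.Ioc 0 (m - 1)) := by
      ext x; simp only [Finset.mem_Ioc, Finset.mem_insert]; omega
    have h2 : Finset.Ioc m 0 = ∅ := Finset.Ioc_eq_empty (by omega)
    have h3 : Finset.Ioc (m - 1) 0 = ∅ := Finset.Ioc_eq_empty (by omega)
    simp only
    rw [h1, h2, h3, Finset.sum_insert (by simp)]
    simp
  · have h1 : Finset.Ioc (m - 1) 0 = insert m (Finset.Ioc m 0) := by
      ext x; simp only [Finset.mem_Ioc, Finset.mem_insert]; omega
    have h2 : Finset.Ioc 0 m = ∅ := Finset.Ioc_eq_empty (by omega)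
    have h3 : Finset.Ioc 0 (m - 1) = ∅ := Finset.Ioc_eq_empty (by omega)
    simp only
    rw [h1, h2, h3, Finset.sum_insert (by simp)]
    simp

/-- A closed discrete one-form on `ℤ²` is exact. -/
theorem exists_potential (h k : ℤ → ℤ → ℂ)
    (hhk : ∀ m n, h m n - h m (n - 1) = k m n - k (m - 1) n) :
    ∃ V : ℤ → ℤ → ℂ, (∀ m n, V m n - V (m - 1) n = h m n) ∧ ∀ m n, V m n - V m (n - 1) = k m n := by
  obtain ⟨f, -, hf⟩ := exists_antidifference fun m => h m 0
  choose K hK0 hK using fun m => exists_antidifference (k m)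
  have hV2 : ∀ m n, (f m + K m n) - (f m + K m (n - 1)) = k m n := fun m n => by
    rw [← hK]; ring
  refine ⟨fun m n => f m + K m n, fun m => ?_, hV2⟩
  refine fun n => int_forall_of_step (Q := fun n => f m + K m n - (f (m - 1) + K (m - 1) n) = h m n)
    0 ?_ (fun n hn => ?_) (fun n hn => ?_) n
  · rw [hK0, hK0, ← hf]; ring
  · have h1 := hhk m (n + 1)
    have h2 := hK m (n + 1)
    have h3 := hK (m - 1) (n + 1)
    simp only [add_sub_cancel_right] at h1 h2 h3
    linear_combination hn + h2 - h3 - h1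
  · linear_combination hn + hhk m n - hK m n + hK (m - 1) n

theorem Propagation.exists_isSEmbedding {θ : Edge → ℝ}
    (hθ : ∀ e, θ e ∈ Set.Ioo 0 (Real.pi / 2)) {X : LiftedCorner → ℂ} (hX : Propagation θ X) :
    ∃ S, IsSEmbedding θ X S := by
  obtain ⟨hflip, hq⟩ := (Propagation.iff_quads hθ).1 hX
  have hsq : ∀ i j s, X ⟨i, j, s⟩ ^ 2 = X ⟨i, j, 1⟩ ^ 2 := by
    intro i j s
    rcases Int.units_eq_one_or s with rfl | rfl
    · rfl
    · have := hflip ⟨i, j, 1⟩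
      simp only [LiftedCorner.flip] at this
      rw [this]; ring
  have hquad : ∀ e : Edge, X e.dPlus ^ 2 + X e.bPlus ^ 2 = X e.aPlus ^ 2 + X e.cPlus ^ 2 := by
    intro e
    have hcs : (Real.cos (θ e) : ℂ) ^ 2 + (Real.sin (θ e) : ℂ) ^ 2 = 1 := by
      exact_mod_cast Real.cos_sq_add_sin_sq (θ e)
    rw [(hq e).1, (hq e).2]
    linear_combination (X e.aPlus ^ 2 + X e.cPlus ^ 2) * hcs
  generalize hG : (fun i j : ℤ => X ⟨i, j, 1⟩ ^ 2) = G
  have hG' : ∀ i j s, X ⟨i, j, s⟩ ^ 2 = G i j := fun i j s => by rw [hsq, ← hG]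
  have hv : ∀ m n, G (2 * m - 1) (2 * n) + G (2 * m) (2 * n + 1) =
      G (2 * m) (2 * n) + G (2 * m - 1) (2 * n + 1) := fun m n => by
    simpa only [Edge.aPlus, Edge.bPlus, Edge.cPlus, Edge.dPlus, hG'] using hquad (.v m n)
  have hh : ∀ m n, G (2 * m) (2 * n) + G (2 * m + 1) (2 * n - 1) =
      G (2 * m) (2 * n - 1) + G (2 * m + 1) (2 * n) := fun m n => by
    simpa only [Edge.aPlus, Edge.bPlus, Edge.cPlus, Edge.dPlus, hG'] using hquad (.h m n)
  obtain ⟨V, hV1, hV2⟩ := exists_potential (fun m n => G (2 * m - 1) (2 * n) - G (2 * m - 2) (2 * n))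
    (fun m n => G (2 * m) (2 * n - 1) - G (2 * m) (2 * n - 2)) (fun m n => by
      have h1 := hv m (n - 1)
      have h2 := hh (m - 1) n
      rw [show 2 * (n - 1) = 2 * n - 2 by ring, show 2 * n - 2 + 1 = 2 * n - 1 by ring] at h1
      rw [show 2 * (m - 1) = 2 * m - 2 by ring, show 2 * m - 2 + 1 = 2 * m - 1 by ring] at h2
      rw [show 2 * (n - 1) = 2 * n - 2 by ring, show 2 * (m - 1) = 2 * m - 2 by ring]
      linear_combination -h1 - h2)
  refine ⟨Sum.elim (fun v => V v.1 v.2) (fun f => V f.1 f.2 - G (2 * f.1) (2 * f.2)), hX, ?_⟩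
  rintro ⟨i, j, s⟩
  rw [hG']
  simp only [LiftedCorner.vertex, LiftedCorner.face, Sum.elim_inl, Sum.elim_inr]
  obtain ⟨m, rfl | rfl⟩ : ∃ m, i = 2 * m ∨ i = 2 * m - 1 := ⟨(i + 1) / 2, by omega⟩ <;>
    obtain ⟨n, rfl | rfl⟩ : ∃ n, j = 2 * n ∨ j = 2 * n - 1 := ⟨(j + 1) / 2, by omega⟩
  · rw [show (2 * m + 1) / 2 = m by omega, show (2 * n + 1) / 2 = n by omega,
      show 2 * m / 2 = m by omega, show 2 * n / 2 = n by omega]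
    ring
  · rw [show (2 * m + 1) / 2 = m by omega, show (2 * n - 1 + 1) / 2 = n by omega,
      show 2 * m / 2 = m by omega, show (2 * n - 1) / 2 = n - 1 by omega,
      show 2 * (n - 1) = 2 * n - 2 by ring]
    linear_combination hV2 m n
  · rw [show (2 * m - 1 + 1) / 2 = m by omega, show (2 * n + 1) / 2 = n by omega,
      show (2 * m - 1) / 2 = m - 1 by omega, show 2 * n / 2 = n by omega,
      show 2 * (m - 1) = 2 * m - 2 by ring]
    linear_combination hV1 m n
  · rw [show (2 * m - 1 + 1) / 2 = m by omega, show (2 * n - 1 + 1) / 2 = n by omega,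
      show (2 * m - 1) / 2 = m - 1 by omega, show (2 * n - 1) / 2 = n - 1 by omega,
      show 2 * (m - 1) = 2 * m - 2 by ring, show 2 * (n - 1) = 2 * n - 2 by ring]
    have h1 := hv m (n - 1)
    rw [show 2 * (n - 1) = 2 * n - 2 by ring, show 2 * n - 2 + 1 = 2 * n - 1 by ring] at h1
    have h2 := hV1 m (n - 1)
    rw [show 2 * (n - 1) = 2 * n - 2 by ring] at h2
    linear_combination hV2 m n + h2 + h1

/-! ### The bracket around a quad -/

section

variable {θ : Edge → ℝ} (hθ : ∀ e, θ e ∈ Set.Ioo 0 (Real.pi / 2))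
include hθ

theorem fermion_quad {z : Edge} {q : LiftedCorner} (hq : IsSource z q) {e : Edge} (he : e ≠ z) :
    fermion θ z q e.dPlus = Real.cos (θ e) * fermion θ z q e.aPlus +
        Real.sin (θ e) * fermion θ z q e.cPlus ∧
      fermion θ z q e.bPlus = Real.cos (θ e) * fermion θ z q e.cPlus -
        Real.sin (θ e) * fermion θ z q e.aPlus := by
  constructor
  · have h := fermion_propagation hθ hq e.adjIn_aPlus_dPlus.symm e.dPlus_vertex.symm
      e.adjIn_dPlus_cPlus e.cPlus_face
    rw [starSign_eq_one (Or.inl he), starSign_eq_one (Or.inl he)] at h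
    simpa using h
  · have h := fermion_propagation hθ hq e.adjIn_cPlus_bPlus.symm e.bPlus_vertex.symm
      e.adjIn_bPlus_aPlus_flip (e.aPlus.flip_face.trans e.aPlus_face)
    rw [starSign_eq_one (Or.inl he), starSign_eq_one (Or.inl he), fermion_flip hθ hq] at h
    simp only [Units.val_one, Int.cast_one, one_mul] at h
    linear_combination h

omit hθ in
theorem fermion_self (z : Edge) (q : LiftedCorner) : fermion θ z q q = 1 := if_pos rfl

/-- The ratio of `cos θ_k - 𝔼[ε_k]` and `sin θ_k`. -/
def energyRatio (θ : Edge → ℝ) (k : Edge) : ℝ :=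
  Real.cos (θ k) / Real.sin (θ k) - energyDensity θ k / Real.sin (θ k)

/-- The values, at the corners of the quad of `k`, of the fermion starting at `a_k⁺`. -/
theorem fermion_aPlus (k : Edge) :
    fermion θ k k.aPlus k.cPlus = energyRatio θ k ∧
    fermion θ k k.aPlus k.dPlus =
      Real.sin (θ k) * energyRatio θ k - Real.cos (θ k) ∧
    fermion θ k k.aPlus k.bPlus = Real.cos (θ k) * energyRatio θ k + Real.sin (θ k) := by
  have hq : IsSource k k.aPlus := Or.inl rfl
  have hs := (Real.sin_pos_of_pos_of_lt_pi (hθ k).1 (by linarith [(hθ k).2, Real.pi_pos])).ne'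
  have hda : k.dPlus.SameCorner k.aPlus → False := by
    cases k <;> simp [LiftedCorner.SameCorner, Edge.aPlus, Edge.dPlus]
    omega
  have hca : k.cPlus.SameCorner k.aPlus → False := by
    cases k <;> simp [LiftedCorner.SameCorner, Edge.aPlus, Edge.cPlus]
  have hba : k.bPlus.SameCorner k.aPlus → False := by
    cases k <;> simp [LiftedCorner.SameCorner, Edge.aPlus, Edge.bPlus]
  have h0 := fermion_vertex_neighbour hθ hq k.adjIn_aPlus_dPlus k.dPlus_vertex
  have h1 := fermion_propagation hθ hq k.adjIn_aPlus_dPlus.symm k.dPlus_vertex.symm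
      k.adjIn_dPlus_cPlus k.cPlus_face
  rw [starSign_eq_neg_one (Or.inr ⟨rfl, rfl⟩), starSign_eq_one (Or.inr ⟨hda, hca⟩),
    fermion_self] at h1
  have h2 := fermion_propagation hθ hq k.adjIn_cPlus_bPlus.symm k.bPlus_vertex.symm
      k.adjIn_bPlus_aPlus_flip (k.aPlus.flip_face.trans k.aPlus_face)
  rw [starSign_eq_neg_one (q := k.aPlus) (p' := k.aPlus.flip) (Or.inr ⟨rfl, rfl⟩),
    starSign_eq_one (Or.inr ⟨hba, hca⟩), fermion_flip hθ hq, fermion_self] at h2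
  simp only [Units.val_one, Units.val_neg, Int.cast_one, Int.cast_neg] at h1 h2
  have hc : fermion θ k k.aPlus k.cPlus = energyRatio θ k := by
    unfold energyRatio
    generalize fermion θ k k.aPlus k.cPlus = x at *
    generalize energyDensity θ k = y at *
    rw [h0] at h1
    field_simp
    linear_combination -h1
  refine ⟨hc, ?_, ?_⟩
  · rw [h1, hc]; ring
  · rw [h2, hc]; ring

/-- The values, at the corners of the quad of `k`, of the fermion starting at `c_k⁺`. -/
theorem fermion_cPlus (k : Edge) :
    fermion θ k k.cPlus k.aPlus = -energyRatio θ k ∧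
    fermion θ k k.cPlus k.dPlus =
      -Real.cos (θ k) * energyRatio θ k - Real.sin (θ k) ∧
    fermion θ k k.cPlus k.bPlus = Real.sin (θ k) * energyRatio θ k - Real.cos (θ k) := by
  have hq : IsSource k k.cPlus := Or.inr rfl
  have hs := (Real.sin_pos_of_pos_of_lt_pi (hθ k).1 (by linarith [(hθ k).2, Real.pi_pos])).ne'
  have hdc : k.dPlus.SameCorner k.cPlus → False := by
    cases k <;> simp [LiftedCorner.SameCorner, Edge.cPlus, Edge.dPlus]
  have hac : k.aPlus.SameCorner k.cPlus → False := by
    cases k <;> simp [LiftedCorner.SameCorner, Edge.cPlus, Edge.aPlus]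
  have hac' : k.aPlus.flip.SameCorner k.cPlus → False := hac
  have hbc : k.bPlus.SameCorner k.cPlus → False := by
    cases k <;> simp [LiftedCorner.SameCorner, Edge.cPlus, Edge.bPlus]
    omega
  have h0 := fermion_vertex_neighbour hθ hq k.adjIn_cPlus_bPlus k.bPlus_vertex
  have h1 := fermion_propagation hθ hq k.adjIn_aPlus_dPlus.symm k.dPlus_vertex.symm
      k.adjIn_dPlus_cPlus k.cPlus_face
  rw [starSign_eq_neg_one (p' := k.cPlus) (Or.inr ⟨rfl, rfl⟩), starSign_eq_one (Or.inr ⟨hdc, hac⟩),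
    fermion_self] at h1
  have h2 := fermion_propagation hθ hq k.adjIn_cPlus_bPlus.symm k.bPlus_vertex.symm
      k.adjIn_bPlus_aPlus_flip (k.aPlus.flip_face.trans k.aPlus_face)
  rw [starSign_eq_neg_one (p' := k.cPlus) (Or.inr ⟨rfl, rfl⟩),
    starSign_eq_one (Or.inr ⟨hbc, hac'⟩), fermion_flip hθ hq, fermion_self] at h2
  simp only [Units.val_one, Units.val_neg, Int.cast_one, Int.cast_neg] at h1 h2
  have hc : fermion θ k k.cPlus k.aPlus = -energyRatio θ k := by
    unfold energyRatio
    generalize fermion θ k k.cPlus k.aPlus = x at *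
    generalize energyDensity θ k = y at *
    rw [h0] at h2
    field_simp
    linear_combination h2
  refine ⟨hc, ?_, ?_⟩
  · rw [h1, hc]; ring
  · rw [h2, hc]; ring

theorem bracket_flip (Y : LiftedCorner → ℂ) (k : Edge) (p : LiftedCorner) :
    bracket θ Y k p.flip = -bracket θ Y k p := by
  unfold bracket
  rw [fermion_flip hθ (Or.inl rfl), fermion_flip hθ (Or.inr rfl)]
  push_cast; ring

/-- Away from the quad of `k`, the bracket satisfies the propagation equation. -/
theorem bracket_quad (Y : LiftedCorner → ℂ) {k e : Edge} (he : e ≠ k) :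
    bracket θ Y k e.dPlus = (Real.cos (θ e) : ℂ) * bracket θ Y k e.aPlus +
        (Real.sin (θ e) : ℂ) * bracket θ Y k e.cPlus ∧
      bracket θ Y k e.bPlus = (Real.cos (θ e) : ℂ) * bracket θ Y k e.cPlus -
        (Real.sin (θ e) : ℂ) * bracket θ Y k e.aPlus := by
  unfold bracket
  obtain ⟨h1, h2⟩ := fermion_quad hθ (Or.inl rfl : IsSource k k.aPlus) he
  obtain ⟨h3, h4⟩ := fermion_quad hθ (Or.inr rfl : IsSource k k.cPlus) he
  rw [h1, h2, h3, h4]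
  push_cast
  constructor <;> ring

theorem bracket_aPlus (Y : LiftedCorner → ℂ) (k : Edge) :
    bracket θ Y k k.aPlus = Y k.cPlus + (energyRatio θ k : ℂ) * Y k.aPlus := by
  rw [bracket, fermion_self, (fermion_cPlus hθ k).1]; push_cast; ring

theorem bracket_cPlus (Y : LiftedCorner → ℂ) (k : Edge) :
    bracket θ Y k k.cPlus = (energyRatio θ k : ℂ) * Y k.cPlus - Y k.aPlus := by
  rw [bracket, fermion_self, (fermion_aPlus hθ k).1]; push_cast; ring

/-- At the quad of `k`, the defect of the propagation equation for the bracket. -/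
theorem bracket_quad_self (Y : LiftedCorner → ℂ) (k : Edge) :
    bracket θ Y k k.dPlus = (Real.cos (θ k) : ℂ) * bracket θ Y k k.aPlus +
        (Real.sin (θ k) : ℂ) * bracket θ Y k k.cPlus +
        2 * ((Real.sin (θ k) : ℂ) * Y k.aPlus - (Real.cos (θ k) : ℂ) * Y k.cPlus) ∧
      bracket θ Y k k.bPlus = (Real.cos (θ k) : ℂ) * bracket θ Y k k.cPlus -
        (Real.sin (θ k) : ℂ) * bracket θ Y k k.aPlus +
        2 * ((Real.sin (θ k) : ℂ) * Y k.cPlus + (Real.cos (θ k) : ℂ) * Y k.aPlus) := by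
  rw [bracket_aPlus hθ, bracket_cPlus hθ]
  unfold bracket
  rw [(fermion_aPlus hθ k).2.1, (fermion_aPlus hθ k).2.2, (fermion_cPlus hθ k).2.1,
    (fermion_cPlus hθ k).2.2]
  push_cast
  constructor <;> ring

end

/-! ### Finitely supported spinors -/

/-- The defect of the propagation equation at the south-western corner of a quad. -/
def defectD (t : ℝ) (e : Edge) : (LiftedCorner → ℂ) →ₗ[ℂ] ℂ :=
  LinearMap.proj e.dPlus - (Real.cos t : ℂ) • LinearMap.proj e.aPlus -
    (Real.sin t : ℂ) • LinearMap.proj e.cPlus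

/-- The defect of the propagation equation at the north-eastern corner of a quad. -/
def defectB (t : ℝ) (e : Edge) : (LiftedCorner → ℂ) →ₗ[ℂ] ℂ :=
  LinearMap.proj e.bPlus - (Real.cos t : ℂ) • LinearMap.proj e.cPlus +
    (Real.sin t : ℂ) • LinearMap.proj e.aPlus

theorem defectD_apply (t : ℝ) (e : Edge) (X : LiftedCorner → ℂ) : defectD t e X =
    X e.dPlus - (Real.cos t : ℂ) * X e.aPlus - (Real.sin t : ℂ) * X e.cPlus := rfl

theorem defectB_apply (t : ℝ) (e : Edge) (X : LiftedCorner → ℂ) : defectB t e X =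
    X e.bPlus - (Real.cos t : ℂ) * X e.cPlus + (Real.sin t : ℂ) * X e.aPlus := rfl

theorem Propagation.iff_defect {θ : Edge → ℝ} (hθ : ∀ e, θ e ∈ Set.Ioo 0 (Real.pi / 2))
    {X : LiftedCorner → ℂ} : Propagation θ X ↔ (∀ p : LiftedCorner, X p.flip = -X p) ∧
      ∀ e, defectD (θ e) e X = 0 ∧ defectB (θ e) e X = 0 := by
  rw [Propagation.iff_quads hθ]
  refine and_congr_right fun _ => forall_congr' fun e => ?_
  rw [defectD_apply, defectB_apply]
  constructor <;> rintro ⟨h1, h2⟩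
  · rw [h1, h2]; constructor <;> ring
  · constructor
    · linear_combination h1
    · linear_combination h2

/-- The circulation around a quad of the product of two spinors. -/
def quadForm (X X' : LiftedCorner → ℂ) (e : Edge) : ℂ :=
  X e.dPlus * X' e.dPlus + X e.bPlus * X' e.bPlus - X e.aPlus * X' e.aPlus -
    X e.cPlus * X' e.cPlus

theorem cos_sq_add_sin_sq_complex (t : ℝ) :
    (Real.cos t : ℂ) ^ 2 + (Real.sin t : ℂ) ^ 2 = 1 := by
  exact_mod_cast Real.cos_sq_add_sin_sq t

theorem quadForm_eq (t : ℝ) {X X' : LiftedCorner → ℂ} {e : Edge} (hd : defectD t e X = 0)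
    (hb : defectB t e X = 0) : quadForm X X' e =
      ((Real.cos t : ℂ) * X e.aPlus + (Real.sin t : ℂ) * X e.cPlus) * defectD t e X' +
      ((Real.cos t : ℂ) * X e.cPlus - (Real.sin t : ℂ) * X e.aPlus) * defectB t e X' := by
  rw [defectD_apply] at hd ⊢
  rw [defectB_apply] at hb ⊢
  have h := cos_sq_add_sin_sq_complex t
  rw [quadForm]
  linear_combination X' e.dPlus * hd + X' e.bPlus * hb +
    (X e.aPlus * X' e.aPlus + X e.cPlus * X' e.cPlus) * h

/-- Every corner belongs to two quads, around which it is counted with opposite signs: the sum of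
all circulations vanishes. -/
theorem finsum_quadForm {X X' : LiftedCorner → ℂ} (hX : ∀ p : LiftedCorner, X p.flip = -X p)
    (hX' : ∀ p : LiftedCorner, X' p.flip = -X' p)
    (hfin : (Function.support fun x : ℤ × ℤ => X ⟨x.1, x.2, 1⟩).Finite) :
    ∑ᶠ x : ℤ × ℤ, (quadForm X X' (.v x.1 x.2) + quadForm X X' (.h x.1 x.2)) = 0 := by
  generalize hg : (fun x : ℤ × ℤ => X ⟨x.1, x.2, 1⟩ * X' ⟨x.1, x.2, 1⟩) = g
  have hgs : ∀ i j s, X ⟨i, j, s⟩ * X' ⟨i, j, s⟩ = g (i, j) := by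
    intro i j s
    rw [← hg]
    rcases Int.units_eq_one_or s with rfl | rfl
    · rfl
    · have h1 := hX ⟨i, j, 1⟩
      have h2 := hX' ⟨i, j, 1⟩
      simp only [LiftedCorner.flip] at h1 h2
      simp only [h1, h2, neg_mul_neg]
  have hgf : (Function.support g).Finite := by
    refine hfin.subset fun x hx => ?_
    rw [Function.mem_support] at hx ⊢
    rw [← hg] at hx
    exact left_ne_zero_of_mul hx
  have hinj : ∀ a b : ℤ, Function.Injective fun x : ℤ × ℤ => (2 * x.1 + a, 2 * x.2 + b) := by
    intro a b x y h
    simp only [Prod.mk.injEq] at h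
    ext <;> omega
  have hf : ∀ a b : ℤ, (Function.support fun x : ℤ × ℤ => g (2 * x.1 + a, 2 * x.2 + b)).Finite :=
    fun a b => hgf.preimage (hinj a b).injOn
  have hshift : ∀ a b c d : ℤ, ∑ᶠ x : ℤ × ℤ, g (2 * x.1 + a, 2 * x.2 + b) =
      ∑ᶠ x : ℤ × ℤ, g (2 * x.1 + (a + 2 * c), 2 * x.2 + (b + 2 * d)) := by
    intro a b c d
    rw [← finsum_comp_equiv (Equiv.addRight ((c, d) : ℤ × ℤ))]
    refine finsum_congr fun x => ?_
    simp only [Equiv.coe_addRight, Prod.fst_add, Prod.snd_add]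
    congr 2 <;> ring
  have e1 : ∀ x : ℤ × ℤ, quadForm X X' (.v x.1 x.2) + quadForm X X' (.h x.1 x.2) =
      (g (2 * x.1 + -1, 2 * x.2 + 0) - g (2 * x.1 + 1, 2 * x.2 + 0)) +
      (g (2 * x.1 + 0, 2 * x.2 + 1) - g (2 * x.1 + 0, 2 * x.2 + -1)) +
      (g (2 * x.1 + 1, 2 * x.2 + -1) - g (2 * x.1 + -1, 2 * x.2 + 1)) := by
    intro x
    simp only [quadForm, Edge.aPlus, Edge.bPlus, Edge.cPlus, Edge.dPlus, hgs, add_zero,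
      ← sub_eq_add_neg]
    ring
  have hsub : ∀ a b c d : ℤ, (Function.support fun x : ℤ × ℤ =>
      g (2 * x.1 + a, 2 * x.2 + b) - g (2 * x.1 + c, 2 * x.2 + d)).Finite := fun a b c d =>
    ((hf a b).union (hf c d)).subset (Function.support_sub _ _)
  rw [finsum_congr e1, finsum_add_distrib
    (((hsub _ _ _ _).union (hsub _ _ _ _)).subset (Function.support_add _ _)) (hsub _ _ _ _),
    finsum_add_distrib (hsub _ _ _ _) (hsub _ _ _ _), finsum_sub_distrib (hf _ _) (hf _ _),
    finsum_sub_distrib (hf _ _) (hf _ _), finsum_sub_distrib (hf _ _) (hf _ _),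
    hshift (-1) 0 1 0, hshift 0 (-1) 0 1, hshift 1 (-1) (-1) 1]
  norm_num

theorem quadForm_eq_zero_of_forall_ne {X X' : LiftedCorner → ℂ}
    (hX : ∀ p : LiftedCorner, X p.flip = -X p) (hX' : ∀ p : LiftedCorner, X' p.flip = -X' p)
    (hfin : (Function.support fun x : ℤ × ℤ => X ⟨x.1, x.2, 1⟩).Finite) {z : Edge}
    (h : ∀ e, e ≠ z → quadForm X X' e = 0) : quadForm X X' z = 0 := by
  have key := finsum_quadForm hX hX' hfin
  cases z with
  | h m n =>
    rw [finsum_eq_single _ (m, n) fun x hx => ?_, h (.v m n) (by simp), zero_add] at key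
    · exact key
    · rw [h (.v x.1 x.2) (by simp), h (.h x.1 x.2), add_zero]
      intro h'; rw [Edge.h.injEq] at h'
      exact hx (Prod.ext h'.1 h'.2)
  | v m n =>
    rw [finsum_eq_single _ (m, n) fun x hx => ?_, h (.h m n) (by simp), add_zero] at key
    · exact key
    · rw [h (.h x.1 x.2) (by simp), h (.v x.1 x.2), add_zero]
      intro h'; rw [Edge.v.injEq] at h'
      exact hx (Prod.ext h'.1 h'.2)

/-! ### Fermions in a box are fundamental solutions -/

/-- The fermion in a box, with complex values. -/
def boxFundamental (θ : Edge → ℝ) (R : ℕ) (q p : LiftedCorner) : ℂ := boxFermion θ R q p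

/-- The fermion, with complex values. -/
def fundamental (θ : Edge → ℝ) (z : Edge) (q p : LiftedCorner) : ℂ := fermion θ z q p

section

variable {θ : Edge → ℝ} (hθ : ∀ e, θ e ∈ Set.Ioo 0 (Real.pi / 2))
include hθ

theorem boxFundamental_flip {R : ℕ} {q : LiftedCorner} (hq : InBox R q.vertex)
    (p : LiftedCorner) : boxFundamental θ R q p.flip = -boxFundamental θ R q p := by
  unfold boxFundamental
  rw [boxFermion_flip hθ hq]
  push_cast; rfl

theorem defect_boxFundamental {R : ℕ} {z : Edge} {q : LiftedCorner} (hq : IsSource z q)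
    (hqR : InBox R q.vertex) {e : Edge} (he : e ≠ z) :
    defectD (boxAngle θ R e) e (boxFundamental θ R q) = 0 ∧
      defectB (boxAngle θ R e) e (boxFundamental θ R q) = 0 := by
  rw [defectD_apply, defectB_apply]
  unfold boxFundamental
  constructor
  · have h := boxFermion_propagation hθ hq hqR e.adjIn_aPlus_dPlus.symm e.dPlus_vertex.symm
      e.adjIn_dPlus_cPlus e.cPlus_face
    rw [starSign_eq_one (Or.inl he), starSign_eq_one (Or.inl he)] at h
    rw [h]
    push_cast; ring
  · have h := boxFermion_propagation hθ hq hqR e.adjIn_cPlus_bPlus.symm e.bPlus_vertex.symm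
      e.adjIn_bPlus_aPlus_flip (e.aPlus.flip_face.trans e.aPlus_face)
    rw [starSign_eq_one (Or.inl he), starSign_eq_one (Or.inl he), boxFermion_flip hθ hqR] at h
    rw [h]
    push_cast; ring

theorem defect_boxFundamental_aPlus {R : ℕ} {k : Edge} (hqR : InBox R k.aPlus.vertex) :
    defectD (boxAngle θ R k) k (boxFundamental θ R k.aPlus) = -2 * Real.cos (boxAngle θ R k) ∧
      defectB (boxAngle θ R k) k (boxFundamental θ R k.aPlus) =
        2 * Real.sin (boxAngle θ R k) := by
  have hq : IsSource k k.aPlus := Or.inl rfl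
  have hda : k.dPlus.SameCorner k.aPlus → False := by
    cases k <;> simp [LiftedCorner.SameCorner, Edge.aPlus, Edge.dPlus]
    omega
  have hca : k.cPlus.SameCorner k.aPlus → False := by
    cases k <;> simp [LiftedCorner.SameCorner, Edge.aPlus, Edge.cPlus]
  have hba : k.bPlus.SameCorner k.aPlus → False := by
    cases k <;> simp [LiftedCorner.SameCorner, Edge.aPlus, Edge.bPlus]
  have h1 := boxFermion_propagation hθ hq hqR k.adjIn_aPlus_dPlus.symm k.dPlus_vertex.symm
      k.adjIn_dPlus_cPlus k.cPlus_face
  rw [starSign_eq_neg_one (Or.inr ⟨rfl, rfl⟩), starSign_eq_one (Or.inr ⟨hda, hca⟩)] at h1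
  have h2 := boxFermion_propagation hθ hq hqR k.adjIn_cPlus_bPlus.symm k.bPlus_vertex.symm
      k.adjIn_bPlus_aPlus_flip (k.aPlus.flip_face.trans k.aPlus_face)
  rw [starSign_eq_neg_one (q := k.aPlus) (p' := k.aPlus.flip) (Or.inr ⟨rfl, rfl⟩),
    starSign_eq_one (Or.inr ⟨hba, hca⟩), boxFermion_flip hθ hqR] at h2
  rw [defectD_apply, defectB_apply]
  unfold boxFundamental
  rw [h1, h2, boxFermion_self hθ hqR]
  push_cast
  constructor <;> ring

theorem defect_boxFundamental_cPlus {R : ℕ} {k : Edge} (hqR : InBox R k.cPlus.vertex) :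
    defectD (boxAngle θ R k) k (boxFundamental θ R k.cPlus) = -2 * Real.sin (boxAngle θ R k) ∧
      defectB (boxAngle θ R k) k (boxFundamental θ R k.cPlus) =
        -2 * Real.cos (boxAngle θ R k) := by
  have hq : IsSource k k.cPlus := Or.inr rfl
  have hdc : k.dPlus.SameCorner k.cPlus → False := by
    cases k <;> simp [LiftedCorner.SameCorner, Edge.cPlus, Edge.dPlus]
  have hac : k.aPlus.SameCorner k.cPlus → False := by
    cases k <;> simp [LiftedCorner.SameCorner, Edge.cPlus, Edge.aPlus]
  have hac' : k.aPlus.flip.SameCorner k.cPlus → False := hac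
  have hbc : k.bPlus.SameCorner k.cPlus → False := by
    cases k <;> simp [LiftedCorner.SameCorner, Edge.cPlus, Edge.bPlus]
    omega
  have h1 := boxFermion_propagation hθ hq hqR k.adjIn_aPlus_dPlus.symm k.dPlus_vertex.symm
      k.adjIn_dPlus_cPlus k.cPlus_face
  rw [starSign_eq_neg_one (p' := k.cPlus) (Or.inr ⟨rfl, rfl⟩),
    starSign_eq_one (Or.inr ⟨hdc, hac⟩)] at h1
  have h2 := boxFermion_propagation hθ hq hqR k.adjIn_cPlus_bPlus.symm k.bPlus_vertex.symm
      k.adjIn_bPlus_aPlus_flip (k.aPlus.flip_face.trans k.aPlus_face)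
  rw [starSign_eq_neg_one (p' := k.cPlus) (Or.inr ⟨rfl, rfl⟩),
    starSign_eq_one (Or.inr ⟨hbc, hac'⟩), boxFermion_flip hθ hqR] at h2
  rw [defectD_apply, defectB_apply]
  unfold boxFundamental
  rw [h1, h2, boxFermion_self hθ hqR]
  push_cast
  constructor <;> ring

omit hθ in
theorem finite_support_of_inBox {R : ℕ} {X : LiftedCorner → ℂ}
    (hR : ∀ p : LiftedCorner, ¬ InBox R p.vertex → X p = 0) :
    (Function.support fun x : ℤ × ℤ => X ⟨x.1, x.2, 1⟩).Finite := by
  refine ((Set.finite_Icc (-(2 * R + 2) : ℤ) (2 * R + 2)).prod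
    (Set.finite_Icc (-(2 * R + 2) : ℤ) (2 * R + 2))).subset fun x hx => ?_
  have hin : InBox R (LiftedCorner.vertex ⟨x.1, x.2, 1⟩) := by
    by_contra h; exact hx (hR _ h)
  simp only [InBox, LiftedCorner.vertex] at hin
  simp only [Set.mem_prod, Set.mem_Icc]
  omega

omit hθ in
/-- Every corner is a source. -/
theorem exists_isSource (p : LiftedCorner) :
    ∃ z : Edge, p.SameCorner z.aPlus ∨ p.SameCorner z.cPlus := by
  obtain ⟨i, j, s⟩ := p
  obtain ⟨m, hm⟩ : ∃ m, m = i / 2 := ⟨_, rfl⟩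
  obtain ⟨n, hn⟩ : ∃ n, n = j / 2 := ⟨_, rfl⟩
  by_cases hi : i % 2 = 0 <;> by_cases hj : j % 2 = 0
  · exact ⟨.v m n, Or.inl (by simp only [LiftedCorner.SameCorner, Edge.aPlus]; omega)⟩
  · exact ⟨.h m (n + 1), Or.inl (by simp only [LiftedCorner.SameCorner, Edge.aPlus]; omega)⟩
  · exact ⟨.h m n, Or.inr (by simp only [LiftedCorner.SameCorner, Edge.cPlus]; omega)⟩
  · exact ⟨.v (m + 1) n, Or.inr (by simp only [LiftedCorner.SameCorner, Edge.cPlus]; omega)⟩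

/-- A spinor in the box that satisfies the propagation equation everywhere vanishes. -/
theorem eq_zero_of_defect_eq_zero {R : ℕ} {G : LiftedCorner → ℂ}
    (hG : ∀ p : LiftedCorner, G p.flip = -G p)
    (hR : ∀ p : LiftedCorner, ¬ InBox R p.vertex → G p = 0)
    (hd : ∀ e, defectD (boxAngle θ R e) e G = 0) (hb : ∀ e, defectB (boxAngle θ R e) e G = 0)
    (p : LiftedCorner) : G p = 0 := by
  by_cases hp : InBox R p.vertex
  swap
  · exact hR p hp
  have key : ∀ q : LiftedCorner, G q = 0 → p.SameCorner q → G p = 0 := by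
    intro q hq hpq
    rcases LiftedCorner.eq_or_eq_flip_of_sameCorner hpq with rfl | rfl
    · exact hq
    · rw [hG, hq, neg_zero]
  have hvert : ∀ q : LiftedCorner, p.SameCorner q → InBox R q.vertex := by
    intro q hpq
    have : q.vertex = p.vertex := by simp only [LiftedCorner.vertex, hpq.1, hpq.2]
    rwa [this]
  have hzero : ∀ z q, IsSource z q → InBox R q.vertex →
      quadForm G (boxFundamental θ R q) z = 0 := fun z q hq hqR =>
    quadForm_eq_zero_of_forall_ne hG (boxFundamental_flip hθ hqR) (finite_support_of_inBox hR)
      fun e he => by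
        obtain ⟨h1, h2⟩ := defect_boxFundamental hθ hq hqR he
        rw [quadForm_eq _ (hd e) (hb e), h1, h2, mul_zero, mul_zero, add_zero]
  obtain ⟨z, h | h⟩ := exists_isSource p
  · refine key _ ?_ h
    have h0 := hzero z _ (Or.inl rfl) (hvert _ h)
    obtain ⟨h1, h2⟩ := defect_boxFundamental_aPlus hθ (hvert _ h)
    rw [quadForm_eq _ (hd z) (hb z), h1, h2] at h0
    linear_combination (-1 / 2 : ℂ) * h0 - G z.aPlus * cos_sq_add_sin_sq_complex (boxAngle θ R z)
  · refine key _ ?_ h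
    have h0 := hzero z _ (Or.inr rfl) (hvert _ h)
    obtain ⟨h1, h2⟩ := defect_boxFundamental_cPlus hθ (hvert _ h)
    rw [quadForm_eq _ (hd z) (hb z), h1, h2] at h0
    linear_combination (-1 / 2 : ℂ) * h0 - G z.cPlus * cos_sq_add_sin_sq_complex (boxAngle θ R z)

end

/-! ### Representation of spinors by their defects -/

/-- The coefficient of the fermion starting at `a_k⁺` that produces given defects. -/
def coeffA (t : ℝ) (k : Edge) : (LiftedCorner → ℂ) →ₗ[ℂ] ℂ :=
  (-(Real.cos t : ℂ) / 2) • defectD t k + ((Real.sin t : ℂ) / 2) • defectB t k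

/-- The coefficient of the fermion starting at `c_k⁺` that produces given defects. -/
def coeffC (t : ℝ) (k : Edge) : (LiftedCorner → ℂ) →ₗ[ℂ] ℂ :=
  (-(Real.sin t : ℂ) / 2) • defectD t k + (-(Real.cos t : ℂ) / 2) • defectB t k

theorem coeffA_apply (t : ℝ) (k : Edge) (X : LiftedCorner → ℂ) : coeffA t k X =
    (-(Real.cos t : ℂ) / 2) * defectD t k X + ((Real.sin t : ℂ) / 2) * defectB t k X := rfl

theorem coeffC_apply (t : ℝ) (k : Edge) (X : LiftedCorner → ℂ) : coeffC t k X =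
    (-(Real.sin t : ℂ) / 2) * defectD t k X + (-(Real.cos t : ℂ) / 2) * defectB t k X := rfl

/-- A spinor which is a limit of spinors in boxes, all of which satisfy the propagation
equation outside of `Λ`. -/
def IsBoxLimit (θ : Edge → ℝ) (Λ : Finset Edge) (X : LiftedCorner → ℂ) : Prop :=
  ∃ Z : ℕ → LiftedCorner → ℂ, (∀ᶠ R in atTop, (∀ p : LiftedCorner, Z R p.flip = -Z R p) ∧
    (∀ p : LiftedCorner, ¬ InBox R p.vertex → Z R p = 0) ∧
    ∀ e, e ∉ Λ → defectD (boxAngle θ R e) e (Z R) = 0 ∧ defectB (boxAngle θ R e) e (Z R) = 0) ∧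
  ∀ p, Tendsto (fun R => Z R p) atTop (𝓝 (X p))

theorem IsBoxLimit.add {θ : Edge → ℝ} {Λ : Finset Edge} {X X' : LiftedCorner → ℂ}
    (h : IsBoxLimit θ Λ X) (h' : IsBoxLimit θ Λ X') : IsBoxLimit θ Λ (X + X') := by
  obtain ⟨Z, h1, h2⟩ := h
  obtain ⟨Z', h1', h2'⟩ := h'
  refine ⟨fun R => Z R + Z' R, ?_, fun p => (h2 p).add (h2' p)⟩
  filter_upwards [h1, h1'] with R ⟨h3, h4, h5⟩ ⟨h3', h4', h5'⟩
  refine ⟨fun p => ?_, fun p hp => ?_, fun e he => ?_⟩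
  · rw [Pi.add_apply, Pi.add_apply, h3, h3', neg_add]
  · rw [Pi.add_apply, h4 p hp, h4' p hp, add_zero]
  · rw [map_add, map_add, (h5 e he).1, (h5 e he).2, (h5' e he).1, (h5' e he).2, add_zero]
    exact ⟨rfl, rfl⟩

theorem IsBoxLimit.smul {θ : Edge → ℝ} {Λ : Finset Edge} {X : LiftedCorner → ℂ} (c : ℂ)
    (h : IsBoxLimit θ Λ X) : IsBoxLimit θ Λ (c • X) := by
  obtain ⟨Z, h1, h2⟩ := h
  refine ⟨fun R => c • Z R, ?_, fun p => (h2 p).const_mul c⟩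
  filter_upwards [h1] with R ⟨h3, h4, h5⟩
  refine ⟨fun p => ?_, fun p hp => ?_, fun e he => ?_⟩
  · rw [Pi.smul_apply, Pi.smul_apply, h3, smul_neg]
  · rw [Pi.smul_apply, h4 p hp, smul_zero]
  · rw [map_smul, map_smul, (h5 e he).1, (h5 e he).2, smul_zero]
    exact ⟨rfl, rfl⟩

theorem IsBoxLimit.sum {θ : Edge → ℝ} {Λ : Finset Edge} {ι : Type*} (s : Finset ι)
    {X : ι → LiftedCorner → ℂ} (h : ∀ i ∈ s, IsBoxLimit θ Λ (X i)) :
    IsBoxLimit θ Λ (∑ i ∈ s, X i) := by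
  classical
  induction s using Finset.induction_on with
  | empty =>
    rw [Finset.sum_empty]
    refine ⟨fun _ => 0, Eventually.of_forall fun R => ⟨by simp, by simp, by simp⟩,
      fun p => tendsto_const_nhds⟩
  | insert i s hi ih =>
    rw [Finset.sum_insert hi]
    exact (h i (Finset.mem_insert_self _ _)).add
      (ih fun j hj => h j (Finset.mem_insert_of_mem hj))

theorem isBoxLimit_fundamental {θ θ' : Edge → ℝ} (hθ : ∀ e, θ e ∈ Set.Ioo 0 (Real.pi / 2))
    {Λ : Finset Edge} (hΛ : ∀ e, e ∉ Λ → θ e = θ' e) {z : Edge} (hz : z ∈ Λ) {q : LiftedCorner}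
    (hq : IsSource z q) : IsBoxLimit θ' Λ (fundamental θ z q) := by
  refine ⟨fun R => boxFundamental θ R q, ?_, fun p => ?_⟩
  · filter_upwards [eventually_inBox q.vertex] with R hR
    refine ⟨boxFundamental_flip hθ hR, fun p hp => ?_, fun e he => ?_⟩
    · rw [boxFundamental, boxFermion_of_not_inBox hp, Complex.ofReal_zero]
    · have h := defect_boxFundamental hθ hq hR (e := e) (fun h => he (h ▸ hz))
      rwa [boxAngle, hΛ e he] at h
  · exact (Complex.continuous_ofReal.tendsto _).comp (tendsto_boxFermion hθ hq p)

theorem tendsto_defect {Z : ℕ → LiftedCorner → ℂ} {X : LiftedCorner → ℂ}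
    (h : ∀ p, Tendsto (fun R => Z R p) atTop (𝓝 (X p))) (t : ℝ) (k : Edge) :
    Tendsto (fun R => coeffA t k (Z R)) atTop (𝓝 (coeffA t k X)) ∧
      Tendsto (fun R => coeffC t k (Z R)) atTop (𝓝 (coeffC t k X)) := by
  have hd : Tendsto (fun R => defectD t k (Z R)) atTop (𝓝 (defectD t k X)) := by
    simp only [defectD_apply]
    exact ((h _).sub ((h _).const_mul _)).sub ((h _).const_mul _)
  have hb : Tendsto (fun R => defectB t k (Z R)) atTop (𝓝 (defectB t k X)) := by
    simp only [defectB_apply]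
    exact ((h _).sub ((h _).const_mul _)).add ((h _).const_mul _)
  simp only [coeffA_apply, coeffC_apply]
  exact ⟨(hd.const_mul _).add (hb.const_mul _), (hd.const_mul _).add (hb.const_mul _)⟩

/-- A limit of spinors in boxes is the combination of fermions with the same defects. -/
theorem IsBoxLimit.eq_sum {θ : Edge → ℝ} (hθ : ∀ e, θ e ∈ Set.Ioo 0 (Real.pi / 2))
    {Λ : Finset Edge} {X : LiftedCorner → ℂ} (hX : IsBoxLimit θ Λ X) (p : LiftedCorner) :
    X p = ∑ k ∈ Λ, (coeffA (θ k) k X * fundamental θ k k.aPlus p +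
      coeffC (θ k) k X * fundamental θ k k.cPlus p) := by
  obtain ⟨Z, h1, h2⟩ := hX
  have hF : ∀ k q, IsSource k q →
      Tendsto (fun R => boxFundamental θ R q p) atTop (𝓝 (fundamental θ k q p)) :=
    fun k q hq => (Complex.continuous_ofReal.tendsto _).comp (tendsto_boxFermion hθ hq p)
  refine tendsto_nhds_unique (h2 p) ((tendsto_finsetSum Λ fun k _ =>
    ((tendsto_defect h2 (θ k) k).1.mul (hF k _ (Or.inl rfl))).add
      ((tendsto_defect h2 (θ k) k).2.mul (hF k _ (Or.inr rfl)))).congr' ?_)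
  have ha : ∀ᶠ R in atTop, ∀ k ∈ Λ, InBox R k.aPlus.vertex :=
    (Finset.eventually_all Λ).2 fun k _ => eventually_inBox _
  have hc : ∀ᶠ R in atTop, ∀ k ∈ Λ, InBox R k.cPlus.vertex :=
    (Finset.eventually_all Λ).2 fun k _ => eventually_inBox _
  filter_upwards [h1, ha, hc, eventually_subset_boxEdges Λ] with R ⟨h3, h4, h5⟩ ha hc hΛ
  have hang : ∀ k ∈ Λ, boxAngle θ R k = θ k := fun k hk => if_pos (hΛ hk)
  -- the difference between both sides is a spinor in the box without defects
  let W : LiftedCorner → ℂ := ∑ k ∈ Λ, (coeffA (θ k) k (Z R) • boxFundamental θ R k.aPlus +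
    coeffC (θ k) k (Z R) • boxFundamental θ R k.cPlus)
  have hW : ∀ p, W p = ∑ k ∈ Λ, (coeffA (θ k) k (Z R) * boxFundamental θ R k.aPlus p +
    coeffC (θ k) k (Z R) * boxFundamental θ R k.cPlus p) := fun p => by
    simp only [W, Finset.sum_apply, Pi.add_apply, Pi.smul_apply, smul_eq_mul]
  have hzero := eq_zero_of_defect_eq_zero hθ (G := Z R - W) (R := R) ?_ ?_ ?_ ?_ p
  · rw [Pi.sub_apply, sub_eq_zero, hW] at hzero
    exact hzero.symm
  · intro p
    have hWf : W p.flip = -W p := by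
      rw [hW, hW, ← Finset.sum_neg_distrib]
      refine Finset.sum_congr rfl fun k hk => ?_
      rw [boxFundamental_flip hθ (ha k hk), boxFundamental_flip hθ (hc k hk)]
      ring
    rw [Pi.sub_apply, Pi.sub_apply, h3, hWf]
    ring
  · intro p hp
    rw [Pi.sub_apply, h4 p hp, hW, Finset.sum_eq_zero, sub_zero]
    intro k _
    rw [boxFundamental, boxFundamental, boxFermion_of_not_inBox hp, boxFermion_of_not_inBox hp]
    simp
  · intro e
    have hk : ∀ k ∈ Λ, k ≠ e → defectD (boxAngle θ R e) e (coeffA (θ k) k (Z R) •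
        boxFundamental θ R k.aPlus + coeffC (θ k) k (Z R) • boxFundamental θ R k.cPlus) = 0 := by
      intro k hk hke
      rw [map_add, map_smul, map_smul,
        (defect_boxFundamental hθ (Or.inl rfl) (ha k hk) (Ne.symm hke)).1,
        (defect_boxFundamental hθ (Or.inr rfl) (hc k hk) (Ne.symm hke)).1]
      simp
    rw [map_sub, map_sum]
    by_cases he : e ∈ Λ
    · rw [Finset.sum_eq_single_of_mem e he hk, map_add, map_smul, map_smul,
        (defect_boxFundamental_aPlus hθ (ha e he)).1, (defect_boxFundamental_cPlus hθ (hc e he)).1,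
        hang e he, coeffA_apply, coeffC_apply, smul_eq_mul, smul_eq_mul]
      linear_combination -(defectD (θ e) e (Z R)) * cos_sq_add_sin_sq_complex (θ e)
    · rw [Finset.sum_eq_zero fun k hk' => hk k hk' fun h => he (h ▸ hk'), (h5 e he).1, sub_zero]
  · intro e
    have hk : ∀ k ∈ Λ, k ≠ e → defectB (boxAngle θ R e) e (coeffA (θ k) k (Z R) •
        boxFundamental θ R k.aPlus + coeffC (θ k) k (Z R) • boxFundamental θ R k.cPlus) = 0 := by
      intro k hk hke
      rw [map_add, map_smul, map_smul,
        (defect_boxFundamental hθ (Or.inl rfl) (ha k hk) (Ne.symm hke)).2,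
        (defect_boxFundamental hθ (Or.inr rfl) (hc k hk) (Ne.symm hke)).2]
      simp
    rw [map_sub, map_sum]
    by_cases he : e ∈ Λ
    · rw [Finset.sum_eq_single_of_mem e he hk, map_add, map_smul, map_smul,
        (defect_boxFundamental_aPlus hθ (ha e he)).2, (defect_boxFundamental_cPlus hθ (hc e he)).2,
        hang e he, coeffA_apply, coeffC_apply, smul_eq_mul, smul_eq_mul]
      linear_combination -(defectB (θ e) e (Z R)) * cos_sq_add_sin_sq_complex (θ e)
    · rw [Finset.sum_eq_zero fun k hk' => hk k hk' fun h => he (h ▸ hk'), (h5 e he).2, sub_zero]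

/-! ### The explicit deformation of a propagator -/

theorem defect_fundamental {θ : Edge → ℝ} (hθ : ∀ e, θ e ∈ Set.Ioo 0 (Real.pi / 2)) {z : Edge}
    {q : LiftedCorner} (hq : IsSource z q) {e : Edge} (he : e ≠ z) :
    defectD (θ e) e (fundamental θ z q) = 0 ∧ defectB (θ e) e (fundamental θ z q) = 0 := by
  obtain ⟨h1, h2⟩ := fermion_quad hθ hq he
  rw [defectD_apply, defectB_apply]
  unfold fundamental
  rw [h1, h2]
  push_cast
  constructor <;> ring

theorem defect_fundamental_aPlus {θ : Edge → ℝ} (hθ : ∀ e, θ e ∈ Set.Ioo 0 (Real.pi / 2))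
    (k : Edge) : defectD (θ k) k (fundamental θ k k.aPlus) = -2 * Real.cos (θ k) ∧
      defectB (θ k) k (fundamental θ k k.aPlus) = 2 * Real.sin (θ k) := by
  obtain ⟨h1, h2, h3⟩ := fermion_aPlus hθ k
  rw [defectD_apply, defectB_apply]
  unfold fundamental
  rw [h1, h2, h3, fermion_self]
  push_cast
  constructor <;> ring

theorem defect_fundamental_cPlus {θ : Edge → ℝ} (hθ : ∀ e, θ e ∈ Set.Ioo 0 (Real.pi / 2))
    (k : Edge) : defectD (θ k) k (fundamental θ k k.cPlus) = -2 * Real.sin (θ k) ∧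
      defectB (θ k) k (fundamental θ k k.cPlus) = -2 * Real.cos (θ k) := by
  obtain ⟨h1, h2, h3⟩ := fermion_cPlus hθ k
  rw [defectD_apply, defectB_apply]
  unfold fundamental
  rw [h1, h2, h3, fermion_self]
  push_cast
  constructor <;> ring

/-- The combination of fermions whose defects on `Λ` are those of `Y`. -/
def correction (Λ : Finset Edge) (Y : LiftedCorner → ℂ) (θ : Edge → ℝ) : LiftedCorner → ℂ :=
  ∑ k ∈ Λ, (coeffA (θ k) k Y • fundamental θ k k.aPlus +
    coeffC (θ k) k Y • fundamental θ k k.cPlus)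

theorem correction_apply (Λ : Finset Edge) (Y : LiftedCorner → ℂ) (θ : Edge → ℝ)
    (p : LiftedCorner) : correction Λ Y θ p = ∑ k ∈ Λ, (coeffA (θ k) k Y *
      fundamental θ k k.aPlus p + coeffC (θ k) k Y * fundamental θ k k.cPlus p) := by
  simp only [correction, Finset.sum_apply, Pi.add_apply, Pi.smul_apply, smul_eq_mul]

/-- The deformation of a propagator `Y` when the angles change on `Λ`: the defects which appear
are cancelled by fermions. -/
def deformation (Λ : Finset Edge) (Y : LiftedCorner → ℂ) (θ : Edge → ℝ) : LiftedCorner → ℂ :=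
  Y - correction Λ Y θ

theorem defect_correction {θ : Edge → ℝ} (hθ : ∀ e, θ e ∈ Set.Ioo 0 (Real.pi / 2))
    (Λ : Finset Edge) (Y : LiftedCorner → ℂ) (e : Edge) :
    defectD (θ e) e (correction Λ Y θ) = (if e ∈ Λ then defectD (θ e) e Y else 0) ∧
      defectB (θ e) e (correction Λ Y θ) = if e ∈ Λ then defectB (θ e) e Y else 0 := by
  have hk : ∀ k ∈ Λ, k ≠ e → defectD (θ e) e (coeffA (θ k) k Y • fundamental θ k k.aPlus +
      coeffC (θ k) k Y • fundamental θ k k.cPlus) = 0 ∧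
      defectB (θ e) e (coeffA (θ k) k Y • fundamental θ k k.aPlus +
      coeffC (θ k) k Y • fundamental θ k k.cPlus) = 0 := by
    intro k _ hke
    obtain ⟨h1, h2⟩ := defect_fundamental hθ (Or.inl rfl : IsSource k k.aPlus) (Ne.symm hke)
    obtain ⟨h3, h4⟩ := defect_fundamental hθ (Or.inr rfl : IsSource k k.cPlus) (Ne.symm hke)
    simp only [map_add, map_smul, h1, h2, h3, h4, smul_zero, add_zero, and_self]
  obtain ⟨h1, h2⟩ := defect_fundamental_aPlus hθ e
  obtain ⟨h3, h4⟩ := defect_fundamental_cPlus hθ e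
  rw [correction, map_sum, map_sum]
  split_ifs with he
  · rw [Finset.sum_eq_single_of_mem e he fun k hk' h => (hk k hk' h).1,
      Finset.sum_eq_single_of_mem e he fun k hk' h => (hk k hk' h).2]
    simp only [map_add, map_smul, h1, h2, h3, h4, smul_eq_mul, coeffA_apply, coeffC_apply]
    constructor
    · linear_combination defectD (θ e) e Y * cos_sq_add_sin_sq_complex (θ e)
    · linear_combination defectB (θ e) e Y * cos_sq_add_sin_sq_complex (θ e)
  · have hne : ∀ k ∈ Λ, k ≠ e := fun k hk' h => he (h ▸ hk')
    exact ⟨Finset.sum_eq_zero fun k hk' => (hk k hk' (hne k hk')).1,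
      Finset.sum_eq_zero fun k hk' => (hk k hk' (hne k hk')).2⟩

section

variable {θ₀ : Edge → ℝ} (hθ₀ : ∀ e, θ₀ e ∈ Set.Ioo 0 (Real.pi / 2)) {Λ : Finset Edge}
  {Y : LiftedCorner → ℂ} (hY : Propagation θ₀ Y) {θ : Edge → ℝ}
  (hθ : ∀ e, θ e ∈ Set.Ioo 0 (Real.pi / 2)) (hΛ : ∀ e, e ∉ Λ → θ e = θ₀ e)
include hθ₀ hY

theorem deformation_self : deformation Λ Y θ₀ = Y := by
  have h := ((Propagation.iff_defect hθ₀).1 hY).2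
  rw [deformation, correction, Finset.sum_eq_zero, sub_zero]
  intro k _
  rw [coeffA_apply, coeffC_apply, (h k).1, (h k).2]
  simp

include hθ hΛ

theorem propagation_deformation : Propagation θ (deformation Λ Y θ) := by
  obtain ⟨hflip, h⟩ := (Propagation.iff_defect hθ₀).1 hY
  refine (Propagation.iff_defect hθ).2 ⟨fun p => ?_, fun e => ?_⟩
  · have : correction Λ Y θ p.flip = -correction Λ Y θ p := by
      rw [correction_apply, correction_apply, ← Finset.sum_neg_distrib]
      refine Finset.sum_congr rfl fun k _ => ?_
      unfold fundamental
      rw [fermion_flip hθ (Or.inl rfl), fermion_flip hθ (Or.inr rfl)]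
      push_cast; ring
    rw [deformation, Pi.sub_apply, Pi.sub_apply, hflip, this]
    ring
  · obtain ⟨h1, h2⟩ := defect_correction hθ Λ Y e
    rw [deformation, map_sub, map_sub, h1, h2]
    split_ifs with he
    · simp
    · rw [hΛ e he, (h e).1, (h e).2]; simp

/-- The exact variation of the deformation when the angles change: it is a combination of
the fermions before the change, with coefficients that involve the deformation after the change. -/
theorem deformation_sub_deformation {θ' : Edge → ℝ} (hθ' : ∀ e, θ' e ∈ Set.Ioo 0 (Real.pi / 2))
    (hΛ' : ∀ e, e ∉ Λ → θ' e = θ₀ e) (p : LiftedCorner) :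
    deformation Λ Y θ' p - deformation Λ Y θ p = ∑ k ∈ Λ, (1 / 2 : ℂ) *
      (((1 - Real.cos (θ' k - θ k)) * deformation Λ Y θ' k.aPlus -
          Real.sin (θ' k - θ k) * deformation Λ Y θ' k.cPlus) * fundamental θ k k.aPlus p +
        ((1 - Real.cos (θ' k - θ k)) * deformation Λ Y θ' k.cPlus +
          Real.sin (θ' k - θ k) * deformation Λ Y θ' k.aPlus) * fundamental θ k k.cPlus p) := by
  have hlim : IsBoxLimit θ Λ (deformation Λ Y θ' - deformation Λ Y θ) := by
    have hc : ∀ θ₁ : Edge → ℝ, (∀ e, θ₁ e ∈ Set.Ioo 0 (Real.pi / 2)) →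
        (∀ e, e ∉ Λ → θ₁ e = θ₀ e) → IsBoxLimit θ Λ (correction Λ Y θ₁) := fun θ₁ h₁ h₂ =>
      IsBoxLimit.sum Λ fun k hk => by
        have h : ∀ e, e ∉ Λ → θ₁ e = θ e := fun e he => by rw [h₂ e he, hΛ e he]
        exact ((isBoxLimit_fundamental h₁ h hk (Or.inl rfl)).smul _).add
          ((isBoxLimit_fundamental h₁ h hk (Or.inr rfl)).smul _)
    have h := (hc θ hθ hΛ).add ((hc θ' hθ' hΛ').smul (-1))
    have e : deformation Λ Y θ' - deformation Λ Y θ =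
        correction Λ Y θ + (-1 : ℂ) • correction Λ Y θ' := by
      rw [deformation, deformation, neg_one_smul]; abel
    rwa [e]
  have h := hlim.eq_sum hθ p
  rw [Pi.sub_apply] at h
  rw [h]
  refine Finset.sum_congr rfl fun k _ => ?_
  obtain ⟨-, h1⟩ := (Propagation.iff_defect hθ).1 (propagation_deformation hθ₀ hY hθ hΛ)
  obtain ⟨-, h2⟩ := (Propagation.iff_defect hθ').1 (propagation_deformation hθ₀ hY hθ' hΛ')
  obtain ⟨h3, h4⟩ := h2 k
  rw [coeffA_apply, coeffC_apply, map_sub, map_sub, (h1 k).1, (h1 k).2, sub_zero, sub_zero]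
  generalize deformation Λ Y θ' = X at *
  rw [defectD_apply] at h3 ⊢
  rw [defectB_apply] at h4 ⊢
  have hcs := cos_sq_add_sin_sq_complex (θ k)
  rw [Real.cos_sub, Real.sin_sub]
  push_cast at *
  generalize (Complex.cos (θ k)) = c at *
  generalize (Complex.sin (θ k)) = s at *
  generalize (Complex.cos (θ' k)) = c' at *
  generalize (Complex.sin (θ' k)) = s' at *
  generalize fundamental θ k k.aPlus p = u at *
  generalize fundamental θ k k.cPlus p = v at *
  linear_combination (-c / 2 * u - s / 2 * v) * h3 + (s / 2 * u - c / 2 * v) * h4 +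
    (X k.aPlus * u + X k.cPlus * v) / 2 * hcs

end

/-! ### Martingale sums -/

section Noise

variable {Ω : Type*} {m m' : MeasurableSpace Ω} [mΩ : MeasurableSpace Ω]

/-- `η` is a centred square integrable random variable with `𝔼 η² ≤ v`, which is known at the time
of `m'` and independent of what is known at the time of `m`. -/
structure IsNoise (m m' : MeasurableSpace Ω) [mΩ : MeasurableSpace Ω] (P : Measure Ω) (η : Ω → ℝ)
    (v : ℝ) : Prop where
  measurable : StronglyMeasurable[m'] η
  memLp : MemLp η 2 P
  integral : ∫ ω, η ω ∂P = 0
  sq_le : ∫ ω, η ω ^ 2 ∂P ≤ v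
  indep : Indep (MeasurableSpace.comap η inferInstance) m P

variable {P : Measure Ω}

theorem IsNoise.nonneg {η : Ω → ℝ} {v : ℝ} (h : IsNoise m m' P η v) :
    0 ≤ v :=
  (integral_nonneg fun _ => sq_nonneg _).trans h.sq_le

theorem IsNoise.indepFun {η X : Ω → ℝ} {v : ℝ} (h : IsNoise m m' P η v)
    (hX : StronglyMeasurable[m] X) : IndepFun X η P :=
  (indep_of_indep_of_le_right h.indep hX.measurable.comap_le).symm

/-- Orthogonality of martingale increments: one step of a martingale transform. -/
theorem integral_sq_add_le (hm : m ≤ mΩ) {S D η : Ω → ℝ} {v c : ℝ}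
    (hS : StronglyMeasurable[m] S) (hS2 : MemLp S 2 P) (hD : StronglyMeasurable[m] D)
    (hc : ∀ ω, |D ω| ≤ c) (hη : IsNoise m m' P η v) :
    MemLp (fun ω => S ω + D ω * η ω) 2 P ∧
      ∫ ω, (S ω + D ω * η ω) ^ 2 ∂P ≤ ∫ ω, S ω ^ 2 ∂P + c ^ 2 * v := by
  have hDb : ∀ᵐ ω ∂P, ‖D ω‖ ≤ c := .of_forall hc
  have hDm : AEStronglyMeasurable D P := (hD.mono hm).aestronglyMeasurable
  have hDη : MemLp (fun ω => D ω * η ω) 2 P := by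
    have := hη.memLp.mul (p := ⊤) (r := 2) (memLp_top_of_bound hDm c hDb)
    exact this
  refine ⟨hS2.add hDη, ?_⟩
  have hSD : MemLp (fun ω => S ω * D ω) 2 P := by
    have := (memLp_top_of_bound hDm c hDb).mul (p := 2) (r := 2) hS2
    exact this
  have i1 : Integrable (fun ω => S ω ^ 2) P := hS2.integrable_sq
  have i3 : Integrable (fun ω => (D ω * η ω) ^ 2) P := hDη.integrable_sq
  have i2 : Integrable (fun ω => (S ω * D ω) * η ω) P := hSD.integrable_mul hη.memLp
  have e2 : ∫ ω, (S ω * D ω) * η ω ∂P = 0 := by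
    rw [(hη.indepFun (X := fun ω => S ω * D ω) (hS.mul hD)).integral_fun_mul_eq_mul_integral
      hSD.1 hη.memLp.1, hη.integral, mul_zero]
  have e3 : ∫ ω, (D ω * η ω) ^ 2 ∂P ≤ c ^ 2 * v := by
    calc ∫ ω, (D ω * η ω) ^ 2 ∂P ≤ ∫ ω, c ^ 2 * η ω ^ 2 ∂P := by
          refine integral_mono i3 (hη.memLp.integrable_sq.const_mul _) fun ω => ?_
          simp only [mul_pow]
          have : D ω ^ 2 ≤ c ^ 2 := sq_le_sq' (by linarith [neg_abs_le (D ω), hc ω])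
            ((le_abs_self _).trans (hc ω))
          exact mul_le_mul_of_nonneg_right this (sq_nonneg _)
      _ = c ^ 2 * ∫ ω, η ω ^ 2 ∂P := integral_const_mul _ _
      _ ≤ c ^ 2 * v := mul_le_mul_of_nonneg_left hη.sq_le (sq_nonneg _)
  have : ∀ ω, (S ω + D ω * η ω) ^ 2 = S ω ^ 2 + 2 * ((S ω * D ω) * η ω) + (D ω * η ω) ^ 2 :=
    fun ω => by ring
  simp_rw [this]
  have e4 : ∫ ω, (S ω ^ 2 + 2 * ((S ω * D ω) * η ω) + (D ω * η ω) ^ 2) ∂P =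
      ∫ ω, (S ω ^ 2 + 2 * ((S ω * D ω) * η ω)) ∂P + ∫ ω, (D ω * η ω) ^ 2 ∂P :=
    integral_add (i1.add (i2.const_mul 2)) i3
  rw [e4, integral_add i1 (i2.const_mul 2), integral_const_mul, e2]
  linarith

/-- The `L²` bound for martingale transforms with bounded coefficients. -/
theorem integral_sq_sum_le {𝓖 : ℕ → MeasurableSpace Ω} (h𝓖 : Monotone 𝓖) (hle : ∀ j, 𝓖 j ≤ mΩ)
    {D η : ℕ → Ω → ℝ} {v c : ℕ → ℝ} (hD : ∀ j, StronglyMeasurable[𝓖 j] (D j))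
    (hc : ∀ j ω, |D j ω| ≤ c j) (hη : ∀ j, IsNoise (𝓖 j) (𝓖 (j + 1)) P (η j) (v j)) (N : ℕ) :
    MemLp (fun ω => ∑ j ∈ Finset.range N, D j ω * η j ω) 2 P ∧
      ∫ ω, (∑ j ∈ Finset.range N, D j ω * η j ω) ^ 2 ∂P ≤
        ∑ j ∈ Finset.range N, c j ^ 2 * v j := by
  suffices StronglyMeasurable[𝓖 N] (fun ω => ∑ j ∈ Finset.range N, D j ω * η j ω) ∧
      MemLp (fun ω => ∑ j ∈ Finset.range N, D j ω * η j ω) 2 P ∧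
      ∫ ω, (∑ j ∈ Finset.range N, D j ω * η j ω) ^ 2 ∂P ≤
        ∑ j ∈ Finset.range N, c j ^ 2 * v j from this.2
  induction N with
  | zero => simp [stronglyMeasurable_const]
  | succ N ih =>
    obtain ⟨h1, h2, h3⟩ := ih
    have h := integral_sq_add_le (hle N) h1 h2 (hD N) (hc N) (hη N)
    simp only [Finset.sum_range_succ]
    refine ⟨(h1.mono (h𝓖 N.le_succ)).add (((hD N).mono (h𝓖 N.le_succ)).mul (hη N).measurable),
      h.1, h.2.trans (by linarith)⟩

/-- Martingale sums split into blocks: the expected sum over the blocks of the squares of the block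
sums. -/
theorem integral_sum_sq_block_le {𝓖 : ℕ → MeasurableSpace Ω} (h𝓖 : Monotone 𝓖)
    (hle : ∀ j, 𝓖 j ≤ mΩ) {D η : ℕ → Ω → ℝ} {v : ℕ → ℝ} {c : ℝ}
    (hD : ∀ j, StronglyMeasurable[𝓖 j] (D j)) (hc : ∀ j ω, |D j ω| ≤ c)
    (hη : ∀ j, IsNoise (𝓖 j) (𝓖 (j + 1)) P (η j) (v j)) (N L : ℕ) (b : ℕ → ℕ) :
    Integrable (fun ω => ∑ l ∈ Finset.range L,
      (∑ j ∈ Finset.range N, if b j = l then D j ω * η j ω else 0) ^ 2) P ∧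
      ∫ ω, ∑ l ∈ Finset.range L,
        (∑ j ∈ Finset.range N, if b j = l then D j ω * η j ω else 0) ^ 2 ∂P ≤
        c ^ 2 * ∑ j ∈ Finset.range N, v j := by
  have key : ∀ l, MemLp (fun ω => ∑ j ∈ Finset.range N, if b j = l then D j ω * η j ω else 0) 2 P ∧
      ∫ ω, (∑ j ∈ Finset.range N, if b j = l then D j ω * η j ω else 0) ^ 2 ∂P ≤
        ∑ j ∈ Finset.range N, (if b j = l then c else 0) ^ 2 * v j := by
    intro l
    have := integral_sq_sum_le (P := P) h𝓖 hle (D := fun j ω => if b j = l then D j ω else 0)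
      (c := fun j => if b j = l then c else 0) (η := η) (v := v) (fun j => ?_) (fun j ω => ?_) hη N
    · simpa only [ite_mul, zero_mul] using this
    · by_cases h : b j = l
      · simpa [h] using hD j
      · simp [h, stronglyMeasurable_const]
    · by_cases h : b j = l
      · simpa [h] using hc j ω
      · simp [h]
  have hi : ∀ l ∈ Finset.range L, Integrable (fun ω =>
      (∑ j ∈ Finset.range N, if b j = l then D j ω * η j ω else 0) ^ 2) P :=
    fun l _ => (key l).1.integrable_sq
  refine ⟨integrable_finsetSum _ hi, ?_⟩
  rw [integral_finsetSum _ hi]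
  refine (Finset.sum_le_sum fun l _ => (key l).2).trans ?_
  rw [Finset.sum_comm, Finset.mul_sum]
  refine Finset.sum_le_sum fun j _ => ?_
  have hv := (hη j).nonneg
  have : ∀ l, (if b j = l then c else 0) ^ 2 * v j = if b j = l then c ^ 2 * v j else 0 := by
    intro l; split_ifs <;> simp
  simp_rw [this, Finset.sum_ite_eq]
  split_ifs
  · exact le_rfl
  · positivity

end Noise

/-! ### Almost sure convergence along subsequences -/

section SubAE

variable {Ω : Type*} [mΩ : MeasurableSpace Ω] {P : Measure Ω}

/-- Every subsequence has a further subsequence along which `x` tends to zero almost surely. For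
measurable random variables this is convergence to zero in probability; it passes to all pathwise
consequences without any question of measurability. -/
def SubAE {E : Type*} [NormedAddCommGroup E] (P : Measure Ω) (x : ℕ → Ω → E) : Prop :=
  ∀ ns : ℕ → ℕ, StrictMono ns → ∃ ms : ℕ → ℕ, StrictMono ms ∧
    ∀ᵐ ω ∂P, Tendsto (fun i => x (ns (ms i)) ω) atTop (𝓝 0)

variable {E F : Type*} [NormedAddCommGroup E] [NormedAddCommGroup F]

theorem SubAE.of_tendstoInMeasure {x : ℕ → Ω → E} {y : Ω → E} (h : TendstoInMeasure P x atTop y) :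
    SubAE P fun n ω => x n ω - y ω := by
  intro ns hns
  have h' : TendstoInMeasure P (fun i => x (ns i)) atTop y :=
    h.comp hns.tendsto_atTop
  obtain ⟨ms, hms, hx⟩ := h'.exists_seq_tendsto_ae
  refine ⟨ms, hms, ?_⟩
  filter_upwards [hx] with ω hω
  simpa using hω.sub_const (y ω)

theorem SubAE.of_ae {x : ℕ → Ω → E} (h : ∀ᵐ ω ∂P, Tendsto (fun n => x n ω) atTop (𝓝 0)) :
    SubAE P x := fun ns hns => ⟨id, strictMono_id, by
  filter_upwards [h] with ω hω
  exact hω.comp hns.tendsto_atTop⟩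

/-- Finitely many sequences have a common subsequence. -/
theorem SubAE.common {ι : Type*} (s : Finset ι) {E : ι → Type*} [∀ i, NormedAddCommGroup (E i)]
    {x : ∀ i, ℕ → Ω → E i} (h : ∀ i ∈ s, SubAE P (x i)) {ns : ℕ → ℕ} (hns : StrictMono ns) :
    ∃ ms : ℕ → ℕ, StrictMono ms ∧
      ∀ᵐ ω ∂P, ∀ i ∈ s, Tendsto (fun n => x i (ns (ms n)) ω) atTop (𝓝 0) := by
  classical
  induction s using Finset.induction_on with
  | empty => exact ⟨id, strictMono_id, by simp⟩
  | insert a s ha ih =>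
    obtain ⟨ms, hms, h1⟩ := ih fun i hi => h i (Finset.mem_insert_of_mem hi)
    obtain ⟨ks, hks, h2⟩ := h a (Finset.mem_insert_self _ _) (ns ∘ ms) (hns.comp hms)
    refine ⟨ms ∘ ks, hms.comp hks, ?_⟩
    filter_upwards [h1, h2] with ω h1 h2 i hi
    rcases Finset.mem_insert.1 hi with rfl | hi
    · exact h2
    · exact (h1 i hi).comp hks.tendsto_atTop

/-- Pathwise consequences of finitely many convergences. -/
theorem SubAE.of_imp {ι : Type*} (s : Finset ι) {E : ι → Type*} [∀ i, NormedAddCommGroup (E i)]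
    {x : ∀ i, ℕ → Ω → E i} (h : ∀ i ∈ s, SubAE P (x i)) {y : ℕ → Ω → F}
    (hy : ∀ᵐ ω ∂P, ∀ ks : ℕ → ℕ, StrictMono ks →
      (∀ i ∈ s, Tendsto (fun n => x i (ks n) ω) atTop (𝓝 0)) →
        Tendsto (fun n => y (ks n) ω) atTop (𝓝 0)) : SubAE P y := by
  intro ns hns
  obtain ⟨ms, hms, hx⟩ := SubAE.common s h hns
  refine ⟨ms, hms, ?_⟩
  filter_upwards [hx, hy] with ω h1 h2
  exact h2 _ (hns.comp hms) h1

theorem SubAE.of_imp_one {x : ℕ → Ω → E} (h : SubAE P x) {y : ℕ → Ω → F}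
    (hy : ∀ᵐ ω ∂P, ∀ ks : ℕ → ℕ, StrictMono ks → Tendsto (fun n => x (ks n) ω) atTop (𝓝 0) →
        Tendsto (fun n => y (ks n) ω) atTop (𝓝 0)) : SubAE P y := by
  intro ns hns
  obtain ⟨ms, hms, hx⟩ := h ns hns
  refine ⟨ms, hms, ?_⟩
  filter_upwards [hx, hy] with ω h1 h2
  exact h2 _ (hns.comp hms) h1

theorem SubAE.add {x y : ℕ → Ω → E} (hx : SubAE P x) (hy : SubAE P y) :
    SubAE P fun n ω => x n ω + y n ω := by
  refine SubAE.of_imp (Finset.univ : Finset Bool) (x := fun b => if b then x else y)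
    (fun i _ => by cases i <;> simpa) (.of_forall fun ω ks _ h => ?_)
  simpa using (h true (Finset.mem_univ _)).add (h false (Finset.mem_univ _))

theorem SubAE.sum {ι : Type*} (s : Finset ι) {x : ι → ℕ → Ω → E} (h : ∀ i ∈ s, SubAE P (x i)) :
    SubAE P fun n ω => ∑ i ∈ s, x i n ω := by
  refine SubAE.of_imp s h (.of_forall fun ω ks _ h => ?_)
  simpa using tendsto_finsetSum s h

theorem SubAE.congr {x y : ℕ → Ω → E} (hx : SubAE P x) (h : ∀ᵐ ω ∂P, ∀ n, x n ω = y n ω) :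
    SubAE P y :=
  hx.of_imp_one <| by
    filter_upwards [h] with ω h ks _ hk
    simpa only [h] using hk

/-- A constant sequence that tends to zero is zero. -/
theorem SubAE.eq_zero {x : Ω → E} (h : SubAE P fun _ => x) : ∀ᵐ ω ∂P, x ω = 0 := by
  obtain ⟨ms, -, h⟩ := h id strictMono_id
  filter_upwards [h] with ω hω
  exact tendsto_nhds_unique tendsto_const_nhds hω

theorem SubAE.tendstoInMeasure [IsFiniteMeasure P] {x : ℕ → Ω → E} {y : Ω → E}
    (hm : ∀ n, AEStronglyMeasurable (x n) P) (h : SubAE P fun n ω => x n ω - y ω) :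
    TendstoInMeasure P x atTop y := by
  rw [exists_seq_tendstoInMeasure_atTop_iff hm]
  intro ns hns
  obtain ⟨ms, hms, hx⟩ := h ns hns
  refine ⟨ms, hms, ?_⟩
  filter_upwards [hx] with ω hω
  simpa using hω.add_const (y ω)

/-- Convergence of martingale sums, in blocks: it suffices that the coefficients are eventually
bounded by a deterministic sequence that makes the `L²` bound small. Before that the coefficients
are truncated at this bound. -/
theorem subAE_sum_sq_block [IsProbabilityMeasure P] {𝓖 : ℕ → ℕ → MeasurableSpace Ω}
    (h𝓖 : ∀ n, Monotone (𝓖 n)) (hle : ∀ n j, 𝓖 n j ≤ mΩ) {D η : ℕ → ℕ → Ω → ℝ} {v : ℕ → ℕ → ℝ}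
    (hD : ∀ n j, StronglyMeasurable[𝓖 n j] (D n j))
    (hη : ∀ n j, IsNoise (𝓖 n j) (𝓖 n (j + 1)) P (η n j) (v n j)) (N L : ℕ → ℕ) (b : ℕ → ℕ → ℕ)
    (h : ∀ κ : ℝ, 0 < κ → ∃ ε : ℕ → ℝ, (∀ n, 0 ≤ ε n) ∧
      (∀ᶠ n in atTop, ε n ^ 2 * ∑ j ∈ Finset.range (N n), v n j ≤ κ) ∧
      ∀ᵐ ω ∂P, ∀ᶠ n in atTop, ∀ j < N n, |D n j ω| ≤ ε n) :
    SubAE P fun n ω => ∑ l ∈ Finset.range (L n),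
      (∑ j ∈ Finset.range (N n), if b n j = l then D n j ω * η n j ω else 0) ^ 2 := by
  set X : ℕ → Ω → ℝ := fun n ω => ∑ l ∈ Finset.range (L n),
      (∑ j ∈ Finset.range (N n), if b n j = l then D n j ω * η n j ω else 0) ^ 2 with hX
  have hX0 : ∀ n ω, 0 ≤ X n ω := fun n ω => Finset.sum_nonneg fun _ _ => sq_nonneg _
  suffices hT : TendstoInMeasure P X atTop 0 by
    simpa using SubAE.of_tendstoInMeasure hT
  rw [tendstoInMeasure_iff_measureReal_norm]
  intro δ hδ
  rw [Metric.tendsto_atTop']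
  intro ρ hρ
  obtain ⟨ε, hε0, hεV, hεD⟩ := h (δ * (ρ / 3)) (by positivity)
  let bad : ℕ → Set Ω := fun n => {ω | ∃ j < N n, ε n < |D n j ω|}
  have hDm : ∀ n j, Measurable (D n j) := fun n j => ((hD n j).mono (hle n j)).measurable
  have hbad : ∀ n, MeasurableSet (bad n) := by
    intro n
    have : bad n = ⋃ j, ⋃ (_ : j < N n), {ω | ε n < |D n j ω|} := by
      ext ω; simp [bad]
    rw [this]
    exact MeasurableSet.iUnion fun j => MeasurableSet.iUnion fun _ =>
      measurableSet_lt measurable_const (hDm n j).abs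
  have hbad0 : Tendsto (fun n => P.real (bad n)) atTop (𝓝 0) := by
    have h1 : Tendsto (fun n => P (bad n)) atTop (𝓝 (P ∅)) := by
      refine tendsto_measure_of_ae_tendsto_indicator_of_isFiniteMeasure atTop MeasurableSet.empty
        hbad ?_
      filter_upwards [hεD] with ω hω
      filter_upwards [hω] with n hn
      simp only [bad, Set.mem_ofPred_eq, Set.mem_empty_iff_false, iff_false]
      rintro ⟨j, hj, h⟩
      exact absurd (hn j hj) (not_le.2 h)
    simpa [Measure.real, Function.comp_def] using (ENNReal.tendsto_toReal (by simp)).comp h1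
  have hlim := (tendsto_order.1 hbad0).2 (ρ / 3) (by positivity)
  obtain ⟨n₀, hn₀⟩ := eventually_atTop.1 (hlim.and hεV)
  refine ⟨n₀, fun n hn => ?_⟩
  obtain ⟨h1, h2⟩ := hn₀ n hn.le
  -- the truncated sums
  let D' : ℕ → Ω → ℝ := fun j => Set.indicator {ω | |D n j ω| ≤ ε n} (D n j)
  have hD' : ∀ j, StronglyMeasurable[𝓖 n j] (D' j) := fun j =>
    (hD n j).indicator ((continuous_abs.comp_stronglyMeasurable (hD n j)).measurable
      measurableSet_Iic)
  have hD'b : ∀ j ω, |D' j ω| ≤ ε n := by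
    intro j ω
    by_cases h : |D n j ω| ≤ ε n
    · simp [D', h]
    · simp [D', h, hε0]
  obtain ⟨hi, hI⟩ := integral_sum_sq_block_le (P := P) (h𝓖 n) (hle n) hD' hD'b (hη n) (N n) (L n)
    (b n)
  set Z : Ω → ℝ := fun ω => ∑ l ∈ Finset.range (L n),
      (∑ j ∈ Finset.range (N n), if b n j = l then D' j ω * η n j ω else 0) ^ 2 with hZ
  have hsub : {ω | δ ≤ ‖X n ω - (0 : Ω → ℝ) ω‖} ⊆ bad n ∪ {ω | δ ≤ Z ω} := by
    intro ω hω
    by_cases hb : ω ∈ bad n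
    · exact Or.inl hb
    · refine Or.inr ?_
      have hD'e : ∀ j ∈ Finset.range (N n), D' j ω = D n j ω := by
        intro j hj
        have : |D n j ω| ≤ ε n := by
          by_contra h
          exact hb ⟨j, Finset.mem_range.1 hj, not_le.1 h⟩
        simp [D', this]
      have : Z ω = X n ω := by
        simp only [hZ, hX]
        refine Finset.sum_congr rfl fun l _ => ?_
        rw [Finset.sum_congr rfl fun j hj => by rw [hD'e j hj]]
      simp only [Set.mem_ofPred_eq, Pi.zero_apply, sub_zero, Real.norm_eq_abs,
        abs_of_nonneg (hX0 n ω)] at hω ⊢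
      rwa [this]
  have hmarkov : δ * P.real {ω | δ ≤ Z ω} ≤ ∫ ω, Z ω ∂P :=
    mul_meas_ge_le_integral_of_nonneg
      (.of_forall fun ω => Finset.sum_nonneg fun _ _ => sq_nonneg _) hi δ
  have h3 : P.real {ω | δ ≤ Z ω} ≤ ρ / 3 := by
    have : δ * P.real {ω | δ ≤ Z ω} ≤ δ * (ρ / 3) := hmarkov.trans (hI.trans h2)
    exact le_of_mul_le_mul_left this hδ
  have h4 : P.real {ω | δ ≤ ‖X n ω - (0 : Ω → ℝ) ω‖} ≤ P.real (bad n) + P.real {ω | δ ≤ Z ω} :=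
    (measureReal_mono hsub).trans (measureReal_union_le _ _)
  rw [Real.dist_eq, sub_zero, abs_of_nonneg measureReal_nonneg]
  linarith

end SubAE

/-! ### Brownian increments -/

section Gaussian

theorem ennreal_holderTriple_four : ENNReal.HolderTriple 4 4 2 := ⟨by
  rw [← two_mul, show (4 : ENNReal) = 2 * 2 by norm_num, ENNReal.mul_inv (by simp) (by simp),
    ← mul_assoc, ENNReal.mul_inv_cancel (by simp) (by simp), one_mul]⟩

/-- The fourth moment of the standard normal distribution. -/
def gaussianFourth : ℝ := ∫ x, x ^ 4 ∂(gaussianReal 0 1)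

theorem gaussianFourth_nonneg : 0 ≤ gaussianFourth :=
  integral_nonneg fun x => by positivity

theorem integral_pow_gaussianReal (h : ℝ≥0) (n : ℕ) :
    ∫ x, x ^ n ∂(gaussianReal 0 h) = √(h : ℝ) ^ n * ∫ x, x ^ n ∂(gaussianReal 0 1) := by
  have hmap : gaussianReal 0 h = (gaussianReal 0 1).map (√(h : ℝ) * ·) := by
    rw [gaussianReal_map_const_mul, mul_zero, mul_one]
    congr 1
    ext
    simp
  rw [hmap, integral_map (by fun_prop) (by fun_prop)]
  simp_rw [mul_pow]
  rw [integral_const_mul]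

theorem integral_sq_gaussianReal (h : ℝ≥0) : ∫ x, x ^ 2 ∂(gaussianReal 0 h) = h := by
  have := variance_fun_id_gaussianReal (μ := 0) (v := h)
  rwa [variance_of_integral_eq_zero (by fun_prop) integral_id_gaussianReal] at this

theorem integral_pow_four_gaussianReal (h : ℝ≥0) :
    ∫ x, x ^ 4 ∂(gaussianReal 0 h) = gaussianFourth * (h : ℝ) ^ 2 := by
  have : √(h : ℝ) ^ 4 = (h : ℝ) ^ 2 := by
    rw [show 4 = 2 * 2 from rfl, pow_mul, Real.sq_sqrt h.coe_nonneg]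
  rw [integral_pow_gaussianReal, this, gaussianFourth, mul_comm]

variable {Ω : Type*} [mΩ : MeasurableSpace Ω] {P : Measure Ω} {X : Ω → ℝ} {h : ℝ≥0}

theorem memLp_of_hasLaw_gaussianReal (hX : HasLaw X (gaussianReal 0 h) P) {p : ENNReal}
    (hp : p ≠ ⊤) : MemLp X p P := by
  have := memLp_id_gaussianReal' (μ := 0) (v := h) p hp
  rw [← hX.map_eq] at this
  exact (memLp_map_measure_iff (by fun_prop) hX.aemeasurable).1 this

theorem integral_pow_of_hasLaw (hX : HasLaw X (gaussianReal 0 h) P) (n : ℕ) :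
    ∫ ω, X ω ^ n ∂P = ∫ x, x ^ n ∂(gaussianReal 0 h) := by
  rw [← hX.map_eq, integral_map hX.aemeasurable (by fun_prop)]

theorem integral_of_hasLaw (hX : HasLaw X (gaussianReal 0 h) P) : ∫ ω, X ω ∂P = 0 := by
  have := integral_pow_of_hasLaw hX 1
  simpa only [pow_one, integral_id_gaussianReal] using this

end Gaussian

section Independence

variable {Ω : Type*} {m₁ m₂ : MeasurableSpace Ω} [mΩ : MeasurableSpace Ω] {P : Measure Ω}

/-- Null sets do not matter for independence. -/
theorem indep_sup_null (h : Indep m₁ m₂ P) :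
    Indep m₁ (m₂ ⊔ MeasurableSpace.generateFrom {N | MeasurableSet N ∧ P N = 0}) P := by
  have hle : m₂ ⊔ MeasurableSpace.generateFrom {N | MeasurableSet N ∧ P N = 0} ≤
      eventuallyMeasurableSpace m₂ (ae P) := by
    refine sup_le le_eventuallyMeasurableSpace (MeasurableSpace.generateFrom_le fun N hN => ?_)
    refine ⟨∅, @MeasurableSet.empty _ m₂, ?_⟩
    exact ae_eq_empty.2 hN.2
  refine indep_of_indep_of_le_right ?_ hle
  rw [Indep_iff] at h ⊢
  rintro s t hs ⟨t', ht', htt⟩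
  rw [measure_congr (ae_eq_set_inter (ae_eq_refl s) htt), measure_congr htt, h s t' hs ht']

theorem iIndepFun_bool [IsProbabilityMeasure P] {E : Type*} [MeasurableSpace E] {X : Bool → Ω → E}
    (h : IndepFun (X true) (X false) P) : iIndepFun X P := by
  rw [iIndepFun_iff_measure_inter_preimage_eq_mul]
  intro S sets hS
  have h' := (indepFun_iff_measure_inter_preimage_eq_mul.1 h)
  by_cases ht : true ∈ S <;> by_cases hf : false ∈ S
  · have : S = {true, false} := by ext b; cases b <;> simp [ht, hf]
    subst this
    have e : ⋂ i ∈ ({true, false} : Finset Bool), X i ⁻¹' sets i =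
        X true ⁻¹' sets true ∩ X false ⁻¹' sets false := by
      ext ω
      simp [and_comm]
    rw [e, h' _ _ (hS _ ht) (hS _ hf), Finset.prod_pair (by simp)]
  · have : S = {true} := by ext b; cases b <;> simp [ht, hf]
    subst this
    simp
  · have : S = {false} := by ext b; cases b <;> simp [ht, hf]
    subst this
    simp
  · have : S = ∅ := by ext b; cases b <;> simp [ht, hf]
    subst this
    simp

end Independence

section Brownian

variable {Ω : Type*} [mΩ : MeasurableSpace Ω] {P : Measure Ω} [IsProbabilityMeasure P]
  {B : Edge → ℝ≥0 → Ω → ℝ} (hBm : ∀ e t, Measurable (B e t))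
  (hB : ∀ e, IsBrownianReal (B e) P)
  (hind : iIndepFun (fun (e : Edge) (ω : Ω) (t : ℝ≥0) => B e t ω) P)
include hBm hB hind

theorem indepFun_increments_past (Λ : Finset Edge) (s : ℝ≥0) :
    IndepFun (fun ω (e : Λ) (u : ℝ≥0) => B e (s + u) ω - B e s ω)
      (fun ω (e : Λ) (u : ℝ≥0) => B e (min u s) ω) P := by
  classical
  let X : Edge → Bool → Ω → ℝ≥0 → ℝ := fun e b ω u =>
    if b then B e (s + u) ω - B e s ω else B e (min u s) ω
  have hXm : ∀ e b, Measurable (X e b) := by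
    intro e b
    refine measurable_pi_lambda _ fun u => ?_
    cases b
    · simpa [X] using hBm e (min u s)
    · simpa [X] using Measurable.fun_sub (hBm e (s + u)) (hBm e s)
  have h1 : iIndepFun (fun e ω => (X e · ω)) P := by
    have := hind.comp (fun (e : Edge) (f : ℝ≥0 → ℝ) (b : Bool) (u : ℝ≥0) =>
      if b then f (s + u) - f s else f (min u s)) fun e => by
        refine measurable_pi_lambda _ fun b => measurable_pi_lambda _ fun u => ?_
        cases b
        · simpa using measurable_pi_apply _
        · simp only [if_true]
          fun_prop
    exact this
  have h2 : ∀ e, iIndepFun (X e) P := by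
    intro e
    refine iIndepFun_bool ?_
    have := ((hB e).toIsPreBrownianReal.indepFun_shift s).comp (φ := id)
      (ψ := fun (f : Set.Iic s → ℝ) (u : ℝ≥0) => f ⟨min u s, Set.mem_Iic.2 (min_le_right _ _)⟩)
      measurable_id (measurable_pi_lambda _ fun u => measurable_pi_apply _)
    exact this
  have h3 := iIndepFun_uncurry hXm h1 h2
  let emb : Bool → Λ → (Σ _ : Edge, Bool) := fun b e => ⟨e, b⟩
  have h4 := h3.indepFun_finset (Finset.univ.image (emb true)) (Finset.univ.image (emb false))
    (by
      rw [Finset.disjoint_left]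
      rintro x hx hx'
      obtain ⟨e, -, rfl⟩ := Finset.mem_image.1 hx
      obtain ⟨e', -, h⟩ := Finset.mem_image.1 hx'
      simp [emb] at h) fun p => hXm _ _
  exact h4.comp
    (φ := fun f (e : Λ) => f ⟨emb true e, Finset.mem_image_of_mem _ (Finset.mem_univ _)⟩)
    (ψ := fun f (e : Λ) => f ⟨emb false e, Finset.mem_image_of_mem _ (Finset.mem_univ _)⟩)
    (measurable_pi_lambda _ fun e => measurable_pi_apply _)
    (measurable_pi_lambda _ fun e => measurable_pi_apply _)

/-- The increments after time `s` are independent of the completed filtration at time `s`. -/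
theorem indep_increments_completedFiltration (Λ : Finset Edge) (s : ℝ≥0) :
    Indep (MeasurableSpace.comap (fun ω (e : Λ) (u : ℝ≥0) => B e (s + u) ω - B e s ω) inferInstance)
      (completedFiltration P B hBm Λ s) P := by
  refine indep_sup_null (indep_of_indep_of_le_right
    ((IndepFun_iff_Indep _ _ _).1 (indepFun_increments_past hBm hB hind Λ s)) ?_)
  refine iSup₂_le fun e he => iSup₂_le fun u hu => ?_
  have : B e u = (fun f : Λ → ℝ≥0 → ℝ => f ⟨e, he⟩ u) ∘
      fun ω (e : Λ) (u : ℝ≥0) => B e (min u s) ω := by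
    ext ω
    simp [min_eq_left hu]
  rw [this, ← MeasurableSpace.comap_comp]
  refine MeasurableSpace.comap_mono (Measurable.comap_le ?_)
  fun_prop

omit hind hBm [IsProbabilityMeasure P] in
theorem hasLaw_increment (e : Edge) {s t : ℝ≥0} (hst : s ≤ t) :
    HasLaw (fun ω => B e t ω - B e s ω) (gaussianReal 0 (t - s)) P := by
  have := (hB e).toIsPreBrownianReal.hasLaw_sub t s
  have h2 : nndist t.1 s.1 = t - s := by
    ext
    rw [coe_nndist, Real.dist_eq, NNReal.coe_sub hst]
    exact abs_of_nonneg (sub_nonneg.2 (NNReal.coe_le_coe.2 hst))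
  rw [h2] at this
  exact this

omit hBm hB hind [IsProbabilityMeasure P] in
theorem measurable_completedFiltration (hBm : ∀ e t, Measurable (B e t)) {Λ : Finset Edge}
    {e : Edge} (he : e ∈ Λ) {s t : ℝ≥0} (hst : s ≤ t) :
    Measurable[completedFiltration P B hBm Λ t] (B e s) := by
  have h1 : MeasurableSpace.comap (B e s) inferInstance ≤
      ⨆ e ∈ Λ, ⨆ s ≤ t, MeasurableSpace.comap (B e s) inferInstance :=
    le_iSup₂_of_le e he (le_iSup₂_of_le s hst le_rfl)
  exact Measurable.of_comap_le (h1.trans le_sup_left)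

omit hBm hB hind [IsProbabilityMeasure P] in
theorem measurableSet_completedFiltration_of_null (hBm : ∀ e t, Measurable (B e t))
    (Λ : Finset Edge) (t : ℝ≥0) {N : Set Ω} (hN : MeasurableSet N) (h0 : P N = 0) :
    MeasurableSet[completedFiltration P B hBm Λ t] N := by
  have h1 : MeasurableSpace.generateFrom {N | MeasurableSet N ∧ P N = 0} ≤
      completedFiltration P B hBm Λ t := le_sup_right
  exact h1 _ (MeasurableSpace.measurableSet_generateFrom ⟨hN, h0⟩)

end Brownian

section System

variable {Ω : Type*} {m m' : MeasurableSpace Ω} [mΩ : MeasurableSpace Ω] {P : Measure Ω}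

theorem IsNoise.congr {η η' : Ω → ℝ} {v : ℝ} (h : IsNoise m m' P η v) (hη : η =ᵐ[P] η')
    (hm : StronglyMeasurable[m'] η') : IsNoise m m' P η' v where
  measurable := hm
  memLp := h.memLp.ae_eq hη
  integral := by rw [← integral_congr_ae hη, h.integral]
  sq_le := by
    have : (fun ω => η ω ^ 2) =ᵐ[P] fun ω => η' ω ^ 2 := by
      filter_upwards [hη] with ω hω
      rw [hω]
    rw [← integral_congr_ae this]
    exact h.sq_le
  indep := by
    have h' := h.indep
    rw [Indep_iff] at h' ⊢
    rintro s t ⟨A, hA, rfl⟩ ht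
    have hs : η' ⁻¹' A =ᵐ[P] η ⁻¹' A := by
      filter_upwards [hη] with ω hω
      change (η' ω ∈ A) = (η ω ∈ A)
      rw [hω]
    rw [measure_congr (ae_eq_set_inter hs (ae_eq_refl t)), measure_congr hs]
    exact h' _ _ ⟨A, hA, rfl⟩ ht

/-- Independent Brownian motions `W k`, `k ∈ Λ`, relative to the filtration `𝓕`, all of whose paths
are continuous, as far as the first two moments of the increments and of their products go. -/
structure BrownianSystem (𝓕 : Filtration ℝ≥0 mΩ) (P : Measure Ω) (Λ : Finset Edge)
    (W : Edge → ℝ≥0 → Ω → ℝ) : Prop where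
  adapted : ∀ k, StronglyAdapted 𝓕 (W k)
  continuous : ∀ k ω, Continuous fun t => W k t ω
  zero : ∀ k ω, W k 0 ω = 0
  noise : ∀ k ∈ Λ, ∀ s t, s ≤ t →
    IsNoise (𝓕 s) (𝓕 t) P (fun ω => W k t ω - W k s ω) ((t : ℝ) - s)
  noise_mul : ∀ j ∈ Λ, ∀ k ∈ Λ, ∀ s t, s ≤ t →
    IsNoise (𝓕 s) (𝓕 t) P (fun ω => (W j t ω - W j s ω) * (W k t ω - W k s ω) -
      if j = k then (t : ℝ) - s else 0) ((2 * gaussianFourth + 2) * ((t : ℝ) - s) ^ 2)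

/-- The processes `B e`, `e ∈ Λ`, on the event that their paths are continuous and start at zero; the
other paths are replaced by zero. -/
def regularPath (Λ : Finset Edge) (N : Set Ω) (B : Edge → ℝ≥0 → Ω → ℝ) (e : Edge) (t : ℝ≥0)
    (ω : Ω) : ℝ :=
  open Classical in if e ∈ Λ ∧ ω ∉ N then B e t ω else 0

variable [IsProbabilityMeasure P] {B : Edge → ℝ≥0 → Ω → ℝ} (hBm : ∀ e t, Measurable (B e t))
  (hB : ∀ e, IsBrownianReal (B e) P)
  (hind : iIndepFun (fun (e : Edge) (ω : Ω) (t : ℝ≥0) => B e t ω) P)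
include hBm hB hind

theorem noise_increment {Λ : Finset Edge} {k : Edge} (hk : k ∈ Λ) {s t : ℝ≥0} (hst : s ≤ t) :
    IsNoise (completedFiltration P B hBm Λ s) (completedFiltration P B hBm Λ t) P
      (fun ω => B k t ω - B k s ω) ((t : ℝ) - s) where
  measurable := ((measurable_completedFiltration hBm hk le_rfl).stronglyMeasurable).sub
    (measurable_completedFiltration hBm hk hst).stronglyMeasurable
  memLp := memLp_of_hasLaw_gaussianReal (hasLaw_increment hB k hst) (by simp)
  integral := integral_of_hasLaw (hasLaw_increment hB k hst)
  sq_le := by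
    rw [integral_pow_of_hasLaw (hasLaw_increment hB k hst), integral_sq_gaussianReal,
      NNReal.coe_sub hst]
  indep := by
    refine indep_of_indep_of_le_left (indep_increments_completedFiltration hBm hB hind Λ s) ?_
    have : (fun ω => B k t ω - B k s ω) = (fun f : Λ → ℝ≥0 → ℝ => f ⟨k, hk⟩ (t - s)) ∘
        fun ω (e : Λ) (u : ℝ≥0) => B e (s + u) ω - B e s ω := by
      ext ω
      simp [add_tsub_cancel_of_le hst]
    rw [this, ← MeasurableSpace.comap_comp]
    refine MeasurableSpace.comap_mono (Measurable.comap_le ?_)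
    fun_prop

theorem noise_increment_mul {Λ : Finset Edge} {j k : Edge} (hj : j ∈ Λ) (hk : k ∈ Λ) {s t : ℝ≥0}
    (hst : s ≤ t) :
    IsNoise (completedFiltration P B hBm Λ s) (completedFiltration P B hBm Λ t) P
      (fun ω => (B j t ω - B j s ω) * (B k t ω - B k s ω) - if j = k then (t : ℝ) - s else 0)
      ((2 * gaussianFourth + 2) * ((t : ℝ) - s) ^ 2) := by
  have hlj := hasLaw_increment hB j hst
  have hlk := hasLaw_increment hB k hst
  have hj4 := memLp_of_hasLaw_gaussianReal hlj (p := 4) (by simp)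
  have hk4 := memLp_of_hasLaw_gaussianReal hlk (p := 4) (by simp)
  have hj2 := memLp_of_hasLaw_gaussianReal hlj (p := 2) (by simp)
  have hk2 := memLp_of_hasLaw_gaussianReal hlk (p := 2) (by simp)
  have h0 : 0 ≤ (t : ℝ) - s := sub_nonneg.2 hst
  have hmul : MemLp (fun ω => (B j t ω - B j s ω) * (B k t ω - B k s ω)) 2 P := by
    have := ennreal_holderTriple_four
    exact hk4.mul hj4
  have hjk : j ≠ k → IndepFun (fun ω => B j t ω - B j s ω) (fun ω => B k t ω - B k s ω) P := by
    intro hne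
    have := hind.indepFun hne
    exact this.comp (φ := fun f => f t - f s) (ψ := fun f => f t - f s) (by fun_prop) (by fun_prop)
  refine ⟨?_, hmul.sub (memLp_const _), ?_, ?_, ?_⟩
  · exact (((measurable_completedFiltration hBm hj le_rfl).stronglyMeasurable.sub
      (measurable_completedFiltration hBm hj hst).stronglyMeasurable).mul
      ((measurable_completedFiltration hBm hk le_rfl).stronglyMeasurable.sub
      (measurable_completedFiltration hBm hk hst).stronglyMeasurable)).sub stronglyMeasurable_const
  · rw [integral_sub (hmul.integrable (by norm_num)) (integrable_const _)]
    by_cases h : j = k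
    · subst h
      have := integral_pow_of_hasLaw hlj 2
      rw [integral_sq_gaussianReal, NNReal.coe_sub hst] at this
      simp only [← sq]
      rw [this]
      simp
    · rw [(hjk h).integral_fun_mul_eq_mul_integral hj2.1 hk2.1, integral_of_hasLaw hlj]
      simp [h]
  · by_cases h : j = k
    · subst h
      have e4 := integral_pow_of_hasLaw hlj 4
      rw [integral_pow_four_gaussianReal, NNReal.coe_sub hst] at e4
      have hi4 : Integrable (fun ω => (B j t ω - B j s ω) ^ 4) P := by
        have := hmul.integrable_sq
        refine this.congr (.of_forall fun ω => ?_)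
        simp only
        ring
      calc _ ≤ ∫ ω, (2 * (B j t ω - B j s ω) ^ 4 + 2 * ((t : ℝ) - s) ^ 2) ∂P := by
            refine integral_mono (hmul.sub (memLp_const _)).integrable_sq
              ((hi4.const_mul 2).add (integrable_const _)) fun ω => ?_
            simp only [if_true]
            nlinarith [sq_nonneg ((B j t ω - B j s ω) ^ 2 + ((t : ℝ) - s))]
        _ = 2 * ∫ ω, (B j t ω - B j s ω) ^ 4 ∂P + 2 * ((t : ℝ) - s) ^ 2 := by
            rw [integral_add (hi4.const_mul 2) (integrable_const _), integral_const_mul]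
            simp
        _ = _ := by rw [e4]; ring
        _ ≤ _ := le_rfl
    · have e : ∀ ω, ((B j t ω - B j s ω) * (B k t ω - B k s ω) -
          if j = k then (t : ℝ) - s else 0) ^ 2 =
          (B j t ω - B j s ω) ^ 2 * (B k t ω - B k s ω) ^ 2 := by
        intro ω
        rw [if_neg h]
        ring
      simp_rw [e]
      have hsq := (hjk h).comp (φ := fun x => x ^ 2) (ψ := fun x => x ^ 2) (by fun_prop)
        (by fun_prop)
      have hsq' : IndepFun (fun ω => (B j t ω - B j s ω) ^ 2) (fun ω => (B k t ω - B k s ω) ^ 2) P :=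
        hsq
      rw [hsq'.integral_fun_mul_eq_mul_integral hj2.integrable_sq.1 hk2.integrable_sq.1,
        integral_pow_of_hasLaw hlj 2, integral_pow_of_hasLaw hlk 2, integral_sq_gaussianReal,
        NNReal.coe_sub hst]
      nlinarith [gaussianFourth_nonneg, mul_nonneg h0 h0,
        mul_nonneg gaussianFourth_nonneg (mul_nonneg h0 h0)]
  · refine indep_of_indep_of_le_left (indep_increments_completedFiltration hBm hB hind Λ s) ?_
    have : (fun ω => (B j t ω - B j s ω) * (B k t ω - B k s ω) - if j = k then (t : ℝ) - s else 0) =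
        (fun f : Λ → ℝ≥0 → ℝ => f ⟨j, hj⟩ (t - s) * f ⟨k, hk⟩ (t - s) -
          if j = k then (t : ℝ) - s else 0) ∘
        fun ω (e : Λ) (u : ℝ≥0) => B e (s + u) ω - B e s ω := by
      ext ω
      simp [add_tsub_cancel_of_le hst]
    rw [this, ← MeasurableSpace.comap_comp]
    refine MeasurableSpace.comap_mono (Measurable.comap_le ?_)
    fun_prop

/-- Brownian motions can be modified on a null set so that they form a Brownian system. -/
theorem exists_brownianSystem (Λ : Finset Edge) :
    ∃ W : Edge → ℝ≥0 → Ω → ℝ, BrownianSystem (completedFiltration P B hBm Λ) P Λ W ∧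
      ∀ᵐ ω ∂P, ∀ k ∈ Λ, ∀ t, W k t ω = B k t ω := by
  have hae : ∀ᵐ ω ∂P, ∀ k ∈ Λ, (Continuous fun t => B k t ω) ∧ B k 0 ω = 0 := by
    refine (ae_ball_iff Λ.countable_toSet).2 fun k _ => ?_
    filter_upwards [(hB k).cont, (hB k).toIsPreBrownianReal.eval_zero_ae_eq_zero] with ω h1 h2
    exact ⟨h1, h2⟩
  obtain ⟨N, hsub, hNm, hN0⟩ := exists_measurable_superset_of_null hae
  have hN : ∀ ω, ω ∉ N → ∀ k ∈ Λ, (Continuous fun t => B k t ω) ∧ B k 0 ω = 0 := by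
    intro ω hω
    by_contra h
    exact hω (hsub h)
  have hNae : ∀ᵐ ω ∂P, ω ∉ N := by
    rw [ae_iff]
    simpa using hN0
  have heq : ∀ᵐ ω ∂P, ∀ k ∈ Λ, ∀ t, regularPath Λ N B k t ω = B k t ω := by
    filter_upwards [hNae] with ω hω k hk t
    simp [regularPath, hk, hω]
  have hadapted : ∀ k, StronglyAdapted (completedFiltration P B hBm Λ) (regularPath Λ N B k) := by
    intro k t
    by_cases hk : k ∈ Λ
    · have : regularPath Λ N B k t = Nᶜ.indicator (B k t) := by
        ext ω
        by_cases hω : ω ∈ N <;> simp [regularPath, hk, hω]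
      rw [this]
      exact (measurable_completedFiltration hBm hk le_rfl).stronglyMeasurable.indicator
        (measurableSet_completedFiltration_of_null hBm Λ t hNm hN0).compl
    · have : regularPath Λ N B k t = fun _ => 0 := by
        ext ω
        simp [regularPath, hk]
      rw [this]
      exact stronglyMeasurable_const
  refine ⟨regularPath Λ N B, ⟨hadapted, ?_, ?_, ?_, ?_⟩, heq⟩
  · intro k ω
    by_cases h : k ∈ Λ ∧ ω ∉ N
    · simpa [regularPath, h] using (hN ω h.2 k h.1).1
    · simpa [regularPath, h] using continuous_const
  · intro k ω
    by_cases h : k ∈ Λ ∧ ω ∉ N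
    · simpa [regularPath, h] using (hN ω h.2 k h.1).2
    · simp [regularPath, h]
  · intro k hk s t hst
    refine (noise_increment hBm hB hind hk hst).congr ?_
      (((hadapted k) t).sub (((hadapted k) s).mono ((completedFiltration P B hBm Λ).mono hst)))
    filter_upwards [heq] with ω hω
    rw [hω k hk, hω k hk]
  · intro j hj k hk s t hst
    have hm : ∀ k, StronglyMeasurable[completedFiltration P B hBm Λ t] fun ω =>
        regularPath Λ N B k t ω - regularPath Λ N B k s ω := fun k =>
      ((hadapted k) t).sub (((hadapted k) s).mono ((completedFiltration P B hBm Λ).mono hst))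
    refine (noise_increment_mul hBm hB hind hj hk hst).congr ?_
      (((hm j).mul (hm k)).sub stronglyMeasurable_const)
    filter_upwards [heq] with ω hω
    rw [hω k hk, hω k hk, hω j hj, hω j hj]

end System

/-! ### Riemann sums along partitions -/

/-- `τ n 0 ≤ … ≤ τ n (N n)` are partitions of `[0, t]` whose mesh tends to zero. -/
structure IsPartition (t : ℝ≥0) (N : ℕ → ℕ) (τ : ℕ → ℕ → ℝ≥0) : Prop where
  mono : ∀ n, Monotone (τ n)
  zero : ∀ n, τ n 0 = 0
  last : ∀ n, τ n (N n) = t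
  mesh : ∀ δ : ℝ≥0, 0 < δ → ∀ᶠ n in atTop, ∀ l < N n, τ n (l + 1) ≤ τ n l + δ

namespace IsPartition

variable {t : ℝ≥0} {N : ℕ → ℕ} {τ : ℕ → ℕ → ℝ≥0} (hτ : IsPartition t N τ)
include hτ

theorem le_last {n j : ℕ} (hj : j ≤ N n) : τ n j ≤ t := (hτ.mono n hj).trans_eq (hτ.last n)

theorem osc {E : Type*} [PseudoMetricSpace E] {f : ℝ≥0 → E} (hf : Continuous f) {ε : ℝ}
    (hε : 0 < ε) :
    ∀ᶠ n in atTop, ∀ j < N n, ∀ u, τ n j ≤ u → u ≤ τ n (j + 1) → dist (f u) (f (τ n j)) ≤ ε := by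
  have hu : UniformContinuousOn f (Set.Icc 0 t) :=
    isCompact_Icc.uniformContinuousOn_of_continuous hf.continuousOn
  rw [Metric.uniformContinuousOn_iff] at hu
  obtain ⟨δ, hδ, h⟩ := hu ε hε
  have hδ2 : 0 < (δ / 2).toNNReal := Real.toNNReal_pos.2 (by positivity)
  filter_upwards [hτ.mesh _ hδ2] with n hn j hj u h1 h2
  have h3 : u ≤ t := h2.trans (hτ.le_last (Nat.succ_le_of_lt hj))
  refine (h u ⟨zero_le, h3⟩ (τ n j) ⟨zero_le, h1.trans h3⟩ ?_).le
  have h4 : (u : ℝ) ≤ τ n j + δ / 2 := by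
    have : ((u : ℝ≥0) : ℝ) ≤ ((τ n j + (δ / 2).toNNReal : ℝ≥0) : ℝ) :=
      NNReal.coe_le_coe.2 (h2.trans (hn j hj))
    rwa [NNReal.coe_add, Real.coe_toNNReal _ (by positivity)] at this
  have h5 : (τ n j : ℝ) ≤ u := h1
  rw [NNReal.dist_eq, abs_of_nonneg (sub_nonneg.2 h5)]
  linarith

theorem osc_succ {E : Type*} [PseudoMetricSpace E] {f : ℝ≥0 → E} (hf : Continuous f) {ε : ℝ}
    (hε : 0 < ε) : ∀ᶠ n in atTop, ∀ j < N n, dist (f (τ n (j + 1))) (f (τ n j)) ≤ ε := by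
  filter_upwards [hτ.osc hf hε] with n hn j hj
  exact hn j hj _ (hτ.mono n j.le_succ) le_rfl

theorem bounded {E : Type*} [NormedAddCommGroup E] {f : ℝ≥0 → E} (hf : Continuous f) :
    ∃ C, 0 ≤ C ∧ ∀ n, ∀ j ≤ N n, ‖f (τ n j)‖ ≤ C := by
  obtain ⟨C, hC⟩ := isCompact_Icc.exists_bound_of_continuousOn (s := Set.Icc 0 t) hf.continuousOn
  refine ⟨C, (norm_nonneg _).trans (hC 0 ⟨le_rfl, zero_le⟩), fun n j hj => hC _ ⟨zero_le, ?_⟩⟩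
  exact hτ.le_last hj

theorem sum_sub (n : ℕ) : ∑ j ∈ Finset.range (N n), ((τ n (j + 1) : ℝ) - τ n j) = t := by
  rw [Finset.sum_range_sub (fun j => (τ n j : ℝ)), hτ.zero, hτ.last]
  simp

theorem tendsto_sum_sq :
    Tendsto (fun n => ∑ j ∈ Finset.range (N n), ((τ n (j + 1) : ℝ) - τ n j) ^ 2) atTop (𝓝 0) := by
  rw [Metric.tendsto_atTop']
  intro ε hε
  have hδ : 0 < ε / (2 * ((t : ℝ) + 1)) := by positivity
  obtain ⟨n₀, h⟩ := eventually_atTop.1 (hτ.osc_succ (f := fun s : ℝ≥0 => (s : ℝ)) (by fun_prop) hδ)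
  refine ⟨n₀, fun n hn => ?_⟩
  have h0 : ∀ j, 0 ≤ (τ n (j + 1) : ℝ) - τ n j := fun j =>
    sub_nonneg.2 (NNReal.coe_le_coe.2 (hτ.mono n j.le_succ))
  rw [dist_zero_right, Real.norm_of_nonneg (Finset.sum_nonneg fun j _ => sq_nonneg _)]
  calc ∑ j ∈ Finset.range (N n), ((τ n (j + 1) : ℝ) - τ n j) ^ 2
      ≤ ∑ j ∈ Finset.range (N n), ε / (2 * ((t : ℝ) + 1)) * ((τ n (j + 1) : ℝ) - τ n j) := by
        refine Finset.sum_le_sum fun j hj => ?_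
        have := h n hn.le j (Finset.mem_range.1 hj)
        rw [Real.dist_eq, abs_of_nonneg (h0 j)] at this
        rw [sq]
        exact mul_le_mul_of_nonneg_right this (h0 j)
    _ = ε / (2 * ((t : ℝ) + 1)) * t := by rw [← Finset.mul_sum, hτ.sum_sub]
    _ < ε := by
        rw [div_mul_eq_mul_div, div_lt_iff₀ (by positivity)]
        nlinarith [t.coe_nonneg]

end IsPartition

/-! ### Stopped Brownian increments -/

section Stopped

variable {Ω : Type*}

/-- Increment of `W k`, stopped at `T`, over the `j`-th interval of the partition `τ`. -/
def incr (W : Edge → ℝ≥0 → Ω → ℝ) (T : Ω → ℝ≥0) (τ : ℕ → ℝ≥0) (k : Edge) (j : ℕ) (ω : Ω) : ℝ :=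
  W k (min (τ (j + 1)) (T ω)) ω - W k (min (τ j) (T ω)) ω

/-- The part before `T` of the length of the `j`-th interval of the partition `τ`. -/
def lapse (T : Ω → ℝ≥0) (τ : ℕ → ℝ≥0) (j : ℕ) (ω : Ω) : ℝ :=
  (min (τ (j + 1)) (T ω) : ℝ≥0) - (min (τ j) (T ω) : ℝ≥0)

theorem lapse_nonneg (T : Ω → ℝ≥0) {τ : ℕ → ℝ≥0} (hτ : Monotone τ) (j : ℕ) (ω : Ω) :
    0 ≤ lapse T τ j ω :=
  sub_nonneg.2 (NNReal.coe_le_coe.2 (min_le_min_right _ (hτ j.le_succ)))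

theorem sum_lapse (T : Ω → ℝ≥0) {t : ℝ≥0} {N : ℕ → ℕ} {τ : ℕ → ℕ → ℝ≥0} (hτ : IsPartition t N τ)
    (n : ℕ) (ω : Ω) :
    ∑ j ∈ Finset.range (N n), lapse T (τ n) j ω = (min t (T ω) : ℝ≥0) := by
  unfold lapse
  rw [Finset.sum_range_sub (fun j => ((min (τ n j) (T ω) : ℝ≥0) : ℝ)), hτ.zero, hτ.last]
  simp

variable [mΩ : MeasurableSpace Ω] {P : Measure Ω} [IsProbabilityMeasure P] {𝓕 : Filtration ℝ≥0 mΩ} {Λ : Finset Edge}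
  {W : Edge → ℝ≥0 → Ω → ℝ} {T : Ω → ℝ≥0} {t : ℝ≥0} {N : ℕ → ℕ} {τ : ℕ → ℕ → ℝ≥0}

/-- Stopping costs at most one term of the sums, the one whose interval contains the stopping time. -/
theorem subAE_stopped_sum_sq_block (hT : IsStoppingTime 𝓕 fun ω => (T ω : WithTop ℝ≥0))
    (hτ : IsPartition t N τ) {D η X : ℕ → ℕ → Ω → ℝ} {v : ℕ → ℕ → ℝ}
    (hD : ∀ n j, StronglyMeasurable[𝓕 (τ n j)] (D n j))
    (hη : ∀ n j, IsNoise (𝓕 (τ n j)) (𝓕 (τ n (j + 1))) P (η n j) (v n j))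
    (hX : ∀ n j ω, τ n j < T ω → τ n (j + 1) ≤ T ω → X n j ω = η n j ω)
    (hX0 : ∀ n j ω, T ω ≤ τ n j → X n j ω = 0)
    (hsmall : ∀ᵐ ω ∂P, ∀ ε > 0, ∀ᶠ n in atTop, ∀ j < N n, |X n j ω| ≤ ε ∧ |η n j ω| ≤ ε)
    (hDb : ∀ᵐ ω ∂P, ∃ C : ℝ, ∀ᶠ n in atTop, ∀ j < N n, |D n j ω| ≤ C)
    (L : ℕ → ℕ) (b : ℕ → ℕ → ℕ)
    (h : ∀ κ : ℝ, 0 < κ → ∃ ε : ℕ → ℝ, (∀ n, 0 ≤ ε n) ∧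
      (∀ᶠ n in atTop, ε n ^ 2 * ∑ j ∈ Finset.range (N n), v n j ≤ κ) ∧
      ∀ᵐ ω ∂P, ∀ᶠ n in atTop, ∀ j < N n, |D n j ω| ≤ ε n) :
    SubAE P fun n ω => ∑ l ∈ Finset.range (L n),
      (∑ j ∈ Finset.range (N n), if b n j = l then D n j ω * X n j ω else 0) ^ 2 := by
  classical
  let D' : ℕ → ℕ → Ω → ℝ := fun n j => Set.indicator {ω | τ n j < T ω} (D n j)
  have hD' : ∀ n j, StronglyMeasurable[𝓕 (τ n j)] (D' n j) := by
    intro n j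
    refine (hD n j).indicator ?_
    have : {ω | τ n j < T ω} = {ω | (T ω : WithTop ℝ≥0) ≤ (τ n j : ℝ≥0)}ᶜ := by
      ext ω
      exact (not_le (a := T ω)).symm.trans (not_congr WithTop.coe_le_coe.symm)
    rw [this]
    exact (hT (τ n j)).compl
  have hle : ∀ n j ω, |D' n j ω| ≤ |D n j ω| := by
    intro n j ω
    by_cases hω : τ n j < T ω <;> simp [D', hω]
  have hmain := subAE_sum_sq_block (P := P) (𝓖 := fun n j => 𝓕 (τ n j))
    (fun n j j' hj => 𝓕.mono (hτ.mono n hj)) (fun n j => 𝓕.le _) hD' hη N L b (fun κ hκ => by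
      obtain ⟨ε, h1, h2, h3⟩ := h κ hκ
      refine ⟨ε, h1, h2, ?_⟩
      filter_upwards [h3] with ω hω
      filter_upwards [hω] with n hn j hj
      exact (hle n j ω).trans (hn j hj))
  refine hmain.of_imp_one ?_
  filter_upwards [hsmall, hDb] with ω hs ⟨C, hC⟩ ks hks hk
  -- the term that is not accounted for
  let R : ℕ → ℕ → ℝ := fun n j => D n j ω * X n j ω - D' n j ω * η n j ω
  have hR0 : ∀ n j, ¬ (τ n j < T ω ∧ T ω < τ n (j + 1)) → R n j = 0 := by
    intro n j hj
    by_cases h1 : τ n j < T ω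
    · have h2 : τ n (j + 1) ≤ T ω := not_lt.1 fun h2 => hj ⟨h1, h2⟩
      simp [R, D', h1, hX n j ω h1 h2]
    · simp [R, D', h1, hX0 n j ω (not_lt.1 h1)]
  have hone : ∀ n j j', τ n j < T ω → T ω < τ n (j + 1) → τ n j' < T ω → T ω < τ n (j' + 1) →
      j = j' := by
    have key : ∀ n j j', j < j' → T ω < τ n (j + 1) → τ n j' < T ω → False := by
      intro n j j' hlt h1 h2
      exact absurd (hτ.mono n (Nat.succ_le_of_lt hlt)) (not_le.2 (h2.trans h1))
    intro n j j' h1 h2 h3 h4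
    rcases lt_trichotomy j j' with hlt | heq | hlt
    · exact (key n j j' hlt h2 h3).elim
    · exact heq
    · exact (key n j' j hlt h4 h1).elim
  have hRsum : ∀ ε > 0, ∀ᶠ n in atTop, ∑ l ∈ Finset.range (L n),
      (∑ j ∈ Finset.range (N n), if b n j = l then R n j else 0) ^ 2 ≤ ε ^ 2 := by
    intro ε hε
    have hC' : 0 < 2 * (|C| + 1) := by positivity
    filter_upwards [hC, hs (ε / (2 * (|C| + 1))) (by positivity)] with n h1 h2
    by_cases hex : ∃ j < N n, τ n j < T ω ∧ T ω < τ n (j + 1)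
    · obtain ⟨j, hj, hj1, hj2⟩ := hex
      have hz : ∀ j' ∈ Finset.range (N n), j' ≠ j → R n j' = 0 := by
        intro j' _ hne
        refine hR0 n j' fun h => hne (hone n j' j h.1 h.2 hj1 hj2)
      have hl : ∀ l, (∑ j' ∈ Finset.range (N n), if b n j' = l then R n j' else 0) =
          if b n j = l then R n j else 0 := by
        intro l
        refine Finset.sum_eq_single j (fun j' hj' hne => ?_) fun h => (h (Finset.mem_range.2 hj)).elim
        rw [hz j' hj' hne, ite_self]
      have hRj : |R n j| ≤ ε := by
        have hD1 : |D n j ω| ≤ |C| + 1 := (h1 j hj).trans ((le_abs_self C).trans (by linarith))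
        have hb : ∀ x y d : ℝ, |d| ≤ |C| + 1 → |y| ≤ ε / (2 * (|C| + 1)) → |d * y| ≤ ε / 2 := by
          intro x y d hd hy
          rw [abs_mul]
          calc |d| * |y| ≤ (|C| + 1) * (ε / (2 * (|C| + 1))) :=
                mul_le_mul hd hy (abs_nonneg _) (by positivity)
            _ = ε / 2 := by field_simp
        have e1 := hb 0 _ _ hD1 (h2 j hj).1
        have e2 := hb 0 _ _ ((hle n j ω).trans hD1) (h2 j hj).2
        calc |R n j| ≤ |D n j ω * X n j ω| + |D' n j ω * η n j ω| := abs_sub _ _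
          _ ≤ ε := by linarith
      simp_rw [hl]
      have : ∀ l, (if b n j = l then R n j else 0) ^ 2 = if b n j = l then R n j ^ 2 else 0 := by
        intro l; split_ifs <;> simp
      simp_rw [this, Finset.sum_ite_eq]
      split_ifs
      · exact sq_le_sq' (by linarith [neg_abs_le (R n j)]) ((le_abs_self _).trans hRj)
      · positivity
    · have : ∀ l, (∑ j' ∈ Finset.range (N n), if b n j' = l then R n j' else 0) = 0 := by
        intro l
        refine Finset.sum_eq_zero fun j hj => ?_
        rw [hR0 n j fun h => hex ⟨j, Finset.mem_range.1 hj, h⟩, ite_self]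
      simp only [this]
      simp
      positivity
  have hRt : Tendsto (fun n => ∑ l ∈ Finset.range (L n),
      (∑ j ∈ Finset.range (N n), if b n j = l then R n j else 0) ^ 2) atTop (𝓝 0) := by
    rw [Metric.tendsto_nhds]
    intro ε hε
    filter_upwards [hRsum (√(ε / 2)) (by positivity)] with n hn
    rw [Real.sq_sqrt (by positivity)] at hn
    rw [dist_zero_right, Real.norm_of_nonneg (Finset.sum_nonneg fun j _ => sq_nonneg _)]
    linarith
  have hlim := (hk.const_mul 2).add ((hRt.comp hks.tendsto_atTop).const_mul 2)
  rw [mul_zero, add_zero] at hlim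
  refine squeeze_zero (fun n => Finset.sum_nonneg fun _ _ => sq_nonneg _) (fun n => ?_) hlim
  simp only [Function.comp]
  rw [Finset.mul_sum, Finset.mul_sum, ← Finset.sum_add_distrib]
  refine Finset.sum_le_sum fun l _ => ?_
  have : (∑ j ∈ Finset.range (N (ks n)),
      if b (ks n) j = l then D (ks n) j ω * X (ks n) j ω else 0) =
      (∑ j ∈ Finset.range (N (ks n)),
        if b (ks n) j = l then D' (ks n) j ω * η (ks n) j ω else 0) +
      ∑ j ∈ Finset.range (N (ks n)), if b (ks n) j = l then R (ks n) j else 0 := by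
    rw [← Finset.sum_add_distrib]
    refine Finset.sum_congr rfl fun j _ => ?_
    split_ifs
    · simp [R]
    · simp
  rw [this]
  nlinarith [sq_nonneg ((∑ j ∈ Finset.range (N (ks n)),
        if b (ks n) j = l then D' (ks n) j ω * η (ks n) j ω else 0) -
      ∑ j ∈ Finset.range (N (ks n)), if b (ks n) j = l then R (ks n) j else 0)]

omit [IsProbabilityMeasure P] in
theorem BrownianSystem.continuous_stopped (hW : BrownianSystem 𝓕 P Λ W) (k : Edge) (ω : Ω) :
    Continuous fun s => W k (min s (T ω)) ω :=
  (hW.continuous k ω).comp (continuous_id.min continuous_const)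

/-- Convergence of the martingale sums `∑ D ΔW` in blocks, for coefficients tending to zero. -/
theorem BrownianSystem.subAE_block_real (hW : BrownianSystem 𝓕 P Λ W)
    (hT : IsStoppingTime 𝓕 fun ω => (T ω : WithTop ℝ≥0)) (hτ : IsPartition t N τ) {k : Edge}
    (hk : k ∈ Λ) {D : ℕ → ℕ → Ω → ℝ} (hD : ∀ n j, StronglyMeasurable[𝓕 (τ n j)] (D n j))
    (hD0 : ∀ᵐ ω ∂P, ∀ ε > 0, ∀ᶠ n in atTop, ∀ j < N n, |D n j ω| ≤ ε) (L : ℕ → ℕ)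
    (b : ℕ → ℕ → ℕ) :
    SubAE P fun n ω => ∑ l ∈ Finset.range (L n),
      (∑ j ∈ Finset.range (N n), if b n j = l then D n j ω * incr W T (τ n) k j ω else 0) ^ 2 := by
  refine subAE_stopped_sum_sq_block hT hτ
    (η := fun n j ω => W k (τ n (j + 1)) ω - W k (τ n j) ω)
    (v := fun n j => (τ n (j + 1) : ℝ) - τ n j) hD
    (fun n j => hW.noise k hk _ _ (hτ.mono n j.le_succ)) ?_ ?_ ?_ ?_ L b ?_
  · intro n j ω h1 h2
    simp [incr, min_eq_left h1.le, min_eq_left h2]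
  · intro n j ω h
    simp [incr, min_eq_right h, min_eq_right (h.trans (hτ.mono n j.le_succ))]
  · refine .of_forall fun ω ε hε => ?_
    filter_upwards [hτ.osc_succ (hW.continuous k ω) hε,
      hτ.osc_succ (hW.continuous_stopped (T := T) k ω) hε] with n h1 h2 j hj
    exact ⟨h2 j hj, h1 j hj⟩
  · filter_upwards [hD0] with ω hω
    exact ⟨1, hω 1 one_pos⟩
  · intro κ hκ
    have hε : 0 < √(κ / ((t : ℝ) + 1)) := by positivity
    refine ⟨fun _ => √(κ / ((t : ℝ) + 1)), fun _ => hε.le, .of_forall fun n => ?_, ?_⟩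
    · rw [hτ.sum_sub, Real.sq_sqrt (by positivity), div_mul_eq_mul_div,
        div_le_iff₀ (by positivity)]
      nlinarith [t.coe_nonneg]
    · filter_upwards [hD0] with ω hω
      exact hω _ hε

/-- Quadratic variation: `∑ G (ΔW^j ΔW^k - δ_{jk} Δs)` tends to zero, for bounded coefficients. -/
theorem BrownianSystem.subAE_quad_real (hW : BrownianSystem 𝓕 P Λ W)
    (hT : IsStoppingTime 𝓕 fun ω => (T ω : WithTop ℝ≥0)) (hτ : IsPartition t N τ) {i k : Edge}
    (hi : i ∈ Λ) (hk : k ∈ Λ) {G : ℕ → ℕ → Ω → ℝ}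
    (hG : ∀ n j, StronglyMeasurable[𝓕 (τ n j)] (G n j))
    (hGb : ∀ᵐ ω ∂P, ∃ C : ℝ, ∀ᶠ n in atTop, ∀ j < N n, |G n j ω| ≤ C) :
    SubAE P fun n ω => ∑ j ∈ Finset.range (N n), G n j ω *
      (incr W T (τ n) i j ω * incr W T (τ n) k j ω - if i = k then lapse T (τ n) j ω else 0) := by
  have hsq : SubAE P fun n ω => ∑ l ∈ Finset.range 1,
      (∑ j ∈ Finset.range (N n), if 0 = l then G n j ω * (incr W T (τ n) i j ω *
        incr W T (τ n) k j ω - if i = k then lapse T (τ n) j ω else 0) else 0) ^ 2 := by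
    refine subAE_stopped_sum_sq_block hT hτ
      (η := fun n j ω => (W i (τ n (j + 1)) ω - W i (τ n j) ω) *
        (W k (τ n (j + 1)) ω - W k (τ n j) ω) - if i = k then (τ n (j + 1) : ℝ) - τ n j else 0)
      (v := fun n j => (2 * gaussianFourth + 2) * ((τ n (j + 1) : ℝ) - τ n j) ^ 2)
      (X := fun n j ω => incr W T (τ n) i j ω * incr W T (τ n) k j ω -
        if i = k then lapse T (τ n) j ω else 0) hG
      (fun n j => hW.noise_mul i hi k hk _ _ (hτ.mono n j.le_succ)) ?_ ?_ ?_ hGb (fun _ => 1)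
      (fun _ _ => 0) ?_
    · intro n j ω h1 h2
      simp [incr, lapse, min_eq_left h1.le, min_eq_left h2]
    · intro n j ω h
      simp [incr, lapse, min_eq_right h, min_eq_right (h.trans (hτ.mono n j.le_succ))]
    · refine .of_forall fun ω ε hε => ?_
      have hε' : 0 < min (ε / 2) 1 := by positivity
      have hb : ∀ x y z : ℝ, |x| ≤ min (ε / 2) 1 → |y| ≤ min (ε / 2) 1 → |z| ≤ min (ε / 2) 1 →
          |x * y - if i = k then z else 0| ≤ ε := by
        intro x y z hx hy hz
        have h1 : |x * y| ≤ ε / 2 := by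
          rw [abs_mul]
          calc |x| * |y| ≤ (ε / 2) * 1 := mul_le_mul (hx.trans (min_le_left _ _))
                (hy.trans (min_le_right _ _)) (abs_nonneg _) (by positivity)
            _ = ε / 2 := mul_one _
        have h2 : |if i = k then z else 0| ≤ ε / 2 := by
          split_ifs
          · exact hz.trans (min_le_left _ _)
          · simpa using (half_pos hε).le
        exact (abs_sub _ _).trans (by linarith)
      have hid : Continuous fun s : ℝ≥0 => (s : ℝ) := by fun_prop
      have hmin : Continuous fun s : ℝ≥0 => ((min s (T ω) : ℝ≥0) : ℝ) := by fun_prop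
      filter_upwards [hτ.osc_succ (hW.continuous k ω) hε', hτ.osc_succ (hW.continuous i ω) hε',
        hτ.osc_succ (hW.continuous_stopped (T := T) k ω) hε',
        hτ.osc_succ (hW.continuous_stopped (T := T) i ω) hε',
        hτ.osc_succ hid hε', hτ.osc_succ hmin hε'] with n h1 h2 h3 h4 h5 h6 j hj
      exact ⟨hb _ _ _ (h4 j hj) (h3 j hj) (h6 j hj), hb _ _ _ (h2 j hj) (h1 j hj) (h5 j hj)⟩
    · intro κ hκ
      -- the bounds `ε n` tend to infinity, but slowly compared with the variances
      let V : ℕ → ℝ := fun n => ∑ j ∈ Finset.range (N n),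
        (2 * gaussianFourth + 2) * ((τ n (j + 1) : ℝ) - τ n j) ^ 2
      have hV0 : ∀ n, 0 ≤ V n := fun n => Finset.sum_nonneg fun j _ =>
        mul_nonneg (by linarith [gaussianFourth_nonneg]) (sq_nonneg _)
      have hV : Tendsto (fun n => V n + 1 / ((n : ℝ) + 1)) atTop (𝓝 0) := by
        have h1 := hτ.tendsto_sum_sq.const_mul (2 * gaussianFourth + 2)
        simp only [Finset.mul_sum] at h1
        simpa using h1.add tendsto_one_div_add_atTop_nhds_zero_nat
      have hpos : ∀ n, 0 < V n + 1 / ((n : ℝ) + 1) := fun n => by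
        have := hV0 n
        positivity
      have hsqrt : Tendsto (fun n => √(V n + 1 / ((n : ℝ) + 1))) atTop (𝓝 0) := by
        simpa using hV.sqrt
      refine ⟨fun n => (√√(V n + 1 / ((n : ℝ) + 1)))⁻¹, fun n => by positivity, ?_, ?_⟩
      · filter_upwards [(tendsto_order.1 hsqrt).2 κ hκ] with n hn
        refine le_trans ?_ hn.le
        change (√√(V n + 1 / ((n : ℝ) + 1)))⁻¹ ^ 2 * V n ≤ _
        rw [inv_pow, Real.sq_sqrt (Real.sqrt_nonneg _), inv_mul_le_iff₀ (Real.sqrt_pos.2 (hpos n)),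
          Real.mul_self_sqrt (hpos n).le]
        have : 0 ≤ 1 / ((n : ℝ) + 1) := by positivity
        linarith
      · have hinf : Tendsto (fun n => (√√(V n + 1 / ((n : ℝ) + 1)))⁻¹) atTop atTop := by
          refine tendsto_inv_nhdsGT_zero.comp (tendsto_nhdsWithin_iff.2 ⟨?_, ?_⟩)
          · simpa using hsqrt.sqrt
          · exact .of_forall fun n => Real.sqrt_pos.2 (Real.sqrt_pos.2 (hpos n))
        filter_upwards [hGb] with ω ⟨C, hC⟩
        filter_upwards [hC, hinf.eventually_ge_atTop C] with n h1 h2 j hj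
        exact (h1 j hj).trans h2
  refine hsq.of_imp_one (.of_forall fun ω ks _ hk => ?_)
  have := hk.sqrt
  simp only [Finset.range_one, Finset.sum_singleton, if_true, Real.sqrt_sq_eq_abs,
    Real.sqrt_zero] at this
  exact (tendsto_zero_iff_abs_tendsto_zero _).2 this

/-- Complex version of `BrownianSystem.subAE_block_real`. -/
theorem BrownianSystem.subAE_block (hW : BrownianSystem 𝓕 P Λ W)
    (hT : IsStoppingTime 𝓕 fun ω => (T ω : WithTop ℝ≥0)) (hτ : IsPartition t N τ) {k : Edge}
    (hk : k ∈ Λ) {D : ℕ → ℕ → Ω → ℂ} (hD : ∀ n j, StronglyMeasurable[𝓕 (τ n j)] (D n j))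
    (hD0 : ∀ᵐ ω ∂P, ∀ ε > 0, ∀ᶠ n in atTop, ∀ j < N n, ‖D n j ω‖ ≤ ε) (L : ℕ → ℕ)
    (b : ℕ → ℕ → ℕ) :
    SubAE P fun n ω => ∑ l ∈ Finset.range (L n),
      ‖∑ j ∈ Finset.range (N n),
        if b n j = l then D n j ω * (incr W T (τ n) k j ω : ℂ) else 0‖ ^ 2 := by
  have hre := hW.subAE_block_real hT hτ hk (D := fun n j ω => (D n j ω).re)
    (fun n j => Complex.continuous_re.comp_stronglyMeasurable (hD n j)) (by
      filter_upwards [hD0] with ω hω ε hε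
      filter_upwards [hω ε hε] with n hn j hj
      exact (Complex.abs_re_le_norm _).trans (hn j hj)) L b
  have him := hW.subAE_block_real hT hτ hk (D := fun n j ω => (D n j ω).im)
    (fun n j => Complex.continuous_im.comp_stronglyMeasurable (hD n j)) (by
      filter_upwards [hD0] with ω hω ε hε
      filter_upwards [hω ε hε] with n hn j hj
      exact (Complex.abs_im_le_norm _).trans (hn j hj)) L b
  refine (hre.add him).congr (.of_forall fun ω n => ?_)
  rw [← Finset.sum_add_distrib]
  refine Finset.sum_congr rfl fun l _ => ?_
  rw [← Complex.normSq_eq_norm_sq, Complex.normSq_apply, Complex.re_sum, Complex.im_sum, sq, sq]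
  congr 1 <;> congr 1 <;>
  · refine Finset.sum_congr rfl fun j _ => ?_
    split_ifs <;> simp

/-- Complex version of `BrownianSystem.subAE_quad_real`. -/
theorem BrownianSystem.subAE_quad (hW : BrownianSystem 𝓕 P Λ W)
    (hT : IsStoppingTime 𝓕 fun ω => (T ω : WithTop ℝ≥0)) (hτ : IsPartition t N τ) {i k : Edge}
    (hi : i ∈ Λ) (hk : k ∈ Λ) {G : ℕ → ℕ → Ω → ℂ}
    (hG : ∀ n j, StronglyMeasurable[𝓕 (τ n j)] (G n j))
    (hGb : ∀ᵐ ω ∂P, ∃ C : ℝ, ∀ᶠ n in atTop, ∀ j < N n, ‖G n j ω‖ ≤ C) :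
    SubAE P fun n ω => ∑ j ∈ Finset.range (N n), G n j ω *
      (incr W T (τ n) i j ω * incr W T (τ n) k j ω -
        if i = k then lapse T (τ n) j ω else 0 : ℝ) := by
  have hre := hW.subAE_quad_real hT hτ hi hk (G := fun n j ω => (G n j ω).re)
    (fun n j => Complex.continuous_re.comp_stronglyMeasurable (hG n j)) (by
      filter_upwards [hGb] with ω ⟨C, hC⟩
      refine ⟨C, ?_⟩
      filter_upwards [hC] with n hn j hj
      exact (Complex.abs_re_le_norm _).trans (hn j hj))
  have him := hW.subAE_quad_real hT hτ hi hk (G := fun n j ω => (G n j ω).im)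
    (fun n j => Complex.continuous_im.comp_stronglyMeasurable (hG n j)) (by
      filter_upwards [hGb] with ω ⟨C, hC⟩
      refine ⟨C, ?_⟩
      filter_upwards [hC] with n hn j hj
      exact (Complex.abs_im_le_norm _).trans (hn j hj))
  have hcast : ∀ {x : ℕ → Ω → ℝ} (z : ℂ), SubAE P x → SubAE P fun n ω => (x n ω : ℂ) * z := by
    intro x z hx
    refine hx.of_imp_one (.of_forall fun ω ks _ h => ?_)
    simpa using ((Complex.continuous_ofReal.tendsto _).comp h).mul_const z
  refine ((hcast 1 hre).add (hcast Complex.I him)).congr (.of_forall fun ω n => ?_)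
  apply Complex.ext <;> simp [Complex.re_sum, Complex.im_sum]

end Stopped

/-! ### Regular processes -/

section Regular

variable {Ω : Type*} [mΩ : MeasurableSpace Ω] {P : Measure Ω} {𝓕 : Filtration ℝ≥0 mΩ}

/-- A process which, outside a null set, is continuous and agrees with an adapted process. -/
structure RegularProcess (𝓕 : Filtration ℝ≥0 mΩ) (P : Measure Ω) (X : ℝ≥0 → Ω → ℂ) : Prop where
  continuous : ∀ᵐ ω ∂P, Continuous fun t => X t ω
  adapted : ∃ X' : ℝ≥0 → Ω → ℂ, (∀ t, StronglyMeasurable[𝓕 t] (X' t)) ∧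
    ∀ᵐ ω ∂P, ∀ t, X' t ω = X t ω

namespace RegularProcess

variable {X Y : ℝ≥0 → Ω → ℂ}

theorem of_adapted (h : ∀ᵐ ω ∂P, Continuous fun t => X t ω) (hX : StronglyAdapted 𝓕 X) :
    RegularProcess 𝓕 P X := ⟨h, X, hX, .of_forall fun _ _ => rfl⟩

theorem const (c : ℂ) : RegularProcess 𝓕 P fun _ _ => c :=
  of_adapted (.of_forall fun _ => continuous_const) fun _ => stronglyMeasurable_const

theorem add (hX : RegularProcess 𝓕 P X) (hY : RegularProcess 𝓕 P Y) :
    RegularProcess 𝓕 P fun t ω => X t ω + Y t ω := by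
  obtain ⟨X', hX1, hX2⟩ := hX.adapted
  obtain ⟨Y', hY1, hY2⟩ := hY.adapted
  refine ⟨?_, fun t ω => X' t ω + Y' t ω, fun t => (hX1 t).add (hY1 t), ?_⟩
  · filter_upwards [hX.continuous, hY.continuous] with ω h1 h2
    exact h1.add h2
  · filter_upwards [hX2, hY2] with ω h1 h2 t
    rw [h1, h2]

theorem mul (hX : RegularProcess 𝓕 P X) (hY : RegularProcess 𝓕 P Y) :
    RegularProcess 𝓕 P fun t ω => X t ω * Y t ω := by
  obtain ⟨X', hX1, hX2⟩ := hX.adapted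
  obtain ⟨Y', hY1, hY2⟩ := hY.adapted
  refine ⟨?_, fun t ω => X' t ω * Y' t ω, fun t => (hX1 t).mul (hY1 t), ?_⟩
  · filter_upwards [hX.continuous, hY.continuous] with ω h1 h2
    exact h1.mul h2
  · filter_upwards [hX2, hY2] with ω h1 h2 t
    rw [h1, h2]

theorem sub (hX : RegularProcess 𝓕 P X) (hY : RegularProcess 𝓕 P Y) :
    RegularProcess 𝓕 P fun t ω => X t ω - Y t ω := by
  simpa [sub_eq_add_neg] using hX.add ((const (-1)).mul hY)

theorem sum {ι : Type*} (s : Finset ι) {X : ι → ℝ≥0 → Ω → ℂ}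
    (h : ∀ i ∈ s, RegularProcess 𝓕 P (X i)) :
    RegularProcess 𝓕 P fun t ω => ∑ i ∈ s, X i t ω := by
  classical
  induction s using Finset.induction_on with
  | empty => simpa using const 0
  | insert a s ha ih =>
    simp only [Finset.sum_insert ha]
    exact (h a (Finset.mem_insert_self _ _)).add (ih fun i hi => h i (Finset.mem_insert_of_mem hi))

theorem aestronglyMeasurable (hX : RegularProcess 𝓕 P X) (t : ℝ≥0) :
    AEStronglyMeasurable (X t) P := by
  obtain ⟨X', hX1, hX2⟩ := hX.adapted
  refine ((hX1 t).mono (𝓕.le t)).aestronglyMeasurable.congr ?_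
  filter_upwards [hX2] with ω h using h t

end RegularProcess

variable {θ₀ : Edge → ℝ} {Λ : Finset Edge}

theorem measurable_indicator_angleBox {g : (Edge → ℝ) → ℂ}
    (hg : ContinuousOn (fun u => g (extendAngles θ₀ Λ u)) (angleBox Λ)) :
    Measurable ((angleBox Λ).indicator fun u => g (extendAngles θ₀ Λ u)) := by
  classical
  have hopen : IsOpen (angleBox Λ) := by
    have : angleBox Λ = ⋂ e : Λ, (fun u : Λ → ℝ => u e) ⁻¹' Set.Ioo 0 (Real.pi / 2) := by
      ext u; simp [angleBox]
    rw [this]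
    exact isOpen_iInter_of_finite fun e => isOpen_Ioo.preimage (continuous_apply e)
  rw [← Set.piecewise_eq_indicator]
  exact hg.measurable_piecewise continuousOn_const hopen.measurableSet

theorem extendAngles_restrict {A : Edge → ℝ} (hA : ∀ e, e ∉ Λ → A e = θ₀ e) :
    extendAngles θ₀ Λ (fun e => A e) = A := by
  ext e
  unfold extendAngles
  split_ifs with h
  · rfl
  · exact (hA e h).symm

/-- The processes `t ↦ g (A t)`, for angles `A t` that vary on `Λ` only and for functions `g` of the
angles which are continuous as long as the angles are admissible. -/
theorem RegularProcess.of_angles {g : (Edge → ℝ) → ℂ}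
    (hg : ContinuousOn (fun u => g (extendAngles θ₀ Λ u)) (angleBox Λ)) {A : ℝ≥0 → Ω → Edge → ℝ}
    (hA : ∀ t ω e, e ∉ Λ → A t ω e = θ₀ e)
    (hAm : ∀ e, StronglyAdapted 𝓕 fun t ω => A t ω e)
    (hAc : ∀ᵐ ω ∂P, ∀ e, Continuous fun t => A t ω e)
    (hAb : ∀ᵐ ω ∂P, ∀ t e, A t ω e ∈ Set.Ioo 0 (Real.pi / 2)) :
    RegularProcess 𝓕 P fun t ω => g (A t ω) := by
  have e1 : ∀ t ω, g (A t ω) = g (extendAngles θ₀ Λ fun e => A t ω e) := fun t ω => by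
    rw [extendAngles_restrict (hA t ω)]
  refine ⟨?_, fun t ω => (angleBox Λ).indicator (fun u => g (extendAngles θ₀ Λ u))
    fun e => A t ω e, fun t => ?_, ?_⟩
  · filter_upwards [hAc, hAb] with ω h1 h2
    simp_rw [e1]
    refine hg.comp_continuous (continuous_pi fun e => h1 e) fun t e => h2 t e
  · refine Measurable.stronglyMeasurable ?_
    refine (measurable_indicator_angleBox hg).comp ?_
    rw [@measurable_pi_iff _ _ _ (𝓕 t)]
    exact fun e => (hAm e t).measurable
  · filter_upwards [hAb] with ω h t
    rw [Set.indicator_of_mem (show (fun e : Λ => A t ω e) ∈ angleBox Λ from fun e => h t e), e1]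

end Regular

section Sums

variable {Ω : Type*} [mΩ : MeasurableSpace Ω] {P : Measure Ω} [IsProbabilityMeasure P]
  {𝓕 : Filtration ℝ≥0 mΩ} {Λ : Finset Edge}
  {W : Edge → ℝ≥0 → Ω → ℝ} {T : Ω → ℝ≥0} {t : ℝ≥0} {N : ℕ → ℕ} {τ : ℕ → ℕ → ℝ≥0}

theorem RegularProcess.subAE_quad {H : ℝ≥0 → Ω → ℂ} (hH : RegularProcess 𝓕 P H)
    (hW : BrownianSystem 𝓕 P Λ W) (hT : IsStoppingTime 𝓕 fun ω => (T ω : WithTop ℝ≥0))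
    (hτ : IsPartition t N τ) {i k : Edge} (hi : i ∈ Λ) (hk : k ∈ Λ) :
    SubAE P fun n ω => ∑ j ∈ Finset.range (N n), H (τ n j) ω *
      (incr W T (τ n) i j ω * incr W T (τ n) k j ω -
        if i = k then lapse T (τ n) j ω else 0 : ℝ) := by
  obtain ⟨H', h1, h2⟩ := hH.adapted
  refine (hW.subAE_quad hT hτ hi hk (G := fun n j => H' (τ n j)) (fun n j => h1 _) ?_).congr ?_
  · filter_upwards [h2, hH.continuous] with ω h2 h3
    obtain ⟨C, -, hC⟩ := hτ.bounded h3
    exact ⟨C, .of_forall fun n j hj => by rw [h2]; exact hC n j hj.le⟩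
  · filter_upwards [h2] with ω h2 n
    simp_rw [h2]

/-- Martingale sums in blocks, the coefficient being the oscillation of a regular process
between the time `τ n j` and an earlier time `τ n (c n j)`, times another regular process at this
earlier time. -/
theorem BrownianSystem.subAE_block_osc {G H : ℝ≥0 → Ω → ℂ} (hW : BrownianSystem 𝓕 P Λ W)
    (hT : IsStoppingTime 𝓕 fun ω => (T ω : WithTop ℝ≥0)) (hG : RegularProcess 𝓕 P G)
    (hH : RegularProcess 𝓕 P H) (hτ : IsPartition t N τ) {k : Edge} (hk : k ∈ Λ) (c : ℕ → ℕ → ℕ)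
    (hc : ∀ n j, c n j ≤ j)
    (hmesh : ∀ δ : ℝ, 0 < δ → ∀ᶠ n in atTop, ∀ j < N n, (τ n j : ℝ) ≤ τ n (c n j) + δ)
    (L : ℕ → ℕ) (b : ℕ → ℕ → ℕ) :
    SubAE P fun n ω => ∑ l ∈ Finset.range (L n),
      ‖∑ j ∈ Finset.range (N n),
        if b n j = l then G (τ n (c n j)) ω * (H (τ n j) ω - H (τ n (c n j)) ω) *
          (incr W T (τ n) k j ω : ℂ) else 0‖ ^ 2 := by
  obtain ⟨G', g1, g2⟩ := hG.adapted
  obtain ⟨H', h1, h2⟩ := hH.adapted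
  have hle : ∀ n j, τ n (c n j) ≤ τ n j := fun n j => hτ.mono n (hc n j)
  refine (hW.subAE_block hT hτ hk
    (D := fun n j ω => G' (τ n (c n j)) ω * (H' (τ n j) ω - H' (τ n (c n j)) ω))
    (fun n j => ?_) ?_ L b).congr ?_
  · exact ((g1 _).mono (𝓕.mono (hle n j))).mul ((h1 _).sub ((h1 _).mono (𝓕.mono (hle n j))))
  · filter_upwards [g2, h2, hG.continuous, hH.continuous] with ω g2 h2 g3 h3 ε hε
    obtain ⟨C, hC0, hC⟩ := hτ.bounded g3
    have hu : UniformContinuousOn (fun s => H s ω) (Set.Icc 0 t) :=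
      isCompact_Icc.uniformContinuousOn_of_continuous h3.continuousOn
    rw [Metric.uniformContinuousOn_iff] at hu
    obtain ⟨δ, hδ, hu⟩ := hu (ε / (C + 1)) (by positivity)
    filter_upwards [hmesh (δ / 2) (by positivity)] with n hn j hj
    have ht : τ n j ≤ t := hτ.le_last hj.le
    have hd : dist (τ n j) (τ n (c n j)) < δ := by
      rw [NNReal.dist_eq, abs_of_nonneg (sub_nonneg.2 (NNReal.coe_le_coe.2 (hle n j)))]
      linarith [hn j hj]
    have h5 := (hu (τ n j) ⟨zero_le, ht⟩ _ ⟨zero_le, (hle n j).trans ht⟩ hd).le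
    rw [dist_eq_norm] at h5
    rw [g2, h2, h2, norm_mul]
    calc _ ≤ C * (ε / (C + 1)) :=
          mul_le_mul (hC n _ ((hc n j).trans hj.le)) h5 (norm_nonneg _) hC0
      _ ≤ ε := by
          rw [← mul_div_assoc, div_le_iff₀ (by positivity)]
          nlinarith
  · filter_upwards [g2, h2] with ω g2 h2 n
    simp_rw [g2, h2]

end Sums

/-! ### Integrals of continuous functions -/

/-- Left-point Riemann sums of a continuous function, stopped at `T`. -/
theorem IsPartition.tendsto_drift {t : ℝ≥0} {N : ℕ → ℕ} {τ : ℕ → ℕ → ℝ≥0} (hτ : IsPartition t N τ)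
    {a : ℝ≥0 → ℂ} (ha : Continuous a) (T : ℝ≥0) :
    Tendsto (fun n => ∑ l ∈ Finset.range (N n),
      ‖((∫ s in (0 : ℝ)..((min (τ n (l + 1)) T : ℝ≥0) : ℝ), a s.toNNReal) -
        ∫ s in (0 : ℝ)..((min (τ n l) T : ℝ≥0) : ℝ), a s.toNNReal) -
        a (τ n l) * (((min (τ n (l + 1)) T : ℝ≥0) : ℝ) - ((min (τ n l) T : ℝ≥0) : ℝ) : ℝ)‖)
      atTop (𝓝 0) := by
  have hac : Continuous fun s : ℝ => a s.toNNReal := ha.comp continuous_real_toNNReal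
  rw [Metric.tendsto_nhds]
  intro ε hε
  have hε' : 0 < ε / (2 * ((t : ℝ) + 1)) := by positivity
  filter_upwards [hτ.osc ha hε'] with n hn
  rw [dist_zero_right, Real.norm_of_nonneg (Finset.sum_nonneg fun _ _ => norm_nonneg _)]
  calc _ ≤ ∑ l ∈ Finset.range (N n), ε / (2 * ((t : ℝ) + 1)) * ((τ n (l + 1) : ℝ) - τ n l) := by
        refine Finset.sum_le_sum fun l hl => ?_
        have hl' := Finset.mem_range.1 hl
        have hmono : τ n l ≤ τ n (l + 1) := hτ.mono n l.le_succ
        have hmin : min (τ n l) T ≤ min (τ n (l + 1)) T := min_le_min_right _ hmono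
        rw [intervalIntegral.integral_interval_sub_left (hac.intervalIntegrable _ _)
          (hac.intervalIntegrable _ _)]
        have hconst : a (τ n l) * (((min (τ n (l + 1)) T : ℝ≥0) : ℝ) -
            ((min (τ n l) T : ℝ≥0) : ℝ) : ℝ) =
            ∫ s in ((min (τ n l) T : ℝ≥0) : ℝ)..((min (τ n (l + 1)) T : ℝ≥0) : ℝ), a (τ n l) := by
          rw [intervalIntegral.integral_const, Complex.real_smul, mul_comm]
        rw [hconst, ← intervalIntegral.integral_sub (hac.intervalIntegrable _ _)
          (continuous_const.intervalIntegrable _ _)]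
        have hb := intervalIntegral.norm_integral_le_of_norm_le_const
          (a := ((min (τ n l) T : ℝ≥0) : ℝ)) (b := ((min (τ n (l + 1)) T : ℝ≥0) : ℝ))
          (f := fun s => a s.toNNReal - a (τ n l)) (C := ε / (2 * ((t : ℝ) + 1))) (fun s hs => by
            rw [Set.uIoc_of_le (NNReal.coe_le_coe.2 hmin)] at hs
            have hs0 : (0 : ℝ) ≤ s := (NNReal.coe_nonneg _).trans hs.1.le
            have h1 : min (τ n l) T < s.toNNReal := by
              rw [← NNReal.coe_lt_coe, Real.coe_toNNReal _ hs0]; exact hs.1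
            have h2 : s.toNNReal ≤ min (τ n (l + 1)) T := by
              rw [← NNReal.coe_le_coe, Real.coe_toNNReal _ hs0]; exact hs.2
            have h3 : τ n l ≤ s.toNNReal := by
              rcases min_lt_iff.1 h1 with h | h
              · exact h.le
              · exact absurd (h2.trans (min_le_right _ _)) (not_le.2 h)
            have := hn l hl' _ h3 (h2.trans (min_le_left _ _))
            rwa [dist_eq_norm] at this)
        refine hb.trans (mul_le_mul_of_nonneg_left ?_ hε'.le)
        rw [abs_of_nonneg (sub_nonneg.2 (NNReal.coe_le_coe.2 hmin))]
        rw [NNReal.coe_min, NNReal.coe_min]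
        have : (τ n l : ℝ) ≤ τ n (l + 1) := hmono
        rcases le_total (τ n l : ℝ) T with h | h <;> rcases le_total (τ n (l + 1) : ℝ) T with h' | h' <;>
          simp only [min_eq_left, min_eq_right, h, h'] <;> linarith
    _ = ε / (2 * ((t : ℝ) + 1)) * t := by rw [← Finset.mul_sum, hτ.sum_sub]
    _ < ε := by
        rw [div_mul_eq_mul_div, div_lt_iff₀ (by positivity)]
        nlinarith [t.coe_nonneg]

/-! ### Itô differentials on uniform partitions -/

/-- The uniform partition of `[0, t]` into `M` intervals. -/
def grid (t : ℝ≥0) (M l : ℕ) : ℝ≥0 := t * (l / M)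

theorem grid_zero (t : ℝ≥0) (M : ℕ) : grid t M 0 = 0 := by simp [grid]

theorem grid_self (t : ℝ≥0) {M : ℕ} (hM : 0 < M) : grid t M M = t := by
  have : (M : ℝ≥0) ≠ 0 := by exact_mod_cast hM.ne'
  simp [grid, div_self this]

theorem grid_mono (t : ℝ≥0) (M : ℕ) : Monotone (grid t M) := by
  intro l l' h
  unfold grid
  gcongr

theorem grid_mul (t : ℝ≥0) (M l : ℕ) {K : ℕ} (hK : 0 < K) :
    grid t (M * K) (l * K) = grid t M l := by
  have : (K : ℝ≥0) ≠ 0 := by exact_mod_cast hK.ne'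
  unfold grid
  push_cast
  rw [mul_div_mul_right _ _ this]

theorem grid_succ (t : ℝ≥0) (M l : ℕ) : grid t M (l + 1) = grid t M l + t / M := by
  unfold grid
  push_cast
  rw [add_div, mul_add, mul_one_div]

theorem eventually_div_le (t : ℝ≥0) {M : ℕ → ℕ} (hM : Tendsto M atTop atTop) {δ : ℝ≥0}
    (hδ : 0 < δ) : ∀ᶠ n in atTop, t / (M n : ℝ≥0) ≤ δ := by
  filter_upwards [(tendsto_natCast_atTop_atTop (R := ℝ≥0)).comp hM |>.eventually_ge_atTop (t / δ),
    hM.eventually_gt_atTop 0] with n hn h0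
  have h1 : (0 : ℝ≥0) < M n := by exact_mod_cast h0
  rw [div_le_iff₀ h1, mul_comm]
  exact (div_le_iff₀ hδ).1 hn

theorem isPartition_grid (t : ℝ≥0) {M : ℕ → ℕ} (h0 : ∀ n, 0 < M n) (hM : Tendsto M atTop atTop) :
    IsPartition t M fun n => grid t (M n) where
  mono n := grid_mono t _
  zero n := grid_zero t _
  last n := grid_self t (h0 n)
  mesh δ hδ := by
    filter_upwards [eventually_div_le t hM hδ] with n hn l _
    rw [grid_succ]
    exact add_le_add_right hn _

theorem isPartition_grid_sub (t : ℝ≥0) (M l : ℕ) :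
    IsPartition (grid t (M + 1) l) (fun m => l * (m + 1)) fun m => grid t ((M + 1) * (m + 1)) where
  mono n := grid_mono t _
  zero n := grid_zero t _
  last n := grid_mul t _ _ n.succ_pos
  mesh δ hδ := by
    have hM : Tendsto (fun m => (M + 1) * (m + 1)) atTop atTop :=
      tendsto_atTop_mono (fun m => by simp only [id]; nlinarith) tendsto_id
    filter_upwards [eventually_div_le t hM hδ] with n hn l _
    rw [grid_succ]
    exact add_le_add_right hn _

/-- The sum over the block `[l K, (l + 1) K)`, as a difference of initial sums. -/
theorem sum_block {M K l : ℕ} (hK : 0 < K) (hl : l < M) (x : ℕ → ℂ) :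
    (∑ j ∈ Finset.range (M * K), if j / K = l then x j else 0) =
      ∑ j ∈ Finset.range ((l + 1) * K), x j - ∑ j ∈ Finset.range (l * K), x j := by
  rw [← Finset.sum_filter, ← Finset.sum_Ico_eq_sub _ (Nat.mul_le_mul_right K l.le_succ)]
  refine Finset.sum_congr ?_ fun _ _ => rfl
  ext j
  simp only [Finset.mem_filter, Finset.mem_range, Finset.mem_Ico]
  rw [← Nat.div_lt_iff_lt_mul hK, ← Nat.le_div_iff_mul_le hK, ← Nat.div_lt_iff_lt_mul hK]
  omega

/-- The contribution of a block to a martingale sum, with the coefficient frozen at the beginning of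
the block subtracted. -/
theorem sum_block_sub {M K l : ℕ} (hK : 0 < K) (hl : l < M) (h : ℕ → ℂ) (V : ℕ → ℝ) :
    (∑ j ∈ Finset.range (M * K),
      if j / K = l then (h j - h (j / K * K)) * ((V (j + 1) - V j : ℝ) : ℂ) else 0) =
      ∑ j ∈ Finset.range ((l + 1) * K), h j * ((V (j + 1) - V j : ℝ) : ℂ) -
      ∑ j ∈ Finset.range (l * K), h j * ((V (j + 1) - V j : ℝ) : ℂ) -
      h (l * K) * ((V ((l + 1) * K) - V (l * K) : ℝ) : ℂ) := by
  have e1 : ∀ j, (if j / K = l then (h j - h (j / K * K)) * ((V (j + 1) - V j : ℝ) : ℂ) else 0) =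
      if j / K = l then (h j - h (l * K)) * ((V (j + 1) - V j : ℝ) : ℂ) else 0 := by
    intro j
    split_ifs with hj
    · rw [hj]
    · rfl
  simp_rw [e1]
  rw [sum_block hK hl fun j => (h j - h (l * K)) * ((V (j + 1) - V j : ℝ) : ℂ)]
  simp_rw [sub_mul, Finset.sum_sub_distrib, ← Finset.mul_sum, ← Complex.ofReal_sum,
    Finset.sum_range_sub]
  push_cast
  ring

/-- Collecting weighted block sums. -/
theorem sum_mul_block {M K : ℕ} (hK : 0 < K) (g x : ℕ → ℂ) :
    ∑ l ∈ Finset.range M, g l * (∑ j ∈ Finset.range (M * K), if j / K = l then x j else 0) =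
      ∑ j ∈ Finset.range (M * K), g (j / K) * x j := by
  simp_rw [Finset.mul_sum]
  rw [Finset.sum_comm]
  refine Finset.sum_congr rfl fun j hj => ?_
  have hlt : j / K < M := (Nat.div_lt_iff_lt_mul hK).2 (Finset.mem_range.1 hj)
  simp_rw [mul_ite, mul_zero, Finset.sum_ite_eq, Finset.mem_range, if_pos hlt]

section Measure

variable {Ω : Type*} [mΩ : MeasurableSpace Ω] {P : Measure Ω} [IsProbabilityMeasure P]

/-- If for each `n` a sequence tends to zero in probability, one can choose a term of each of
them so that the resulting sequence tends to zero in probability. -/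
theorem exists_diagonal {X : ℕ → ℕ → Ω → ℝ}
    (h : ∀ n, TendstoInMeasure P (X n) atTop fun _ => 0) :
    ∃ m : ℕ → ℕ, TendstoInMeasure P (fun n => X n (m n)) atTop fun _ => 0 := by
  have h1 : ∀ n : ℕ, ∃ m, P.real {ω | 1 / ((n : ℝ) + 1) ≤ ‖X n m ω - 0‖} ≤ 1 / ((n : ℝ) + 1) := by
    intro n
    have hpos : (0 : ℝ) < 1 / ((n : ℝ) + 1) := by positivity
    have h2 := (tendstoInMeasure_iff_measureReal_norm.1 (h n)) _ hpos
    obtain ⟨m, hm⟩ := ((tendsto_order.1 h2).2 _ hpos).exists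
    exact ⟨m, hm.le⟩
  choose m hm using h1
  refine ⟨m, tendstoInMeasure_iff_measureReal_norm.2 fun ε hε => ?_⟩
  refine squeeze_zero' (.of_forall fun _ => measureReal_nonneg) ?_
    tendsto_one_div_add_atTop_nhds_zero_nat
  filter_upwards [(tendsto_order.1 (tendsto_one_div_add_atTop_nhds_zero_nat (𝕜 := ℝ))).2 ε hε]
    with n hn
  refine (measureReal_mono fun ω hω => ?_).trans (hm n)
  exact hn.le.trans hω

theorem tendstoInMeasure_sum_norm {ι : Type*} (s : Finset ι) {x : ι → ℕ → Ω → ℂ} {y : ι → Ω → ℂ}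
    (h : ∀ i ∈ s, TendstoInMeasure P (x i) atTop (y i)) :
    TendstoInMeasure P (fun n ω => ∑ i ∈ s, ‖x i n ω - y i ω‖) atTop fun _ => 0 := by
  rw [tendstoInMeasure_iff_measureReal_norm]
  intro ε hε
  have hpos : 0 < ε / (s.card + 1) := by positivity
  have h0 : Tendsto (fun n => ∑ i ∈ s, P.real {ω | ε / (s.card + 1) ≤ ‖x i n ω - y i ω‖}) atTop
      (𝓝 (∑ i ∈ s, 0)) := tendsto_finsetSum _ fun i hi =>
    (tendstoInMeasure_iff_measureReal_norm.1 (h i hi)) _ hpos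
  rw [Finset.sum_const_zero] at h0
  refine squeeze_zero (fun _ => measureReal_nonneg) (fun n => ?_) h0
  refine le_trans (measureReal_mono ?_ (measure_ne_top _ _)) (measureReal_biUnion_finset_le s _)
  intro ω hω
  by_contra hcon
  simp only [Set.mem_iUnion, Set.mem_ofPred_eq, not_exists, not_le] at hcon
  have hω' : ε ≤ ‖(∑ i ∈ s, ‖x i n ω - y i ω‖) - 0‖ := hω
  rw [sub_zero, Real.norm_of_nonneg (Finset.sum_nonneg fun _ _ => norm_nonneg _)] at hω'
  have : ∑ i ∈ s, ‖x i n ω - y i ω‖ ≤ ∑ i ∈ s, ε / (s.card + 1) :=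
    Finset.sum_le_sum fun i hi => (hcon i hi).le
  rw [Finset.sum_const, nsmul_eq_mul, ← mul_div_assoc, le_div_iff₀ (by positivity)] at this
  nlinarith

end Measure

section Differential

variable {Ω : Type*}

/-- The difference between the increment of `Y` over the `l`-th interval of a partition and its
first order approximation `∑ H^k ΔW^k + a Δs`. -/
def itoError (W : Edge → ℝ≥0 → Ω → ℝ) (T : Ω → ℝ≥0) (Λ : Finset Edge) (Y : ℝ≥0 → Ω → ℂ)
    (H : Edge → ℝ≥0 → Ω → ℂ) (a : ℝ≥0 → Ω → ℂ) (τ : ℕ → ℝ≥0) (l : ℕ) (ω : Ω) : ℂ :=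
  Y (τ (l + 1)) ω - Y (τ l) ω - ∑ k ∈ Λ, H k (τ l) ω * (incr W T τ k l ω : ℂ) -
    a (τ l) ω * (lapse T τ l ω : ℂ)

variable [mΩ : MeasurableSpace Ω] {P : Measure Ω} [IsProbabilityMeasure P]
  {𝓕 : Filtration ℝ≥0 mΩ} {Λ : Finset Edge} {W : Edge → ℝ≥0 → Ω → ℝ} {T : Ω → ℝ≥0}

/-- The process `Y` has the Itô differential `∑ H^k dW^k + a ds`: on uniform partitions, the errors
of the first order approximation are negligible in the weighted sums that occur in the product
rule, and have no quadratic variation. -/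
structure HasItoDifferential (𝓕 : Filtration ℝ≥0 mΩ) (P : Measure Ω) (W : Edge → ℝ≥0 → Ω → ℝ)
    (T : Ω → ℝ≥0) (Λ : Finset Edge) (Y : ℝ≥0 → Ω → ℂ) (H : Edge → ℝ≥0 → Ω → ℂ)
    (a : ℝ≥0 → Ω → ℂ) : Prop where
  sum_mul : ∀ (t : ℝ≥0) (G : ℝ≥0 → Ω → ℂ), RegularProcess 𝓕 P G → SubAE P fun n ω =>
    ∑ l ∈ Finset.range (n + 1), G (grid t (n + 1) l) ω *
      itoError W T Λ Y H a (grid t (n + 1)) l ω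
  sum_sq : ∀ t : ℝ≥0, SubAE P fun n ω =>
    ∑ l ∈ Finset.range (n + 1), ‖itoError W T Λ Y H a (grid t (n + 1)) l ω‖ ^ 2

/-- The Riemann sums which approximate the Itô integral up to the `l`-th point of the coarse
partition, along a partition which is `m + 1` times as fine. -/
def fineSum (W : Edge → ℝ≥0 → Ω → ℝ) (T : Ω → ℝ≥0) (Λ : Finset Edge) (H : Edge → ℝ≥0 → Ω → ℂ)
    (t : ℝ≥0) (n m l : ℕ) (ω : Ω) : ℂ :=
  ∑ k ∈ Λ, ∑ j ∈ Finset.range (l * (m + 1)), H k (grid t ((n + 1) * (m + 1)) j) ω *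
    (incr W T (grid t ((n + 1) * (m + 1))) k j ω : ℂ)

/-- The block sums by which the Riemann sums on the fine partition differ from those on the coarse
one. -/
def blockSum (W : Edge → ℝ≥0 → Ω → ℝ) (T : Ω → ℝ≥0) (H : Edge → ℝ≥0 → Ω → ℂ)
    (t : ℝ≥0) (n m : ℕ) (k : Edge) (l : ℕ) (ω : Ω) : ℂ :=
  ∑ j ∈ Finset.range ((n + 1) * (m + 1)), if j / (m + 1) = l then
    (H k (grid t ((n + 1) * (m + 1)) j) ω -
      H k (grid t ((n + 1) * (m + 1)) (j / (m + 1) * (m + 1))) ω) *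
    (incr W T (grid t ((n + 1) * (m + 1))) k j ω : ℂ) else 0

omit mΩ in
theorem sum_blockSum (W : Edge → ℝ≥0 → Ω → ℝ) (T : Ω → ℝ≥0) (Λ : Finset Edge)
    (H : Edge → ℝ≥0 → Ω → ℂ) (t : ℝ≥0) (n m : ℕ) {l : ℕ} (hl : l < n + 1) (ω : Ω) :
    ∑ k ∈ Λ, blockSum W T H t n m k l ω = fineSum W T Λ H t n m (l + 1) ω -
      fineSum W T Λ H t n m l ω -
      ∑ k ∈ Λ, H k (grid t (n + 1) l) ω * (incr W T (grid t (n + 1)) k l ω : ℂ) := by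
  unfold fineSum
  rw [← Finset.sum_sub_distrib, ← Finset.sum_sub_distrib]
  refine Finset.sum_congr rfl fun k _ => ?_
  have h := sum_block_sub m.succ_pos hl (fun j => H k (grid t ((n + 1) * (m + 1)) j) ω)
    (fun j => W k (min (grid t ((n + 1) * (m + 1)) j) (T ω)) ω)
  rw [Nat.succ_eq_add_one, grid_mul t (n + 1) l m.succ_pos,
    grid_mul t (n + 1) (l + 1) m.succ_pos] at h
  exact h

omit mΩ in
/-- The error of the first order approximation, for an Itô process. -/
theorem itoError_eq {Y I : ℝ≥0 → Ω → ℂ} {H : Edge → ℝ≥0 → Ω → ℂ} {a : ℝ≥0 → Ω → ℂ} {y₀ : ℂ} {ω : Ω}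
    (hI : ∀ t, I t ω = Y t ω - y₀ - ∫ s in (0 : ℝ)..((min t (T ω) : ℝ≥0) : ℝ), a s.toNNReal ω)
    (t : ℝ≥0) (n m : ℕ) {l : ℕ} (hl : l < n + 1) :
    itoError W T Λ Y H a (grid t (n + 1)) l ω =
      ∑ k ∈ Λ, blockSum W T H t n m k l ω +
      ((fineSum W T Λ H t n m l ω - I (grid t (n + 1) l) ω) -
        (fineSum W T Λ H t n m (l + 1) ω - I (grid t (n + 1) (l + 1)) ω)) +
      (((∫ s in (0 : ℝ)..((min (grid t (n + 1) (l + 1)) (T ω) : ℝ≥0) : ℝ), a s.toNNReal ω) -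
        ∫ s in (0 : ℝ)..((min (grid t (n + 1) l) (T ω) : ℝ≥0) : ℝ), a s.toNNReal ω) -
        a (grid t (n + 1) l) ω * (lapse T (grid t (n + 1)) l ω : ℂ)) := by
  rw [sum_blockSum W T Λ H t n m hl ω, hI, hI]
  unfold itoError
  ring

end Differential

/-! ### Itô integrals have Itô differentials -/

section

variable {Ω : Type*} [mΩ : MeasurableSpace Ω] {P : Measure Ω} [IsProbabilityMeasure P]
  {𝓕 : Filtration ℝ≥0 mΩ} {Λ : Finset Edge} {W : Edge → ℝ≥0 → Ω → ℝ} {T : Ω → ℝ≥0}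

theorem exists_tendstoInMeasure_fineSum {H : Edge → ℝ≥0 → Ω → ℂ} {I : ℝ≥0 → Ω → ℂ}
    (hI : IsItoIntegral P Λ H (fun k t ω => W k (min t (T ω)) ω) I) (t : ℝ≥0) :
    ∃ m : ℕ → ℕ, TendstoInMeasure P (fun n ω => ∑ l ∈ Finset.range (n + 2),
      ‖fineSum W T Λ H t n (m n) l ω - I (grid t (n + 1) l) ω‖) atTop fun _ => 0 := by
  refine exists_diagonal (X := fun n m ω => ∑ l ∈ Finset.range (n + 2),
      ‖fineSum W T Λ H t n m l ω - I (grid t (n + 1) l) ω‖) fun n => ?_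
  refine tendstoInMeasure_sum_norm (Finset.range (n + 2))
    (x := fun l m => fineSum W T Λ H t n m l) fun l _ => ?_
  have hp := isPartition_grid_sub t n l
  exact hI _ _ _ hp.mono hp.zero hp.last hp.mesh

theorem isPartition_fine (t : ℝ≥0) (m : ℕ → ℕ) :
    IsPartition t (fun n => (n + 1) * (m n + 1)) fun n => grid t ((n + 1) * (m n + 1)) :=
  isPartition_grid t (fun n => by positivity)
    (tendsto_atTop_mono (fun n => by simp only [id]; nlinarith) tendsto_id)

theorem isPartition_coarse (t : ℝ≥0) :
    IsPartition t (fun n => n + 1) fun n => grid t (n + 1) :=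
  isPartition_grid t (fun n => n.succ_pos) (tendsto_add_atTop_nat 1)

theorem fine_mesh (t : ℝ≥0) (m : ℕ → ℕ) (δ : ℝ) (hδ : 0 < δ) : ∀ᶠ n in atTop,
    ∀ j < (n + 1) * (m n + 1), (grid t ((n + 1) * (m n + 1)) j : ℝ) ≤
      grid t ((n + 1) * (m n + 1)) (j / (m n + 1) * (m n + 1)) + δ := by
  have hδ' : 0 < δ.toNNReal := Real.toNNReal_pos.2 hδ
  filter_upwards [(isPartition_coarse t).mesh _ hδ'] with n hn j hj
  have hl : j / (m n + 1) < n + 1 := (Nat.div_lt_iff_lt_mul (m n).succ_pos).2 hj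
  have h1 := hn _ hl
  rw [grid_mul t (n + 1) _ (m n).succ_pos]
  have h2 : grid t ((n + 1) * (m n + 1)) j ≤ grid t (n + 1) (j / (m n + 1) + 1) := by
    rw [← grid_mul t (n + 1) (j / (m n + 1) + 1) (m n).succ_pos]
    refine grid_mono t _ ?_
    rw [Nat.succ_eq_add_one, add_mul, one_mul]
    have := Nat.div_add_mod j (m n + 1)
    have := Nat.mod_lt j (m n).succ_pos
    nlinarith
  have h3 := NNReal.coe_le_coe.2 (h2.trans h1)
  rwa [NNReal.coe_add, Real.coe_toNNReal _ hδ.le] at h3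

theorem subAE_sum_sq_blockSum (hW : BrownianSystem 𝓕 P Λ W)
    (hT : IsStoppingTime 𝓕 fun ω => (T ω : WithTop ℝ≥0)) {H : Edge → ℝ≥0 → Ω → ℂ} {k : Edge}
    (hk : k ∈ Λ) (hH : RegularProcess 𝓕 P (H k)) (t : ℝ≥0) (m : ℕ → ℕ) :
    SubAE P fun n ω => ∑ l ∈ Finset.range (n + 1), ‖blockSum W T H t n (m n) k l ω‖ ^ 2 := by
  have := hW.subAE_block_osc hT (RegularProcess.const 1) hH (isPartition_fine t m) hk
    (fun n j => j / (m n + 1) * (m n + 1)) (fun n j => Nat.div_mul_le_self j _) (fine_mesh t m)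
    (fun n => n + 1) (fun n j => j / (m n + 1))
  simp only [one_mul] at this
  exact this

theorem subAE_sum_mul_blockSum (hW : BrownianSystem 𝓕 P Λ W)
    (hT : IsStoppingTime 𝓕 fun ω => (T ω : WithTop ℝ≥0)) {H : Edge → ℝ≥0 → Ω → ℂ} {k : Edge}
    (hk : k ∈ Λ) (hH : RegularProcess 𝓕 P (H k)) {G : ℝ≥0 → Ω → ℂ} (hG : RegularProcess 𝓕 P G)
    (t : ℝ≥0) (m : ℕ → ℕ) :
    SubAE P fun n ω => ∑ l ∈ Finset.range (n + 1),
      G (grid t (n + 1) l) ω * blockSum W T H t n (m n) k l ω := by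
  have := hW.subAE_block_osc hT hG hH (isPartition_fine t m) hk
    (fun n j => j / (m n + 1) * (m n + 1)) (fun n j => Nat.div_mul_le_self j _) (fine_mesh t m)
    (fun n => 1) (fun n j => 0)
  refine this.of_imp_one (.of_forall fun ω ks _ h => ?_)
  have h' := h.sqrt
  simp only [Finset.range_one, Finset.sum_singleton, if_true, Real.sqrt_zero,
    Real.sqrt_sq (norm_nonneg _)] at h'
  refine (tendsto_zero_iff_norm_tendsto_zero.2 h').congr fun i => ?_
  generalize ks i = n
  unfold blockSum
  rw [sum_mul_block (m n).succ_pos (fun l => G (grid t (n + 1) l) ω)]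
  refine Finset.sum_congr rfl fun j _ => ?_
  rw [grid_mul t (n + 1) _ (m n).succ_pos]
  ring

theorem hasItoDifferential_of_isItoIntegral (hW : BrownianSystem 𝓕 P Λ W)
    (hT : IsStoppingTime 𝓕 fun ω => (T ω : WithTop ℝ≥0)) {Y I : ℝ≥0 → Ω → ℂ}
    {H : Edge → ℝ≥0 → Ω → ℂ} {a : ℝ≥0 → Ω → ℂ} {y₀ : ℂ}
    (hH : ∀ k ∈ Λ, RegularProcess 𝓕 P (H k)) (ha : ∀ᵐ ω ∂P, Continuous fun t => a t ω)
    (hI : IsItoIntegral P Λ H (fun k t ω => W k (min t (T ω)) ω) I)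
    (hIY : ∀ᵐ ω ∂P, ∀ t,
      I t ω = Y t ω - y₀ - ∫ s in (0 : ℝ)..((min t (T ω) : ℝ≥0) : ℝ), a s.toNNReal ω) :
    HasItoDifferential 𝓕 P W T Λ Y H a := by
  -- the errors apart from the block sums are absolutely summable
  have hrest : ∀ t, ∃ (m : ℕ → ℕ) (r : ℕ → ℕ → Ω → ℂ),
      SubAE P (fun n ω => ∑ l ∈ Finset.range (n + 1), ‖r n l ω‖) ∧
      ∀ᵐ ω ∂P, ∀ n, ∀ l < n + 1, itoError W T Λ Y H a (grid t (n + 1)) l ω =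
        ∑ k ∈ Λ, blockSum W T H t n (m n) k l ω + r n l ω := by
    intro t
    obtain ⟨m, hm⟩ := exists_tendstoInMeasure_fineSum hI t
    have hm' : SubAE P fun n ω => ∑ l ∈ Finset.range (n + 2),
        ‖fineSum W T Λ H t n (m n) l ω - I (grid t (n + 1) l) ω‖ := by
      simpa using SubAE.of_tendstoInMeasure hm
    refine ⟨m, fun n l ω => ((fineSum W T Λ H t n (m n) l ω - I (grid t (n + 1) l) ω) -
        (fineSum W T Λ H t n (m n) (l + 1) ω - I (grid t (n + 1) (l + 1)) ω)) +
      (((∫ s in (0 : ℝ)..((min (grid t (n + 1) (l + 1)) (T ω) : ℝ≥0) : ℝ), a s.toNNReal ω) -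
        ∫ s in (0 : ℝ)..((min (grid t (n + 1) l) (T ω) : ℝ≥0) : ℝ), a s.toNNReal ω) -
        a (grid t (n + 1) l) ω * (lapse T (grid t (n + 1)) l ω : ℂ)), ?_, ?_⟩
    · refine hm'.of_imp_one ?_
      filter_upwards [ha] with ω ha ks hks hk
      have hd := ((isPartition_coarse t).tendsto_drift ha (T ω)).comp hks.tendsto_atTop
      have hlim := (hk.const_mul 2).add hd
      rw [mul_zero, zero_add] at hlim
      refine squeeze_zero (fun n => Finset.sum_nonneg fun _ _ => norm_nonneg _) (fun i => ?_) hlim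
      simp only [Function.comp]
      generalize ks i = n
      set e : ℕ → ℂ := fun l => fineSum W T Λ H t n (m n) l ω - I (grid t (n + 1) l) ω with he
      refine (Finset.sum_le_sum fun l _ => norm_add_le _ _).trans ?_
      rw [Finset.sum_add_distrib]
      refine add_le_add ?_ le_rfl
      calc ∑ l ∈ Finset.range (n + 1), ‖e l - e (l + 1)‖
          ≤ ∑ l ∈ Finset.range (n + 1), (‖e l‖ + ‖e (l + 1)‖) :=
            Finset.sum_le_sum fun l _ => norm_sub_le _ _
        _ = ∑ l ∈ Finset.range (n + 1), ‖e l‖ + ∑ l ∈ Finset.range (n + 1), ‖e (l + 1)‖ :=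
            Finset.sum_add_distrib
        _ ≤ ∑ l ∈ Finset.range (n + 2), ‖e l‖ + ∑ l ∈ Finset.range (n + 2), ‖e l‖ := by
            refine add_le_add ?_ ?_
            · rw [Finset.sum_range_succ _ (n + 1)]
              linarith [norm_nonneg (e (n + 1))]
            · rw [Finset.sum_range_succ' _ (n + 1)]
              linarith [norm_nonneg (e 0)]
        _ = 2 * ∑ l ∈ Finset.range (n + 2), ‖e l‖ := by ring
    · filter_upwards [hIY] with ω hω n l hl
      rw [itoError_eq hω t n (m n) hl, add_assoc]
  refine ⟨fun t G hG => ?_, fun t => ?_⟩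
  · obtain ⟨m, r, hr, hU⟩ := hrest t
    have hQ := SubAE.sum Λ fun k hk => subAE_sum_mul_blockSum hW hT hk (hH k hk) hG t m
    have hGr : SubAE P fun n ω => ∑ l ∈ Finset.range (n + 1), G (grid t (n + 1) l) ω * r n l ω := by
      refine hr.of_imp_one ?_
      filter_upwards [hG.continuous] with ω hG ks _ hk
      obtain ⟨C, hC0, hC⟩ := (isPartition_coarse t).bounded hG
      refine squeeze_zero_norm (fun i => ?_) (by simpa using hk.const_mul C)
      refine (norm_sum_le _ _).trans ?_
      rw [Finset.mul_sum]
      refine Finset.sum_le_sum fun l hl => ?_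
      rw [norm_mul]
      exact mul_le_mul_of_nonneg_right (hC _ _ (Finset.mem_range.1 hl).le) (norm_nonneg _)
    refine (hQ.add hGr).congr ?_
    filter_upwards [hU] with ω hω n
    rw [Finset.sum_comm, ← Finset.sum_add_distrib]
    refine Finset.sum_congr rfl fun l hl => ?_
    rw [hω n l (Finset.mem_range.1 hl), mul_add, Finset.mul_sum]
  · obtain ⟨m, r, hr, hU⟩ := hrest t
    have hQ := SubAE.sum Λ fun k hk => subAE_sum_sq_blockSum hW hT hk (hH k hk) t m
    refine SubAE.of_imp_one (SubAE.sum (Finset.univ : Finset Bool)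
      (x := fun b n ω => if b then (2 * Λ.card : ℝ) * ∑ k ∈ Λ, ∑ l ∈ Finset.range (n + 1),
        ‖blockSum W T H t n (m n) k l ω‖ ^ 2 else
        2 * (∑ l ∈ Finset.range (n + 1), ‖r n l ω‖) ^ 2) fun b _ => ?_) ?_
    · cases b
      · refine hr.of_imp_one (.of_forall fun ω ks _ h => ?_)
        simpa using (h.pow 2).const_mul 2
      · refine hQ.of_imp_one (.of_forall fun ω ks _ h => ?_)
        simpa using h.const_mul (2 * Λ.card : ℝ)
    · filter_upwards [hU] with ω hω ks _ h
      refine squeeze_zero (fun i => Finset.sum_nonneg fun _ _ => sq_nonneg _) (fun i => ?_) h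
      generalize ks i = n
      simp only [Fintype.sum_bool, if_true, Bool.false_eq_true, if_false]
      have h1 : ∀ l ∈ Finset.range (n + 1), ‖itoError W T Λ Y H a (grid t (n + 1)) l ω‖ ^ 2 ≤
          (2 * Λ.card : ℝ) * ∑ k ∈ Λ, ‖blockSum W T H t n (m n) k l ω‖ ^ 2 +
            2 * ‖r n l ω‖ ^ 2 := by
        intro l hl
        rw [hω n l (Finset.mem_range.1 hl)]
        have e1 : ‖∑ k ∈ Λ, blockSum W T H t n (m n) k l ω + r n l ω‖ ≤
            ∑ k ∈ Λ, ‖blockSum W T H t n (m n) k l ω‖ + ‖r n l ω‖ :=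
          (norm_add_le _ _).trans (add_le_add (norm_sum_le _ _) le_rfl)
        have e2 := sq_sum_le_card_mul_sum_sq (s := Λ)
          (f := fun k => ‖blockSum W T H t n (m n) k l ω‖)
        have e3 := pow_le_pow_left₀ (norm_nonneg _) e1 2
        nlinarith [sq_nonneg (∑ k ∈ Λ, ‖blockSum W T H t n (m n) k l ω‖ - ‖r n l ω‖)]
      refine (Finset.sum_le_sum h1).trans ?_
      rw [Finset.sum_add_distrib, ← Finset.mul_sum, ← Finset.mul_sum, Finset.sum_comm]
      have h2 : ∑ l ∈ Finset.range (n + 1), ‖r n l ω‖ ^ 2 ≤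
          (∑ l ∈ Finset.range (n + 1), ‖r n l ω‖) ^ 2 :=
        Finset.sum_sq_le_sq_sum_of_nonneg fun _ _ => norm_nonneg _
      linarith

end

/-! ### The product rule -/

/-- Second order Taylor expansion of `f`, with first and second derivatives `f₁` and `f₂`. -/
structure TaylorBound (f f₁ f₂ : ℝ → ℂ) : Prop where
  continuous : Continuous f
  continuous₁ : Continuous f₁
  continuous₂ : Continuous f₂
  norm₁ : ∀ x, ‖f₁ x‖ ≤ 1
  norm₂ : ∀ x, ‖f₂ x‖ ≤ 1
  expansion : ∀ x δ : ℝ, |δ| ≤ 1 → ‖f (x + δ) - f x - f₁ x * δ - f₂ x / 2 * δ ^ 2‖ ≤ |δ| ^ 3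

theorem TaylorBound.lipschitz {f f₁ f₂ : ℝ → ℂ} (hf : TaylorBound f f₁ f₂) (x : ℝ) {δ : ℝ}
    (hδ : |δ| ≤ 1) : ‖f (x + δ) - f x‖ ≤ 3 * |δ| := by
  have h0 := abs_nonneg δ
  have h1 : ‖f₁ x * δ‖ ≤ |δ| := by
    rw [norm_mul, Complex.norm_real, Real.norm_eq_abs]
    nlinarith [hf.norm₁ x]
  have h2 : ‖f₂ x / 2 * δ ^ 2‖ ≤ |δ| := by
    rw [norm_mul, norm_div, norm_pow, Complex.norm_real, Real.norm_eq_abs]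
    have h3 : ‖f₂ x‖ / ‖(2 : ℂ)‖ ≤ 1 := by
      rw [Complex.norm_ofNat]
      linarith [hf.norm₂ x]
    calc ‖f₂ x‖ / ‖(2 : ℂ)‖ * |δ| ^ 2 ≤ 1 * |δ| ^ 2 := mul_le_mul_of_nonneg_right h3 (sq_nonneg _)
      _ ≤ |δ| := by nlinarith
  have h3 : |δ| ^ 3 ≤ |δ| := by
    calc |δ| ^ 3 = |δ| * (|δ| * |δ|) := by ring
      _ ≤ |δ| * 1 := by gcongr; nlinarith
      _ = |δ| := mul_one _
  have e : f (x + δ) - f x =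
      (f (x + δ) - f x - f₁ x * δ - f₂ x / 2 * δ ^ 2) + f₁ x * δ + f₂ x / 2 * δ ^ 2 := by ring
  rw [e]
  refine (norm_add₃_le).trans ?_
  linarith [hf.expansion x δ hδ]

theorem abs_sin_sub_le {δ : ℝ} (hδ : |δ| ≤ 1) : |Real.sin δ - δ| ≤ |δ| ^ 3 / 4 := by
  have h := Real.sin_bound hδ
  have h4 : |δ| ^ 5 ≤ |δ| ^ 3 := pow_le_pow_of_le_one (abs_nonneg _) hδ (by norm_num)
  have e : Real.sin δ - δ = (Real.sin δ - (δ - δ ^ 3 / 6)) - δ ^ 3 / 6 := by ring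
  rw [e]
  refine (abs_sub _ _).trans ?_
  rw [abs_div, abs_pow, abs_of_pos (by norm_num : (0 : ℝ) < 6)]
  nlinarith [pow_nonneg (abs_nonneg δ) 3]

theorem abs_cos_sub_le {δ : ℝ} (hδ : |δ| ≤ 1) : |Real.cos δ - (1 - δ ^ 2 / 2)| ≤ |δ| ^ 3 / 4 := by
  have h := Real.cos_bound hδ
  have h4 : |δ| ^ 4 ≤ |δ| ^ 3 := pow_le_pow_of_le_one (abs_nonneg _) hδ (by norm_num)
  nlinarith [pow_nonneg (abs_nonneg δ) 3]

theorem abs_mul_add_mul_le {a b x y c : ℝ} (ha : |a| ≤ 1) (hb : |b| ≤ 1) (hx : |x| ≤ c)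
    (hy : |y| ≤ c) : |a * x + b * y| ≤ 2 * c := by
  refine (abs_add_le _ _).trans ?_
  rw [abs_mul, abs_mul]
  nlinarith [abs_nonneg x, abs_nonneg y]

theorem taylorBound_cos :
    TaylorBound (fun x => (Real.cos x : ℂ)) (fun x => (-Real.sin x : ℝ)) (fun x => (-Real.cos x : ℝ))
    where
  continuous := Complex.continuous_ofReal.comp Real.continuous_cos
  continuous₁ := Complex.continuous_ofReal.comp Real.continuous_sin.neg
  continuous₂ := Complex.continuous_ofReal.comp Real.continuous_cos.neg
  norm₁ x := by
    simp only [Complex.norm_real, Real.norm_eq_abs, abs_neg]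
    exact Real.abs_sin_le_one x
  norm₂ x := by
    simp only [Complex.norm_real, Real.norm_eq_abs, abs_neg]
    exact Real.abs_cos_le_one x
  expansion x δ hδ := by
    have e : (Real.cos (x + δ) : ℂ) - (Real.cos x : ℂ) - ((-Real.sin x : ℝ) : ℂ) * δ -
        ((-Real.cos x : ℝ) : ℂ) / 2 * δ ^ 2 =
        ((Real.cos x * (Real.cos δ - (1 - δ ^ 2 / 2)) + -Real.sin x * (Real.sin δ - δ) : ℝ) : ℂ) := by
      rw [Real.cos_add]
      push_cast
      ring
    rw [e, Complex.norm_real, Real.norm_eq_abs]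
    refine (abs_mul_add_mul_le (Real.abs_cos_le_one x) ?_ (abs_cos_sub_le hδ)
      (abs_sin_sub_le hδ)).trans ?_
    · rw [abs_neg]; exact Real.abs_sin_le_one x
    · nlinarith [pow_nonneg (abs_nonneg δ) 3]

theorem taylorBound_sin :
    TaylorBound (fun x => (Real.sin x : ℂ)) (fun x => (Real.cos x : ℝ)) (fun x => (-Real.sin x : ℝ))
    where
  continuous := Complex.continuous_ofReal.comp Real.continuous_sin
  continuous₁ := Complex.continuous_ofReal.comp Real.continuous_cos
  continuous₂ := Complex.continuous_ofReal.comp Real.continuous_sin.neg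
  norm₁ x := by
    simp only [Complex.norm_real, Real.norm_eq_abs]
    exact Real.abs_cos_le_one x
  norm₂ x := by
    simp only [Complex.norm_real, Real.norm_eq_abs, abs_neg]
    exact Real.abs_sin_le_one x
  expansion x δ hδ := by
    have e : (Real.sin (x + δ) : ℂ) - (Real.sin x : ℂ) - ((Real.cos x : ℝ) : ℂ) * δ -
        ((-Real.sin x : ℝ) : ℂ) / 2 * δ ^ 2 =
        ((Real.sin x * (Real.cos δ - (1 - δ ^ 2 / 2)) + Real.cos x * (Real.sin δ - δ) : ℝ) : ℂ) := by
      rw [Real.sin_add]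
      push_cast
      ring
    rw [e, Complex.norm_real, Real.norm_eq_abs]
    refine (abs_mul_add_mul_le (Real.abs_sin_le_one x) (Real.abs_cos_le_one x)
      (abs_cos_sub_le hδ) (abs_sin_sub_le hδ)).trans ?_
    nlinarith [pow_nonneg (abs_nonneg δ) 3]

theorem tendsto_zero_of_forall_le {x : ℕ → ℝ} (h0 : ∀ n, 0 ≤ x n) (K : ℝ)
    (h : ∀ ε > 0, ε ≤ 1 → ∀ᶠ n in atTop, x n ≤ ε * K) : Tendsto x atTop (𝓝 0) := by
  rw [Metric.tendsto_nhds]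
  intro ε hε
  have hK : 0 < 2 * (|K| + 1) := by positivity
  have hε' : 0 < min (ε / (2 * (|K| + 1))) 1 := by positivity
  filter_upwards [h _ hε' (min_le_right _ _)] with n hn
  rw [dist_zero_right, Real.norm_of_nonneg (h0 n)]
  refine hn.trans_lt ?_
  calc min (ε / (2 * (|K| + 1))) 1 * K ≤ ε / (2 * (|K| + 1)) * (|K| + 1) :=
        (mul_le_mul_of_nonneg_left ((le_abs_self K).trans (by linarith)) hε'.le).trans
          (mul_le_mul_of_nonneg_right (min_le_left _ _) (by positivity))
    _ = ε / 2 := by field_simp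
    _ < ε := by linarith

section

variable {Ω : Type*}

/-- The first and second order terms of the increment of `f(θ) Y`, for a process `Y` with
differential `∑ H^k dW^k + a ds` and `θ = θ₀ + σ W^e`. -/
def productTerm (W : Edge → ℝ≥0 → Ω → ℝ) (T : Ω → ℝ≥0) (Λ : Finset Edge) (f f₁ f₂ : ℝ → ℂ)
    (θ : ℝ≥0 → Ω → ℝ) (σ : ℝ) (e : Edge) (Y : ℝ≥0 → Ω → ℂ) (H : Edge → ℝ≥0 → Ω → ℂ)
    (a : ℝ≥0 → Ω → ℂ) (τ : ℕ → ℝ≥0) (l : ℕ) (ω : Ω) : ℂ :=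
  f (θ (τ l) ω) * (∑ k ∈ Λ, H k (τ l) ω * (incr W T τ k l ω : ℂ) +
      a (τ l) ω * (lapse T τ l ω : ℂ)) +
    Y (τ l) ω * (f₁ (θ (τ l) ω) * (σ * incr W T τ e l ω : ℝ) +
      f₂ (θ (τ l) ω) / 2 * (σ ^ 2 * lapse T τ l ω : ℝ)) +
    f₁ (θ (τ l) ω) * σ * H e (τ l) ω * (lapse T τ l ω : ℂ)

variable [mΩ : MeasurableSpace Ω] {P : Measure Ω}
  {𝓕 : Filtration ℝ≥0 mΩ} {Λ : Finset Edge} {W : Edge → ℝ≥0 → Ω → ℝ} {T : Ω → ℝ≥0}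

theorem SubAE.of_imp_two {E F E' : Type*} [NormedAddCommGroup E] [NormedAddCommGroup F]
    [NormedAddCommGroup E'] {x : ℕ → Ω → E} {x' : ℕ → Ω → E'} (hx : SubAE P x) (hx' : SubAE P x')
    {y : ℕ → Ω → F}
    (hy : ∀ᵐ ω ∂P, ∀ ks : ℕ → ℕ, StrictMono ks → Tendsto (fun n => x (ks n) ω) atTop (𝓝 0) →
      Tendsto (fun n => x' (ks n) ω) atTop (𝓝 0) →
        Tendsto (fun n => y (ks n) ω) atTop (𝓝 0)) : SubAE P y := by
  intro ns hns
  obtain ⟨ms, hms, hx⟩ := hx ns hns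
  obtain ⟨ps, hps, hx'⟩ := hx' (ns ∘ ms) (hns.comp hms)
  refine ⟨ms ∘ ps, hms.comp hps, ?_⟩
  filter_upwards [hx, hx', hy] with ω h1 h2 h3
  exact h3 _ ((hns.comp hms).comp hps) (h1.comp hps.tendsto_atTop) h2

/-- The third order terms in the increment of a product are bounded by a small multiple of a sum of
second order terms. -/
theorem norm_remainder_le {f f₁ f₂ : ℝ → ℂ} (hf : TaylorBound f f₁ f₂) {x σ w ε C h c : ℝ}
    {y u z v : ℂ} (hε : 0 < ε) (hw : |w| ≤ ε) (hσw : |σ * w| ≤ 1) (hy : ‖y‖ ≤ C)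
    (hz : ‖z‖ ≤ C * c * ε) (hv : ‖v‖ ≤ C * h) (hC : 0 ≤ C) :
    ‖y * (f (x + σ * w) - f x - f₁ x * (σ * w : ℝ) - f₂ x / 2 * (σ * w : ℝ) ^ 2) +
      (f (x + σ * w) - f x) * u + f₁ x * (σ * w : ℝ) * v +
      (f₂ x / 2 * (σ * w : ℝ) ^ 2 +
        (f (x + σ * w) - f x - f₁ x * (σ * w : ℝ) - f₂ x / 2 * (σ * w : ℝ) ^ 2)) * z‖ ≤
      ε * ((C * |σ| ^ 3 + 2 * |σ| + 2 * |σ| ^ 2 * (C * c)) * w ^ 2 + |σ| * C * h) +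
        2 * |σ| / ε * ‖u‖ ^ 2 := by
  set δ := σ * w with hδ
  have hδ2 : |δ| ^ 2 = |σ| ^ 2 * w ^ 2 := by rw [hδ, abs_mul, mul_pow, sq_abs w]
  have hδε : |δ| ≤ |σ| * ε := by rw [hδ, abs_mul]; gcongr
  have hσ0 := abs_nonneg σ
  have hw0 := abs_nonneg w
  have hδ0 := abs_nonneg δ
  set r := f (x + δ) - f x - f₁ x * (δ : ℝ) - f₂ x / 2 * (δ : ℝ) ^ 2 with hr
  have hr3 : ‖r‖ ≤ |δ| ^ 3 := hf.expansion x δ hσw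
  have b1 : ‖y * r‖ ≤ ε * (C * |σ| ^ 3 * w ^ 2) := by
    rw [norm_mul]
    calc ‖y‖ * ‖r‖ ≤ C * |δ| ^ 3 := mul_le_mul hy hr3 (norm_nonneg _) hC
      _ = C * (|δ| * |δ| ^ 2) := by ring
      _ ≤ C * ((|σ| * ε) * |δ| ^ 2) := by gcongr
      _ = ε * (C * |σ| ^ 3 * w ^ 2) := by rw [hδ2]; ring
  have b2 : ‖(f (x + δ) - f x) * u‖ ≤ ε * (2 * |σ| * w ^ 2) + 2 * |σ| / ε * ‖u‖ ^ 2 := by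
    rw [norm_mul]
    have h1 : ‖f (x + δ) - f x‖ * ‖u‖ ≤ 3 * |δ| * ‖u‖ :=
      mul_le_mul_of_nonneg_right (hf.lipschitz x hσw) (norm_nonneg _)
    have h2 : 4 * (|w| * ‖u‖) ≤ 2 * ε * w ^ 2 + 2 / ε * ‖u‖ ^ 2 := by
      have h3 : 2 * ε * w ^ 2 + 2 / ε * ‖u‖ ^ 2 - 4 * (|w| * ‖u‖) =
          2 / ε * (ε * |w| - ‖u‖) ^ 2 := by
        rw [← sq_abs w]
        field_simp
        ring
      have : 0 ≤ 2 / ε * (ε * |w| - ‖u‖) ^ 2 := by positivity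
      linarith
    have h4 : |δ| * ‖u‖ = |σ| * (|w| * ‖u‖) := by rw [hδ, abs_mul]; ring
    have h5 : 0 ≤ |σ| * (|w| * ‖u‖) := by positivity
    have h6 := mul_le_mul_of_nonneg_left h2 hσ0
    have h7 : |σ| * (2 * ε * w ^ 2 + 2 / ε * ‖u‖ ^ 2) =
        ε * (2 * |σ| * w ^ 2) + 2 * |σ| / ε * ‖u‖ ^ 2 := by ring
    nlinarith
  have b3 : ‖f₁ x * (δ : ℝ) * v‖ ≤ ε * (|σ| * C * h) := by
    rw [norm_mul, norm_mul, Complex.norm_real, Real.norm_eq_abs]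
    have h1 : ‖f₁ x‖ * |δ| ≤ |σ| * ε := by
      calc ‖f₁ x‖ * |δ| ≤ 1 * (|σ| * ε) := mul_le_mul (hf.norm₁ x) hδε hδ0 zero_le_one
        _ = |σ| * ε := one_mul _
    calc ‖f₁ x‖ * |δ| * ‖v‖ ≤ |σ| * ε * (C * h) := mul_le_mul h1 hv (norm_nonneg _) (by positivity)
      _ = ε * (|σ| * C * h) := by ring
  have b4 : ‖(f₂ x / 2 * (δ : ℝ) ^ 2 + r) * z‖ ≤ ε * (2 * |σ| ^ 2 * (C * c) * w ^ 2) := by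
    have h1 : ‖f₂ x / 2 * (δ : ℝ) ^ 2 + r‖ ≤ 2 * |δ| ^ 2 := by
      refine (norm_add_le _ _).trans ?_
      rw [norm_mul, norm_div, norm_pow, Complex.norm_real, Real.norm_eq_abs, Complex.norm_ofNat]
      have h2 : ‖f₂ x‖ / 2 * |δ| ^ 2 ≤ 1 * |δ| ^ 2 :=
        mul_le_mul_of_nonneg_right (by linarith [hf.norm₂ x]) (sq_nonneg _)
      have h3 : |δ| ^ 3 ≤ |δ| ^ 2 := pow_le_pow_of_le_one hδ0 hσw (by norm_num)
      linarith
    rw [norm_mul]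
    calc _ ≤ 2 * |δ| ^ 2 * (C * c * ε) := mul_le_mul h1 hz (norm_nonneg _) (by positivity)
      _ = ε * (2 * |σ| ^ 2 * (C * c) * w ^ 2) := by rw [hδ2]; ring
  refine (norm_add_le _ _).trans ((add_le_add ((norm_add_le _ _).trans (add_le_add
    ((norm_add_le _ _).trans (add_le_add b1 b2)) b3)) b4).trans (le_of_eq ?_))
  ring

theorem BrownianSystem.adapted_stopped (hW : BrownianSystem 𝓕 P Λ W)
    (hT : IsStoppingTime 𝓕 fun ω => (T ω : WithTop ℝ≥0)) (k : Edge) :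
    StronglyAdapted 𝓕 fun t ω => W k (min t (T ω)) ω := by
  have h := StronglyAdapted.stoppedProcess (hW.adapted k) (hW.continuous k) hT
  have e : stoppedProcess (W k) (fun ω => (T ω : WithTop ℝ≥0)) =
      fun t ω => W k (min t (T ω)) ω := by
    ext t ω
    simp only [stoppedProcess]
    rw [← WithTop.coe_min]
    rfl
  rwa [e] at h

variable [IsProbabilityMeasure P]

/-- The product rule for `f(θ) Y`, where `θ = θ₀ + σ W^e` up to time `T`, on uniform partitions. -/
theorem HasItoDifferential.product_rule (hW : BrownianSystem 𝓕 P Λ W)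
    (hT : IsStoppingTime 𝓕 fun ω => (T ω : WithTop ℝ≥0)) {f f₁ f₂ : ℝ → ℂ}
    (hf : TaylorBound f f₁ f₂) {θ : ℝ≥0 → Ω → ℝ} {x₀ σ : ℝ} {e : Edge} (he : e ∈ Λ)
    (hθ : ∀ t ω, θ t ω = x₀ + σ * W e (min t (T ω)) ω) {Y : ℝ≥0 → Ω → ℂ}
    {H : Edge → ℝ≥0 → Ω → ℂ} {a : ℝ≥0 → Ω → ℂ} (hY : RegularProcess 𝓕 P Y)
    (hH : ∀ k ∈ Λ, RegularProcess 𝓕 P (H k)) (ha : RegularProcess 𝓕 P a)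
    (hI : HasItoDifferential 𝓕 P W T Λ Y H a) (t : ℝ≥0) :
    SubAE P fun n ω => f (θ t ω) * Y t ω - f (θ 0 ω) * Y 0 ω -
      ∑ l ∈ Finset.range (n + 1),
        productTerm W T Λ f f₁ f₂ θ σ e Y H a (grid t (n + 1)) l ω := by
  have hτ := isPartition_coarse t
  have hreg : ∀ g : ℝ → ℂ, Continuous g → RegularProcess 𝓕 P fun t ω => g (θ t ω) := by
    intro g hg
    refine RegularProcess.of_adapted (.of_forall fun ω => ?_) fun t => ?_
    · simp_rw [hθ]
      exact hg.comp (continuous_const.add (continuous_const.mul (hW.continuous_stopped e ω)))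
    · simp_rw [hθ]
      have h1 : Continuous fun w : ℝ => g (x₀ + σ * w) := by fun_prop
      exact h1.comp_stronglyMeasurable (hW.adapted_stopped hT e t)
  have hfr := hreg f hf.continuous
  have hf1 := hreg f₁ hf.continuous₁
  have hf2 := hreg f₂ hf.continuous₂
  -- the leading errors
  have hL1 := hI.sum_mul t _ hfr
  have hL2 := RegularProcess.subAE_quad ((hY.mul hf2).mul (RegularProcess.const ((σ : ℂ) ^ 2 / 2)))
    hW hT hτ he he
  have hL3 := SubAE.sum Λ fun k hk => RegularProcess.subAE_quad
    ((hf1.mul (RegularProcess.const (σ : ℂ))).mul (hH k hk)) hW hT hτ he hk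
  have hQ := RegularProcess.subAE_quad (RegularProcess.const 1) hW hT hτ he he
  -- the remainder
  let R : ℕ → ℕ → Ω → ℂ := fun n l ω =>
    let τ := grid t (n + 1)
    let x := θ (τ l) ω
    let δ := σ * incr W T τ e l ω
    Y (τ l) ω * (f (x + δ) - f x - f₁ x * (δ : ℝ) - f₂ x / 2 * (δ : ℝ) ^ 2) +
      (f (x + δ) - f x) * itoError W T Λ Y H a τ l ω +
      f₁ x * (δ : ℝ) * (a (τ l) ω * (lapse T τ l ω : ℂ)) +
      (f₂ x / 2 * (δ : ℝ) ^ 2 + (f (x + δ) - f x - f₁ x * (δ : ℝ) - f₂ x / 2 * (δ : ℝ) ^ 2)) *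
        (∑ k ∈ Λ, H k (τ l) ω * (incr W T τ k l ω : ℂ) + a (τ l) ω * (lapse T τ l ω : ℂ))
  have hR : SubAE P fun n ω => ∑ l ∈ Finset.range (n + 1), R n l ω := by
    refine SubAE.of_imp_two (hI.sum_sq t) hQ ?_
    have hHc : ∀ᵐ ω ∂P, ∀ k ∈ Λ, Continuous fun s => H k s ω :=
      (ae_ball_iff Λ.countable_toSet).2 fun k hk => (hH k hk).continuous
    filter_upwards [hY.continuous, hHc, ha.continuous] with ω hYc hHc hac ks hks hU hq
    obtain ⟨C₁, hC₁0, hC₁⟩ := hτ.bounded hYc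
    obtain ⟨C₂, hC₂0, hC₂⟩ := hτ.bounded hac
    obtain ⟨C₃, hC₃0, hC₃⟩ : ∃ C, 0 ≤ C ∧ ∀ k ∈ Λ, ∀ n, ∀ j ≤ n + 1,
        ‖H k (grid t (n + 1) j) ω‖ ≤ C := by
      choose! C hC0 hC using fun k hk => hτ.bounded (hHc k hk)
      refine ⟨∑ k ∈ Λ, C k, Finset.sum_nonneg hC0, fun k hk n j hj => (hC k hk n j hj).trans ?_⟩
      exact Finset.single_le_sum hC0 hk
    set C := C₁ + C₂ + C₃ with hC
    have hC0 : 0 ≤ C := by positivity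
    set c : ℝ := Λ.card + 1 with hc
    set A := C * |σ| ^ 3 + 2 * |σ| + 2 * |σ| ^ 2 * (C * c) with hA
    have hA0 : 0 ≤ A := by positivity
    suffices hs : Tendsto (fun i => ∑ l ∈ Finset.range (ks i + 1), ‖R (ks i) l ω‖) atTop (𝓝 0) from
      squeeze_zero_norm (fun i => norm_sum_le _ _) hs
    refine tendsto_zero_of_forall_le (fun i => Finset.sum_nonneg fun _ _ => norm_nonneg _)
      (A * (t + 1) + |σ| * C * t + 2 * |σ|) fun ε hε hε1 => ?_
    have hε' : 0 < min ε (1 / (|σ| + 1)) := by positivity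
    have hinc : ∀ᶠ n in atTop, ∀ k ∈ Λ, ∀ l < n + 1,
        |incr W T (grid t (n + 1)) k l ω| ≤ min ε (1 / (|σ| + 1)) := by
      exact (Finset.eventually_all Λ).2 fun k _ => hτ.osc_succ (hW.continuous_stopped (T := T) k ω) hε'
    have hmin : Continuous fun s : ℝ≥0 => ((min s (T ω) : ℝ≥0) : ℝ) := by fun_prop
    have hlap : ∀ᶠ n in atTop, ∀ l < n + 1, |lapse T (grid t (n + 1)) l ω| ≤ ε :=
      hτ.osc_succ hmin hε
    have hq1 : ∀ᶠ i in atTop,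
        ∑ l ∈ Finset.range (ks i + 1), incr W T (grid t (ks i + 1)) e l ω ^ 2 ≤ t + 1 := by
      have := (tendsto_order.1 (tendsto_zero_iff_norm_tendsto_zero.1 hq)).2 1 one_pos
      filter_upwards [this] with i hi
      simp only [one_mul, if_true, ← Complex.ofReal_sum, Complex.norm_real,
        Finset.sum_sub_distrib] at hi
      rw [sum_lapse T hτ, Real.norm_eq_abs] at hi
      have h1 := (abs_lt.1 hi).2
      have h2 : ((min t (T ω) : ℝ≥0) : ℝ) ≤ t := NNReal.coe_le_coe.2 (min_le_left _ _)
      simp only [sq]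
      linarith
    have hU1 := (tendsto_order.1 hU).2 (ε ^ 2) (by positivity)
    filter_upwards [hks.tendsto_atTop.eventually hinc, hks.tendsto_atTop.eventually hlap, hq1, hU1]
      with i h1 h2 h3 h4
    generalize ks i = n at h1 h2 h3 h4
    have hterm : ∀ l ∈ Finset.range (n + 1), ‖R n l ω‖ ≤
        ε * (A * incr W T (grid t (n + 1)) e l ω ^ 2 +
          |σ| * C * lapse T (grid t (n + 1)) l ω) +
        2 * |σ| / ε * ‖itoError W T Λ Y H a (grid t (n + 1)) l ω‖ ^ 2 := by
      intro l hl
      have hl' := Finset.mem_range.1 hl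
      have hlap0 : 0 ≤ lapse T (grid t (n + 1)) l ω := lapse_nonneg T (grid_mono t _) l ω
      have hal : ‖a (grid t (n + 1) l) ω * (lapse T (grid t (n + 1)) l ω : ℂ)‖ ≤
          C * lapse T (grid t (n + 1)) l ω := by
        rw [norm_mul, Complex.norm_real, Real.norm_of_nonneg hlap0]
        exact mul_le_mul_of_nonneg_right ((hC₂ n l hl'.le).trans (by linarith)) hlap0
      refine norm_remainder_le hf hε ((h1 e he l hl').trans (min_le_left _ _)) ?_
        ((hC₁ n l hl'.le).trans (by linarith)) ?_ hal hC0
      · rw [abs_mul]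
        calc |σ| * |incr W T (grid t (n + 1)) e l ω| ≤ |σ| * (1 / (|σ| + 1)) :=
              mul_le_mul_of_nonneg_left ((h1 e he l hl').trans (min_le_right _ _)) (abs_nonneg _)
          _ ≤ 1 := by
              rw [mul_one_div, div_le_one (by positivity)]
              linarith
      · have hsum : ‖∑ k ∈ Λ, H k (grid t (n + 1) l) ω * (incr W T (grid t (n + 1)) k l ω : ℂ)‖ ≤
            ∑ k ∈ Λ, C * ε := by
          refine (norm_sum_le _ _).trans (Finset.sum_le_sum fun k hk => ?_)
          rw [norm_mul, Complex.norm_real, Real.norm_eq_abs]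
          exact mul_le_mul ((hC₃ k hk n l hl'.le).trans (by linarith))
            ((h1 k hk l hl').trans (min_le_left _ _)) (abs_nonneg _) hC0
        have h5 : C * lapse T (grid t (n + 1)) l ω ≤ C * ε :=
          mul_le_mul_of_nonneg_left ((le_abs_self _).trans (h2 l hl')) hC0
        rw [Finset.sum_const, nsmul_eq_mul] at hsum
        refine (norm_add_le _ _).trans ((add_le_add hsum (hal.trans h5)).trans (le_of_eq ?_))
        rw [hc]; ring
    refine (Finset.sum_le_sum hterm).trans ?_
    rw [Finset.sum_add_distrib, ← Finset.mul_sum, ← Finset.mul_sum, Finset.sum_add_distrib,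
      ← Finset.mul_sum, ← Finset.mul_sum, sum_lapse T hτ]
    have h6 : ((min t (T ω) : ℝ≥0) : ℝ) ≤ t := NNReal.coe_le_coe.2 (min_le_left _ _)
    have h7 : 2 * |σ| / ε * ∑ l ∈ Finset.range (n + 1),
        ‖itoError W T Λ Y H a (grid t (n + 1)) l ω‖ ^ 2 ≤ 2 * |σ| / ε * ε ^ 2 := by
      gcongr
    have h8 : 2 * |σ| / ε * ε ^ 2 = ε * (2 * |σ|) := by field_simp
    have h9 : A * ∑ l ∈ Finset.range (n + 1), incr W T (grid t (n + 1)) e l ω ^ 2 ≤ A * (t + 1) := by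
      gcongr
    have h10 : |σ| * C * ((min t (T ω) : ℝ≥0) : ℝ) ≤ |σ| * C * t := by gcongr
    calc _ ≤ ε * (A * (t + 1) + |σ| * C * t) + ε * (2 * |σ|) :=
          add_le_add (mul_le_mul_of_nonneg_left (add_le_add h9 h10) hε.le) (h7.trans_eq h8)
      _ = _ := by ring
  refine (((hL1.add hL2).add hL3).add hR).congr (.of_forall fun ω n => ?_)
  have htel : f (θ t ω) * Y t ω - f (θ 0 ω) * Y 0 ω = ∑ l ∈ Finset.range (n + 1),
      (f (θ (grid t (n + 1) (l + 1)) ω) * Y (grid t (n + 1) (l + 1)) ω -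
        f (θ (grid t (n + 1) l) ω) * Y (grid t (n + 1) l) ω) := by
    rw [Finset.sum_range_sub (fun l => f (θ (grid t (n + 1) l) ω) * Y (grid t (n + 1) l) ω),
      grid_self t n.succ_pos, grid_zero]
  rw [htel, Finset.sum_comm (s := Λ), ← Finset.sum_add_distrib, ← Finset.sum_add_distrib,
    ← Finset.sum_add_distrib, ← Finset.sum_sub_distrib]
  refine Finset.sum_congr rfl fun l _ => ?_
  have hx : θ (grid t (n + 1) (l + 1)) ω =
      θ (grid t (n + 1) l) ω + σ * incr W T (grid t (n + 1)) e l ω := by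
    rw [hθ, hθ, incr]; ring
  have hdiag : ∑ k ∈ Λ, f₁ (θ (grid t (n + 1) l) ω) * σ * H k (grid t (n + 1) l) ω *
      ((incr W T (grid t (n + 1)) e l ω * incr W T (grid t (n + 1)) k l ω -
        if e = k then lapse T (grid t (n + 1)) l ω else 0 : ℝ) : ℂ) =
      f₁ (θ (grid t (n + 1) l) ω) * (σ * incr W T (grid t (n + 1)) e l ω : ℝ) *
        ∑ k ∈ Λ, H k (grid t (n + 1) l) ω * (incr W T (grid t (n + 1)) k l ω : ℂ) -
      f₁ (θ (grid t (n + 1) l) ω) * σ * H e (grid t (n + 1) l) ω *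
        (lapse T (grid t (n + 1)) l ω : ℂ) := by
    have e1 : ∀ k ∈ Λ, f₁ (θ (grid t (n + 1) l) ω) * σ * H k (grid t (n + 1) l) ω *
        ((incr W T (grid t (n + 1)) e l ω * incr W T (grid t (n + 1)) k l ω -
          if e = k then lapse T (grid t (n + 1)) l ω else 0 : ℝ) : ℂ) =
        f₁ (θ (grid t (n + 1) l) ω) * (σ * incr W T (grid t (n + 1)) e l ω : ℝ) *
          (H k (grid t (n + 1) l) ω * (incr W T (grid t (n + 1)) k l ω : ℂ)) -
        if e = k then f₁ (θ (grid t (n + 1) l) ω) * σ * H k (grid t (n + 1) l) ω *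
          (lapse T (grid t (n + 1)) l ω : ℂ) else 0 := by
      intro k _
      split_ifs <;> push_cast <;> ring
    rw [Finset.sum_congr rfl e1, Finset.sum_sub_distrib, ← Finset.mul_sum, Finset.sum_ite_eq,
      if_pos he]
  rw [hdiag]
  simp only [R, productTerm, hx, if_true]
  unfold itoError
  generalize ∑ k ∈ Λ, H k (grid t (n + 1) l) ω * (incr W T (grid t (n + 1)) k l ω : ℂ) = S
  push_cast
  ring

end

/-! ### Propagation defects of the coefficients -/

section Coefficients

variable {θ : Edge → ℝ} (hθ : ∀ e, θ e ∈ Set.Ioo 0 (Real.pi / 2)) (σ : Edge → ℝ)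
  (Y : LiftedCorner → ℂ)
include hθ

theorem diffusion_flip (k : Edge) (p : LiftedCorner) :
    diffusion σ θ Y k p.flip = -diffusion σ θ Y k p := by
  rw [diffusion, diffusion, bracket_flip hθ]; ring

theorem drift_flip (Λ : Finset Edge) (p : LiftedCorner) :
    drift Λ σ θ Y p.flip = -drift Λ σ θ Y p := by
  simp_rw [drift, bracket_flip hθ]
  rw [← mul_neg, ← Finset.sum_neg_distrib]
  simp_rw [mul_neg]

theorem diffusion_quad {k e : Edge} (he : e ≠ k) :
    diffusion σ θ Y k e.dPlus = (Real.cos (θ e) : ℂ) * diffusion σ θ Y k e.aPlus +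
        (Real.sin (θ e) : ℂ) * diffusion σ θ Y k e.cPlus ∧
      diffusion σ θ Y k e.bPlus = (Real.cos (θ e) : ℂ) * diffusion σ θ Y k e.cPlus -
        (Real.sin (θ e) : ℂ) * diffusion σ θ Y k e.aPlus := by
  obtain ⟨h1, h2⟩ := bracket_quad hθ Y he
  unfold diffusion
  rw [h1, h2]
  constructor <;> ring

theorem diffusion_quad_self (e : Edge) :
    diffusion σ θ Y e e.dPlus = (Real.cos (θ e) : ℂ) * diffusion σ θ Y e e.aPlus +
        (Real.sin (θ e) : ℂ) * diffusion σ θ Y e e.cPlus -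
        σ e * ((Real.sin (θ e) : ℂ) * Y e.aPlus - (Real.cos (θ e) : ℂ) * Y e.cPlus) ∧
      diffusion σ θ Y e e.bPlus = (Real.cos (θ e) : ℂ) * diffusion σ θ Y e e.cPlus -
        (Real.sin (θ e) : ℂ) * diffusion σ θ Y e e.aPlus -
        σ e * ((Real.sin (θ e) : ℂ) * Y e.cPlus + (Real.cos (θ e) : ℂ) * Y e.aPlus) := by
  obtain ⟨h1, h2⟩ := bracket_quad_self hθ Y e
  unfold diffusion
  rw [h1, h2]
  constructor <;> ring

theorem sum_diffusion_quad {Λ : Finset Edge} {e : Edge} (he : e ∈ Λ) (w : Edge → ℂ) :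
    ∑ k ∈ Λ, diffusion σ θ Y k e.dPlus * w k =
        (Real.cos (θ e) : ℂ) * ∑ k ∈ Λ, diffusion σ θ Y k e.aPlus * w k +
        (Real.sin (θ e) : ℂ) * ∑ k ∈ Λ, diffusion σ θ Y k e.cPlus * w k -
        σ e * ((Real.sin (θ e) : ℂ) * Y e.aPlus - (Real.cos (θ e) : ℂ) * Y e.cPlus) * w e ∧
      ∑ k ∈ Λ, diffusion σ θ Y k e.bPlus * w k =
        (Real.cos (θ e) : ℂ) * ∑ k ∈ Λ, diffusion σ θ Y k e.cPlus * w k -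
        (Real.sin (θ e) : ℂ) * ∑ k ∈ Λ, diffusion σ θ Y k e.aPlus * w k -
        σ e * ((Real.sin (θ e) : ℂ) * Y e.cPlus + (Real.cos (θ e) : ℂ) * Y e.aPlus) * w e := by
  have key : ∀ x y z : Edge → ℂ, ∀ c s r : ℂ, (∀ k, k ≠ e → x k = c * y k + s * z k) →
      x e = c * y e + s * z e - r →
      ∑ k ∈ Λ, x k * w k = c * ∑ k ∈ Λ, y k * w k + s * ∑ k ∈ Λ, z k * w k - r * w e := by
    intro x y z c s r h1 h2
    rw [← Finset.add_sum_erase _ _ he, ← Finset.add_sum_erase _ (fun k => y k * w k) he,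
      ← Finset.add_sum_erase _ (fun k => z k * w k) he,
      Finset.sum_congr rfl fun k hk => by rw [h1 k (Finset.ne_of_mem_erase hk)]]
    simp_rw [add_mul, Finset.sum_add_distrib, mul_assoc, ← Finset.mul_sum]
    rw [h2]
    ring
  constructor
  · exact key _ _ _ _ _ _ (fun k hk => (diffusion_quad hθ σ Y (Ne.symm hk)).1)
      (diffusion_quad_self hθ σ Y e).1
  · have := key (fun k => diffusion σ θ Y k e.bPlus) (fun k => diffusion σ θ Y k e.cPlus)
      (fun k => diffusion σ θ Y k e.aPlus) (Real.cos (θ e)) (-Real.sin (θ e))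
      (σ e * ((Real.sin (θ e) : ℂ) * Y e.cPlus + (Real.cos (θ e) : ℂ) * Y e.aPlus))
      (fun k hk => by rw [(diffusion_quad hθ σ Y (Ne.symm hk)).2]; ring)
      (by rw [(diffusion_quad_self hθ σ Y e).2]; ring)
    rw [this]
    ring

theorem sum_diffusion_quad_of_notMem {Λ : Finset Edge} {e : Edge} (he : e ∉ Λ) (w : Edge → ℂ) :
    ∑ k ∈ Λ, diffusion σ θ Y k e.dPlus * w k =
        (Real.cos (θ e) : ℂ) * ∑ k ∈ Λ, diffusion σ θ Y k e.aPlus * w k +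
        (Real.sin (θ e) : ℂ) * ∑ k ∈ Λ, diffusion σ θ Y k e.cPlus * w k ∧
      ∑ k ∈ Λ, diffusion σ θ Y k e.bPlus * w k =
        (Real.cos (θ e) : ℂ) * ∑ k ∈ Λ, diffusion σ θ Y k e.cPlus * w k -
        (Real.sin (θ e) : ℂ) * ∑ k ∈ Λ, diffusion σ θ Y k e.aPlus * w k := by
  have hne : ∀ k ∈ Λ, e ≠ k := fun k hk h => he (h ▸ hk)
  simp_rw [Finset.mul_sum]
  rw [← Finset.sum_add_distrib, ← Finset.sum_sub_distrib]
  constructor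
  · refine Finset.sum_congr rfl fun k hk => ?_
    rw [(diffusion_quad hθ σ Y (hne k hk)).1]; ring
  · refine Finset.sum_congr rfl fun k hk => ?_
    rw [(diffusion_quad hθ σ Y (hne k hk)).2]; ring

omit hθ in
/-- The drift is a combination of the diffusion coefficients. -/
theorem drift_eq_sum (Λ : Finset Edge) (p : LiftedCorner) :
    drift Λ σ θ Y p = ∑ k ∈ Λ, diffusion σ θ Y k p * (-(1 / 2) * σ k * energyRatio θ k) := by
  unfold drift diffusion energyRatio
  rw [Finset.mul_sum]
  exact Finset.sum_congr rfl fun k _ => by ring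

/-- The defects of the drift compensate the second order terms in the product rule. -/
theorem drift_quad {Λ : Finset Edge} {e : Edge} (he : e ∈ Λ) :
    drift Λ σ θ Y e.dPlus - (Real.cos (θ e) : ℂ) * drift Λ σ θ Y e.aPlus -
        (Real.sin (θ e) : ℂ) * drift Λ σ θ Y e.cPlus +
        σ e ^ 2 / 2 * ((Real.cos (θ e) : ℂ) * Y e.aPlus + (Real.sin (θ e) : ℂ) * Y e.cPlus) +
        σ e * ((Real.sin (θ e) : ℂ) * diffusion σ θ Y e e.aPlus -
          (Real.cos (θ e) : ℂ) * diffusion σ θ Y e e.cPlus) = 0 ∧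
      drift Λ σ θ Y e.bPlus - (Real.cos (θ e) : ℂ) * drift Λ σ θ Y e.cPlus +
        (Real.sin (θ e) : ℂ) * drift Λ σ θ Y e.aPlus +
        σ e ^ 2 / 2 * ((Real.cos (θ e) : ℂ) * Y e.cPlus - (Real.sin (θ e) : ℂ) * Y e.aPlus) +
        σ e * ((Real.sin (θ e) : ℂ) * diffusion σ θ Y e e.cPlus +
          (Real.cos (θ e) : ℂ) * diffusion σ θ Y e e.aPlus) = 0 := by
  obtain ⟨h1, h2⟩ := sum_diffusion_quad hθ σ Y he fun k => -(1 / 2) * σ k * energyRatio θ k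
  simp_rw [drift_eq_sum]
  rw [h1, h2]
  have ha : diffusion σ θ Y e e.aPlus = -(1 / 2) * σ e * (Y e.cPlus + energyRatio θ e * Y e.aPlus) := by
    rw [diffusion, bracket_aPlus hθ]
  have hc : diffusion σ θ Y e e.cPlus = -(1 / 2) * σ e * (energyRatio θ e * Y e.cPlus - Y e.aPlus) := by
    rw [diffusion, bracket_cPlus hθ]
  rw [ha, hc]
  constructor <;> ring

theorem drift_quad_of_notMem {Λ : Finset Edge} {e : Edge} (he : e ∉ Λ) :
    drift Λ σ θ Y e.dPlus = (Real.cos (θ e) : ℂ) * drift Λ σ θ Y e.aPlus +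
        (Real.sin (θ e) : ℂ) * drift Λ σ θ Y e.cPlus ∧
      drift Λ σ θ Y e.bPlus = (Real.cos (θ e) : ℂ) * drift Λ σ θ Y e.cPlus -
        (Real.sin (θ e) : ℂ) * drift Λ σ θ Y e.aPlus := by
  simp_rw [drift_eq_sum]
  exact sum_diffusion_quad_of_notMem hθ σ Y he _

end Coefficients

section ContinuousCoefficients

variable {θ₀ : Edge → ℝ} (hθ₀ : ∀ e, θ₀ e ∈ Set.Ioo 0 (Real.pi / 2)) (Λ : Finset Edge)
include hθ₀

theorem continuousOn_fermion (z : Edge) (q p : LiftedCorner) :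
    ContinuousOn (fun u => (fermion (extendAngles θ₀ Λ u) z q p : ℂ)) (angleBox Λ) :=
  Complex.continuous_ofReal.comp_continuousOn (contDiffOn_fermion hθ₀ Λ z q p).continuousOn

theorem continuousOn_energyRatio (k : Edge) :
    ContinuousOn (fun u => (energyRatio (extendAngles θ₀ Λ u) k : ℂ)) (angleBox Λ) := by
  refine Complex.continuous_ofReal.comp_continuousOn ?_
  have h1 := (contDiffOn_extendAngles θ₀ Λ k).continuousOn
  have hs : ∀ u ∈ angleBox Λ, Real.sin (extendAngles θ₀ Λ u k) ≠ 0 := fun u hu => by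
    have h := extendAngles_mem hθ₀ hu k
    exact (Real.sin_pos_of_pos_of_lt_pi h.1 (by linarith [h.2, Real.pi_pos])).ne'
  exact ((Real.continuous_cos.comp_continuousOn h1).div (Real.continuous_sin.comp_continuousOn h1)
    hs).sub ((contDiffOn_energyDensity hθ₀ Λ k).continuousOn.div
      (Real.continuous_sin.comp_continuousOn h1) hs)

end ContinuousCoefficients

/-! ### Solutions are propagators -/

section Transfer

variable {Ω : Type*} [mΩ : MeasurableSpace Ω] {P : Measure Ω}

theorem IsItoIntegral.congr {ι : Type*} {K : Finset ι} {H H' : ι → ℝ≥0 → Ω → ℂ}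
    {W W' : ι → ℝ≥0 → Ω → ℝ} {I I' : ℝ≥0 → Ω → ℂ} (h : IsItoIntegral P K H W I)
    (hHW : ∀ᵐ ω ∂P, ∀ k ∈ K, ∀ t, H k t ω = H' k t ω ∧ W k t ω = W' k t ω)
    (hI : ∀ᵐ ω ∂P, ∀ t, I t ω = I' t ω) : IsItoIntegral P K H' W' I' := by
  intro t N τ h1 h2 h3 h4
  refine (h t N τ h1 h2 h3 h4).congr (fun n => ?_) ?_
  · filter_upwards [hHW] with ω hω
    refine Finset.sum_congr rfl fun k hk => Finset.sum_congr rfl fun l _ => ?_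
    rw [(hω k hk _).1, (hω k hk _).2, (hω k hk _).2]
  · filter_upwards [hI] with ω hω using hω t

end Transfer

section Differential

variable {Ω : Type*} [mΩ : MeasurableSpace Ω] {P : Measure Ω} [IsProbabilityMeasure P]
  {𝓕 : Filtration ℝ≥0 mΩ} {Λ : Finset Edge} {W : Edge → ℝ≥0 → Ω → ℝ} {T : Ω → ℝ≥0}

omit [IsProbabilityMeasure P] in
/-- The case of the product rule without a factor. -/
theorem HasItoDifferential.increment {Y : ℝ≥0 → Ω → ℂ} {H : Edge → ℝ≥0 → Ω → ℂ} {a : ℝ≥0 → Ω → ℂ}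
    (hI : HasItoDifferential 𝓕 P W T Λ Y H a) (t : ℝ≥0) :
    SubAE P fun n ω => Y t ω - Y 0 ω - ∑ l ∈ Finset.range (n + 1),
      (∑ k ∈ Λ, H k (grid t (n + 1) l) ω * (incr W T (grid t (n + 1)) k l ω : ℂ) +
        a (grid t (n + 1) l) ω * (lapse T (grid t (n + 1)) l ω : ℂ)) := by
  refine (hI.sum_mul t _ (RegularProcess.const 1)).congr (.of_forall fun ω n => ?_)
  have htel : Y t ω - Y 0 ω = ∑ l ∈ Finset.range (n + 1),
      (Y (grid t (n + 1) (l + 1)) ω - Y (grid t (n + 1) l) ω) := by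
    rw [Finset.sum_range_sub (fun l => Y (grid t (n + 1) l) ω), grid_self t n.succ_pos, grid_zero]
  rw [htel, ← Finset.sum_sub_distrib]
  refine Finset.sum_congr rfl fun l _ => ?_
  unfold itoError
  ring

omit [IsProbabilityMeasure P] in
theorem SubAE.sub {E : Type*} [NormedAddCommGroup E] {x y : ℕ → Ω → E} (hx : SubAE P x)
    (hy : SubAE P y) : SubAE P fun n ω => x n ω - y n ω := by
  refine SubAE.of_imp_two hx hy (.of_forall fun ω ks _ h h' => ?_)
  simpa using h.sub h'

omit [IsProbabilityMeasure P] in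
theorem SubAE.const_mul {x : ℕ → Ω → ℂ} (hx : SubAE P x) (c : ℂ) :
    SubAE P fun n ω => c * x n ω := by
  refine hx.of_imp_one (.of_forall fun ω ks _ h => ?_)
  simpa using h.const_mul c

omit [IsProbabilityMeasure P] in
theorem SubAE.ae_eq_zero_of_forall_eq {x : ℕ → Ω → ℂ} (hx : SubAE P x) {y : Ω → ℂ}
    (h : ∀ᵐ ω ∂P, ∀ n, x n ω = y ω) : ∀ᵐ ω ∂P, y ω = 0 :=
  (hx.congr (y := fun _ => y) h).eq_zero

end Differential

section Stopped

variable {Ω : Type*} [mΩ : MeasurableSpace Ω] {P : Measure Ω} [IsProbabilityMeasure P]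
  {𝓕 : Filtration ℝ≥0 mΩ} {Λ : Finset Edge} {W : Edge → ℝ≥0 → Ω → ℝ} {T : Ω → ℝ≥0}
  {θ₀ σ : Edge → ℝ}

omit [IsProbabilityMeasure P] in
theorem RegularProcess.of_stopped_angles (hW : BrownianSystem 𝓕 P Λ W)
    (hT : IsStoppingTime 𝓕 fun ω => (T ω : WithTop ℝ≥0)) (hσ : ∀ e, e ∉ Λ → σ e = 0)
    (hA : ∀ᵐ ω ∂P, ∀ t e, angle θ₀ σ W (min t (T ω)) ω e ∈ Set.Ioo 0 (Real.pi / 2))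
    {g : (Edge → ℝ) → ℂ}
    (hg : ContinuousOn (fun u => g (extendAngles θ₀ Λ u)) (angleBox Λ)) :
    RegularProcess 𝓕 P fun t ω => g (angle θ₀ σ W (min t (T ω)) ω) := by
  refine RegularProcess.of_angles hg (A := fun t ω => angle θ₀ σ W (min t (T ω)) ω) ?_ ?_ ?_ hA
  · intro t ω e he
    simp [angle, hσ e he]
  · intro e t
    exact stronglyMeasurable_const.add (stronglyMeasurable_const.mul (hW.adapted_stopped hT e t))
  · exact .of_forall fun ω e =>
      continuous_const.add (continuous_const.mul (hW.continuous_stopped e ω))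

variable (hθ₀ : ∀ e, θ₀ e ∈ Set.Ioo 0 (Real.pi / 2)) (hW : BrownianSystem 𝓕 P Λ W)
  (hT : IsStoppingTime 𝓕 fun ω => (T ω : WithTop ℝ≥0)) (hσ : ∀ e, e ∉ Λ → σ e = 0)
  (hA : ∀ᵐ ω ∂P, ∀ t e, angle θ₀ σ W (min t (T ω)) ω e ∈ Set.Ioo 0 (Real.pi / 2))
include hθ₀ hW hT hσ hA

omit [IsProbabilityMeasure P] in
theorem regularProcess_bracket {X : LiftedCorner → ℝ≥0 → Ω → ℂ}
    (hX : ∀ p, RegularProcess 𝓕 P (X p)) (k : Edge) (p : LiftedCorner) :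
    RegularProcess 𝓕 P fun t ω =>
      bracket (angle θ₀ σ W (min t (T ω)) ω) (fun q => X q t ω) k p :=
  ((hX _).mul (RegularProcess.of_stopped_angles hW hT hσ hA
      (g := fun θ => (fermion θ k k.aPlus p : ℂ)) (continuousOn_fermion hθ₀ Λ k k.aPlus p))).sub
    ((hX _).mul (RegularProcess.of_stopped_angles hW hT hσ hA
      (g := fun θ => (fermion θ k k.cPlus p : ℂ)) (continuousOn_fermion hθ₀ Λ k k.cPlus p)))

omit [IsProbabilityMeasure P] in
theorem regularProcess_diffusion {X : LiftedCorner → ℝ≥0 → Ω → ℂ}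
    (hX : ∀ p, RegularProcess 𝓕 P (X p)) (k : Edge) (p : LiftedCorner) :
    RegularProcess 𝓕 P fun t ω =>
      diffusion σ (angle θ₀ σ W (min t (T ω)) ω) (fun q => X q t ω) k p :=
  (RegularProcess.const _).mul (regularProcess_bracket hθ₀ hW hT hσ hA hX k p)

omit [IsProbabilityMeasure P] in
theorem regularProcess_drift {X : LiftedCorner → ℝ≥0 → Ω → ℂ}
    (hX : ∀ p, RegularProcess 𝓕 P (X p)) (p : LiftedCorner) :
    RegularProcess 𝓕 P fun t ω =>
      drift Λ σ (angle θ₀ σ W (min t (T ω)) ω) (fun q => X q t ω) p := by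
  simp_rw [drift_eq_sum]
  exact RegularProcess.sum Λ fun k _ => (regularProcess_diffusion hθ₀ hW hT hσ hA hX k p).mul
    ((RegularProcess.const _).mul (RegularProcess.of_stopped_angles hW hT hσ hA
      (g := fun θ => (energyRatio θ k : ℂ)) (continuousOn_energyRatio hθ₀ Λ k)))

variable {X : LiftedCorner → ℝ≥0 → Ω → ℂ} (hX : ∀ p, RegularProcess 𝓕 P (X p))
  (hI : ∀ p, HasItoDifferential 𝓕 P W T Λ (X p)
    (fun k t ω => diffusion σ (angle θ₀ σ W (min t (T ω)) ω) (fun q => X q t ω) k p)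
    (fun t ω => drift Λ σ (angle θ₀ σ W (min t (T ω)) ω) (fun q => X q t ω) p))
include hX hI

omit [IsProbabilityMeasure P] hX hθ₀ hσ hW hT in
theorem flip_of_hasItoDifferential (p : LiftedCorner) (t : ℝ≥0) :
    ∀ᵐ ω ∂P, X p.flip t ω + X p t ω = X p.flip 0 ω + X p 0 ω := by
  have h := ((hI p.flip).increment t).add ((hI p).increment t)
  have := h.ae_eq_zero_of_forall_eq
    (y := fun ω => X p.flip t ω + X p t ω - (X p.flip 0 ω + X p 0 ω)) (by
      filter_upwards [hA] with ω hω n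
      have e1 : ∀ l, (∑ k ∈ Λ, diffusion σ (angle θ₀ σ W (min (grid t (n + 1) l) (T ω)) ω)
            (fun q => X q (grid t (n + 1) l) ω) k p.flip *
              (incr W T (grid t (n + 1)) k l ω : ℂ) +
          drift Λ σ (angle θ₀ σ W (min (grid t (n + 1) l) (T ω)) ω)
            (fun q => X q (grid t (n + 1) l) ω) p.flip * (lapse T (grid t (n + 1)) l ω : ℂ)) =
          -(∑ k ∈ Λ, diffusion σ (angle θ₀ σ W (min (grid t (n + 1) l) (T ω)) ω)
            (fun q => X q (grid t (n + 1) l) ω) k p *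
              (incr W T (grid t (n + 1)) k l ω : ℂ) +
          drift Λ σ (angle θ₀ σ W (min (grid t (n + 1) l) (T ω)) ω)
            (fun q => X q (grid t (n + 1) l) ω) p * (lapse T (grid t (n + 1)) l ω : ℂ)) := by
        intro l
        simp_rw [diffusion_flip (hω _), drift_flip (hω _), neg_mul, Finset.sum_neg_distrib]
        ring
      rw [Finset.sum_congr rfl fun l _ => e1 l, Finset.sum_neg_distrib]
      ring)
  filter_upwards [this] with ω hω
  exact sub_eq_zero.1 hω

omit [IsProbabilityMeasure P] hX hθ₀ hW hT in
theorem defect_of_hasItoDifferential_of_notMem {e : Edge} (he : e ∉ Λ) (t : ℝ≥0) :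
    ∀ᵐ ω ∂P, defectD (θ₀ e) e (fun p => X p t ω) = defectD (θ₀ e) e (fun p => X p 0 ω) ∧
      defectB (θ₀ e) e (fun p => X p t ω) = defectB (θ₀ e) e (fun p => X p 0 ω) := by
  have ha := (hI e.aPlus).increment t
  have hb := (hI e.bPlus).increment t
  have hc := (hI e.cPlus).increment t
  have hd := (hI e.dPlus).increment t
  have h1 := ((hd.sub (ha.const_mul (Real.cos (θ₀ e)))).sub
    (hc.const_mul (Real.sin (θ₀ e)))).ae_eq_zero_of_forall_eq
      (y := fun ω => defectD (θ₀ e) e (fun p => X p t ω) - defectD (θ₀ e) e (fun p => X p 0 ω)) (by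
      filter_upwards [hA] with ω hω n
      rw [defectD_apply, defectD_apply]
      have e1 := fun l => (sum_diffusion_quad_of_notMem (hω (grid t (n + 1) l)) σ
        (fun q => X q (grid t (n + 1) l) ω) he
        fun k => (incr W T (grid t (n + 1)) k l ω : ℂ)).1
      have e2 := fun l => (drift_quad_of_notMem (hω (grid t (n + 1) l)) σ
        (fun q => X q (grid t (n + 1) l) ω) he).1
      have e3 : ∀ s, angle θ₀ σ W s ω e = θ₀ e := fun s => by simp [angle, hσ e he]
      simp only [e3] at e1 e2
      simp_rw [e1, e2, Finset.sum_add_distrib, add_mul, Finset.sum_add_distrib, mul_assoc,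
        ← Finset.mul_sum]
      ring)
  have h2 := ((hb.sub (hc.const_mul (Real.cos (θ₀ e)))).add
    (ha.const_mul (Real.sin (θ₀ e)))).ae_eq_zero_of_forall_eq
      (y := fun ω => defectB (θ₀ e) e (fun p => X p t ω) - defectB (θ₀ e) e (fun p => X p 0 ω)) (by
      filter_upwards [hA] with ω hω n
      rw [defectB_apply, defectB_apply]
      have e1 := fun l => (sum_diffusion_quad_of_notMem (hω (grid t (n + 1) l)) σ
        (fun q => X q (grid t (n + 1) l) ω) he
        fun k => (incr W T (grid t (n + 1)) k l ω : ℂ)).2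
      have e2 := fun l => (drift_quad_of_notMem (hω (grid t (n + 1) l)) σ
        (fun q => X q (grid t (n + 1) l) ω) he).2
      have e3 : ∀ s, angle θ₀ σ W s ω e = θ₀ e := fun s => by simp [angle, hσ e he]
      simp only [e3] at e1 e2
      simp_rw [e1, e2, Finset.sum_add_distrib, sub_mul, Finset.sum_sub_distrib, mul_assoc,
        ← Finset.mul_sum]
      ring)
  filter_upwards [h1, h2] with ω h1 h2
  exact ⟨sub_eq_zero.1 h1, sub_eq_zero.1 h2⟩

/-- Along a solution, the defects at the quads of the edges with random angles are constant: this is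
the product rule, all the terms of which cancel. -/
theorem defect_of_hasItoDifferential {e : Edge} (he : e ∈ Λ) (t : ℝ≥0) :
    ∀ᵐ ω ∂P, defectD (angle θ₀ σ W (min t (T ω)) ω e) e (fun p => X p t ω) =
        defectD (angle θ₀ σ W (min 0 (T ω)) ω e) e (fun p => X p 0 ω) ∧
      defectB (angle θ₀ σ W (min t (T ω)) ω e) e (fun p => X p t ω) =
        defectB (angle θ₀ σ W (min 0 (T ω)) ω e) e (fun p => X p 0 ω) := by
  have hb := (hI e.bPlus).increment t
  have hd := (hI e.dPlus).increment t
  have hprod : ∀ {f f₁ f₂ : ℝ → ℂ} (_ : TaylorBound f f₁ f₂) (p : LiftedCorner),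
      SubAE P fun n ω => f (angle θ₀ σ W (min t (T ω)) ω e) * X p t ω -
        f (angle θ₀ σ W (min 0 (T ω)) ω e) * X p 0 ω -
        ∑ l ∈ Finset.range (n + 1), productTerm W T Λ f f₁ f₂
          (fun t ω => angle θ₀ σ W (min t (T ω)) ω e) (σ e) e (X p)
          (fun k t ω => diffusion σ (angle θ₀ σ W (min t (T ω)) ω) (fun q => X q t ω) k p)
          (fun t ω => drift Λ σ (angle θ₀ σ W (min t (T ω)) ω) (fun q => X q t ω) p)
          (grid t (n + 1)) l ω := fun hf p =>
    HasItoDifferential.product_rule hW hT hf he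
      (θ := fun t ω => angle θ₀ σ W (min t (T ω)) ω e) (x₀ := θ₀ e) (fun t ω => rfl) (hX p)
      (fun k _ => regularProcess_diffusion hθ₀ hW hT hσ hA hX k p)
      (regularProcess_drift hθ₀ hW hT hσ hA hX p) (hI p) t
  have h1 := ((hd.sub (hprod taylorBound_cos e.aPlus)).sub
    (hprod taylorBound_sin e.cPlus)).ae_eq_zero_of_forall_eq
      (y := fun ω => defectD (angle θ₀ σ W (min t (T ω)) ω e) e (fun p => X p t ω) -
        defectD (angle θ₀ σ W (min 0 (T ω)) ω e) e (fun p => X p 0 ω)) (by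
      filter_upwards [hA] with ω hω n
      rw [defectD_apply, defectD_apply]
      have e1 : ∀ l,
          (∑ k ∈ Λ, diffusion σ (angle θ₀ σ W (min (grid t (n + 1) l) (T ω)) ω)
            (fun q => X q (grid t (n + 1) l) ω) k e.dPlus *
              (incr W T (grid t (n + 1)) k l ω : ℂ) +
          drift Λ σ (angle θ₀ σ W (min (grid t (n + 1) l) (T ω)) ω)
            (fun q => X q (grid t (n + 1) l) ω) e.dPlus * (lapse T (grid t (n + 1)) l ω : ℂ)) =
          productTerm W T Λ (fun x => (Real.cos x : ℂ)) (fun x => (-Real.sin x : ℝ))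
            (fun x => (-Real.cos x : ℝ))
            (fun t ω => angle θ₀ σ W (min t (T ω)) ω e) (σ e) e (X e.aPlus)
            (fun k t ω => diffusion σ (angle θ₀ σ W (min t (T ω)) ω) (fun q => X q t ω) k e.aPlus)
            (fun t ω => drift Λ σ (angle θ₀ σ W (min t (T ω)) ω) (fun q => X q t ω) e.aPlus)
            (grid t (n + 1)) l ω +
          productTerm W T Λ (fun x => (Real.sin x : ℂ)) (fun x => (Real.cos x : ℝ))
            (fun x => (-Real.sin x : ℝ))
            (fun t ω => angle θ₀ σ W (min t (T ω)) ω e) (σ e) e (X e.cPlus)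
            (fun k t ω => diffusion σ (angle θ₀ σ W (min t (T ω)) ω) (fun q => X q t ω) k e.cPlus)
            (fun t ω => drift Λ σ (angle θ₀ σ W (min t (T ω)) ω) (fun q => X q t ω) e.cPlus)
            (grid t (n + 1)) l ω := by
        intro l
        have e2 := (sum_diffusion_quad (hω (grid t (n + 1) l)) σ
          (fun q => X q (grid t (n + 1) l) ω) he
          fun k => (incr W T (grid t (n + 1)) k l ω : ℂ)).1
        have e3 := (drift_quad (hω (grid t (n + 1) l)) σ
          (fun q => X q (grid t (n + 1) l) ω) he).1
        unfold productTerm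
        simp only [e2]
        push_cast at e3 ⊢
        linear_combination (lapse T (grid t (n + 1)) l ω : ℂ) * e3
      rw [Finset.sum_congr rfl fun l _ => e1 l, Finset.sum_add_distrib]
      ring)
  have h2 := ((hb.sub (hprod taylorBound_cos e.cPlus)).add
    (hprod taylorBound_sin e.aPlus)).ae_eq_zero_of_forall_eq
      (y := fun ω => defectB (angle θ₀ σ W (min t (T ω)) ω e) e (fun p => X p t ω) -
        defectB (angle θ₀ σ W (min 0 (T ω)) ω e) e (fun p => X p 0 ω)) (by
      filter_upwards [hA] with ω hω n
      rw [defectB_apply, defectB_apply]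
      have e1 : ∀ l,
          (∑ k ∈ Λ, diffusion σ (angle θ₀ σ W (min (grid t (n + 1) l) (T ω)) ω)
            (fun q => X q (grid t (n + 1) l) ω) k e.bPlus *
              (incr W T (grid t (n + 1)) k l ω : ℂ) +
          drift Λ σ (angle θ₀ σ W (min (grid t (n + 1) l) (T ω)) ω)
            (fun q => X q (grid t (n + 1) l) ω) e.bPlus * (lapse T (grid t (n + 1)) l ω : ℂ)) =
          productTerm W T Λ (fun x => (Real.cos x : ℂ)) (fun x => (-Real.sin x : ℝ))
            (fun x => (-Real.cos x : ℝ))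
            (fun t ω => angle θ₀ σ W (min t (T ω)) ω e) (σ e) e (X e.cPlus)
            (fun k t ω => diffusion σ (angle θ₀ σ W (min t (T ω)) ω) (fun q => X q t ω) k e.cPlus)
            (fun t ω => drift Λ σ (angle θ₀ σ W (min t (T ω)) ω) (fun q => X q t ω) e.cPlus)
            (grid t (n + 1)) l ω -
          productTerm W T Λ (fun x => (Real.sin x : ℂ)) (fun x => (Real.cos x : ℝ))
            (fun x => (-Real.sin x : ℝ))
            (fun t ω => angle θ₀ σ W (min t (T ω)) ω e) (σ e) e (X e.aPlus)
            (fun k t ω => diffusion σ (angle θ₀ σ W (min t (T ω)) ω) (fun q => X q t ω) k e.aPlus)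
            (fun t ω => drift Λ σ (angle θ₀ σ W (min t (T ω)) ω) (fun q => X q t ω) e.aPlus)
            (grid t (n + 1)) l ω := by
        intro l
        have e2 := (sum_diffusion_quad (hω (grid t (n + 1) l)) σ
          (fun q => X q (grid t (n + 1) l) ω) he
          fun k => (incr W T (grid t (n + 1)) k l ω : ℂ)).2
        have e3 := (drift_quad (hω (grid t (n + 1) l)) σ
          (fun q => X q (grid t (n + 1) l) ω) he).2
        unfold productTerm
        simp only [e2]
        push_cast at e3 ⊢
        linear_combination (lapse T (grid t (n + 1)) l ω : ℂ) * e3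
      rw [Finset.sum_congr rfl fun l _ => e1 l, Finset.sum_sub_distrib]
      ring)
  filter_upwards [h1, h2] with ω h1 h2
  exact ⟨sub_eq_zero.1 h1, sub_eq_zero.1 h2⟩

end Stopped

instance : Countable Edge := by
  refine Function.Injective.countable (β := Bool × ℤ × ℤ)
    (f := fun e => match e with | .h m n => (true, m, n) | .v m n => (false, m, n)) ?_
  rintro (⟨m, n⟩ | ⟨m, n⟩) (⟨m', n'⟩ | ⟨m', n'⟩) h <;> simp_all

instance : Countable LiftedCorner := by
  refine Function.Injective.countable (β := ℤ × ℤ × ℤˣ) (f := fun p => (p.i, p.j, p.sgn)) ?_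
  rintro ⟨i, j, s⟩ ⟨i', j', s'⟩ h
  simp_all

section Solutions

variable {Ω : Type*} [mΩ : MeasurableSpace Ω] {P : Measure Ω} [IsProbabilityMeasure P]
  {Λ : Finset Edge} {W : Edge → ℝ≥0 → Ω → ℝ} {T : Ω → ℝ≥0} {θ₀ σ : Edge → ℝ}

/-- The solution, stopped at `T`, satisfies the propagation equation at all times. -/
theorem propagation_of_hasItoDifferential {𝓕 : Filtration ℝ≥0 mΩ}
    (hθ₀ : ∀ e, θ₀ e ∈ Set.Ioo 0 (Real.pi / 2)) (hW : BrownianSystem 𝓕 P Λ W)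
    (hT : IsStoppingTime 𝓕 fun ω => (T ω : WithTop ℝ≥0)) (hσ : ∀ e, e ∉ Λ → σ e = 0)
    (hA : ∀ᵐ ω ∂P, ∀ t e, angle θ₀ σ W (min t (T ω)) ω e ∈ Set.Ioo 0 (Real.pi / 2))
    {X : LiftedCorner → ℝ≥0 → Ω → ℂ} (hX : ∀ p, RegularProcess 𝓕 P (X p))
    (hI : ∀ p, HasItoDifferential 𝓕 P W T Λ (X p)
      (fun k t ω => diffusion σ (angle θ₀ σ W (min t (T ω)) ω) (fun q => X q t ω) k p)
      (fun t ω => drift Λ σ (angle θ₀ σ W (min t (T ω)) ω) (fun q => X q t ω) p))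
    {Y₀ : LiftedCorner → ℂ} (hY₀ : Propagation θ₀ Y₀) (hX0 : ∀ᵐ ω ∂P, ∀ p, X p 0 ω = Y₀ p) :
    ∀ᵐ ω ∂P, ∀ t, Propagation (angle θ₀ σ W (min t (T ω)) ω) fun p => X p t ω := by
  obtain ⟨D, hDc, hD⟩ := TopologicalSpace.exists_countable_dense ℝ≥0
  have h0 : ∀ ω, angle θ₀ σ W (min 0 (T ω)) ω = θ₀ := fun ω => by
    ext e
    simp [angle, hW.zero]
  obtain ⟨hflip₀, hdef₀⟩ := (Propagation.iff_defect hθ₀).1 hY₀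
  have hflip : ∀ᵐ ω ∂P, ∀ p : LiftedCorner, ∀ t ∈ D, X p.flip t ω + X p t ω = 0 := by
    refine ae_all_iff.2 fun p => (ae_ball_iff hDc).2 fun t _ => ?_
    filter_upwards [flip_of_hasItoDifferential hA hI p t, hX0] with ω h h0
    rw [h, h0, h0, hflip₀, neg_add_cancel]
  have hdef : ∀ᵐ ω ∂P, ∀ e, ∀ t ∈ D,
      defectD (angle θ₀ σ W (min t (T ω)) ω e) e (fun p => X p t ω) = 0 ∧
        defectB (angle θ₀ σ W (min t (T ω)) ω e) e (fun p => X p t ω) = 0 := by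
    refine ae_all_iff.2 fun e => (ae_ball_iff hDc).2 fun t _ => ?_
    by_cases he : e ∈ Λ
    · filter_upwards [defect_of_hasItoDifferential hθ₀ hW hT hσ hA hX hI he t, hX0] with ω h h1
      simp_rw [h0, h1] at h
      exact ⟨h.1.trans (hdef₀ e).1, h.2.trans (hdef₀ e).2⟩
    · filter_upwards [defect_of_hasItoDifferential_of_notMem hσ hA hI he t, hX0] with ω h h1
      have e3 : ∀ s, angle θ₀ σ W s ω e = θ₀ e := fun s => by simp [angle, hσ e he]
      simp_rw [h1] at h
      rw [e3]
      exact ⟨h.1.trans (hdef₀ e).1, h.2.trans (hdef₀ e).2⟩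
  filter_upwards [hflip, hdef, hA, ae_all_iff.2 fun p => (hX p).continuous] with ω h1 h2 hω hc t
  have hcos : ∀ e, Continuous fun t =>
      (Real.cos (angle θ₀ σ W (min t (T ω)) ω e) : ℂ) := fun e =>
    Complex.continuous_ofReal.comp (Real.continuous_cos.comp
      (continuous_const.add (continuous_const.mul (hW.continuous_stopped e ω))))
  have hsin : ∀ e, Continuous fun t =>
      (Real.sin (angle θ₀ σ W (min t (T ω)) ω e) : ℂ) := fun e =>
    Complex.continuous_ofReal.comp (Real.continuous_sin.comp
      (continuous_const.add (continuous_const.mul (hW.continuous_stopped e ω))))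
  refine (Propagation.iff_defect (hω t)).2 ⟨fun p => ?_, fun e => ⟨?_, ?_⟩⟩
  · have := congrFun (Continuous.ext_on hD ((hc p.flip).add (hc p)) continuous_const
      fun t ht => h1 p t ht) t
    exact eq_neg_of_add_eq_zero_left this
  · exact congrFun (Continuous.ext_on hD (f := fun t =>
      defectD (angle θ₀ σ W (min t (T ω)) ω e) e (fun p => X p t ω)) (g := fun _ => 0)
      (((hc _).sub ((hcos e).mul (hc _))).sub ((hsin e).mul (hc _))) continuous_const
      fun t ht => (h2 e t ht).1) t
  · exact congrFun (Continuous.ext_on hD (f := fun t =>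
      defectB (angle θ₀ σ W (min t (T ω)) ω e) e (fun p => X p t ω)) (g := fun _ => 0)
      (((hc _).sub ((hcos e).mul (hc _))).add ((hsin e).mul (hc _))) continuous_const
      fun t ht => (h2 e t ht).2) t

omit mΩ in
theorem angle_congr {B : Edge → ℝ≥0 → Ω → ℝ} (hσ : ∀ e, e ∉ Λ → σ e = 0) {ω : Ω}
    (h : ∀ k ∈ Λ, ∀ t, W k t ω = B k t ω) (t : ℝ≥0) : angle θ₀ σ W t ω = angle θ₀ σ B t ω := by
  ext e
  by_cases he : e ∈ Λ
  · simp only [angle, h e he]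
  · simp [angle, hσ e he]

/-- On the interval of integration, the solution is not affected by stopping. -/
theorem integral_stopped {E : Type*} [NormedAddCommGroup E] [NormedSpace ℝ E] (f : ℝ≥0 → E)
    (t T : ℝ≥0) : ∫ s in (0 : ℝ)..((min t T : ℝ≥0) : ℝ), f (min s.toNNReal T) =
      ∫ s in (0 : ℝ)..((min t T : ℝ≥0) : ℝ), f s.toNNReal := by
  refine intervalIntegral.integral_congr fun s hs => ?_
  rw [Set.uIcc_of_le (NNReal.coe_nonneg _)] at hs
  have : s.toNNReal ≤ T := (Real.toNNReal_le_iff_le_coe.2 hs.2).trans (min_le_right _ _)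
  simp only [min_eq_left this]

theorem IsSDESolution.exists_isSEmbedding {B : Edge → ℝ≥0 → Ω → ℝ}
    (hBm : ∀ e t, Measurable (B e t)) (hB : ∀ e, IsBrownianReal (B e) P)
    (hind : iIndepFun (fun (e : Edge) (ω : Ω) (t : ℝ≥0) => B e t ω) P)
    (hθ₀ : ∀ e, θ₀ e ∈ Set.Ioo 0 (Real.pi / 2)) {Y₀ : LiftedCorner → ℂ}
    (hY₀ : Propagation θ₀ Y₀) (hσ : ∀ e, e ∉ Λ → σ e = 0) {Y : LiftedCorner → ℝ≥0 → Ω → ℂ}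
    (hS : IsSDESolution P B hBm Λ θ₀ σ Y₀ T Y) :
    ∀ᵐ ω ∂P, ∀ s ≤ T ω, ∃ S : Vertex ⊕ Face → ℂ,
      IsSEmbedding (angle θ₀ σ B s ω) (fun p => Y p s ω) S := by
  obtain ⟨W, hW, hWB⟩ := exists_brownianSystem hBm hB hind Λ
  have hT := hS.stopping
  have hA : ∀ᵐ ω ∂P, ∀ t e, angle θ₀ σ W (min t (T ω)) ω e ∈ Set.Ioo 0 (Real.pi / 2) := by
    filter_upwards [hS.angle_mem, hWB] with ω h h' t e
    rw [angle_congr hσ h']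
    exact h _ (min_le_right _ _) e
  have hX : ∀ p, RegularProcess (completedFiltration P B hBm Λ) P
      fun t ω => Y p (min t (T ω)) ω := fun p => .of_adapted (by
    filter_upwards [hS.continuous] with ω h
    exact (h p).comp_continuous (continuous_id.min continuous_const) fun t => Set.mem_Iic.2 (min_le_right _ _))
    (hS.adapted p)
  have hI : ∀ p, HasItoDifferential (completedFiltration P B hBm Λ) P W T Λ
      (fun t ω => Y p (min t (T ω)) ω)
      (fun k t ω => diffusion σ (angle θ₀ σ W (min t (T ω)) ω)
        (fun q => Y q (min t (T ω)) ω) k p)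
      (fun t ω => drift Λ σ (angle θ₀ σ W (min t (T ω)) ω) (fun q => Y q (min t (T ω)) ω) p) :=
    fun p => by
    have h := (hS.equation p).congr (I' := fun t ω => Y p (min t (T ω)) ω - Y₀ p -
      ∫ s in (0 : ℝ)..((min t (T ω) : ℝ≥0) : ℝ), drift Λ σ (angle θ₀ σ B s.toNNReal ω)
        (fun q => Y q s.toNNReal ω) p)
      (H' := fun k t ω => diffusion σ (angle θ₀ σ W (min t (T ω)) ω)
        (fun q => Y q (min t (T ω)) ω) k p) (W' := fun k t ω => W k (min t (T ω)) ω) (by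
        filter_upwards [hWB] with ω h' k hk t
        rw [angle_congr hσ h', h' k hk]
        exact ⟨rfl, rfl⟩) (.of_forall fun _ _ => rfl)
    refine hasItoDifferential_of_isItoIntegral hW hT
      (fun k _ => regularProcess_diffusion hθ₀ hW hT hσ hA hX k p)
      (regularProcess_drift hθ₀ hW hT hσ hA hX p).continuous h (y₀ := Y₀ p) ?_
    filter_upwards [hWB] with ω h' t
    congr 1
    simp_rw [angle_congr hσ h']
    exact (integral_stopped (fun s => drift Λ σ (angle θ₀ σ B s ω) (fun q => Y q s ω) p)
      t (T ω)).symm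
  have hX0 : ∀ᵐ ω ∂P, ∀ p, Y p (min 0 (T ω)) ω = Y₀ p := by
    filter_upwards [hS.initial] with ω h p
    rw [min_eq_left zero_le, h]
  filter_upwards [propagation_of_hasItoDifferential hθ₀ hW hT hσ hA hX hI hY₀ hX0, hA, hWB]
    with ω h hω h' s hs
  have h1 := h s
  have h2 := hω s
  rw [min_eq_left hs, angle_congr hσ h'] at h1 h2
  exact Propagation.exists_isSEmbedding h2 h1

end Solutions

/-! ### Expansion of the deformation -/

section Expansion

theorem norm_mul_add_mul_le {x y f g : ℂ} {A M : ℝ} (hx : ‖x‖ ≤ A) (hy : ‖y‖ ≤ A) (hf : ‖f‖ ≤ M)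
    (hg : ‖g‖ ≤ M) : ‖x * f + y * g‖ ≤ 2 * A * M := by
  have hA : 0 ≤ A := (norm_nonneg _).trans hx
  calc _ ≤ ‖x‖ * ‖f‖ + ‖y‖ * ‖g‖ := (norm_add_le _ _).trans (by rw [norm_mul, norm_mul])
    _ ≤ A * M + A * M := by gcongr
    _ = _ := by ring

theorem norm_mul_sub_mul_le {x y f g : ℂ} {A M : ℝ} (hx : ‖x‖ ≤ A) (hy : ‖y‖ ≤ A) (hf : ‖f‖ ≤ M)
    (hg : ‖g‖ ≤ M) : ‖x * f - y * g‖ ≤ 2 * A * M := by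
  have := norm_mul_add_mul_le hx (y := -y) (by rwa [norm_neg]) hf hg
  rwa [neg_mul, ← sub_eq_add_neg] at this

theorem norm_sum_le_mul_sum {ι : Type*} (s : Finset ι) {f : ι → ℂ} {g : ι → ℝ} (C : ℝ)
    (h : ∀ i ∈ s, ‖f i‖ ≤ C * g i) : ‖∑ i ∈ s, f i‖ ≤ C * ∑ i ∈ s, g i := by
  rw [Finset.mul_sum]
  exact norm_sum_le_of_le s h

variable {Λ : Finset Edge} {X X' : LiftedCorner → ℂ} {F G : Edge → LiftedCorner → ℂ}
  {δ : Edge → ℝ} {M : ℝ}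

/-- Second order expansion of a family `X` whose increments are given by the formula of
`deformation_sub_deformation`: the increment in the right-hand side is expanded to first order, by
means of the same formula. -/
theorem norm_increment_sub_le (hM : 1 ≤ M)
    (hX : ∀ p, X' p - X p = ∑ k ∈ Λ, (1 / 2 : ℂ) *
      (((1 - Real.cos (δ k)) * X' k.aPlus - Real.sin (δ k) * X' k.cPlus) * F k p +
        ((1 - Real.cos (δ k)) * X' k.cPlus + Real.sin (δ k) * X' k.aPlus) * G k p))
    (hXM : ∀ k ∈ Λ, ‖X k.aPlus‖ ≤ M ∧ ‖X k.cPlus‖ ≤ M)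
    (hXM' : ∀ k ∈ Λ, ‖X' k.aPlus‖ ≤ M ∧ ‖X' k.cPlus‖ ≤ M) (hδ : ∀ k ∈ Λ, |δ k| ≤ 1)
    {p : LiftedCorner} (hp : ∀ k ∈ Λ, ‖F k p‖ ≤ M ∧ ‖G k p‖ ≤ M)
    (hac : ∀ j ∈ Λ, ∀ k ∈ Λ, (‖F k j.aPlus‖ ≤ M ∧ ‖G k j.aPlus‖ ≤ M) ∧
      ‖F k j.cPlus‖ ≤ M ∧ ‖G k j.cPlus‖ ≤ M) :
    ‖X' p - X p - ∑ k ∈ Λ, (-(1 / 2) * δ k * (X k.cPlus * F k p - X k.aPlus * G k p) +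
      1 / 4 * δ k ^ 2 * (X k.aPlus * F k p + X k.cPlus * G k p) +
      ∑ j ∈ Λ, 1 / 4 * δ j * δ k * ((X j.cPlus * F j k.cPlus - X j.aPlus * G j k.cPlus) * F k p -
        (X j.cPlus * F j k.aPlus - X j.aPlus * G j k.aPlus) * G k p))‖ ≤
      7 * M ^ 4 * (∑ k ∈ Λ, |δ k|) ^ 3 := by
  set D := ∑ k ∈ Λ, |δ k| with hD
  have hD0 : 0 ≤ D := Finset.sum_nonneg fun _ _ => abs_nonneg _
  have hM0 : 0 ≤ M := by linarith
  have hδD : ∀ k ∈ Λ, |δ k| ≤ D := fun k hk =>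
    Finset.single_le_sum (f := fun k => |δ k|) (fun _ _ => abs_nonneg _) hk
  have hcube : ∀ k ∈ Λ, |δ k| ^ 3 ≤ |δ k| ^ 2 := fun k hk =>
    pow_le_pow_of_le_one (abs_nonneg _) (hδ k hk) (by norm_num)
  have hs3 : ∀ k ∈ Λ, ‖(Real.sin (δ k) : ℂ) - δ k‖ ≤ |δ k| ^ 3 / 4 := fun k hk => by
    rw [← Complex.ofReal_sub, Complex.norm_real, Real.norm_eq_abs]
    exact abs_sin_sub_le (hδ k hk)
  have hc3 : ∀ k ∈ Λ, ‖(1 : ℂ) - Real.cos (δ k) - δ k ^ 2 / 2‖ ≤ |δ k| ^ 3 / 4 := fun k hk => by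
    have e : (1 : ℂ) - Real.cos (δ k) - δ k ^ 2 / 2 =
        -((Real.cos (δ k) - (1 - δ k ^ 2 / 2) : ℝ) : ℂ) := by push_cast; ring
    rw [e, norm_neg, Complex.norm_real, Real.norm_eq_abs]
    exact abs_cos_sub_le (hδ k hk)
  have hc2 : ∀ k ∈ Λ, ‖(1 : ℂ) - Real.cos (δ k)‖ ≤ |δ k| ^ 2 := fun k hk => by
    have e : (1 : ℂ) - Real.cos (δ k) =
        (1 - Real.cos (δ k) - δ k ^ 2 / 2) + ((δ k ^ 2 / 2 : ℝ) : ℂ) := by push_cast; ring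
    rw [e]
    refine (norm_add_le_of_le (hc3 k hk) (le_refl _)).trans ?_
    have e2 : |δ k ^ 2 / 2| = |δ k| ^ 2 / 2 := by
      rw [abs_of_nonneg (by positivity), sq_abs]
    rw [Complex.norm_real, Real.norm_eq_abs, e2]
    linarith [hcube k hk, sq_nonneg |δ k|]
  have hδn : ∀ k, ‖(δ k : ℂ)‖ = |δ k| := fun k => by rw [Complex.norm_real, Real.norm_eq_abs]
  -- inserting `X' - X = O(D)` and then its first order expansion into the right-hand side of `hX`
  -- gains one order each time
  have h1 : ∀ q, (∀ k ∈ Λ, ‖F k q‖ ≤ M ∧ ‖G k q‖ ≤ M) → ‖X' q - X q‖ ≤ 2 * M ^ 2 * D := by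
    intro q hq
    rw [hX, hD]
    refine norm_sum_le_mul_sum Λ _ fun k hk => ?_
    have hs : ‖(Real.sin (δ k) : ℂ)‖ ≤ |δ k| := by
      rw [Complex.norm_real, Real.norm_eq_abs]; exact Real.abs_sin_le_abs
    have hc : ‖(1 : ℂ) - Real.cos (δ k)‖ ≤ |δ k| :=
      (hc2 k hk).trans (by nlinarith [hδ k hk, abs_nonneg (δ k)])
    have hA1 : ‖(1 - Real.cos (δ k)) * X' k.aPlus - Real.sin (δ k) * X' k.cPlus‖ ≤
        2 * |δ k| * M := norm_mul_sub_mul_le hc hs (hXM' k hk).1 (hXM' k hk).2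
    have hA2 : ‖(1 - Real.cos (δ k)) * X' k.cPlus + Real.sin (δ k) * X' k.aPlus‖ ≤
        2 * |δ k| * M := norm_mul_add_mul_le hc hs (hXM' k hk).2 (hXM' k hk).1
    have h := norm_mul_add_mul_le hA1 hA2 (hq k hk).1 (hq k hk).2
    rw [norm_mul]
    have e : ‖(1 / 2 : ℂ)‖ = 1 / 2 := by norm_num
    rw [e]
    linarith
  have h2 : ∀ q, (∀ k ∈ Λ, ‖F k q‖ ≤ M ∧ ‖G k q‖ ≤ M) →
      ‖X' q - X q + ∑ j ∈ Λ, 1 / 2 * δ j * (X j.cPlus * F j q - X j.aPlus * G j q)‖ ≤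
        4 * M ^ 3 * D ^ 2 := by
    intro q hq
    have e : X' q - X q + ∑ j ∈ Λ, 1 / 2 * δ j * (X j.cPlus * F j q - X j.aPlus * G j q) =
        ∑ k ∈ Λ, 1 / 2 * ((1 - Real.cos (δ k)) * (X' k.aPlus * F k q + X' k.cPlus * G k q) -
          (Real.sin (δ k) - δ k) * (X' k.cPlus * F k q - X' k.aPlus * G k q) -
          δ k * ((X' k.cPlus - X k.cPlus) * F k q - (X' k.aPlus - X k.aPlus) * G k q)) := by
      rw [hX, ← Finset.sum_add_distrib]
      exact Finset.sum_congr rfl fun k _ => by ring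
    have hb : ∀ k ∈ Λ, ‖1 / 2 * ((1 - Real.cos (δ k)) *
          (X' k.aPlus * F k q + X' k.cPlus * G k q) -
          (Real.sin (δ k) - δ k) * (X' k.cPlus * F k q - X' k.aPlus * G k q) -
          δ k * ((X' k.cPlus - X k.cPlus) * F k q - (X' k.aPlus - X k.aPlus) * G k q))‖ ≤
        (4 * M ^ 3 * D) * |δ k| := by
      intro k hk
      have b1 := norm_mul_add_mul_le (hXM' k hk).1 (hXM' k hk).2 (hq k hk).1 (hq k hk).2
      have b2 := norm_mul_sub_mul_le (hXM' k hk).2 (hXM' k hk).1 (hq k hk).1 (hq k hk).2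
      have b3 := norm_mul_sub_mul_le (h1 _ fun j hj => (hac k hk j hj).2)
        (h1 _ fun j hj => (hac k hk j hj).1) (hq k hk).1 (hq k hk).2
      have e2 : ‖(1 / 2 : ℂ)‖ = 1 / 2 := by norm_num
      have c1 := mul_le_mul (hc2 k hk) b1 (norm_nonneg _) (by positivity)
      have c2 := mul_le_mul (hs3 k hk) b2 (norm_nonneg _) (by positivity)
      have c3 := mul_le_mul (hδn k).le b3 (norm_nonneg _) (by positivity)
      rw [norm_mul, e2]
      refine (mul_le_mul_of_nonneg_left (norm_sub_le_of_le (norm_sub_le_of_le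
        ((norm_mul_le _ _).trans c1) ((norm_mul_le _ _).trans c2)) ((norm_mul_le _ _).trans c3))
        (by norm_num)).trans ?_
      have d1 : |δ k| ^ 2 ≤ D * |δ k| := by
        rw [sq]; exact mul_le_mul_of_nonneg_right (hδD k hk) (abs_nonneg _)
      have hMM : M ^ 2 ≤ M ^ 3 := pow_le_pow_right₀ hM (by norm_num)
      have hDd : 0 ≤ D * |δ k| := by positivity
      have d2 : |δ k| ^ 2 * M ^ 2 ≤ D * |δ k| * M ^ 3 :=
        mul_le_mul d1 hMM (by positivity) hDd
      have d3 : |δ k| ^ 3 * M ^ 2 ≤ |δ k| ^ 2 * M ^ 2 :=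
        mul_le_mul_of_nonneg_right (hcube k hk) (by positivity)
      nlinarith [d2, d3]
    rw [e]
    refine (norm_sum_le_mul_sum Λ _ hb).trans_eq ?_
    rw [← hD]; ring
  have e : X' p - X p - ∑ k ∈ Λ, (-(1 / 2) * δ k * (X k.cPlus * F k p - X k.aPlus * G k p) +
      1 / 4 * δ k ^ 2 * (X k.aPlus * F k p + X k.cPlus * G k p) +
      ∑ j ∈ Λ, 1 / 4 * δ j * δ k * ((X j.cPlus * F j k.cPlus - X j.aPlus * G j k.cPlus) * F k p -
        (X j.cPlus * F j k.aPlus - X j.aPlus * G j k.aPlus) * G k p)) =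
      ∑ k ∈ Λ, 1 / 2 * ((1 - Real.cos (δ k) - δ k ^ 2 / 2) *
          (X k.aPlus * F k p + X k.cPlus * G k p) +
        (1 - Real.cos (δ k)) *
          ((X' k.aPlus - X k.aPlus) * F k p + (X' k.cPlus - X k.cPlus) * G k p) -
        (Real.sin (δ k) - δ k) * (X' k.cPlus * F k p - X' k.aPlus * G k p) -
        δ k * ((X' k.cPlus - X k.cPlus +
            ∑ j ∈ Λ, 1 / 2 * δ j * (X j.cPlus * F j k.cPlus - X j.aPlus * G j k.cPlus)) * F k p -
          (X' k.aPlus - X k.aPlus + ∑ j ∈ Λ, 1 / 2 * δ j *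
            (X j.cPlus * F j k.aPlus - X j.aPlus * G j k.aPlus)) * G k p)) := by
    rw [hX, ← Finset.sum_sub_distrib]
    refine Finset.sum_congr rfl fun k _ => ?_
    have e3 : ∑ j ∈ Λ, 1 / 4 * δ j * δ k *
        ((X j.cPlus * F j k.cPlus - X j.aPlus * G j k.cPlus) * F k p -
          (X j.cPlus * F j k.aPlus - X j.aPlus * G j k.aPlus) * G k p) = 1 / 2 * δ k *
        ((∑ j ∈ Λ, 1 / 2 * δ j * (X j.cPlus * F j k.cPlus - X j.aPlus * G j k.cPlus)) * F k p -
          (∑ j ∈ Λ, 1 / 2 * δ j * (X j.cPlus * F j k.aPlus - X j.aPlus * G j k.aPlus)) *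
            G k p) := by
      rw [Finset.sum_mul, Finset.sum_mul, ← Finset.sum_sub_distrib, Finset.mul_sum]
      exact Finset.sum_congr rfl fun j _ => by ring
    rw [e3]
    ring
  have hb : ∀ k ∈ Λ, ‖1 / 2 * ((1 - Real.cos (δ k) - δ k ^ 2 / 2) *
          (X k.aPlus * F k p + X k.cPlus * G k p) +
        (1 - Real.cos (δ k)) *
          ((X' k.aPlus - X k.aPlus) * F k p + (X' k.cPlus - X k.cPlus) * G k p) -
        (Real.sin (δ k) - δ k) * (X' k.cPlus * F k p - X' k.aPlus * G k p) -
        δ k * ((X' k.cPlus - X k.cPlus +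
            ∑ j ∈ Λ, 1 / 2 * δ j * (X j.cPlus * F j k.cPlus - X j.aPlus * G j k.cPlus)) * F k p -
          (X' k.aPlus - X k.aPlus + ∑ j ∈ Λ, 1 / 2 * δ j *
            (X j.cPlus * F j k.aPlus - X j.aPlus * G j k.aPlus)) * G k p))‖ ≤
      (7 * M ^ 4 * D ^ 2) * |δ k| := by
    intro k hk
    have b0 := norm_mul_add_mul_le (hXM k hk).1 (hXM k hk).2 (hp k hk).1 (hp k hk).2
    have b1 := norm_mul_add_mul_le (h1 _ fun j hj => (hac k hk j hj).1)
      (h1 _ fun j hj => (hac k hk j hj).2) (hp k hk).1 (hp k hk).2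
    have b2 := norm_mul_sub_mul_le (hXM' k hk).2 (hXM' k hk).1 (hp k hk).1 (hp k hk).2
    have b3 := norm_mul_sub_mul_le (h2 _ fun j hj => (hac k hk j hj).2)
      (h2 _ fun j hj => (hac k hk j hj).1) (hp k hk).1 (hp k hk).2
    have e2 : ‖(1 / 2 : ℂ)‖ = 1 / 2 := by norm_num
    have c0 := mul_le_mul (hc3 k hk) b0 (norm_nonneg _) (by positivity)
    have c1 := mul_le_mul (hc2 k hk) b1 (norm_nonneg _) (by positivity)
    have c2 := mul_le_mul (hs3 k hk) b2 (norm_nonneg _) (by positivity)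
    have c3 := mul_le_mul (hδn k).le b3 (norm_nonneg _) (by positivity)
    rw [norm_mul, e2]
    refine (mul_le_mul_of_nonneg_left (norm_sub_le_of_le (norm_sub_le_of_le (norm_add_le_of_le
      ((norm_mul_le _ _).trans c0) ((norm_mul_le _ _).trans c1)) ((norm_mul_le _ _).trans c2))
      ((norm_mul_le _ _).trans c3)) (by norm_num)).trans ?_
    have ha := abs_nonneg (δ k)
    have d1 : |δ k| ^ 2 ≤ D * |δ k| := by
      rw [sq]; exact mul_le_mul_of_nonneg_right (hδD k hk) ha
    have d1' : |δ k| ^ 3 ≤ D ^ 2 * |δ k| := by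
      calc |δ k| ^ 3 = |δ k| ^ 2 * |δ k| := by ring
        _ ≤ D ^ 2 * |δ k| := by gcongr; exact hδD k hk
    have hDd : 0 ≤ D ^ 2 * |δ k| := by positivity
    have d2 : |δ k| ^ 3 * M ^ 2 ≤ D ^ 2 * |δ k| * M ^ 4 :=
      mul_le_mul d1' (pow_le_pow_right₀ hM (by norm_num)) (by positivity) hDd
    have d3 : |δ k| ^ 2 * (M ^ 3 * D) ≤ D ^ 2 * |δ k| * M ^ 4 :=
      calc |δ k| ^ 2 * (M ^ 3 * D) ≤ D * |δ k| * (M ^ 4 * D) := by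
            gcongr
            · norm_num
        _ = _ := by ring
    have d4 : 0 ≤ D ^ 2 * |δ k| * M ^ 4 := by positivity
    nlinarith [d2, d3, d4]
  rw [e]
  refine (norm_sum_le_mul_sum Λ _ hb).trans_eq ?_
  rw [← hD]; ring

end Expansion

section ContinuousDeformation

variable {θ₀ : Edge → ℝ} (hθ₀ : ∀ e, θ₀ e ∈ Set.Ioo 0 (Real.pi / 2)) (Λ : Finset Edge)
include hθ₀

theorem continuousOn_deformation (Y : LiftedCorner → ℂ) (p : LiftedCorner) :
    ContinuousOn (fun u => deformation Λ Y (extendAngles θ₀ Λ u) p) (angleBox Λ) := by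
  have hc : ∀ k, ContinuousOn (fun u => (Real.cos (extendAngles θ₀ Λ u k) : ℂ)) (angleBox Λ) :=
    fun k => Complex.continuous_ofReal.comp_continuousOn
      (Real.continuous_cos.comp_continuousOn (contDiffOn_extendAngles θ₀ Λ k).continuousOn)
  have hs : ∀ k, ContinuousOn (fun u => (Real.sin (extendAngles θ₀ Λ u k) : ℂ)) (angleBox Λ) :=
    fun k => Complex.continuous_ofReal.comp_continuousOn
      (Real.continuous_sin.comp_continuousOn (contDiffOn_extendAngles θ₀ Λ k).continuousOn)
  simp only [deformation, Pi.sub_apply, correction_apply, coeffA_apply, coeffC_apply,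
    defectD_apply, defectB_apply, fundamental]
  refine continuousOn_const.sub (continuousOn_finsetSum _ fun k _ => ?_)
  have hA := continuousOn_fermion hθ₀ Λ k k.aPlus p
  have hC := continuousOn_fermion hθ₀ Λ k k.cPlus p
  have hck := hc k
  have hsk := hs k
  fun_prop

end ContinuousDeformation

/-! ### Hitting times -/

section Hitting

variable {Ω : Type*} [mΩ : MeasurableSpace Ω] {𝓕 : Filtration ℝ≥0 mΩ}

/-- The first time, at most `1`, at which a continuous process reaches a level. -/
theorem exists_isStoppingTime_le {m : ℝ≥0 → Ω → ℝ} (hm : StronglyAdapted 𝓕 m)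
    (hc : ∀ ω, Continuous fun t => m t ω) {c : ℝ} (h0 : ∀ ω, m 0 ω < c) :
    ∃ T : Ω → ℝ≥0, IsStoppingTime 𝓕 (fun ω => (T ω : WithTop ℝ≥0)) ∧ (∀ ω, 0 < T ω) ∧
      ∀ ω, ∀ t ≤ T ω, m t ω ≤ c := by
  obtain ⟨T, hmem, hle⟩ : ∃ T : Ω → ℝ≥0, (∀ ω, c ≤ m (T ω) ω ∨ T ω = 1) ∧
      ∀ ω t, c ≤ m t ω ∨ t = 1 → T ω ≤ t := by
    have hcl : ∀ ω, IsClosed {t : ℝ≥0 | c ≤ m t ω ∨ t = 1} := fun ω =>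
      (isClosed_le continuous_const (hc ω)).union isClosed_singleton
    exact ⟨fun ω => sInf {t | c ≤ m t ω ∨ t = 1}, fun ω =>
      (hcl ω).csInf_mem ⟨1, Or.inr rfl⟩ (OrderBot.bddBelow _),
      fun ω t ht => csInf_le (OrderBot.bddBelow _) ht⟩
  refine ⟨T, fun t => ?_, fun ω => ?_, fun ω t ht => ?_⟩
  · obtain ⟨D, hDc, hD⟩ := TopologicalSpace.exists_countable_dense ℝ≥0
    have key : {ω | (T ω : WithTop ℝ≥0) ≤ t} =
        {_ω | 1 ≤ t} ∪ ⋂ n : ℕ, ⋃ d ∈ D, {ω | c - 1 / ((n : ℝ) + 1) < m (min t d) ω} := by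
      ext ω
      simp only [Set.mem_ofPred_eq, WithTop.coe_le_coe, Set.mem_union, Set.mem_iInter,
        Set.mem_iUnion, exists_prop]
      constructor
      · intro h
        rcases hmem ω with h1 | h1
        · refine Or.inr fun n => ?_
          have hopen : IsOpen {s | c - 1 / ((n : ℝ) + 1) < m (min t s) ω} :=
            isOpen_lt continuous_const ((hc ω).comp (continuous_const.min continuous_id))
          obtain ⟨d, hd, hd'⟩ := hD.exists_mem_open hopen ⟨T ω, by
            rw [Set.mem_ofPred_eq, min_eq_right h]
            exact lt_of_lt_of_le (sub_lt_self _ (by positivity)) h1⟩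
          exact ⟨d, hd, hd'⟩
        · exact Or.inl (h1 ▸ h)
      · rintro (h | h)
        · exact (hle ω 1 (Or.inr rfl)).trans h
        · obtain ⟨s, hs, hmax⟩ := (isCompact_Icc (a := (0 : ℝ≥0)) (b := t)).exists_isMaxOn
            ⟨0, le_rfl, zero_le⟩ (hc ω).continuousOn
          refine (hle ω s (Or.inl ?_)).trans hs.2
          refine le_of_forall_pos_lt_add fun ε hε => ?_
          obtain ⟨n, hn⟩ := exists_nat_one_div_lt hε
          obtain ⟨d, -, hd⟩ := h n
          have := hmax (show min t d ∈ Set.Icc 0 t from ⟨zero_le, min_le_left _ _⟩)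
          simp only [Set.mem_ofPred_eq] at this
          linarith
    rw [key]
    refine MeasurableSet.union (MeasurableSet.const _) (MeasurableSet.iInter fun n =>
      MeasurableSet.biUnion hDc fun d _ => ?_)
    exact ((hm _).mono (𝓕.mono (min_le_left t d))).measurable measurableSet_Ioi
  · refine pos_iff_ne_zero.2 fun h => ?_
    rcases hmem ω with h1 | h1 <;> rw [h] at h1
    · exact absurd (h0 ω) (not_lt.2 h1)
    · exact zero_ne_one h1
  · have hlt : ∀ s, s < T ω → m s ω < c := fun s hs => by
      by_contra h
      exact absurd (hle ω s (Or.inl (not_lt.1 h))) (not_le.2 hs)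
    rcases eq_or_ne t 0 with rfl | hne0
    · exact (h0 ω).le
    · have : (𝓝[<] t).NeBot := nhdsLT_neBot_of_exists_lt ⟨0, pos_iff_ne_zero.2 hne0⟩
      refine le_of_tendsto (f := fun s => m s ω) (x := 𝓝[<] t)
        ((hc ω).continuousAt.tendsto.mono_left nhdsWithin_le_nhds) ?_
      filter_upwards [self_mem_nhdsWithin] with s hs
      exact (hlt s (lt_of_lt_of_le hs ht)).le

end Hitting

/-! ### The deformation solves the system -/

section Hessian

variable {σ θ : Edge → ℝ}

/-- The coefficients of the products of two increments of the Brownian motions in the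
expansion of the deformation. -/
def hessian (σ θ : Edge → ℝ) (X : LiftedCorner → ℂ) (j k : Edge) (p : LiftedCorner) : ℂ :=
  1 / 4 * σ j * σ k * (bracket θ (fun q => bracket θ X j q) k p +
    if j = k then X k.aPlus * (fermion θ k k.aPlus p : ℂ) + X k.cPlus * (fermion θ k k.cPlus p : ℂ)
    else 0)

/-- The diagonal second order terms add up to the drift. -/
theorem sum_hessian_self (hθ : ∀ e, θ e ∈ Set.Ioo 0 (Real.pi / 2)) (Λ : Finset Edge)
    (X : LiftedCorner → ℂ) (p : LiftedCorner) :
    ∑ k ∈ Λ, hessian σ θ X k k p = drift Λ σ θ X p := by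
  rw [drift_eq_sum]
  refine Finset.sum_congr rfl fun k _ => ?_
  rw [hessian, if_pos rfl, bracket, bracket_aPlus hθ, bracket_cPlus hθ, diffusion, bracket]
  ring

theorem expansion_eq (Λ : Finset Edge) (X : LiftedCorner → ℂ) (p : LiftedCorner) (w : Edge → ℝ) :
    ∑ k ∈ Λ, (-(1 / 2) * ((σ k * w k : ℝ) : ℂ) * (X k.cPlus * fundamental θ k k.aPlus p -
        X k.aPlus * fundamental θ k k.cPlus p) +
      1 / 4 * ((σ k * w k : ℝ) : ℂ) ^ 2 * (X k.aPlus * fundamental θ k k.aPlus p +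
        X k.cPlus * fundamental θ k k.cPlus p) +
      ∑ j ∈ Λ, 1 / 4 * ((σ j * w j : ℝ) : ℂ) * ((σ k * w k : ℝ) : ℂ) *
        ((X j.cPlus * fundamental θ j j.aPlus k.cPlus -
            X j.aPlus * fundamental θ j j.cPlus k.cPlus) * fundamental θ k k.aPlus p -
          (X j.cPlus * fundamental θ j j.aPlus k.aPlus -
            X j.aPlus * fundamental θ j j.cPlus k.aPlus) * fundamental θ k k.cPlus p)) =
      ∑ k ∈ Λ, diffusion σ θ X k p * (w k : ℂ) +
        ∑ k ∈ Λ, ∑ j ∈ Λ, hessian σ θ X j k p * ((w j * w k : ℝ) : ℂ) := by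
  rw [← Finset.sum_add_distrib]
  refine Finset.sum_congr rfl fun k hk => ?_
  have e : ∑ j ∈ Λ, hessian σ θ X j k p * ((w j * w k : ℝ) : ℂ) =
      1 / 4 * ((σ k * w k : ℝ) : ℂ) ^ 2 * (X k.aPlus * fundamental θ k k.aPlus p +
        X k.cPlus * fundamental θ k k.cPlus p) +
      ∑ j ∈ Λ, 1 / 4 * ((σ j * w j : ℝ) : ℂ) * ((σ k * w k : ℝ) : ℂ) *
        bracket θ (fun q => bracket θ X j q) k p := by
    have e1 : ∀ j ∈ Λ, hessian σ θ X j k p * ((w j * w k : ℝ) : ℂ) =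
        (if j = k then 1 / 4 * ((σ k * w k : ℝ) : ℂ) ^ 2 *
          (X k.aPlus * fundamental θ k k.aPlus p + X k.cPlus * fundamental θ k k.cPlus p) else 0) +
        1 / 4 * ((σ j * w j : ℝ) : ℂ) * ((σ k * w k : ℝ) : ℂ) *
          bracket θ (fun q => bracket θ X j q) k p := by
      intro j _
      unfold hessian fundamental
      split_ifs with h
      · subst h; push_cast; ring
      · push_cast; ring
    rw [Finset.sum_congr rfl e1, Finset.sum_add_distrib, Finset.sum_ite_eq' Λ k, if_pos hk]
  rw [e]
  unfold diffusion bracket fundamental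
  push_cast
  ring

end Hessian

section Solution

variable {Ω : Type*} [mΩ : MeasurableSpace Ω] {P : Measure Ω} [IsProbabilityMeasure P]
  {𝓕 : Filtration ℝ≥0 mΩ} {Λ : Finset Edge} {W : Edge → ℝ≥0 → Ω → ℝ} {T : Ω → ℝ≥0}
  {θ₀ σ : Edge → ℝ} {t : ℝ≥0} {N : ℕ → ℕ} {τ : ℕ → ℕ → ℝ≥0}

omit [IsProbabilityMeasure P] mΩ in
/-- The increments of the angles are uniformly small. -/
theorem IsPartition.eventually_sum_abs_incr_le (hτ : IsPartition t N τ) (Λ : Finset Edge)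
    (σ : Edge → ℝ) {ω : Ω} (hc : ∀ k, Continuous fun s => W k (min s (T ω)) ω) {ε : ℝ}
    (hε : 0 < ε) :
    ∀ᶠ n in atTop, ∀ l < N n, ∑ k ∈ Λ, |σ k * incr W T (τ n) k l ω| ≤ ε := by
  have hS : 0 < ∑ k ∈ Λ, |σ k| + 1 := by
    have : 0 ≤ ∑ k ∈ Λ, |σ k| := Finset.sum_nonneg fun _ _ => abs_nonneg _
    linarith
  filter_upwards [(Finset.eventually_all Λ).2 fun k _ =>
    hτ.osc_succ (hc k) (div_pos hε hS)] with n hn l hl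
  calc ∑ k ∈ Λ, |σ k * incr W T (τ n) k l ω|
      ≤ ∑ k ∈ Λ, |σ k| * (ε / (∑ k ∈ Λ, |σ k| + 1)) := by
        refine Finset.sum_le_sum fun k hk => ?_
        rw [abs_mul]
        refine mul_le_mul_of_nonneg_left ?_ (abs_nonneg _)
        have := hn k hk l hl
        rwa [Real.dist_eq] at this
    _ = (∑ k ∈ Λ, |σ k|) * (ε / (∑ k ∈ Λ, |σ k| + 1)) := by rw [Finset.sum_mul]
    _ ≤ ε := by
        rw [← mul_div_assoc, div_le_iff₀ hS]
        nlinarith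

/-- Third order terms are negligible. -/
theorem BrownianSystem.subAE_cubic (hW : BrownianSystem 𝓕 P Λ W)
    (hT : IsStoppingTime 𝓕 fun ω => (T ω : WithTop ℝ≥0)) (hτ : IsPartition t N τ)
    (σ : Edge → ℝ) :
    SubAE P fun n ω => ∑ l ∈ Finset.range (N n), (∑ k ∈ Λ, |σ k * incr W T (τ n) k l ω|) ^ 3 := by
  refine SubAE.of_imp Λ (fun k hk => (RegularProcess.const 1).subAE_quad hW hT hτ hk hk)
    (.of_forall fun ω ks hks h => ?_)
  set C : ℝ := (Λ.card : ℝ) * ∑ k ∈ Λ, σ k ^ 2 * (1 + t) with hC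
  have hC0 : 0 ≤ C := mul_nonneg (Nat.cast_nonneg _)
    (Finset.sum_nonneg fun k _ => mul_nonneg (sq_nonneg _) (by positivity))
  rw [Metric.tendsto_nhds]
  intro ε hε
  have hε' : 0 < ε / (C + 1) := by positivity
  have hone : ∀ᶠ n in atTop, ∀ k ∈ Λ, _ < (1 : ℝ) := (Finset.eventually_all Λ).2 fun k hk =>
    (Metric.tendsto_nhds.1 (h k hk)) 1 one_pos
  filter_upwards [hone, hks.tendsto_atTop.eventually
    (hτ.eventually_sum_abs_incr_le Λ σ (fun k => hW.continuous_stopped k ω) hε')] with n h1 h2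
  have hV : ∀ k ∈ Λ, ∑ l ∈ Finset.range (N (ks n)), incr W T (τ (ks n)) k l ω ^ 2 ≤ 1 + t := by
    intro k hk
    have h3 := h1 k hk
    rw [dist_zero_right] at h3
    simp only [one_mul, if_true] at h3
    rw [← Complex.ofReal_sum, Complex.norm_real, Finset.sum_sub_distrib, sum_lapse T hτ,
      Real.norm_eq_abs] at h3
    have h4 := (abs_lt.1 h3).2
    have h5 : ((min t (T ω) : ℝ≥0) : ℝ) ≤ t := NNReal.coe_le_coe.2 (min_le_left _ _)
    simp_rw [sq]
    linarith
  rw [dist_zero_right, Real.norm_of_nonneg (Finset.sum_nonneg fun l _ => by positivity)]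
  calc ∑ l ∈ Finset.range (N (ks n)), (∑ k ∈ Λ, |σ k * incr W T (τ (ks n)) k l ω|) ^ 3
      ≤ ∑ l ∈ Finset.range (N (ks n)), ε / (C + 1) *
          (Λ.card * ∑ k ∈ Λ, σ k ^ 2 * incr W T (τ (ks n)) k l ω ^ 2) := by
        refine Finset.sum_le_sum fun l hl => ?_
        rw [pow_succ']
        refine mul_le_mul (h2 l (Finset.mem_range.1 hl)) ?_ (by positivity) hε'.le
        refine sq_sum_le_card_mul_sum_sq.trans_eq ?_
        simp_rw [sq_abs, mul_pow]
    _ = ε / (C + 1) * (Λ.card * ∑ k ∈ Λ, σ k ^ 2 *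
          ∑ l ∈ Finset.range (N (ks n)), incr W T (τ (ks n)) k l ω ^ 2) := by
        rw [← Finset.mul_sum, ← Finset.mul_sum, Finset.sum_comm]
        simp_rw [← Finset.mul_sum]
    _ ≤ ε / (C + 1) * C := by
        rw [hC]
        gcongr with k hk
        exact hV k hk
    _ < ε := by
        rw [div_mul_eq_mul_div, div_lt_iff₀ (by positivity)]
        nlinarith

variable (hθ₀ : ∀ e, θ₀ e ∈ Set.Ioo 0 (Real.pi / 2)) (hW : BrownianSystem 𝓕 P Λ W)
  (hT : IsStoppingTime 𝓕 fun ω => (T ω : WithTop ℝ≥0)) (hσ : ∀ e, e ∉ Λ → σ e = 0)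
  (hA : ∀ᵐ ω ∂P, ∀ t e, angle θ₀ σ W (min t (T ω)) ω e ∈ Set.Ioo 0 (Real.pi / 2))
include hθ₀ hW hT hσ hA

omit [IsProbabilityMeasure P] in
theorem regularProcess_deformation (Y₀ : LiftedCorner → ℂ) (p : LiftedCorner) :
    RegularProcess 𝓕 P fun t ω => deformation Λ Y₀ (angle θ₀ σ W (min t (T ω)) ω) p :=
  RegularProcess.of_stopped_angles hW hT hσ hA (g := fun θ => deformation Λ Y₀ θ p)
    (continuousOn_deformation hθ₀ Λ Y₀ p)

omit [IsProbabilityMeasure P] in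
theorem regularProcess_fundamental (k : Edge) (q p : LiftedCorner) :
    RegularProcess 𝓕 P fun t ω => fundamental (angle θ₀ σ W (min t (T ω)) ω) k q p :=
  RegularProcess.of_stopped_angles hW hT hσ hA (g := fun θ => fundamental θ k q p)
    (continuousOn_fermion hθ₀ Λ k q p)

omit [IsProbabilityMeasure P] in
theorem regularProcess_hessian {X : LiftedCorner → ℝ≥0 → Ω → ℂ}
    (hX : ∀ p, RegularProcess 𝓕 P (X p)) (j k : Edge) (p : LiftedCorner) :
    RegularProcess 𝓕 P fun t ω =>
      hessian σ (angle θ₀ σ W (min t (T ω)) ω) (fun q => X q t ω) j k p := by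
  refine (RegularProcess.const _).mul ((regularProcess_bracket hθ₀ hW hT hσ hA
    (fun q => regularProcess_bracket hθ₀ hW hT hσ hA hX j q) k p).add ?_)
  split_ifs with h
  · exact ((hX _).mul (regularProcess_fundamental hθ₀ hW hT hσ hA k _ p)).add
      ((hX _).mul (regularProcess_fundamental hθ₀ hW hT hσ hA k _ p))
  · exact RegularProcess.const 0

/-- Up to third order terms, the deformation has the increments of an Itô process. -/
theorem subAE_deformation_remainder {Y₀ : LiftedCorner → ℂ} (hY₀ : Propagation θ₀ Y₀)
    (hτ : IsPartition t N τ) (p : LiftedCorner) :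
    SubAE P fun n ω => ∑ l ∈ Finset.range (N n),
      (deformation Λ Y₀ (angle θ₀ σ W (min (τ n (l + 1)) (T ω)) ω) p -
        deformation Λ Y₀ (angle θ₀ σ W (min (τ n l) (T ω)) ω) p -
        (∑ k ∈ Λ, diffusion σ (angle θ₀ σ W (min (τ n l) (T ω)) ω)
            (deformation Λ Y₀ (angle θ₀ σ W (min (τ n l) (T ω)) ω)) k p *
            (incr W T (τ n) k l ω : ℂ) +
          ∑ k ∈ Λ, ∑ j ∈ Λ, hessian σ (angle θ₀ σ W (min (τ n l) (T ω)) ω)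
            (deformation Λ Y₀ (angle θ₀ σ W (min (τ n l) (T ω)) ω)) j k p *
            ((incr W T (τ n) j l ω * incr W T (τ n) k l ω : ℝ) : ℂ))) := by
  refine (hW.subAE_cubic hT hτ σ).of_imp_one ?_
  have hcF : ∀ᵐ ω ∂P, ∀ k q r, Continuous fun s =>
      fundamental (angle θ₀ σ W (min s (T ω)) ω) k q r := by
    simp_rw [ae_all_iff]
    exact fun k q r => (regularProcess_fundamental hθ₀ hW hT hσ hA k q r).continuous
  have hcX : ∀ᵐ ω ∂P, ∀ q, Continuous fun s =>
      deformation Λ Y₀ (angle θ₀ σ W (min s (T ω)) ω) q :=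
    ae_all_iff.2 fun q => (regularProcess_deformation hθ₀ hW hT hσ hA Y₀ q).continuous
  filter_upwards [hcF, hcX, hA] with ω hcF hcX hω ks hks h
  have hbd : ∀ {f : ℝ≥0 → ℂ}, Continuous f →
      ∀ᶠ M : ℝ in atTop, ∀ n, ∀ j ≤ N n, ‖f (τ n j)‖ ≤ M := fun {f} hf => by
    obtain ⟨C, -, hC⟩ := hτ.bounded hf
    filter_upwards [eventually_ge_atTop C] with M hM n j hj
    exact (hC n j hj).trans hM
  obtain ⟨M, hM, hXM, hpM, hacM⟩ := ((eventually_ge_atTop (1 : ℝ)).and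
    (((Finset.eventually_all Λ).2 fun k _ => (hbd (hcX k.aPlus)).and (hbd (hcX k.cPlus))).and
    (((Finset.eventually_all Λ).2 fun k _ => (hbd (hcF k k.aPlus p)).and
      (hbd (hcF k k.cPlus p))).and
    ((Finset.eventually_all Λ).2 fun j _ => (Finset.eventually_all Λ).2 fun k _ =>
      ((hbd (hcF k k.aPlus j.aPlus)).and (hbd (hcF k k.cPlus j.aPlus))).and
      ((hbd (hcF k k.aPlus j.cPlus)).and (hbd (hcF k k.cPlus j.cPlus))))))).exists
  have hΛ : ∀ s e, e ∉ Λ → angle θ₀ σ W s ω e = θ₀ e := fun s e he => by simp [angle, hσ e he]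
  refine squeeze_zero_norm' ?_ (by simpa only [mul_zero] using h.const_mul (7 * M ^ 4))
  filter_upwards [hks.tendsto_atTop.eventually (hτ.eventually_sum_abs_incr_le Λ σ
    (fun k => hW.continuous_stopped k ω) one_pos)] with n hn
  refine norm_sum_le_mul_sum _ _ fun l hl => ?_
  have hl := Finset.mem_range.1 hl
  rw [← expansion_eq]
  refine norm_increment_sub_le (F := fun k => fundamental _ k k.aPlus)
    (G := fun k => fundamental _ k k.cPlus)
    (δ := fun k => σ k * incr W T (τ (ks n)) k l ω) hM (fun q => ?_)
    (fun k hk => ⟨(hXM k hk).1 _ l hl.le, (hXM k hk).2 _ l hl.le⟩)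
    (fun k hk => ⟨(hXM k hk).1 _ (l + 1) hl, (hXM k hk).2 _ (l + 1) hl⟩)
    (fun k hk => (Finset.single_le_sum (f := fun k => |σ k * incr W T (τ (ks n)) k l ω|)
      (fun _ _ => abs_nonneg _) hk).trans (hn l hl))
    (fun k hk => ⟨(hpM k hk).1 _ l hl.le, (hpM k hk).2 _ l hl.le⟩)
    (fun j hj k hk => ⟨⟨(hacM j hj k hk).1.1 _ l hl.le, (hacM j hj k hk).1.2 _ l hl.le⟩,
      ⟨(hacM j hj k hk).2.1 _ l hl.le, (hacM j hj k hk).2.2 _ l hl.le⟩⟩)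
  rw [deformation_sub_deformation hθ₀ hY₀ (hω (τ (ks n) l)) (hΛ _) (hω (τ (ks n) (l + 1))) (hΛ _)]
  refine Finset.sum_congr rfl fun k _ => ?_
  have e : angle θ₀ σ W (min (τ (ks n) (l + 1)) (T ω)) ω k -
      angle θ₀ σ W (min (τ (ks n) l) (T ω)) ω k = σ k * incr W T (τ (ks n)) k l ω := by
    unfold angle incr; ring
  rw [e]

theorem isItoIntegral_deformation {Y₀ : LiftedCorner → ℂ} (hY₀ : Propagation θ₀ Y₀)
    (p : LiftedCorner) : IsItoIntegral P Λ
      (fun k t ω => diffusion σ (angle θ₀ σ W (min t (T ω)) ω)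
        (deformation Λ Y₀ (angle θ₀ σ W (min t (T ω)) ω)) k p)
      (fun k t ω => W k (min t (T ω)) ω)
      (fun t ω => deformation Λ Y₀ (angle θ₀ σ W (min t (T ω)) ω) p - Y₀ p -
        ∫ s in (0 : ℝ)..((min t (T ω) : ℝ≥0) : ℝ),
          drift Λ σ (angle θ₀ σ W (min s.toNNReal (T ω)) ω)
            (deformation Λ Y₀ (angle θ₀ σ W (min s.toNNReal (T ω)) ω)) p) := by
  intro t N τ h1 h2 h3 h4
  have hτ : IsPartition t N τ := ⟨h1, h2, h3, h4⟩
  have hX := regularProcess_deformation hθ₀ hW hT hσ hA Y₀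
  refine SubAE.tendstoInMeasure (fun n => ?_) ?_
  · refine Finset.aestronglyMeasurable_fun_sum _ fun k _ =>
      Finset.aestronglyMeasurable_fun_sum _ fun l _ => ?_
    refine ((regularProcess_diffusion hθ₀ hW hT hσ hA hX k p).aestronglyMeasurable _).mul ?_
    have hm : ∀ s, StronglyMeasurable fun ω => W k (min s (T ω)) ω := fun s =>
      (hW.adapted_stopped hT k s).mono (𝓕.le s)
    exact Complex.continuous_ofReal.comp_aestronglyMeasurable
      ((hm (τ n (l + 1))).sub (hm (τ n l))).aestronglyMeasurable
  have hR := subAE_deformation_remainder hθ₀ hW hT hσ hA hY₀ hτ p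
  have hQ := SubAE.sum Λ fun k hk => SubAE.sum Λ fun j hj =>
    (regularProcess_hessian hθ₀ hW hT hσ hA hX j k p).subAE_quad hW hT hτ hj hk
  have hD : SubAE P fun n ω => ∑ l ∈ Finset.range (N n),
      (((∫ s in (0 : ℝ)..((min (τ n (l + 1)) (T ω) : ℝ≥0) : ℝ),
          drift Λ σ (angle θ₀ σ W (min s.toNNReal (T ω)) ω)
            (deformation Λ Y₀ (angle θ₀ σ W (min s.toNNReal (T ω)) ω)) p) -
        ∫ s in (0 : ℝ)..((min (τ n l) (T ω) : ℝ≥0) : ℝ),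
          drift Λ σ (angle θ₀ σ W (min s.toNNReal (T ω)) ω)
            (deformation Λ Y₀ (angle θ₀ σ W (min s.toNNReal (T ω)) ω)) p) -
        drift Λ σ (angle θ₀ σ W (min (τ n l) (T ω)) ω)
            (deformation Λ Y₀ (angle θ₀ σ W (min (τ n l) (T ω)) ω)) p *
          (lapse T (τ n) l ω : ℂ)) := by
    refine SubAE.of_ae ?_
    filter_upwards [(regularProcess_drift hθ₀ hW hT hσ hA hX p).continuous] with ω hc
    exact squeeze_zero_norm (fun n => norm_sum_le _ _) (hτ.tendsto_drift hc (T ω))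
  refine ((hD.sub hQ).sub hR).congr ?_
  filter_upwards [hA] with ω hω n
  have h0 : angle θ₀ σ W (min 0 (T ω)) ω = θ₀ := by
    ext e
    simp [angle, hW.zero]
  -- `e1` and `e2` telescope; in `e3` the diagonal terms are collected into the drift
  have e1 : deformation Λ Y₀ (angle θ₀ σ W (min t (T ω)) ω) p - Y₀ p =
      ∑ l ∈ Finset.range (N n), (deformation Λ Y₀ (angle θ₀ σ W (min (τ n (l + 1)) (T ω)) ω) p -
        deformation Λ Y₀ (angle θ₀ σ W (min (τ n l) (T ω)) ω) p) := by
    rw [Finset.sum_range_sub fun l => deformation Λ Y₀ (angle θ₀ σ W (min (τ n l) (T ω)) ω) p,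
      h2, h3, h0, deformation_self hθ₀ hY₀]
  have e2 : (∫ s in (0 : ℝ)..((min t (T ω) : ℝ≥0) : ℝ),
          drift Λ σ (angle θ₀ σ W (min s.toNNReal (T ω)) ω)
            (deformation Λ Y₀ (angle θ₀ σ W (min s.toNNReal (T ω)) ω)) p) =
      ∑ l ∈ Finset.range (N n), ((∫ s in (0 : ℝ)..((min (τ n (l + 1)) (T ω) : ℝ≥0) : ℝ),
          drift Λ σ (angle θ₀ σ W (min s.toNNReal (T ω)) ω)
            (deformation Λ Y₀ (angle θ₀ σ W (min s.toNNReal (T ω)) ω)) p) -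
        ∫ s in (0 : ℝ)..((min (τ n l) (T ω) : ℝ≥0) : ℝ),
          drift Λ σ (angle θ₀ σ W (min s.toNNReal (T ω)) ω)
            (deformation Λ Y₀ (angle θ₀ σ W (min s.toNNReal (T ω)) ω)) p) := by
    rw [Finset.sum_range_sub fun l => ∫ s in (0 : ℝ)..((min (τ n l) (T ω) : ℝ≥0) : ℝ),
          drift Λ σ (angle θ₀ σ W (min s.toNNReal (T ω)) ω)
            (deformation Λ Y₀ (angle θ₀ σ W (min s.toNNReal (T ω)) ω)) p, h2, h3]
    simp
  have e3 : ∑ k ∈ Λ, ∑ j ∈ Λ, ∑ l ∈ Finset.range (N n),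
      hessian σ (angle θ₀ σ W (min (τ n l) (T ω)) ω)
        (fun q => deformation Λ Y₀ (angle θ₀ σ W (min (τ n l) (T ω)) ω) q) j k p *
        ((incr W T (τ n) j l ω * incr W T (τ n) k l ω -
          if j = k then lapse T (τ n) l ω else 0 : ℝ) : ℂ) =
      ∑ l ∈ Finset.range (N n), (∑ k ∈ Λ, ∑ j ∈ Λ,
        hessian σ (angle θ₀ σ W (min (τ n l) (T ω)) ω)
          (deformation Λ Y₀ (angle θ₀ σ W (min (τ n l) (T ω)) ω)) j k p *
          ((incr W T (τ n) j l ω * incr W T (τ n) k l ω : ℝ) : ℂ) -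
        drift Λ σ (angle θ₀ σ W (min (τ n l) (T ω)) ω)
            (deformation Λ Y₀ (angle θ₀ σ W (min (τ n l) (T ω)) ω)) p *
          (lapse T (τ n) l ω : ℂ)) := by
    simp_rw [Finset.sum_comm (s := Λ) (t := Finset.range (N n))]
    refine Finset.sum_congr rfl fun l _ => ?_
    rw [← sum_hessian_self (hω (τ n l)), Finset.sum_mul, ← Finset.sum_sub_distrib]
    refine Finset.sum_congr rfl fun k hk => ?_
    rw [eq_sub_iff_add_eq, ← Finset.sum_ite_eq' Λ k (fun j =>
      hessian σ (angle θ₀ σ W (min (τ n l) (T ω)) ω)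
          (deformation Λ Y₀ (angle θ₀ σ W (min (τ n l) (T ω)) ω)) j k p *
          (lapse T (τ n) l ω : ℂ)) |>.trans (if_pos hk), ← Finset.sum_add_distrib]
    refine Finset.sum_congr rfl fun j _ => ?_
    split_ifs <;> push_cast <;> ring
  rw [e1, e2, e3, Finset.sum_comm, ← Finset.sum_sub_distrib, ← Finset.sum_sub_distrib,
    ← Finset.sum_sub_distrib, ← Finset.sum_sub_distrib]
  refine Finset.sum_congr rfl fun l _ => ?_
  unfold incr
  ring

end Solution

section Existence

variable {Ω : Type*} [mΩ : MeasurableSpace Ω] {P : Measure Ω} [IsProbabilityMeasure P]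
  {Λ : Finset Edge} {W : Edge → ℝ≥0 → Ω → ℝ} {T : Ω → ℝ≥0} {θ₀ σ : Edge → ℝ}

omit [IsProbabilityMeasure P] in
/-- If the angles stay admissible on the whole probability space, the stopped deformation is
adapted in the strict sense, without exceptional set. -/
theorem stronglyAdapted_deformation {𝓕 : Filtration ℝ≥0 mΩ}
    (hθ₀ : ∀ e, θ₀ e ∈ Set.Ioo 0 (Real.pi / 2)) (hW : BrownianSystem 𝓕 P Λ W)
    (hT : IsStoppingTime 𝓕 fun ω => (T ω : WithTop ℝ≥0)) (hσ : ∀ e, e ∉ Λ → σ e = 0)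
    (hA : ∀ ω t e, angle θ₀ σ W (min t (T ω)) ω e ∈ Set.Ioo 0 (Real.pi / 2))
    (Y₀ : LiftedCorner → ℂ) (p : LiftedCorner) :
    StronglyAdapted 𝓕 fun t ω => deformation Λ Y₀ (angle θ₀ σ W (min t (T ω)) ω) p := by
  intro t
  have e : (fun ω => deformation Λ Y₀ (angle θ₀ σ W (min t (T ω)) ω) p) = fun ω =>
      (angleBox Λ).indicator (fun u => deformation Λ Y₀ (extendAngles θ₀ Λ u) p)
        fun e => angle θ₀ σ W (min t (T ω)) ω e := by
    ext ω
    rw [Set.indicator_of_mem (show (fun e : Λ => angle θ₀ σ W (min t (T ω)) ω e) ∈ angleBox Λ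
      from fun e => hA ω t e), extendAngles_restrict fun e he => by simp [angle, hσ e he]]
  beta_reduce
  rw [e]
  refine Measurable.stronglyMeasurable ?_
  refine (measurable_indicator_angleBox (g := fun θ => deformation Λ Y₀ θ p)
    (continuousOn_deformation hθ₀ Λ Y₀ p)).comp ?_
  rw [@measurable_pi_iff _ _ _ (𝓕 t)]
  exact fun e => (stronglyMeasurable_const.add
    (stronglyMeasurable_const.mul (hW.adapted_stopped hT e t))).measurable

omit [IsProbabilityMeasure P] in
/-- Before a positive stopping time, the angles do not leave the interval `(0, π / 2)`. -/
theorem BrownianSystem.exists_stoppingTime {𝓕 : Filtration ℝ≥0 mΩ}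
    (hθ₀ : ∀ e, θ₀ e ∈ Set.Ioo 0 (Real.pi / 2)) (hW : BrownianSystem 𝓕 P Λ W)
    (hσ : ∀ e, e ∉ Λ → σ e = 0) :
    ∃ T : Ω → ℝ≥0, IsStoppingTime 𝓕 (fun ω => (T ω : WithTop ℝ≥0)) ∧ (∀ ω, 0 < T ω) ∧
      ∀ ω, ∀ t ≤ T ω, ∀ e, angle θ₀ σ W t ω e ∈ Set.Ioo 0 (Real.pi / 2) := by
  have hev : ∀ᶠ c : ℝ in 𝓝[>] 0, 0 < c ∧ ∀ e ∈ Λ, c < θ₀ e ∧ c < Real.pi / 2 - θ₀ e := by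
    refine (eventually_mem_nhdsWithin.mono fun c hc => hc).and
      ((Finset.eventually_all Λ).2 fun e _ => ?_)
    exact ((eventually_lt_nhds (hθ₀ e).1).and
      (eventually_lt_nhds (sub_pos.2 (hθ₀ e).2))).filter_mono nhdsWithin_le_nhds
  obtain ⟨c, hc, hcΛ⟩ := hev.exists
  obtain ⟨T, hT, hpos, hle⟩ := exists_isStoppingTime_le (𝓕 := 𝓕)
    (m := fun t ω => ∑ k ∈ Λ, |σ k * W k t ω|) (c := c)
    (fun t => Finset.stronglyMeasurable_fun_sum _ fun k _ =>
      continuous_abs.comp_stronglyMeasurable (stronglyMeasurable_const.mul (hW.adapted k t)))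
    (fun ω => continuous_finsetSum _ fun k _ =>
      (continuous_const.mul (hW.continuous k ω)).abs)
    (fun ω => by simpa [hW.zero] using hc)
  refine ⟨T, hT, hpos, fun ω t ht e => ?_⟩
  by_cases he : e ∈ Λ
  · have h1 := (Finset.single_le_sum (f := fun k => |σ k * W k t ω|)
      (fun _ _ => abs_nonneg _) he).trans (hle ω t ht)
    obtain ⟨h2, h3⟩ := abs_le.1 h1
    obtain ⟨h4, h5⟩ := hcΛ e he
    rw [angle]
    constructor <;> linarith
  · simpa [angle, hσ e he] using hθ₀ e

/-- The deformation of the initial propagator along the random angles is a solution up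
to a positive stopping time. -/
theorem exists_isSDESolution {B : Edge → ℝ≥0 → Ω → ℝ}
    (hBm : ∀ e t, Measurable (B e t)) (hB : ∀ e, IsBrownianReal (B e) P)
    (hind : iIndepFun (fun (e : Edge) (ω : Ω) (t : ℝ≥0) => B e t ω) P)
    (hθ₀ : ∀ e, θ₀ e ∈ Set.Ioo 0 (Real.pi / 2)) {Y₀ : LiftedCorner → ℂ}
    (hY₀ : Propagation θ₀ Y₀) (hσ : ∀ e, e ∉ Λ → σ e = 0) :
    ∃ (T : Ω → ℝ≥0) (Y : LiftedCorner → ℝ≥0 → Ω → ℂ),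
      (∀ᵐ ω ∂P, 0 < T ω) ∧ IsSDESolution P B hBm Λ θ₀ σ Y₀ T Y := by
  obtain ⟨W, hW, hWB⟩ := exists_brownianSystem hBm hB hind Λ
  obtain ⟨T, hT, hpos, hle⟩ := hW.exists_stoppingTime hθ₀ hσ
  have hA : ∀ ω t e, angle θ₀ σ W (min t (T ω)) ω e ∈ Set.Ioo 0 (Real.pi / 2) :=
    fun ω t => hle ω _ (min_le_right _ _)
  have hA' := Eventually.of_forall (f := ae P) hA
  have hmin : ∀ t ω, min (min t (T ω)) (T ω) = min t (T ω) := fun t ω =>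
    min_eq_left (min_le_right _ _)
  refine ⟨T, fun p t ω => deformation Λ Y₀ (angle θ₀ σ W (min t (T ω)) ω) p, .of_forall hpos,
    hT, ?_, fun p => ?_, ?_, ?_, fun p => ?_⟩
  · filter_upwards [hWB] with ω h s hs
    rw [← angle_congr hσ h]
    exact hle ω s hs
  · simp_rw [hmin]
    exact stronglyAdapted_deformation hθ₀ hW hT hσ hA Y₀ p
  · filter_upwards [ae_all_iff.2 fun p =>
      (regularProcess_deformation hθ₀ hW hT hσ hA' Y₀ p).continuous] with ω h p
    exact (h p).continuousOn
  · refine .of_forall fun ω p => ?_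
    have h0 : angle θ₀ σ W (min 0 (T ω)) ω = θ₀ := by
      ext e
      simp [angle, hW.zero]
    simp only [h0, deformation_self hθ₀ hY₀]
  · simp_rw [hmin]
    refine (isItoIntegral_deformation hθ₀ hW hT hσ hA' hY₀ p).congr ?_ ?_
    · filter_upwards [hWB] with ω h k hk t
      simp only [angle_congr hσ h, h k hk, and_self]
    · filter_upwards [hWB] with ω h t
      rw [integral_stopped (fun s => drift Λ σ (angle θ₀ σ W s ω)
        (deformation Λ Y₀ (angle θ₀ σ W s ω)) p) t (T ω)]
      congr 1
      refine intervalIntegral.integral_congr fun s hs => ?_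
      rw [Set.uIcc_of_le (NNReal.coe_nonneg _)] at hs
      have hs' : s.toNNReal ≤ T ω :=
        (Real.toNNReal_le_iff_le_coe.2 hs.2).trans (min_le_right _ _)
      simp only [min_eq_left hs', angle_congr hσ h]

end Existence

end IsingEmb

end

theorem mainTheorem11 {Ω : Type*} [MeasurableSpace Ω] (P : Measure Ω) [IsProbabilityMeasure P]
    (B : IsingEmb.Edge → ℝ≥0 → Ω → ℝ) (hBm : ∀ e t, Measurable (B e t))
    (hB : ∀ e, IsBrownianReal (B e) P)
    (hind : iIndepFun (fun (e : IsingEmb.Edge) (ω : Ω) (t : ℝ≥0) => B e t ω) P)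
    (θ₀ : IsingEmb.Edge → ℝ) (hθ₀ : ∀ e, θ₀ e ∈ Set.Ioo 0 (Real.pi / 2))
    (Y₀ : IsingEmb.LiftedCorner → ℂ) (S₀ : IsingEmb.Vertex ⊕ IsingEmb.Face → ℂ)
    (hY₀ : IsingEmb.IsSEmbedding θ₀ Y₀ S₀)
    (Λ : Finset IsingEmb.Edge) (σ : IsingEmb.Edge → ℝ) (hσ : ∀ e, e ∉ Λ → σ e = 0) :
    (∃ (T : Ω → ℝ≥0) (Y : IsingEmb.LiftedCorner → ℝ≥0 → Ω → ℂ),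
      (∀ᵐ ω ∂P, 0 < T ω) ∧ IsingEmb.IsSDESolution P B hBm Λ θ₀ σ Y₀ T Y) ∧
    (∀ (T : Ω → ℝ≥0) (Y : IsingEmb.LiftedCorner → ℝ≥0 → Ω → ℂ),
      IsingEmb.IsSDESolution P B hBm Λ θ₀ σ Y₀ T Y →
      ∀ᵐ ω ∂P, ∀ s ≤ T ω, ∃ S : IsingEmb.Vertex ⊕ IsingEmb.Face → ℂ,
        IsingEmb.IsSEmbedding (IsingEmb.angle θ₀ σ B s ω) (fun p => Y p s ω) S) := by
  exact ⟨IsingEmb.exists_isSDESolution hBm hB hind hθ₀ hY₀.propagation hσ,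
    fun T Y hS => hS.exists_isSEmbedding hBm hB hind hθ₀ hY₀.propagation hσ⟩
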